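/- **Conventions.** Let $\mathcal C$ be a unitary fusion category (a finitely semisimple rigid $\mathbb C$-linear C*-tensor category with simple unit, tensor products of morphisms compatible with adjoints, and unitary structure isomorphisms) and let $X\in\mathcal C$ be strongly tensor generating: for some $N\ge1$ every simple object is a direct summand of $X^{\otimes N}$. Assume $X\not\cong\mathbb 1$. The fusion spin chain $A=A(\mathcal C,X)$ is the C*-inductive limit of the algebras $A_I=\operatorname{End}(X^{\otimes |I|})$ over the finite nonempty intervals $I\subset\mathbb Z$, with inclusions $w\mapsto 1_X^{\otimes p}\otimes w\otimes 1_X^{\otimes q}$. A QCA is a $*$-automorphism $\alpha$ of $A$ such that, for some $l\ge 0$, $\alpha(A_I)$ and $\alpha^{-1}(A_I)$ are contained in $A_{I^{+l}}$ for all $I$, where $[a,b]^{+l}=[a-l,b+l]$. If $\tau$ is the unique tracial state of $A$, let $\mathcal A_x=\big(\bigcup_{I\le x}A_I\big)''\subseteq B(L^2(A,\tau))$. The chain has the finite index property if every $\mathcal A_x$ is an infinite-dimensional factor and all Jones indices $[\mathcal A_z:\mathcal A_x]$ with $z>x$ are finite. Then $\operatorname{ind}(\alpha)=\big([\alpha(\mathcal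 A_x):\mathcal A_y]/[\mathcal A_x:\mathcal A_y]\big)^{1/2}$ for any integers $y\le x$ with $\mathcal A_y\subseteq\alpha(\mathcal A_x)$, where $[M:N]=\dim_N L^2(M)$. For an object $Y$ of a unitary fusion category, $\dim(Y)$ is its intrinsic (unitary) dimension, i.e. the minimum of $\|R\|\,\|\bar R\|$ over all solutions $(R,\bar R)$ of the conjugate equations for $Y$. Let $\mathcal C\subseteq\mathcal D$ be a full inclusion of unitary fusion categories. Let $\varphi:X^{\otimes n}\cong Y\otimes Z$ with $n\ge1$, $Y,Z\in\mathcal D$, and $\sigma:Y\otimes Z\cong Z\otimes Y$ be isomorphisms in $\mathcal D$, and partition $\mathbb Z$ into intervals of length $n$. A generalized translation built from these data is a $*$-automorphism $\alpha$ of $A$ such that for every interval $I$ that is a union of $m\ge1$ intervals of the partition and every $w\in A_I$, $$\alpha(w)=1_{Y\otimes Z}\otimes 1_Y\otimes\big[\sigma^{\otimes m}\circ w\circ(\sigma^{-1})^{\otimes m}\big]\otimes 1_Z\in A_{I^{+n}},$$ where $\varphi$ is used to identify $A_I$ with $\operatorname{End}_{\mathcal D}((Y\otimes Z)^{\otimes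 m})$ and $A_{I^{+n}}$ with $\operatorname{End}_{\mathcal D}((Y\otimes Z)^{\otimes (m+2)})$. **Proposition (index of generalized translations).** 1. The chain $A(\mathcal C,X)$ has a unique tracial state and the finite index property. If $\varphi$ and $\sigma$ are unitary, then there is exactly one QCA that is a generalized translation built from $(\varphi,\sigma)$ and the partition. For arbitrary isomorphisms $\varphi,\sigma$, every QCA $\alpha$ that is a generalized translation built from them has well-defined index (finite Jones indices, independent of the choice of $x,y$), and $$\operatorname{ind}(\alpha)=\dim(Y).$$ 2. (Kramers–Wannier translations.) Let $B$ be a nontrivial finite abelian group and let $\mathcal D$ be a unitary Tambara–Yamagami category over $B$, that is, a unitary fusion category whose simple objects are, up to isomorphism, the elements of $B$ together with one further object $\rho$, with $b\otimes a\cong ba$, $b\otimes\rho\cong\rho\otimes b\cong\rho$ and $\rho\otimes\rho\cong\bigoplus_{b\in B}b$. Let $\mathcal C\subseteq\mathcal D$ be the full fusion subcategory with simple objects $B$ (this is $\mathbf{Hilb}(B)$), and let $X\cong\bigoplus_{b\in B}b$ in $\mathcal C$. Then $X$ is strongly tensor generating, $X\not\cong\mathbb 1$, the chain $A(\mathcal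 C,X)$ has a unique tracial state and the finite index property, and there is a unitary isomorphism $\varphi:X\cong\rho\otimes\rho$. For each unitary isomorphism $\varphi:X\cong\rho\otimes\rho$ there is exactly one QCA that is a generalized translation with $n=1$, $Y=Z=\rho$ and $\sigma=\mathrm{id}_{\rho\otimes\rho}$. Every QCA that is a generalized translation with such data, for any isomorphism $\varphi$, has index $\sqrt{|B|}$. -/

import Mathlib

open CategoryTheory MonoidalCategory Limits Filter Topology
open scoped ComplexOrder

attribute [local instance] CategoryTheory.Abelian.hasFiniteBiproducts

/-! ### Unitary fusion categories -/

/-- A C*-category: a `ℂ`-linear category with a conjugate-linear involution `dag` on morphisms and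
C*-norms on the morphism spaces, such that every `dag f ∘ f` is positive. (Completeness of the
morphism spaces is automatic below, where they are finite dimensional.) -/
class CStarCategory (C : Type*) [Category C] [Preadditive C] [Linear ℂ C] where
  dag : ∀ {X Y : C}, (X ⟶ Y) → (Y ⟶ X)
  dag_dag : ∀ {X Y : C} (f : X ⟶ Y), dag (dag f) = f
  dag_id : ∀ X : C, dag (𝟙 X) = 𝟙 X
  dag_comp : ∀ {X Y Z : C} (f : X ⟶ Y) (g : Y ⟶ Z), dag (f ≫ g) = dag g ≫ dag f
  dag_add : ∀ {X Y : C} (f g : X ⟶ Y), dag (f + g) = dag f + dag g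
  dag_smul : ∀ {X Y : C} (c : ℂ) (f : X ⟶ Y), dag (c • f) = star c • dag f
  homNorm : ∀ {X Y : C}, (X ⟶ Y) → ℝ
  homNorm_add_le : ∀ {X Y : C} (f g : X ⟶ Y), homNorm (f + g) ≤ homNorm f + homNorm g
  homNorm_smul : ∀ {X Y : C} (c : ℂ) (f : X ⟶ Y), homNorm (c • f) = ‖c‖ * homNorm f
  eq_zero_of_homNorm : ∀ {X Y : C} (f : X ⟶ Y), homNorm f = 0 → f = 0
  homNorm_comp_le : ∀ {X Y Z : C} (f : X ⟶ Y) (g : Y ⟶ Z),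
    homNorm (f ≫ g) ≤ homNorm f * homNorm g
  homNorm_comp_dag : ∀ {X Y : C} (f : X ⟶ Y), homNorm (f ≫ dag f) = homNorm f ^ 2
  exists_comp_dag_eq : ∀ {X Y : C} (f : X ⟶ Y), ∃ g : X ⟶ X, f ≫ dag f = g ≫ dag g

open CStarCategory

/-- An isomorphism is unitary if its inverse is its adjoint. -/
def IsUnitaryIso {C : Type*} [Category C] [Preadditive C] [Linear ℂ C] [CStarCategory C]
    {X Y : C} (e : X ≅ Y) : Prop := dag e.hom = e.inv

/-- A unitary fusion category: a finitely semisimple rigid `ℂ`-linear abelian tensor category with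
simple unit, with a compatible C*-structure for which the structure isomorphisms are unitary. -/
class UnitaryFusionCategory (C : Type*) [Category C] [Abelian C] [Linear ℂ C]
    [MonoidalCategory C] [MonoidalPreadditive C] [MonoidalLinear ℂ C] [RigidCategory C]
    extends CStarCategory C where
  dag_whiskerLeft : ∀ (X : C) {Y Z : C} (f : Y ⟶ Z), dag (X ◁ f) = X ◁ dag f
  dag_whiskerRight : ∀ {Y Z : C} (f : Y ⟶ Z) (X : C), dag (f ▷ X) = dag f ▷ X
  unitary_associator : ∀ X Y Z : C, IsUnitaryIso (α_ X Y Z)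
  unitary_leftUnitor : ∀ X : C, IsUnitaryIso (λ_ X)
  unitary_rightUnitor : ∀ X : C, IsUnitaryIso (ρ_ X)
  finiteDimensional_hom : ∀ X Y : C, FiniteDimensional ℂ (X ⟶ Y)
  simple_unit : Simple (𝟙_ C)
  finitely_many_simples : ∃ (n : ℕ) (S : Fin n → C), ∀ T : C, Simple T → ∃ i, Nonempty (T ≅ S i)
  semisimple : ∀ X : C, ∃ (n : ℕ) (S : Fin n → C), (∀ i, Simple (S i)) ∧ Nonempty (X ≅ ⨁ S)

section EndAlgebra

variable {C : Type*} [Category C] [Preadditive C] [Linear ℂ C] [CStarCategory C]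

theorem dag_zero {X Y : C} : dag (0 : X ⟶ Y) = 0 := by
  simpa using dag_smul (0 : ℂ) (0 : X ⟶ Y)

theorem homNorm_zero {X Y : C} : homNorm (0 : X ⟶ Y) = 0 := by
  simpa using homNorm_smul (0 : ℂ) (0 : X ⟶ Y)

theorem homNorm_neg {X Y : C} (f : X ⟶ Y) : homNorm (-f) = homNorm f := by
  simpa using homNorm_smul (-1 : ℂ) f

theorem homNorm_nonneg {X Y : C} (f : X ⟶ Y) : 0 ≤ homNorm f := by
  have h := homNorm_add_le f (-f)
  rw [add_neg_cancel, homNorm_zero, homNorm_neg] at h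
  linarith

theorem homNorm_dag {X Y : C} (f : X ⟶ Y) : homNorm (dag f) = homNorm f := by
  have key : ∀ {X Y : C} (f : X ⟶ Y), homNorm f ≤ homNorm (dag f) := by
    intro X Y f
    rcases (homNorm_nonneg f).eq_or_lt with h | h
    · rw [← h]; exact homNorm_nonneg _
    · have h1 := homNorm_comp_le f (dag f)
      rw [homNorm_comp_dag, sq] at h1
      exact le_of_mul_le_mul_left h1 h
  refine le_antisymm ?_ (key f)
  simpa [dag_dag] using key (dag f)

noncomputable instance (T : C) : NormedRing (End T) where
  __ := (inferInstance : Ring (End T))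
  norm f := homNorm (X := T) (Y := T) f
  dist f g := homNorm (X := T) (Y := T) (f - g)
  dist_self f := by simp [homNorm_zero]
  dist_comm f g := by rw [← homNorm_neg, neg_sub]
  dist_triangle f g h := by
    rw [← sub_add_sub_cancel f g h]
    exact homNorm_add_le (X := T) (Y := T) _ _
  eq_of_dist_eq_zero {f g} h := sub_eq_zero.1 (eq_zero_of_homNorm (X := T) (Y := T) (f - g) h)
  dist_eq f g := by
    rw [← homNorm_neg, neg_sub, neg_add_eq_sub]
  norm_mul_le f g := by
    rw [End.mul_def, mul_comm]
    exact homNorm_comp_le _ _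

noncomputable instance (T : C) : NormedAlgebra ℂ (End T) where
  __ := (inferInstance : Algebra ℂ (End T))
  norm_smul_le c f := (homNorm_smul (X := T) (Y := T) c f).le

instance (T : C) : StarRing (End T) where
  star f := dag (X := T) (Y := T) f
  star_involutive f := dag_dag (X := T) (Y := T) f
  star_mul f g := dag_comp (X := T) (Y := T) (Z := T) g f
  star_add f g := dag_add (X := T) (Y := T) f g

instance (T : C) : StarModule ℂ (End T) where
  star_smul c f := dag_smul (X := T) (Y := T) c f

instance (T : C) : CStarRing (End T) where
  norm_mul_self_le f := by
    change homNorm f * homNorm f ≤ homNorm (f ≫ dag f)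
    rw [homNorm_comp_dag, sq]

end EndAlgebra

theorem completeSpace_of_finiteDimensional_normedAlgebra (E : Type*) [NormedRing E]
    [NormedAlgebra ℂ E] [FiniteDimensional ℂ E] : CompleteSpace E :=
  FiniteDimensional.complete ℂ E

noncomputable instance {C : Type*} [Category C] [Abelian C] [Linear ℂ C]
    [MonoidalCategory C] [MonoidalPreadditive C] [MonoidalLinear ℂ C] [RigidCategory C]
    [UnitaryFusionCategory C] (T : C) : CStarAlgebra (End T) where
  __ := (inferInstance : NormedRing (End T))
  __ := (inferInstance : StarRing (End T))
  __ := (inferInstance : CStarRing (End T))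
  __ := (inferInstance : NormedAlgebra ℂ (End T))
  __ := (inferInstance : StarModule ℂ (End T))
  toCompleteSpace :=
    have : FiniteDimensional ℂ (End T) := UnitaryFusionCategory.finiteDimensional_hom T T
    completeSpace_of_finiteDimensional_normedAlgebra (End T)

section Powers

variable {C : Type*} [Category C] [MonoidalCategory C]

/-- The tensor power `X ^ ⊗ n`. The categories are not assumed to be strict, so the canonical
isomorphisms between differently bracketed tensor powers are written out. -/
def tensorPow (X : C) : ℕ → C
  | 0 => 𝟙_ C
  | n + 1 => tensorPow X n ⊗ X

/-- The canonical isomorphism `X ^ ⊗ m ⊗ X ^ ⊗ n ≅ X ^ ⊗ (m + n)`. -/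
def powAdd (X : C) (m : ℕ) : ∀ n : ℕ, tensorPow X m ⊗ tensorPow X n ≅ tensorPow X (m + n)
  | 0 => ρ_ (tensorPow X m)
  | n + 1 => (α_ _ _ _).symm ≪≫ whiskerRightIso (powAdd X m n) X

/-- The canonical isomorphism `X ^ ⊗ p ⊗ X ^ ⊗ n ⊗ X ^ ⊗ q ≅ X ^ ⊗ N` for `N = p + n + q`. -/
def padIso (X : C) (p n q N : ℕ) (h : p + n + q = N) :
    (tensorPow X p ⊗ tensorPow X n) ⊗ tensorPow X q ≅ tensorPow X N :=
  whiskerRightIso (powAdd X p n) _ ≪≫ powAdd X (p + n) q ≪≫ eqToIso (by rw [h])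

/-- `w ↦ 1_X ^ ⊗ p ⊗ w ⊗ 1_X ^ ⊗ q`. -/
def padFun (X : C) {n N : ℕ} (p q : ℕ) (h : p + n + q = N) (w : tensorPow X n ⟶ tensorPow X n) :
    tensorPow X N ⟶ tensorPow X N :=
  (padIso X p n q N h).inv ≫ ((tensorPow X p ◁ w) ▷ tensorPow X q) ≫ (padIso X p n q N h).hom


theorem eqToHom_tensorPow_whiskerRight (X : C) {a b : ℕ} (h : a = b) :
    eqToHom (congrArg (tensorPow X) h) ▷ X =
      eqToHom (congrArg (fun k => tensorPow X k ⊗ X) h) := by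
  subst h; simp

theorem powAdd_assoc (X : C) (m n k : ℕ) :
    (powAdd X m n).hom ▷ tensorPow X k ≫ (powAdd X (m + n) k).hom ≫
        eqToHom (congrArg (tensorPow X) (Nat.add_assoc m n k)) =
      (α_ _ _ _).hom ≫ tensorPow X m ◁ (powAdd X n k).hom ≫ (powAdd X m (n + k)).hom := by
  induction k with
  | zero =>
    change (powAdd X m n).hom ▷ 𝟙_ C ≫ (ρ_ (tensorPow X (m + n))).hom ≫ 𝟙 _ =
      (α_ (tensorPow X m) (tensorPow X n) (𝟙_ C)).hom ≫
        tensorPow X m ◁ (ρ_ (tensorPow X n)).hom ≫ (powAdd X m n).hom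
    simp
  | succ k ih =>
    change (powAdd X m n).hom ▷ (tensorPow X k ⊗ X) ≫
        ((α_ (tensorPow X (m + n)) (tensorPow X k) X).inv ≫ (powAdd X (m + n) k).hom ▷ X) ≫
        eqToHom (congrArg (fun j => tensorPow X j ⊗ X) (Nat.add_assoc m n k)) =
      (α_ (tensorPow X m) (tensorPow X n) (tensorPow X k ⊗ X)).hom ≫
        tensorPow X m ◁ ((α_ (tensorPow X n) (tensorPow X k) X).inv ≫ (powAdd X n k).hom ▷ X) ≫
        ((α_ (tensorPow X m) (tensorPow X (n + k)) X).inv ≫ (powAdd X m (n + k)).hom ▷ X)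
    rw [← eqToHom_tensorPow_whiskerRight X (Nat.add_assoc m n k)]
    have h2 := congrArg (fun f => (α_ _ _ _).inv ≫ f ▷ X) ih
    simp only [comp_whiskerRight] at h2
    simp only [Category.assoc]
    have h3 : (powAdd X m n).hom ▷ (tensorPow X k ⊗ X) ≫
        (α_ (tensorPow X (m + n)) (tensorPow X k) X).inv =
        (α_ _ _ _).inv ≫ (powAdd X m n).hom ▷ tensorPow X k ▷ X := by simp
    rw [← Category.assoc, h3, Category.assoc, h2]
    simp


end Powers

section Pad

/-- Conjugation by an isomorphism. -/
def conjFun {C : Type*} [Category C] {A B : C} (e : A ≅ B) (w : A ⟶ A) : B ⟶ B := e.inv ≫ w ≫ e.hom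

theorem conjFun_trans {C : Type*} [Category C] {A B D : C} (e : A ≅ B) (f : B ≅ D) (w : A ⟶ A) :
    conjFun (e ≪≫ f) w = conjFun f (conjFun e w) := by
  simp [conjFun]

variable {C : Type*} [Category C] [MonoidalCategory C]

theorem conjFun_whiskerRight {A B : C} (e : A ≅ B) (w : A ⟶ A) (Z : C) :
    conjFun e w ▷ Z = conjFun (whiskerRightIso e Z) (w ▷ Z) := by
  simp [conjFun]

theorem conjFun_whiskerLeft {A B : C} (e : A ≅ B) (w : A ⟶ A) (Z : C) :
    Z ◁ conjFun e w = conjFun (whiskerLeftIso Z e) (Z ◁ w) := by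
  simp [conjFun]

/-- Transport of endomorphisms along an equality of exponents. -/
def castPow (X : C) {a b : ℕ} (h : a = b) : tensorPow X a ≅ tensorPow X b :=
  eqToIso (congrArg (tensorPow X) h)

/-- `w ↦ 1_X ^ ⊗ p ⊗ w`. -/
def padL (X : C) (p : ℕ) {n : ℕ} (w : tensorPow X n ⟶ tensorPow X n) :=
  conjFun (powAdd X p n) (tensorPow X p ◁ w)

/-- `w ↦ w ⊗ 1_X ^ ⊗ q`. -/
def padR (X : C) (q : ℕ) {n : ℕ} (w : tensorPow X n ⟶ tensorPow X n) :=
  conjFun (powAdd X n q) (w ▷ tensorPow X q)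

theorem padFun_eq (X : C) {n N : ℕ} (p q : ℕ) (h : p + n + q = N)
    (w : tensorPow X n ⟶ tensorPow X n) :
    padFun X p q h w = conjFun (castPow X h) (padR X q (padL X p w)) := by
  simp [padFun, padIso, padL, padR, castPow, conjFun]

theorem conjFun_castPow_trans (X : C) {a b c : ℕ} (h : a = b) (h' : b = c)
    (w : tensorPow X a ⟶ tensorPow X a) :
    conjFun (castPow X h') (conjFun (castPow X h) w) = conjFun (castPow X (h.trans h')) w := by
  simp [conjFun, castPow]

theorem padR_cast (X : C) (q : ℕ) {a b : ℕ} (h : a = b) (w : tensorPow X a ⟶ tensorPow X a) :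
    padR X q (conjFun (castPow X h) w) =
      conjFun (castPow X (congrArg (· + q) h)) (padR X q w) := by
  subst h; simp [castPow, conjFun]

theorem padL_cast (X : C) (q : ℕ) {a b : ℕ} (h : a = b) (w : tensorPow X a ⟶ tensorPow X a) :
    padL X q (conjFun (castPow X h) w) =
      conjFun (castPow X (congrArg (q + ·) h)) (padL X q w) := by
  subst h; simp [castPow, conjFun]

theorem padL_congr (X : C) {p p' n : ℕ} (h : p = p') (w : tensorPow X n ⟶ tensorPow X n) :
    padL X p' w = conjFun (castPow X (congrArg (· + n) h)) (padL X p w) := by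
  subst h; simp [castPow, conjFun]

theorem padR_congr (X : C) {p p' n : ℕ} (h : p = p') (w : tensorPow X n ⟶ tensorPow X n) :
    padR X p' w = conjFun (castPow X (congrArg (n + ·) h)) (padR X p w) := by
  subst h; simp [castPow, conjFun]

theorem powAdd_assoc_iso (X : C) (m n k : ℕ) :
    whiskerRightIso (powAdd X m n) (tensorPow X k) ≪≫ powAdd X (m + n) k ≪≫
        castPow X (Nat.add_assoc m n k) =
      α_ _ _ _ ≪≫ whiskerLeftIso (tensorPow X m) (powAdd X n k) ≪≫ powAdd X m (n + k) :=
  Iso.ext (powAdd_assoc X m n k)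

theorem conjFun_whiskerLeftIso_whiskerRight {A B Z : C} (e : A ≅ B) (w : Z ⟶ Z) :
    conjFun (whiskerLeftIso Z e) (w ▷ A) = w ▷ B := by
  simp only [conjFun, whiskerLeftIso_inv, whiskerLeftIso_hom]
  rw [whisker_exchange_assoc]
  simp

theorem conjFun_whiskerRightIso_whiskerLeft {A B Z : C} (e : A ≅ B) (w : Z ⟶ Z) :
    conjFun (whiskerRightIso e Z) (A ◁ w) = B ◁ w := by
  simp only [conjFun, whiskerRightIso_inv, whiskerRightIso_hom]
  rw [← whisker_exchange_assoc]
  simp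

theorem padR_padR (X : C) (q r : ℕ) {n : ℕ} (w : tensorPow X n ⟶ tensorPow X n) :
    padR X r (padR X q w) = conjFun (castPow X (Nat.add_assoc n q r).symm) (padR X (q + r) w) := by
  have : conjFun (castPow X (Nat.add_assoc n q r)) (padR X r (padR X q w)) =
      padR X (q + r) w := by
    unfold padR
    rw [conjFun_whiskerRight, ← conjFun_trans, ← conjFun_trans, powAdd_assoc_iso]
    simp only [conjFun_trans]
    rw [← conjFun_whiskerLeftIso_whiskerRight (powAdd X q r)]
    refine congrArg _ (congrArg _ ?_)
    simp [conjFun]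
  rw [← this, conjFun_castPow_trans]
  simp [conjFun, castPow]

theorem padL_padL (X : C) (p r : ℕ) {n : ℕ} (w : tensorPow X n ⟶ tensorPow X n) :
    padL X r (padL X p w) = conjFun (castPow X (Nat.add_assoc r p n)) (padL X (r + p) w) := by
  unfold padL
  rw [conjFun_whiskerLeft, ← conjFun_whiskerRightIso_whiskerLeft (powAdd X r p),
    ← conjFun_trans _ (powAdd X (r + p) n), ← conjFun_trans _ (castPow X _), Iso.trans_assoc,
    powAdd_assoc_iso]
  simp only [conjFun_trans]
  refine congrArg _ (congrArg _ ?_)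
  simp [conjFun]

theorem padL_padR (X : C) (p q : ℕ) {n : ℕ} (w : tensorPow X n ⟶ tensorPow X n) :
    padL X p (padR X q w) = conjFun (castPow X (Nat.add_assoc p n q)) (padR X q (padL X p w)) := by
  unfold padL padR
  rw [conjFun_whiskerRight, conjFun_whiskerLeft, ← conjFun_trans _ (powAdd X (p + n) q),
    ← conjFun_trans _ (castPow X _), Iso.trans_assoc, powAdd_assoc_iso]
  simp only [conjFun_trans]
  refine congrArg _ (congrArg _ ?_)
  simp [conjFun]

theorem padFun_padFun (X : C) {n N K : ℕ} (p q p' q' : ℕ) (h : p + n + q = N)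
    (h' : p' + N + q' = K) (w : tensorPow X n ⟶ tensorPow X n) :
    padFun X p' q' h' (padFun X p q h w) =
      padFun X (p' + p) (q + q') (by omega) w := by
  simp only [padFun_eq, padL_cast, padR_cast, padL_padR, padR_padR, padL_padL,
    conjFun_castPow_trans]

theorem padFun_congr (X : C) {n N : ℕ} {p q p' q' : ℕ} (h : p + n + q = N)
    (hp : p' = p) (hq : q' = q) (w : tensorPow X n ⟶ tensorPow X n) :
    padFun X p q h w = padFun X p' q' (by rw [hp, hq, h]) w := by
  subst hp hq; rfl

/-- Operators localized on disjoint parts of a word commute. -/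
theorem padFun_comm (X : C) {n m N : ℕ} (p q p' q' : ℕ) (h : p + n + q = N)
    (h' : p' + m + q' = N) (hlt : p + n ≤ p') (w : tensorPow X n ⟶ tensorPow X n)
    (v : tensorPow X m ⟶ tensorPow X m) :
    padFun X p q h w ≫ padFun X p' q' h' v = padFun X p' q' h' v ≫ padFun X p q h w := by
  obtain ⟨d, rfl⟩ := Nat.exists_eq_add_of_le hlt
  have hq : q = d + m + q' := by omega
  subst hq
  have h1 : padFun X p (d + m + q') h w =
      conjFun (castPow X h) (padR X (d + m + q') (padL X p w)) := padFun_eq ..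
  have h2 : padFun X (p + n + d) q' h' v =
      conjFun (castPow X h) (padL X (p + n) (padR X q' (padL X d v))) := by
    simp only [padFun_eq, padL_cast, padR_cast, padL_padR, padR_padR, padL_padL,
      conjFun_castPow_trans]
  rw [h1, h2]
  have h3 : ∀ {a b : ℕ} (u : tensorPow X a ⟶ tensorPow X a) (z : tensorPow X b ⟶ tensorPow X b),
      padR X b u ≫ padL X a z = padL X a z ≫ padR X b u := by
    intro a b u z
    simp [padR, padL, conjFun, whisker_exchange_assoc]
  have h4 : ∀ {A B : C} (e : A ≅ B) (f g : A ⟶ A),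
      conjFun e f ≫ conjFun e g = conjFun e (f ≫ g) := by
    intro A B e f g; simp [conjFun]
  rw [h4, h4, h3]

end Pad

section FusionSpinChain

variable {C : Type*} [Category C] [Abelian C] [Linear ℂ C] [MonoidalCategory C]
  [MonoidalPreadditive C] [MonoidalLinear ℂ C] [RigidCategory C] [UnitaryFusionCategory C]

theorem isUnitaryIso_trans {A B D : C} {e : A ≅ B} {f : B ≅ D} (he : IsUnitaryIso e)
    (hf : IsUnitaryIso f) : IsUnitaryIso (e ≪≫ f) := by
  unfold IsUnitaryIso at *
  simp [dag_comp, he, hf]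

theorem isUnitaryIso_symm {A B : C} {e : A ≅ B} (he : IsUnitaryIso e) : IsUnitaryIso e.symm := by
  unfold IsUnitaryIso at *
  simp [← he, dag_dag]

theorem isUnitaryIso_whiskerRightIso {A B : C} {e : A ≅ B} (he : IsUnitaryIso e) (Z : C) :
    IsUnitaryIso (whiskerRightIso e Z) := by
  unfold IsUnitaryIso at *
  simp [UnitaryFusionCategory.dag_whiskerRight, he]

theorem isUnitaryIso_eqToIso {A B : C} (h : A = B) : IsUnitaryIso (eqToIso h) := by
  subst h
  simp [IsUnitaryIso, dag_id]

theorem isUnitaryIso_powAdd (X : C) (m n : ℕ) : IsUnitaryIso (powAdd X m n) := by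
  induction n with
  | zero => exact UnitaryFusionCategory.unitary_rightUnitor _
  | succ n ih =>
    exact isUnitaryIso_trans (isUnitaryIso_symm (UnitaryFusionCategory.unitary_associator _ _ _))
      (isUnitaryIso_whiskerRightIso ih X)

theorem isUnitaryIso_padIso (X : C) (p n q N : ℕ) (h : p + n + q = N) :
    IsUnitaryIso (padIso X p n q N h) :=
  isUnitaryIso_trans (isUnitaryIso_whiskerRightIso (isUnitaryIso_powAdd X p n) _)
    (isUnitaryIso_trans (isUnitaryIso_powAdd X _ q) (isUnitaryIso_eqToIso _))

theorem padFun_add (X : C) {n N : ℕ} (p q : ℕ) (h : p + n + q = N)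
    (f g : tensorPow X n ⟶ tensorPow X n) :
    padFun X p q h (f + g) = padFun X p q h f + padFun X p q h g := by
  simp only [padFun, MonoidalPreadditive.whiskerLeft_add, MonoidalPreadditive.add_whiskerRight,
    Preadditive.add_comp, Preadditive.comp_add]

theorem padFun_dag (X : C) {n N : ℕ} (p q : ℕ) (h : p + n + q = N)
    (f : tensorPow X n ⟶ tensorPow X n) :
    padFun X p q h (dag f) = dag (padFun X p q h f) := by
  have hu : dag (padIso X p n q N h).hom = (padIso X p n q N h).inv :=
    isUnitaryIso_padIso X p n q N h
  have hu' : dag (padIso X p n q N h).inv = (padIso X p n q N h).hom := by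
    rw [← hu, dag_dag]
  simp only [padFun, dag_comp, hu, hu', UnitaryFusionCategory.dag_whiskerRight,
    UnitaryFusionCategory.dag_whiskerLeft, Category.assoc]

/-- `w ↦ 1_X ^ ⊗ p ⊗ w ⊗ 1_X ^ ⊗ q` as a *-homomorphism. -/
noncomputable def pad (X : C) {n N : ℕ} (p q : ℕ) (h : p + n + q = N) :
    End (tensorPow X n) →⋆ₐ[ℂ] End (tensorPow X N) where
  toFun w := padFun X p q h w
  map_one' := by
    change padFun X p q h (𝟙 _) = 𝟙 _
    simp [padFun]
  map_mul' f g := by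
    change padFun X p q h (g ≫ f) = padFun X p q h g ≫ padFun X p q h f
    simp [padFun]
  map_zero' := by
    change padFun X p q h 0 = 0
    simp [padFun]
  map_add' f g := padFun_add X p q h f g
  commutes' c := by
    change padFun X p q h (c • 𝟙 _) = c • 𝟙 _
    simp [padFun]
  map_star' f := padFun_dag X p q h f

/-- The inclusion of the operators on the sites `[-N, N)` into those on `[-N-1, N+1)`. -/
noncomputable def boxStep (X : C) (N : ℕ) :
    End (tensorPow X (2 * N)) →⋆ₐ[ℂ] End (tensorPow X (2 * (N + 1))) :=
  pad X 1 1 (by omega)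

/-- The sequences of operators on the boxes `[-N, N)` that are eventually compatible with the
inclusions. Modulo sequences of seminorm zero they form the algebraic inductive limit. -/
noncomputable def localSeqSub (X : C) : StarSubalgebra ℂ (∀ N : ℕ, End (tensorPow X (2 * N))) where
  carrier := {f | ∀ᶠ N in atTop, f (N + 1) = boxStep X N (f N)}
  mul_mem' {f g} hf hg := by
    filter_upwards [hf, hg] with N h1 h2
    rw [Pi.mul_apply, Pi.mul_apply, h1, h2, map_mul]
  add_mem' {f g} hf hg := by
    filter_upwards [hf, hg] with N h1 h2
    rw [Pi.add_apply, Pi.add_apply, h1, h2, map_add]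
  algebraMap_mem' c := by
    refine Eventually.of_forall fun N => ?_
    rw [Pi.algebraMap_apply, Pi.algebraMap_apply, AlgHomClass.commutes]
  star_mem' {f} hf := by
    filter_upwards [hf] with N h1
    rw [Pi.star_apply, Pi.star_apply, h1, map_star]

/-- Eventually compatible sequences of operators on the boxes `[-N, N)`. -/
noncomputable def LocalSeq (X : C) : Type _ := localSeqSub X

namespace LocalSeq

variable {X : C}

noncomputable instance : Ring (LocalSeq X) := inferInstanceAs (Ring (localSeqSub X))
noncomputable instance : StarRing (LocalSeq X) := inferInstanceAs (StarRing (localSeqSub X))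
noncomputable instance : Algebra ℂ (LocalSeq X) := inferInstanceAs (Algebra ℂ (localSeqSub X))
instance : StarModule ℂ (LocalSeq X) := inferInstanceAs (StarModule ℂ (localSeqSub X))

/-- The `N`-th term of a sequence. -/
noncomputable def term (N : ℕ) : LocalSeq X →⋆ₐ[ℂ] End (tensorPow X (2 * N)) :=
  (Pi.evalStarAlgHom ℂ (fun N : ℕ => End (tensorPow X (2 * N))) N).comp (localSeqSub X).subtype

theorem eventually_term (f : LocalSeq X) :
    ∀ᶠ N in atTop, term (N + 1) f = boxStep X N (term N f) := f.2

theorem exists_tendsto (f : LocalSeq X) :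
    ∃ r, Tendsto (fun N => ‖term N f‖) atTop (𝓝 r) := by
  obtain ⟨N₀, h⟩ := eventually_atTop.1 (eventually_term f)
  have hanti : Antitone fun k => ‖term (k + N₀) f‖ := by
    refine antitone_nat_of_succ_le fun k => ?_
    have := h (k + N₀) (by omega)
    rw [show k + 1 + N₀ = k + N₀ + 1 by omega, this]
    exact NonUnitalStarAlgHom.norm_apply_le (boxStep X (k + N₀)) _
  refine ⟨_, (tendsto_add_atTop_iff_nat N₀).1 (tendsto_atTop_ciInf hanti ⟨0, ?_⟩)⟩
  rintro _ ⟨k, rfl⟩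
  exact norm_nonneg _

/-- The limit of the norms of the terms. -/
noncomputable def limNorm (f : LocalSeq X) : ℝ := (exists_tendsto f).choose

theorem tendsto_limNorm (f : LocalSeq X) :
    Tendsto (fun N => ‖term N f‖) atTop (𝓝 (limNorm f)) := (exists_tendsto f).choose_spec

theorem limNorm_eq_zero {f : LocalSeq X} (h : ∀ᶠ N in atTop, term N f = 0) : limNorm f = 0 :=
  tendsto_nhds_unique (tendsto_limNorm f)
    (tendsto_const_nhds.congr' (h.mono fun N hN => by simp [hN]))

/-- The limit of the norms, as a ring seminorm. -/
noncomputable def ringSeminorm (X : C) : RingSeminorm (LocalSeq X) where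
  toFun := limNorm
  map_zero' := limNorm_eq_zero (Eventually.of_forall fun N => map_zero _)
  add_le' f g := le_of_tendsto_of_tendsto' (tendsto_limNorm (f + g))
    ((tendsto_limNorm f).add (tendsto_limNorm g)) fun N => by
      rw [map_add]; exact norm_add_le _ _
  neg' f := tendsto_nhds_unique (tendsto_limNorm (-f))
    ((tendsto_limNorm f).congr fun N => by rw [map_neg, norm_neg])
  mul_le' f g := le_of_tendsto_of_tendsto' (tendsto_limNorm (f * g))
    ((tendsto_limNorm f).mul (tendsto_limNorm g)) fun N => by
      rw [map_mul]; exact norm_mul_le _ _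

noncomputable instance : SeminormedRing (LocalSeq X) := (ringSeminorm X).toSeminormedRing

theorem tendsto_norm (f : LocalSeq X) : Tendsto (fun N => ‖term N f‖) atTop (𝓝 ‖f‖) :=
  tendsto_limNorm f

noncomputable instance : NormedAlgebra ℂ (LocalSeq X) where
  norm_smul_le c f := (tendsto_nhds_unique (tendsto_norm (c • f))
    (((tendsto_norm f).const_mul ‖c‖).congr fun N => by rw [map_smul, norm_smul])).le

theorem norm_star (f : LocalSeq X) : ‖star f‖ = ‖f‖ :=
  tendsto_nhds_unique (tendsto_norm (star f))
    ((tendsto_norm f).congr fun N => by rw [map_star, _root_.norm_star])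

theorem norm_star_mul_self (f : LocalSeq X) : ‖star f * f‖ = ‖f‖ * ‖f‖ :=
  tendsto_nhds_unique (tendsto_norm (star f * f))
    (((tendsto_norm f).mul (tendsto_norm f)).congr fun N => by
      rw [map_mul, map_star, CStarRing.norm_star_mul_self])

theorem uniformContinuous_star : UniformContinuous (star : LocalSeq X → LocalSeq X) :=
  AddMonoidHomClass.uniformContinuous_of_bound (starAddEquiv : LocalSeq X ≃+ LocalSeq X) 1
    fun f => by simp [norm_star]

end LocalSeq

/-- The quasi-local C*-algebra of the fusion spin chain: the C*-algebraic inductive limit of the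
algebras `End (X ^ ⊗ 2N)` along the boxes `[-N, N)`, a cofinal sequence of intervals. -/
def QuasiLocal (X : C) : Type _ := UniformSpace.Completion (LocalSeq X)

namespace QuasiLocal

open UniformSpace

variable {X : C}

noncomputable instance : NormedRing (QuasiLocal X) :=
  inferInstanceAs (NormedRing (Completion (LocalSeq X)))

instance : CompleteSpace (QuasiLocal X) :=
  inferInstanceAs (CompleteSpace (Completion (LocalSeq X)))

noncomputable instance : Algebra ℂ (QuasiLocal X) :=
  inferInstanceAs (Algebra ℂ (Completion (LocalSeq X)))

noncomputable instance : NormedAlgebra ℂ (QuasiLocal X) where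
  norm_smul_le := (inferInstance : NormedSpace ℂ (Completion (LocalSeq X))).norm_smul_le

/-- The canonical map from local operators to the quasi-local algebra. -/
noncomputable def ofLocal : LocalSeq X →ₐ[ℂ] QuasiLocal X where
  toFun f := (f : Completion (LocalSeq X))
  map_one' := Completion.coe_one _
  map_mul' := Completion.coe_mul
  map_zero' := Completion.coe_zero
  map_add' := Completion.coe_add
  commutes' c := (Completion.algebraMap_def _ _ c).symm

theorem norm_ofLocal (f : LocalSeq X) : ‖ofLocal f‖ = ‖f‖ := Completion.norm_coe f

theorem dense_ofLocal : DenseRange (ofLocal : LocalSeq X → QuasiLocal X) :=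
  Completion.denseRange_coe

theorem induction_on {p : QuasiLocal X → Prop} (a : QuasiLocal X) (hc : IsClosed {a | p a})
    (h : ∀ f, p (ofLocal f)) : p a := Completion.induction_on a hc h

noncomputable instance : Star (QuasiLocal X) where
  star a := Completion.map (star : LocalSeq X → LocalSeq X) a

theorem star_ofLocal (f : LocalSeq X) : star (ofLocal f) = ofLocal (star f) :=
  Completion.map_coe LocalSeq.uniformContinuous_star f

theorem continuous_star' : Continuous (star : QuasiLocal X → QuasiLocal X) :=
  Completion.continuous_map

noncomputable instance : StarRing (QuasiLocal X) where
  star_involutive a := by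
    refine induction_on (p := fun a => star (star a) = a) a
      (isClosed_eq (continuous_star'.comp continuous_star') continuous_id) fun f => ?_
    rw [star_ofLocal, star_ofLocal, star_star]
  star_mul a b := by
    refine induction_on (p := fun a => star (a * b) = star b * star a) a
      (isClosed_eq (continuous_star'.comp (continuous_id.mul continuous_const))
      (continuous_const.mul continuous_star')) fun f => ?_
    refine induction_on (p := fun b => star (ofLocal f * b) = star b * star (ofLocal f)) b
      (isClosed_eq (continuous_star'.comp (continuous_const.mul continuous_id))
      (continuous_star'.mul continuous_const)) fun g => ?_
    rw [← map_mul, star_ofLocal, star_ofLocal, star_ofLocal, ← map_mul, star_mul]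
  star_add a b := by
    refine induction_on (p := fun a => star (a + b) = star a + star b) a
      (isClosed_eq (continuous_star'.comp (continuous_id.add continuous_const))
      (continuous_star'.add continuous_const)) fun f => ?_
    refine induction_on (p := fun b => star (ofLocal f + b) = star (ofLocal f) + star b) b
      (isClosed_eq (continuous_star'.comp (continuous_const.add continuous_id))
      (continuous_const.add continuous_star')) fun g => ?_
    rw [← map_add, star_ofLocal, star_ofLocal, star_ofLocal, ← map_add, star_add]

noncomputable instance : CStarAlgebra (QuasiLocal X) where
  norm_mul_self_le a := by
    refine induction_on (p := fun a => ‖a‖ * ‖a‖ ≤ ‖star a * a‖) a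
      (isClosed_le (continuous_norm.mul continuous_norm)
      ((continuous_star'.mul continuous_id).norm)) fun f => ?_
    rw [star_ofLocal, ← map_mul, norm_ofLocal, norm_ofLocal, LocalSeq.norm_star_mul_self]
  star_smul c a := by
    refine induction_on (p := fun a => star (c • a) = star c • star a) a
      (isClosed_eq (continuous_star'.comp (continuous_id.const_smul c))
      ((continuous_const_smul (star c)).comp continuous_star')) fun f => ?_
    rw [← map_smul, star_ofLocal, star_ofLocal, ← map_smul, star_smul]

noncomputable instance : PartialOrder (QuasiLocal X) := CStarAlgebra.spectralOrder _

instance : StarOrderedRing (QuasiLocal X) := CStarAlgebra.spectralOrderedRing _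

theorem ofLocal_eq_of_eventually {f g : LocalSeq X}
    (h : ∀ᶠ N in atTop, LocalSeq.term N f = LocalSeq.term N g) : ofLocal f = ofLocal g := by
  rw [← sub_eq_zero, ← map_sub, ← norm_eq_zero, norm_ofLocal]
  exact LocalSeq.limNorm_eq_zero (h.mono fun N hN => by rw [map_sub, hN, sub_self])

end QuasiLocal

/-- The operator `w` placed on the sites `a, …, a + n - 1`, viewed on all boxes `[-N, N)` that
contain these sites. -/
noncomputable def siteSeq (X : C) (a : ℤ) (n : ℕ) (w : End (tensorPow X n)) : LocalSeq X :=
  ⟨fun N => if h : -(N : ℤ) ≤ a ∧ a + n ≤ N then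
      pad X (a + N).toNat (N - (a + n)).toNat (by omega) w else 0, by
    refine eventually_atTop.2 ⟨(-a).toNat + (a + n).toNat, fun N hN => ?_⟩
    have h1 : -(N : ℤ) ≤ a ∧ a + n ≤ N := by omega
    have h2 : -((N + 1 : ℕ) : ℤ) ≤ a ∧ a + n ≤ (N + 1 : ℕ) := by omega
    simp only [dif_pos h1, dif_pos h2]
    refine Eq.trans ?_ (padFun_padFun X _ _ _ _ _ _ w).symm
    exact padFun_congr X _ (by omega) (by omega) w⟩

theorem term_siteSeq (X : C) (a : ℤ) (n : ℕ) (w : End (tensorPow X n)) (N : ℕ)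
    (h : -(N : ℤ) ≤ a ∧ a + n ≤ N) : LocalSeq.term N (siteSeq X a n w) =
      pad X (a + N).toNat (N - (a + n)).toNat (by omega) w := dif_pos h

theorem eventually_term_siteSeq (X : C) (a : ℤ) (n : ℕ) : ∀ᶠ N : ℕ in atTop,
    ∃ h : -(N : ℤ) ≤ a ∧ a + n ≤ N, ∀ w, LocalSeq.term N (siteSeq X a n w) =
      pad X (a + N).toNat (N - (a + n)).toNat (by omega) w :=
  eventually_atTop.2 ⟨(-a).toNat + (a + n).toNat, fun N hN =>
    ⟨by omega, fun w => term_siteSeq X a n w N (by omega)⟩⟩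

/-- The embedding of `End (X ^ ⊗ n)` into the quasi-local algebra as the operators on the
sites `a, …, a + n - 1`. -/
noncomputable def siteHom (X : C) (a : ℤ) (n : ℕ) :
    End (tensorPow X n) →⋆ₐ[ℂ] QuasiLocal X where
  toFun w := QuasiLocal.ofLocal (siteSeq X a n w)
  map_one' := by
    rw [← map_one QuasiLocal.ofLocal]
    refine QuasiLocal.ofLocal_eq_of_eventually ?_
    filter_upwards [eventually_term_siteSeq X a n] with N ⟨_, hN⟩
    rw [hN, map_one, map_one]
  map_mul' v w := by
    rw [← map_mul]
    refine QuasiLocal.ofLocal_eq_of_eventually ?_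
    filter_upwards [eventually_term_siteSeq X a n] with N ⟨_, hN⟩
    rw [map_mul, hN, hN, hN, map_mul]
  map_zero' := by
    rw [← map_zero QuasiLocal.ofLocal]
    refine QuasiLocal.ofLocal_eq_of_eventually ?_
    filter_upwards [eventually_term_siteSeq X a n] with N ⟨_, hN⟩
    rw [hN, map_zero, map_zero]
  map_add' v w := by
    rw [← map_add]
    refine QuasiLocal.ofLocal_eq_of_eventually ?_
    filter_upwards [eventually_term_siteSeq X a n] with N ⟨_, hN⟩
    rw [map_add, hN, hN, hN, map_add]
  commutes' c := by
    rw [← AlgHomClass.commutes QuasiLocal.ofLocal]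
    refine QuasiLocal.ofLocal_eq_of_eventually ?_
    filter_upwards [eventually_term_siteSeq X a n] with N ⟨_, hN⟩
    rw [hN, AlgHomClass.commutes, AlgHomClass.commutes]
  map_star' w := by
    rw [QuasiLocal.star_ofLocal]
    refine QuasiLocal.ofLocal_eq_of_eventually ?_
    filter_upwards [eventually_term_siteSeq X a n] with N ⟨_, hN⟩
    rw [map_star, hN, hN, map_star]

theorem siteHom_pad (X : C) {n m : ℕ} (a : ℤ) (p q : ℕ) (h : p + n + q = m)
    (w : End (tensorPow X n)) :
    siteHom X a m (pad X p q h w) = siteHom X (a + p) n w := by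
  refine QuasiLocal.ofLocal_eq_of_eventually ?_
  filter_upwards [eventually_term_siteSeq X a m, eventually_term_siteSeq X (a + p) n]
    with N ⟨h1, h1'⟩ ⟨h2, h2'⟩
  rw [h1', h2']
  refine (padFun_padFun X _ _ _ _ _ _ w).trans ?_
  exact padFun_congr X _ (by omega) (by omega) w

theorem siteHom_comm (X : C) {n m : ℕ} (a b : ℤ) (hab : a + n ≤ b) (w : End (tensorPow X n))
    (v : End (tensorPow X m)) : Commute (siteHom X a n w) (siteHom X b m v) := by
  have h1 : siteHom X a n w = siteHom X a (b + m - a).toNat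
      (pad X 0 ((b + m - a).toNat - n) (by omega) w) := by
    rw [siteHom_pad]; simp
  have h2 : siteHom X b m v = siteHom X a (b + m - a).toNat
      (pad X (b - a).toNat 0 (by omega) v) := by
    rw [siteHom_pad]
    congr 2
    omega
  rw [h1, h2]
  refine Commute.map ?_ _
  exact (padFun_comm X _ _ _ _ _ _ (by omega) w v).symm

end FusionSpinChain

/-! ### Abstract spin chains and quantum cellular automata -/

/-- An abstract spin chain with quasi-local algebra `A`. -/
structure AbstractSpinChain (A : Type*) [CStarAlgebra A] where
  /-- The algebra of operators localized in a finite nonempty interval. -/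
  alg : NonemptyInterval ℤ → StarSubalgebra ℂ A
  mono : Monotone alg
  finiteDimensional : ∀ I, FiniteDimensional ℂ (alg I)
  locality : ∀ I J : NonemptyInterval ℤ, Disjoint (Set.Icc I.fst I.snd) (Set.Icc J.fst J.snd) →
    ∀ x ∈ alg I, ∀ y ∈ alg J, x * y = y * x
  quasiLocality : Dense (⋃ I, (alg I : Set A))

/-- The number of sites of an interval. -/
def intervalLength (I : NonemptyInterval ℤ) : ℕ := (I.snd - I.fst + 1).toNat

/-- The fusion spin chain `A(C, X)`. -/
noncomputable def fusionSpinChain {C : Type*} [Category C] [Abelian C] [Linear ℂ C]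
    [MonoidalCategory C] [MonoidalPreadditive C] [MonoidalLinear ℂ C] [RigidCategory C]
    [UnitaryFusionCategory C] (X : C) : AbstractSpinChain (QuasiLocal X) where
  alg I := (siteHom X I.fst (intervalLength I)).range
  mono := by
    rintro I J hIJ _ ⟨w, rfl⟩
    have h1 : J.fst ≤ I.fst := hIJ.1
    have h2 : I.snd ≤ J.snd := hIJ.2
    have h3 := I.fst_le_snd
    refine ⟨pad X (I.fst - J.fst).toNat (J.snd - I.snd).toNat
      (by simp only [intervalLength]; omega) w, ?_⟩
    refine (siteHom_pad X _ _ _ _ w).trans ?_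
    change _ = siteHom X I.fst _ w
    congr 2
    omega
  finiteDimensional I := by
    have : FiniteDimensional ℂ (End (tensorPow X (intervalLength I))) :=
      UnitaryFusionCategory.finiteDimensional_hom _ _
    exact Module.Finite.range (siteHom X I.fst (intervalLength I)).toAlgHom.toLinearMap
  locality := by
    rintro I J hIJ _ ⟨w, rfl⟩ _ ⟨v, rfl⟩
    have h3 := I.fst_le_snd
    have h4 := J.fst_le_snd
    rcases lt_or_ge I.snd J.fst with h | h
    · exact siteHom_comm X _ _ (by simp only [intervalLength]; omega) w v
    · have h' : J.snd < I.fst := by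
        by_contra hc
        exact Set.disjoint_left.1 hIJ
          (show max I.fst J.fst ∈ Set.Icc I.fst I.snd from ⟨le_max_left _ _, max_le h3 h⟩)
          ⟨le_max_right _ _, max_le (not_lt.1 hc) h4⟩
      exact (siteHom_comm X _ _ (by simp only [intervalLength]; omega) v w).symm
  quasiLocality := by
    refine QuasiLocal.dense_ofLocal.mono ?_
    rintro _ ⟨f, rfl⟩
    obtain ⟨N₀, h⟩ := eventually_atTop.1 (LocalSeq.eventually_term f)
    set M := N₀ + 1 with hM
    refine Set.mem_iUnion.2 ⟨⟨(-(M : ℤ), (M : ℤ) - 1), by change -(M : ℤ) ≤ M - 1; omega⟩, ?_⟩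
    have hlen : intervalLength ⟨(-(M : ℤ), (M : ℤ) - 1), by change -(M : ℤ) ≤ M - 1; omega⟩
        = 2 * M := by
      simp only [intervalLength]; omega
    have key : ∀ k, LocalSeq.term (M + 1 + k) f = pad X (k + 1) (k + 1) (by omega)
        (LocalSeq.term M f) := by
      intro k
      induction k with
      | zero => exact h M (by omega)
      | succ k ih =>
        refine (h (M + 1 + k) (by omega)).trans ?_
        rw [ih]
        refine (padFun_padFun X _ _ _ _ _ _ _).trans ?_
        exact padFun_congr X _ (by omega) (by omega) _
    have hmem : QuasiLocal.ofLocal f = siteHom X (-(M : ℤ)) (2 * M) (LocalSeq.term M f) := by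
      refine QuasiLocal.ofLocal_eq_of_eventually ?_
      filter_upwards [eventually_term_siteSeq X (-(M : ℤ)) (2 * M), eventually_ge_atTop (M + 1)]
        with N ⟨h1, h2⟩ hN
      obtain ⟨k, rfl⟩ := Nat.exists_eq_add_of_le hN
      rw [h2, key]
      exact padFun_congr X _ (by omega) (by omega) _
    have : ∀ (n : ℕ), n = 2 * M → QuasiLocal.ofLocal f ∈ (siteHom X (-(M : ℤ)) n).range := by
      rintro _ rfl
      exact ⟨_, hmem.symm⟩
    exact this _ hlen

/-- The interval `[a - l, b + l]` for `I = [a, b]`. -/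
def thicken (I : NonemptyInterval ℤ) (l : ℕ) : NonemptyInterval ℤ :=
  ⟨(I.fst - l, I.snd + l), by have := I.fst_le_snd; change I.fst - l ≤ I.snd + l; omega⟩

/-- A quantum cellular automaton: a *-automorphism of bounded spread. -/
def IsQCA {A : Type*} [CStarAlgebra A] (𝒩 : AbstractSpinChain A) (α : A ≃⋆ₐ[ℂ] A) : Prop :=
  ∃ l : ℕ, ∀ I, (∀ a ∈ 𝒩.alg I, α a ∈ 𝒩.alg (thicken I l)) ∧
    (∀ a ∈ 𝒩.alg I, α.symm a ∈ 𝒩.alg (thicken I l))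

/-! ### Murray–von Neumann dimension and Jones index -/

section Jones

variable {H : Type*} [NormedAddCommGroup H] [InnerProductSpace ℂ H] [CompleteSpace H]

/-- The von Neumann algebra generated by a set of operators: the bicommutant of its
*-closure. -/
noncomputable def generatedVN (S : Set (H →L[ℂ] H)) : VonNeumannAlgebra H where
  toStarSubalgebra :=
    StarSubalgebra.centralizer ℂ (StarSubalgebra.centralizer ℂ S : Set (H →L[ℂ] H))
  centralizer_centralizer' := by
    change Set.centralizer (Set.centralizer
      (StarSubalgebra.centralizer ℂ (StarSubalgebra.centralizer ℂ S : Set (H →L[ℂ] H)) :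
        Set (H →L[ℂ] H))) = _
    rw [StarSubalgebra.coe_centralizer, Set.centralizer_centralizer_centralizer]
    rfl

/-- A factor: a von Neumann algebra with trivial center. -/
def IsFactor (M : VonNeumannAlgebra H) : Prop :=
  ∀ z ∈ M, (∀ y ∈ M, z * y = y * z) → ∃ c : ℂ, z = c • (1 : H →L[ℂ] H)

/-- The closure of `M Ω`. If the vector state of `Ω` is a trace on `M`, this is the standard
module `L²(M)`, with `M` acting by restriction and with `Ω` as the trace vector. -/
def vnL2 (M : VonNeumannAlgebra H) (Ω : H) : Submodule ℂ H :=
  (Submodule.span ℂ {v | ∃ T ∈ M, T Ω = v}).topologicalClosure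

theorem isClosed_vnL2 (M : VonNeumannAlgebra H) (Ω : H) : IsClosed (vnL2 M Ω : Set H) :=
  Submodule.isClosed_topologicalClosure _

instance (M : VonNeumannAlgebra H) (Ω : H) : CompleteSpace (vnL2 M Ω) :=
  (isClosed_vnL2 M Ω).completeSpace_coe

/-- The trace vector, as an element of `L²(M)`. -/
noncomputable def traceVector (M : VonNeumannAlgebra H) (Ω : H) : vnL2 M Ω :=
  ⟨Ω, Submodule.le_topologicalClosure _ (Submodule.subset_span ⟨1, one_mem M, rfl⟩)⟩

/-- `ℓ²(ℕ) ⊗ L²(N)`. -/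
abbrev ampliation (N : VonNeumannAlgebra H) (Ω : H) : Type _ :=
  lp (fun _ : ℕ => vnL2 N Ω) 2

/-- `u : K → ℓ²(ℕ) ⊗ L²(N)` commutes with the actions of `N`. -/
def IsModuleMap (N : VonNeumannAlgebra H) (Ω : H) (K : Submodule ℂ H)
    (u : K →ₗᵢ[ℂ] ampliation N Ω) : Prop :=
  ∀ T ∈ N, ∀ ξ η : K, (η : H) = T ξ → ∀ i, ((u η i : vnL2 N Ω) : H) = T (u ξ i : vnL2 N Ω)

/-- The Murray–von Neumann dimension `dim_N(K)` of a closed `N`-invariant subspace `K`, for a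
`II₁` factor `N` whose trace is the vector state of `Ω`: if `u : K → ℓ²(ℕ) ⊗ L²(N)` is an
`N`-linear isometry, then `dim_N(K) = Tr(u u*) = ∑ i, ⟨δ_i ⊗ Ω, u u* (δ_i ⊗ Ω)⟩`, which does not
depend on `u`. It is `∞` if there is no such `u`. -/
noncomputable def mvnDim (N : VonNeumannAlgebra H) (Ω : H) (K : Submodule ℂ H)
    [CompleteSpace K] : ENNReal :=
  ⨅ (u : K →ₗᵢ[ℂ] ampliation N Ω) (_ : IsModuleMap N Ω K u),
    ∑' i : ℕ, ENNReal.ofReal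
      (‖ContinuousLinearMap.adjoint u.toContinuousLinearMap
        (lp.single 2 i (traceVector N Ω))‖ ^ 2)

/-- The Jones index `[M : N] = dim_N(L²(M))`. -/
noncomputable def jonesIndex (N M : VonNeumannAlgebra H) (Ω : H) : ENNReal :=
  mvnDim N Ω (vnL2 M Ω)

end Jones

/-! ### The index of a quantum cellular automaton -/

section Index

variable {A : Type*} [CStarAlgebra A] [PartialOrder A] [StarOrderedRing A]

/-- A tracial state. -/
structure IsTracialState (τ : A →ₚ[ℂ] ℂ) : Prop where
  map_one : τ 1 = 1
  map_mul_comm : ∀ a b, τ (a * b) = τ (b * a)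

/-- The class of `1` in the GNS space `L²(A, τ)`. -/
noncomputable def gnsVector (τ : A →ₚ[ℂ] ℂ) : τ.GNS :=
  ((τ.toPreGNS 1 : τ.PreGNS) : UniformSpace.Completion τ.PreGNS)

/-- The operators localized in some interval `I ≤ x`. -/
def leftLocal (𝒩 : AbstractSpinChain A) (x : ℤ) : Set A :=
  {a | ∃ I : NonemptyInterval ℤ, I.snd ≤ x ∧ a ∈ 𝒩.alg I}

/-- The von Neumann algebra `𝒜_x` on `L²(A, τ)` generated by the operators localized at
sites `≤ x`. -/
noncomputable def leftVN (𝒩 : AbstractSpinChain A) (τ : A →ₚ[ℂ] ℂ) (x : ℤ) :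
    VonNeumannAlgebra τ.GNS :=
  generatedVN (τ.gnsStarAlgHom '' leftLocal 𝒩 x)

/-- The image `α(𝒜_x)` of `𝒜_x` under the extension of `α` to `A''`, that is, the von Neumann
algebra generated by the image under `α` of the operators localized at sites `≤ x`. -/
noncomputable def leftVNImage (𝒩 : AbstractSpinChain A) (τ : A →ₚ[ℂ] ℂ) (α : A ≃⋆ₐ[ℂ] A) (x : ℤ) :
    VonNeumannAlgebra τ.GNS :=
  generatedVN (τ.gnsStarAlgHom '' (α '' leftLocal 𝒩 x))

/-- The finite index property (for the unique tracial state `τ`). -/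
def FiniteIndexProperty (𝒩 : AbstractSpinChain A) (τ : A →ₚ[ℂ] ℂ) : Prop :=
  ∀ x : ℤ, IsFactor (leftVN 𝒩 τ x) ∧
    ¬ FiniteDimensional ℂ (leftVN 𝒩 τ x).toStarSubalgebra ∧
    ∀ z : ℤ, x < z → jonesIndex (leftVN 𝒩 τ x) (leftVN 𝒩 τ z) (gnsVector τ) ≠ ⊤

/-- `ind(α) = r`: there are `y ≤ x` with `𝒜_y ⊆ α(𝒜_x)`, and for all of them the Jones indices
are finite and `r = ([α(𝒜_x) : 𝒜_y] / [𝒜_x : 𝒜_y]) ^ (1/2)`. -/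
def HasIndex (𝒩 : AbstractSpinChain A) (τ : A →ₚ[ℂ] ℂ) (α : A ≃⋆ₐ[ℂ] A) (r : ℝ) : Prop :=
  (∃ x y : ℤ, y ≤ x ∧ leftVN 𝒩 τ y ≤ leftVNImage 𝒩 τ α x) ∧
  ∀ x y : ℤ, y ≤ x → leftVN 𝒩 τ y ≤ leftVNImage 𝒩 τ α x →
    jonesIndex (leftVN 𝒩 τ y) (leftVNImage 𝒩 τ α x) (gnsVector τ) ≠ ⊤ ∧
    jonesIndex (leftVN 𝒩 τ y) (leftVN 𝒩 τ x) (gnsVector τ) ≠ ⊤ ∧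
    r = Real.sqrt
      ((jonesIndex (leftVN 𝒩 τ y) (leftVNImage 𝒩 τ α x) (gnsVector τ)).toReal /
        (jonesIndex (leftVN 𝒩 τ y) (leftVN 𝒩 τ x) (gnsVector τ)).toReal)

end Index

/-! ### Generalized translations -/

section Categorical

variable {C : Type*} [Category C] [Abelian C] [Linear ℂ C] [MonoidalCategory C]
  [MonoidalPreadditive C] [MonoidalLinear ℂ C] [RigidCategory C] [UnitaryFusionCategory C]

/-- Some tensor power of `X` contains every simple object as a direct summand. -/
def StronglyTensorGenerating (X : C) : Prop :=
  ∃ n : ℕ, 0 < n ∧ ∀ S : C, Simple S → Nonempty (Retract S (tensorPow X n))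

/-- The (unitary, or intrinsic) dimension: the minimum of `‖R‖ ‖R'‖` over the solutions
`(R : 𝟙 → Y' ⊗ Y, R' : 𝟙 → Y ⊗ Y')` of the conjugate equations, where `R* R` and `R'* R'` are
identified with scalars. -/
noncomputable def quantumDim (Y : C) : ℝ :=
  sInf {d : ℝ | ∃ (Y' : C) (_ : ExactPairing Y Y') (r r' : ℝ),
    dag (ExactPairing.evaluation Y Y') ≫ ExactPairing.evaluation Y Y' = (r : ℂ) • 𝟙 (𝟙_ C) ∧
    ExactPairing.coevaluation Y Y' ≫ dag (ExactPairing.coevaluation Y Y') =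
      (r' : ℂ) • 𝟙 (𝟙_ C) ∧
    d = Real.sqrt r * Real.sqrt r'}

/-- A Tambara–Yamagami category over the finite abelian group `B`: its simple objects are, up to
isomorphism, the pairwise non-isomorphic objects `b ∈ B` and `ρ`, with fusion rules
`b ⊗ a ≅ ba`, `b ⊗ ρ ≅ ρ ≅ ρ ⊗ b` and `ρ ⊗ ρ ≅ ⨁ b`. -/
structure TambaraYamagami (B : Type*) [CommGroup B] [Finite B] (C : Type*) [Category C]
    [Abelian C] [MonoidalCategory C] where
  obj : B → C
  ρ : C
  simple_obj : ∀ b, Simple (obj b)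
  simple_ρ : Simple ρ
  obj_injective : ∀ a b, Nonempty (obj a ≅ obj b) → a = b
  ρ_not_obj : ∀ b, IsEmpty (ρ ≅ obj b)
  exhaustive : ∀ S : C, Simple S → (∃ b, Nonempty (S ≅ obj b)) ∨ Nonempty (S ≅ ρ)
  fusion_obj_obj : ∀ b a, Nonempty (obj b ⊗ obj a ≅ obj (b * a))
  fusion_obj_ρ : ∀ b, Nonempty (obj b ⊗ ρ ≅ ρ)
  fusion_ρ_obj : ∀ b, Nonempty (ρ ⊗ obj b ≅ ρ)
  fusion_ρ_ρ : Nonempty (ρ ⊗ ρ ≅ ⨁ obj)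

variable {D : Type*} [Category D] [Abelian D] [Linear ℂ D] [MonoidalCategory D]
  [MonoidalPreadditive D] [MonoidalLinear ℂ D] [RigidCategory D] [UnitaryFusionCategory D]

/-- A full monoidal functor `ι` is a full inclusion of unitary fusion categories: it is moreover
a faithful `ℂ`-linear *-functor with unitary monoidal structure isomorphisms. -/
structure IsFullInclusion (ι : C ⥤ D) [ι.Monoidal] [ι.Full] : Prop where
  faithful : ι.Faithful
  map_add : ∀ {X Y : C} (f g : X ⟶ Y), ι.map (f + g) = ι.map f + ι.map g
  map_smul : ∀ {X Y : C} (c : ℂ) (f : X ⟶ Y), ι.map (c • f) = c • ι.map f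
  map_dag : ∀ {X Y : C} (f : X ⟶ Y), ι.map (dag f) = dag (ι.map f)
  unitary_ε : IsUnitaryIso (Functor.Monoidal.εIso ι)
  unitary_μ : ∀ X Y : C, IsUnitaryIso (Functor.Monoidal.μIso ι X Y)

/-- The isomorphism `X ^ ⊗ nm ≅ (Y ⊗ Z) ^ ⊗ m` induced by `φ : X ^ ⊗ n ≅ Y ⊗ Z`. -/
def blockIso (ι : C ⥤ D) [ι.Monoidal] (X : C) (n : ℕ) {Y Z : D}
    (φ : ι.obj (tensorPow X n) ≅ Y ⊗ Z) :
    ∀ m : ℕ, ι.obj (tensorPow X (n * m)) ≅ tensorPow (Y ⊗ Z) m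
  | 0 => (Functor.Monoidal.εIso ι).symm
  | m + 1 => ι.mapIso (powAdd X (n * m) n).symm ≪≫
      (Functor.Monoidal.μIso ι (tensorPow X (n * m)) (tensorPow X n)).symm ≪≫
      (blockIso ι X n φ m ⊗ᵢ φ)

/-- The tensor power of an isomorphism. -/
def powIso {V W : D} (σ : V ≅ W) : ∀ m : ℕ, tensorPow V m ≅ tensorPow W m
  | 0 => Iso.refl _
  | m + 1 => powIso σ m ⊗ᵢ σ

/-- The canonical isomorphism `V ⊗ V ^ ⊗ m ≅ V ^ ⊗ (m + 1)`. -/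
def frontIso (V : D) : ∀ m : ℕ, V ⊗ tensorPow V m ≅ tensorPow V (m + 1)
  | 0 => ρ_ V ≪≫ (λ_ V).symm
  | m + 1 => (α_ V (tensorPow V m) V).symm ≪≫ whiskerRightIso (frontIso V m) V

/-- The canonical isomorphism `Y ⊗ (Z ⊗ Y) ^ ⊗ m ⊗ Z ≅ (Y ⊗ Z) ^ ⊗ (m + 1)`. -/
def regroupIso (Y Z : D) : ∀ m : ℕ, Y ⊗ (tensorPow (Z ⊗ Y) m ⊗ Z) ≅ tensorPow (Y ⊗ Z) (m + 1)
  | 0 => whiskerLeftIso Y (λ_ Z) ≪≫ (λ_ (Y ⊗ Z)).symm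
  | m + 1 => monoidalIso (Y ⊗ ((tensorPow (Z ⊗ Y) m ⊗ (Z ⊗ Y)) ⊗ Z))
      ((Y ⊗ (tensorPow (Z ⊗ Y) m ⊗ Z)) ⊗ (Y ⊗ Z)) ≪≫
      whiskerRightIso (regroupIso Y Z m) (Y ⊗ Z)

/-- The operator `1_{Y ⊗ Z} ⊗ 1_Y ⊗ [σ^{⊗ m} ∘ w ∘ (σ⁻¹)^{⊗ m}] ⊗ 1_Z` on `m + 2` blocks, for an
operator `w` on `m` blocks, where each block `X ^ ⊗ n` is identified with `Y ⊗ Z` through `φ`. -/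
noncomputable def translateBlock (ι : C ⥤ D) [ι.Monoidal] [ι.Full] (X : C) (n : ℕ) {Y Z : D}
    (φ : ι.obj (tensorPow X n) ≅ Y ⊗ Z) (σ : Y ⊗ Z ≅ Z ⊗ Y) (m : ℕ)
    (w : End (tensorPow X (n * m))) : End (tensorPow X (n * (m + 2))) :=
  let v : tensorPow (Z ⊗ Y) m ⟶ tensorPow (Z ⊗ Y) m :=
    conjFun (powIso σ m) (conjFun (blockIso ι X n φ m) (ι.map w))
  let u : tensorPow (Y ⊗ Z) (m + 2) ⟶ tensorPow (Y ⊗ Z) (m + 2) :=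
    conjFun (whiskerLeftIso (Y ⊗ Z) (regroupIso Y Z m) ≪≫ frontIso (Y ⊗ Z) (m + 1))
      ((Y ⊗ Z) ◁ (Y ◁ (v ▷ Z)))
  ι.preimage (conjFun (blockIso ι X n φ (m + 2)).symm u)

/-- `α` is the generalized translation given by the factorization `φ : X ^ ⊗ n ≅ Y ⊗ Z` and the
isomorphism `σ : Y ⊗ Z ≅ Z ⊗ Y`, for the partition of `ℤ` into the intervals
`[s + n k, s + n (k + 1))`. -/
def IsGeneralizedTranslation (ι : C ⥤ D) [ι.Monoidal] [ι.Full] (X : C) (n : ℕ) {Y Z : D}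
    (φ : ι.obj (tensorPow X n) ≅ Y ⊗ Z) (σ : Y ⊗ Z ≅ Z ⊗ Y) (s : ℤ)
    (α : QuasiLocal X ≃⋆ₐ[ℂ] QuasiLocal X) : Prop :=
  ∀ (k : ℤ) (m : ℕ), 0 < m → ∀ w : End (tensorPow X (n * m)),
    α (siteHom X (s + n * k) (n * m) w) =
      siteHom X (s + n * (k - 1)) (n * (m + 2)) (translateBlock ι X n φ σ m w)

end Categorical

set_option linter.unusedSectionVars false


/-! ### Positivity, Schur scalars and orthonormal decompositions -/

/-! The argument reduces everything to traces and partial traces in the two fusion categories. On a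
simple object both one-sided traces are multiples of one scalar, so a dual pair can be rescaled
until they agree; orthonormal direct sums then give every object a spherical dual
(`exists_spherical`). The resulting trace `catTr` is positive, faithful and cyclic (`lTr_comp_comm`)
and compatible with partial traces. Its dimension `catDim` is multiplicative and, by Cauchy–Schwarz,
attains the minimum in `quantumDim` (`quantumDim_eq_catDim`).

Uniqueness of the trace is `IsTraceFamily.eq_smul_normTr`. Since every simple object occurs in a
fixed power of `X`, a positive trace family compatible with padding dominates a fixed fraction of
its mass times the normalized categorical trace. Subtracting this and iterating leaves a positive
family of mass zero, which vanishes. The same lemma is used twice more: for a positive central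
operator `T` it applies to `a ↦ ⟨Ω, a T Ω⟩` and shows that `T` is scalar, hence factoriality; and it
applies to the trace of `D` pulled back along `ι`, so that the state `τ` can be evaluated in `D`
(`catTr_map_eq`). Infinite dimensionality follows from `1 < catDim X`.

Jones indices are computed from finite module bases. The coordinate operators of a basis are
corrected by an inverse square root to an isometric frame, and traciality of the vector state on
operators commuting with `B` shows that the dimension is the scalar `∑ m' j * m j`
(`HasIndexBasis.jonesIndex_eq`). Bases come from bending: if `W` contains every simple summand of
`(W ⊗ V) ⊗ sphDual V`, then `End (W ⊗ V)` has a Pimsner–Popa basis over `End W` with index element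
`catDim V ^ 2`. It remains a basis after tensoring with identities on the left, hence for increasing
unions (`IsCatTower.isIndexBasis`). For `V = X` this gives the finite index property.

For a generalized translation, the half-line algebra ending at a block boundary is mapped onto the
union of the algebras `End ((Y ⊗ Z) ^ ⊗ m ⊗ Y)`, tensored with the identity of the last `Z`
(`isCatTower_translation`). It therefore contains the original half-line algebra with index `catDim
Y ^ 2`. Other positions of `x` and `y` are compared through a common subalgebra far to the left
(`hasIndex_translation`). For non-unitary `φ` or `σ` the identification with operators in `D` need
not respect adjoints; for this reason a basis and its dual basis are kept as separate data.

Existence holds because the local formula is compatible with adding blocks on either side, so it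
defines a map on local operators. For unitary data this map is a *-homomorphism; it preserves the
trace, hence is isometric, and every block operator is a translate. In the Tambara–Yamagami case the
fusion rules force dimension `1` on group elements and `√|B|` on `ρ`. -/

theorem exists_selfAdjoint_inv_sqrt {A : Type*} [CStarAlgebra A] {ι : Type*} (s : Finset ι)
    (g : ι → A) (hu : IsUnit (∑ i ∈ s, star (g i) * g i)) :
    ∃ t : A, star t = t ∧ t * (∑ i ∈ s, star (g i) * g i) * t = 1 ∧
      ∀ b, Commute (∑ i ∈ s, star (g i) * g i) b → Commute t b := by
  let _ : PartialOrder A := CStarAlgebra.spectralOrder A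
  have _ : StarOrderedRing A := CStarAlgebra.spectralOrderedRing A
  set h := ∑ i ∈ s, star (g i) * g i with hh
  have hpos : 0 ≤ h := Finset.sum_nonneg fun i _ => star_mul_self_nonneg _
  -- The witness is the inverse of `q`. It commutes with everything that commutes with `h`, because
  -- `q` is a function of `h`.
  set q := CFC.sqrt h with hq
  have hqq : q * q = h := CFC.sqrt_mul_sqrt_self h hpos
  have hqs : star q = q := (CFC.sqrt_nonneg h).isSelfAdjoint.star_eq
  have hqu : IsUnit q := by
    rw [← hqq] at hu
    exact ((Commute.refl q).isUnit_mul_iff.1 hu).1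
  obtain ⟨u, hu'⟩ := hqu
  refine ⟨(↑u⁻¹ : A), ?_, ?_, fun b hb => ?_⟩
  · have h1 : star u = u := Units.ext (by simpa [hu'] using hqs)
    rw [← Units.coe_star, star_inv, h1]
  · rw [← hqq, ← hu']; simp
  · refine Commute.units_inv_left ?_
    rw [hu', hq]
    exact hb.cfcₙ_nnreal _

section CStarCat

variable {C : Type*} [Category C] [Preadditive C] [Linear ℂ C] [CStarCategory C]

theorem dag_neg {X Y : C} (f : X ⟶ Y) : dag (-f) = -dag f := by
  simpa using dag_smul (-1 : ℂ) f

theorem dag_sub {X Y : C} (f g : X ⟶ Y) : dag (f - g) = dag f - dag g := by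
  rw [sub_eq_add_neg, dag_add, dag_neg, sub_eq_add_neg]

theorem dag_sum {X Y : C} {ι : Type*} (s : Finset ι) (f : ι → (X ⟶ Y)) :
    dag (∑ i ∈ s, f i) = ∑ i ∈ s, dag (f i) :=
  map_sum (AddMonoidHom.mk' (fun f : X ⟶ Y => dag f) dag_add) f s

theorem dag_injective {X Y : C} {f g : X ⟶ Y} (h : dag f = dag g) : f = g := by
  rw [← dag_dag f, h, dag_dag]

theorem comp_dag_eq_zero {X Y : C} {f : X ⟶ Y} (h : f ≫ dag f = 0) : f = 0 := by
  apply eq_zero_of_homNorm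
  have := homNorm_comp_dag f
  rw [h, homNorm_zero] at this
  exact pow_eq_zero_iff (two_ne_zero) |>.1 this.symm

end CStarCat

section Fusion

variable {C : Type*} [Category C] [Abelian C] [Linear ℂ C] [MonoidalCategory C]
  [MonoidalPreadditive C] [MonoidalLinear ℂ C] [RigidCategory C] [UnitaryFusionCategory C]

instance finiteDimensional_hom_inst (X Y : C) : FiniteDimensional ℂ (X ⟶ Y) :=
  UnitaryFusionCategory.finiteDimensional_hom X Y

instance simple_unit_inst : Simple (𝟙_ C) := UnitaryFusionCategory.simple_unit

/-- The scalar by which an endomorphism of a simple object acts. -/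
noncomputable def schurScalar {S : C} [Simple S] (f : S ⟶ S) : ℂ :=
  (endomorphism_simple_eq_smul_id ℂ f).choose

theorem schurScalar_smul_id {S : C} [Simple S] (f : S ⟶ S) : schurScalar f • 𝟙 S = f :=
  (endomorphism_simple_eq_smul_id ℂ f).choose_spec

theorem smul_id_injective {S : C} [Simple S] {a b : ℂ} (h : a • 𝟙 S = b • 𝟙 S) : a = b := by
  have h2 : (a - b) • 𝟙 S = 0 := by rw [sub_smul, h, sub_self]
  rcases smul_eq_zero.1 h2 with h3 | h3
  · exact sub_eq_zero.1 h3
  · exact absurd h3 (id_nonzero S)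

theorem schurScalar_eq {S : C} [Simple S] {f : S ⟶ S} {c : ℂ} (h : f = c • 𝟙 S) :
    schurScalar f = c :=
  smul_id_injective ((schurScalar_smul_id f).trans h)

theorem schurScalar_id (S : C) [Simple S] : schurScalar (𝟙 S) = 1 :=
  schurScalar_eq (one_smul _ _).symm

theorem schurScalar_add {S : C} [Simple S] (f g : S ⟶ S) :
    schurScalar (f + g) = schurScalar f + schurScalar g :=
  schurScalar_eq (by rw [add_smul, schurScalar_smul_id, schurScalar_smul_id])

theorem schurScalar_smul {S : C} [Simple S] (c : ℂ) (f : S ⟶ S) :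
    schurScalar (c • f) = c * schurScalar f :=
  schurScalar_eq (by rw [mul_smul, schurScalar_smul_id])

/-- `schurScalar` as a linear map. -/
noncomputable def schurLin (S : C) [Simple S] : (S ⟶ S) →ₗ[ℂ] ℂ where
  toFun := schurScalar
  map_add' := schurScalar_add
  map_smul' := schurScalar_smul

theorem schurScalar_sum {S : C} [Simple S] {ι : Type*} (s : Finset ι) (f : ι → (S ⟶ S)) :
    schurScalar (∑ i ∈ s, f i) = ∑ i ∈ s, schurScalar (f i) :=
  map_sum (schurLin S) f s

theorem schurScalar_comp {S : C} [Simple S] (f g : S ⟶ S) :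
    schurScalar (f ≫ g) = schurScalar f * schurScalar g := by
  refine schurScalar_eq ?_
  conv_lhs => rw [← schurScalar_smul_id f, ← schurScalar_smul_id g]
  simp [smul_smul, mul_comm]

theorem schurScalar_dag {S : C} [Simple S] (f : S ⟶ S) :
    schurScalar (dag f) = star (schurScalar f) := by
  refine schurScalar_eq ?_
  conv_lhs => rw [← schurScalar_smul_id f]
  rw [dag_smul, dag_id]

theorem schurScalar_comp_dag_nonneg {S Y : C} [Simple S] (f : S ⟶ Y) :
    0 ≤ schurScalar (f ≫ dag f) := by
  obtain ⟨g, hg⟩ := exists_comp_dag_eq f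
  rw [hg, schurScalar_comp, schurScalar_dag, mul_comm]
  exact star_mul_self_nonneg _

theorem schurScalar_comp_dag_eq_zero {S Y : C} [Simple S] {f : S ⟶ Y}
    (h : schurScalar (f ≫ dag f) = 0) : f = 0 := by
  apply comp_dag_eq_zero
  rw [← schurScalar_smul_id (f ≫ dag f), h, zero_smul]

/-- By Schur and positivity, `f ≫ dag f` is a positive multiple of the identity; dividing `f` by the
square root of that scalar gives an isometry. -/
theorem exists_isometry_of_ne_zero {S Y : C} [Simple S] {f : S ⟶ Y} (h : f ≠ 0) :
    ∃ (c : ℝ) (v : S ⟶ Y), 0 < c ∧ v ≫ dag v = 𝟙 S ∧ f = (c : ℂ) • v := by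
  set r := schurScalar (f ≫ dag f) with hr
  have h0 : 0 ≤ r := schurScalar_comp_dag_nonneg f
  have h1 : r ≠ 0 := fun h' => h (schurScalar_comp_dag_eq_zero h')
  have hre : r = (r.re : ℂ) := Complex.eq_re_of_ofReal_le h0
  have hpos : 0 < r.re := lt_of_le_of_ne (Complex.le_def.1 h0).1
    fun h' => h1 (by rw [hre, ← h']; simp)
  have hs : 0 < Real.sqrt r.re := Real.sqrt_pos.2 hpos
  have hsc : ((Real.sqrt r.re : ℝ) : ℂ) ≠ 0 := by exact_mod_cast hs.ne'
  refine ⟨Real.sqrt r.re, ((Real.sqrt r.re : ℝ) : ℂ)⁻¹ • f, hs, ?_, ?_⟩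
  · rw [dag_smul, Linear.smul_comp, Linear.comp_smul, smul_smul, ← schurScalar_smul_id (f ≫ dag f),
      ← hr, smul_smul]
    have : ((Real.sqrt r.re : ℝ) : ℂ)⁻¹ * star ((Real.sqrt r.re : ℝ) : ℂ)⁻¹ * r = 1 := by
      rw [star_inv₀, Complex.star_def, Complex.conj_ofReal, ← mul_inv, ← Complex.ofReal_mul,
        Real.mul_self_sqrt hpos.le, ← hre, inv_mul_cancel₀ h1]
    rw [this, one_smul]
  · rw [smul_smul, mul_inv_cancel₀ hsc, one_smul]

theorem exists_inv_sqrt {T : C} {ι : Type*} [Fintype ι] {S : ι → C} (i : ∀ k, S k ⟶ T)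
    (hu : IsIso (∑ k, dag (i k) ≫ i k)) :
    ∃ t : T ⟶ T, dag t = t ∧ t ≫ (∑ k, dag (i k) ≫ i k) ≫ t = 𝟙 T := by
  -- The C*-axiom on positivity replaces a product factoring through `S k` by one inside the single
  -- C*-algebra `End T`, where the functional calculus is available.
  have hex : ∀ k, ∃ g : End T, dag (i k) ≫ i k = star g * g := fun k => by
    obtain ⟨g, hg⟩ := exists_comp_dag_eq (dag (i k))
    rw [dag_dag] at hg
    exact ⟨g, hg⟩
  choose g hg using hex
  have hsum : (∑ k, dag (i k) ≫ i k : T ⟶ T) = (∑ k, star (g k) * g k : End T) :=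
    Finset.sum_congr rfl fun k _ => hg k
  have hunit : IsUnit (∑ k, star (g k) * g k : End T) := by
    rw [← hsum]
    exact (isUnit_iff_isIso (∑ k, dag (i k) ≫ i k : T ⟶ T)).2 hu
  obtain ⟨t, ht, ht', _⟩ := exists_selfAdjoint_inv_sqrt (A := End T) Finset.univ g hunit
  refine ⟨t, ht, ?_⟩
  rw [hsum]
  exact ht'

/-- A complete system of inclusions and projections can be made orthonormal without changing the
objects. -/
theorem exists_orthonormal {T : C} {ι : Type*} [Fintype ι] [DecidableEq ι] {S : ι → C}
    (i : ∀ k, S k ⟶ T) (p : ∀ k, T ⟶ S k)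
    (hip : ∀ k l, i k ≫ p l = if h : k = l then eqToHom (by rw [h]) else 0)
    (hsum : ∑ k, p k ≫ i k = 𝟙 T) :
    ∃ v : ∀ k, S k ⟶ T,
      (∀ k l, v k ≫ dag (v l) = if h : k = l then eqToHom (by rw [h]) else 0) ∧
      ∑ k, dag (v k) ≫ v k = 𝟙 T := by
  -- Biorthogonality of `i` and `p` makes `h'` the inverse of `h`. The orthonormal system is `i k ≫
  -- t` with `t` the inverse square root of `h`.
  set h := ∑ k, dag (i k) ≫ i k with hh
  set h' := ∑ k, p k ≫ dag (p k) with hh'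
  have hdag_e : ∀ {k l : ι} (e : k = l), dag (eqToHom (congrArg S e)) =
      eqToHom (congrArg S e.symm) := by
    intro k l e; subst e; simp [dag_id]
  have hpi : ∀ k l, dag (p k) ≫ dag (i l) = if h : k = l then eqToHom (by rw [h]) else 0 := by
    intro k l
    rw [← dag_comp, hip]
    by_cases e : k = l
    · subst e; simp [dag_id]
    · rw [dif_neg e, dif_neg (Ne.symm e), dag_zero]
  have hsum' : ∑ k, dag (i k) ≫ dag (p k) = 𝟙 T := by
    rw [← dag_id T, ← hsum, dag_sum]
    simp only [dag_comp]
  have h1 : h ≫ h' = 𝟙 T := by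
    rw [← hsum', hh, hh', Preadditive.sum_comp]
    refine Finset.sum_congr rfl fun k _ => ?_
    rw [Preadditive.comp_sum, Finset.sum_eq_single k]
    · have := hip k k
      rw [dif_pos rfl, eqToHom_refl] at this
      rw [Category.assoc, reassoc_of% this]
    · intro l _ hl
      have := hip k l
      rw [dif_neg hl.symm] at this
      rw [Category.assoc, reassoc_of% this, zero_comp, comp_zero]
    · simp
  have h2 : h' ≫ h = 𝟙 T := by
    rw [← hsum, hh, hh', Preadditive.sum_comp]
    refine Finset.sum_congr rfl fun k _ => ?_
    rw [Preadditive.comp_sum, Finset.sum_eq_single k]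
    · have := hpi k k
      rw [dif_pos rfl, eqToHom_refl] at this
      rw [Category.assoc, reassoc_of% this]
    · intro l _ hl
      have := hpi k l
      rw [dif_neg hl.symm] at this
      rw [Category.assoc, reassoc_of% this, zero_comp, comp_zero]
    · simp
  have hiso : IsIso h := ⟨h', h1, h2⟩
  obtain ⟨t, ht, ht'⟩ := exists_inv_sqrt i hiso
  rw [← hh] at ht'
  -- From `t ≫ h ≫ t = 𝟙` alone: `t` is split on both sides, hence invertible, and therefore
  -- commutes with `h`.
  have htt : t ≫ t = h' := by
    have ha : t ≫ (h ≫ t) = 𝟙 T := ht'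
    have hb : (t ≫ h) ≫ t = 𝟙 T := by rw [Category.assoc]; exact ht'
    have hc : (h ≫ t) ≫ t = 𝟙 T := by
      have : t ≫ h = h ≫ t := by
        have _ : IsIso t := by
          have hl : IsSplitMono t := ⟨⟨⟨h ≫ t, ha⟩⟩⟩
          have hr : IsSplitEpi t := ⟨⟨⟨t ≫ h, hb⟩⟩⟩
          exact isIso_of_epi_of_isSplitMono t
        rw [← cancel_mono t, hb, ← cancel_epi t, Category.assoc, reassoc_of% ha, Category.comp_id]
      rw [← this]; exact hb
    calc t ≫ t = h' ≫ h ≫ t ≫ t := by rw [reassoc_of% h2]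
      _ = h' := by rw [Category.assoc] at hc; rw [hc, Category.comp_id]
  refine ⟨fun k => i k ≫ t, fun k l => ?_, ?_⟩
  · rw [dag_comp, ht, Category.assoc, reassoc_of% htt, hh', Preadditive.sum_comp,
      Preadditive.comp_sum, Finset.sum_eq_single l]
    · have := hpi l l
      rw [dif_pos rfl, eqToHom_refl] at this
      rw [Category.assoc, this, Category.comp_id, hip]
    · intro m _ hm
      have := hpi m l
      rw [dif_neg hm] at this
      rw [Category.assoc, this, comp_zero, comp_zero]
    · simp
  · rw [← ht', hh, Preadditive.sum_comp, Preadditive.comp_sum]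
    refine Finset.sum_congr rfl fun k _ => ?_
    rw [dag_comp, ht]
    simp

/-- An orthonormal decomposition of `T` into simple objects. -/
structure SimpleDecomp (T : C) where
  n : ℕ
  obj : Fin n → C
  simple : ∀ k, Simple (obj k)
  v : ∀ k, obj k ⟶ T
  ortho : ∀ k l, v k ≫ dag (v l) = if h : k = l then eqToHom (by rw [h]) else 0
  sum_eq : ∑ k, dag (v k) ≫ v k = 𝟙 T

attribute [instance] SimpleDecomp.simple

theorem SimpleDecomp.isometry {T : C} (d : SimpleDecomp T) (k : Fin d.n) :
    d.v k ≫ dag (d.v k) = 𝟙 _ := by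
  simpa using d.ortho k k

theorem SimpleDecomp.ortho_ne {T : C} (d : SimpleDecomp T) {k l : Fin d.n} (h : k ≠ l) :
    d.v k ≫ dag (d.v l) = 0 := by
  simpa [h] using d.ortho k l

theorem exists_orthonormal_biproduct {n : ℕ} (S : Fin n → C) :
    ∃ (T : C) (v : ∀ k, S k ⟶ T),
      (∀ k l, v k ≫ dag (v l) = if h : k = l then eqToHom (by rw [h]) else 0) ∧
      ∑ k, dag (v k) ≫ v k = 𝟙 T :=
  ⟨⨁ S, exists_orthonormal (fun k => biproduct.ι S k) (fun k => biproduct.π S k)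
    (fun k l => biproduct.ι_π S k l) biproduct.total⟩

theorem nonempty_simpleDecomp (T : C) : Nonempty (SimpleDecomp T) := by
  obtain ⟨n, S, hS, ⟨e⟩⟩ := UnitaryFusionCategory.semisimple T
  obtain ⟨v, hv, hv'⟩ := exists_orthonormal (fun k => biproduct.ι S k ≫ e.inv)
    (fun k => e.hom ≫ biproduct.π S k)
    (fun k l => by simpa using biproduct.ι_π S k l)
    (by
      have : ∀ k, (e.hom ≫ biproduct.π S k) ≫ biproduct.ι S k ≫ e.inv =
          e.hom ≫ (biproduct.π S k ≫ biproduct.ι S k) ≫ e.inv := fun k => by simp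
      simp only [this]
      rw [← Preadditive.comp_sum, ← Preadditive.sum_comp, biproduct.total]
      simp)
  exact ⟨⟨n, S, hS, v, hv, hv'⟩⟩

/-- A chosen orthonormal decomposition into simple objects. -/
noncomputable def simpleDecomp (T : C) : SimpleDecomp T := (nonempty_simpleDecomp T).some

/-- The unitary part in the polar decomposition of an isomorphism. -/
theorem exists_unitaryIso {X Y : C} (e : X ≅ Y) : ∃ u : X ≅ Y, IsUnitaryIso u := by
  obtain ⟨v, hv, hv'⟩ := exists_orthonormal (ι := Fin 1) (S := fun _ => X) (T := Y)
    (fun _ => e.hom) (fun _ => e.inv)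
    (fun k l => by simp [Subsingleton.elim k l]) (by simp)
  refine ⟨⟨v 0, dag (v 0), ?_, ?_⟩, rfl⟩
  · simpa using hv 0 0
  · simpa using hv'

theorem exists_ne_zero_comp_of_ne_zero {X T : C} (d : SimpleDecomp T) {f : T ⟶ X} (h : f ≠ 0) :
    ∃ k, d.v k ≫ f ≠ 0 := by
  by_contra! hc
  apply h
  rw [← Category.id_comp f, ← d.sum_eq, Preadditive.sum_comp]
  exact Finset.sum_eq_zero fun k _ => by rw [Category.assoc, hc, comp_zero]

end Fusion


/-! ### Spherical pairings and the categorical trace -/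

section Spherical

variable {C : Type*} [Category C] [Abelian C] [Linear ℂ C] [MonoidalCategory C]
  [MonoidalPreadditive C] [MonoidalLinear ℂ C] [RigidCategory C] [UnitaryFusionCategory C]

theorem dag_associator_hom (X Y Z : C) : dag (α_ X Y Z).hom = (α_ X Y Z).inv :=
  UnitaryFusionCategory.unitary_associator X Y Z

theorem dag_associator_inv (X Y Z : C) : dag (α_ X Y Z).inv = (α_ X Y Z).hom := by
  rw [← dag_associator_hom, dag_dag]

theorem dag_leftUnitor_hom (X : C) : dag (λ_ X).hom = (λ_ X).inv :=
  UnitaryFusionCategory.unitary_leftUnitor X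

theorem dag_leftUnitor_inv (X : C) : dag (λ_ X).inv = (λ_ X).hom := by
  rw [← dag_leftUnitor_hom, dag_dag]

theorem dag_rightUnitor_hom (X : C) : dag (ρ_ X).hom = (ρ_ X).inv :=
  UnitaryFusionCategory.unitary_rightUnitor X

theorem dag_rightUnitor_inv (X : C) : dag (ρ_ X).inv = (ρ_ X).hom := by
  rw [← dag_rightUnitor_hom, dag_dag]

theorem dag_whiskerL (X : C) {Y Z : C} (f : Y ⟶ Z) : dag (X ◁ f) = X ◁ dag f :=
  UnitaryFusionCategory.dag_whiskerLeft X f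

theorem dag_whiskerR {Y Z : C} (f : Y ⟶ Z) (X : C) : dag (f ▷ X) = dag f ▷ X :=
  UnitaryFusionCategory.dag_whiskerRight f X

theorem exists_rightMate {V V' U U' : C} [ExactPairing V V'] [ExactPairing U U'] (f : U ⟶ V) :
    ∃ g : V' ⟶ U', g ▷ U ≫ ε_ U U' = V' ◁ f ≫ ε_ V V' ∧
      η_ V V' ≫ V ◁ g = η_ U U' ≫ f ▷ U' :=
  let _ : HasRightDual V := ⟨V'⟩
  let _ : HasRightDual U := ⟨U'⟩
  ⟨rightAdjointMate f, rightAdjointMate_comp_evaluation f, coevaluation_comp_rightAdjointMate f⟩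

theorem exists_leftMate {V V' U U' : C} [ExactPairing V V'] [ExactPairing U U'] (g : V' ⟶ U') :
    ∃ f : U ⟶ V, g ▷ U ≫ ε_ U U' = V' ◁ f ≫ ε_ V V' ∧
      η_ V V' ≫ V ◁ g = η_ U U' ≫ f ▷ U' :=
  let _ : HasLeftDual V' := ⟨V⟩
  let _ : HasLeftDual U' := ⟨U⟩
  ⟨leftAdjointMate g, (leftAdjointMate_comp_evaluation g).symm,
    (coevaluation_comp_leftAdjointMate g).symm⟩

/-- Frobenius reciprocity: bending the leg `V'` is a bijection, and it sends zero to zero. -/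
theorem eq_zero_of_whiskerLeft_comp_evaluation {V V' U : C} [ExactPairing V V'] {f : U ⟶ V}
    (h : V' ◁ f ≫ ε_ V V' = 0) : f = 0 := by
  let _ : HasLeftDual V' := ⟨V⟩
  have h1 := tensorLeftHomEquiv_whiskerLeft_comp_evaluation (Z := V') f
  have h2 : V' ◁ f ≫ ε_ (ᘁV') V' = 0 := h
  rw [h2] at h1
  have h3 : (tensorLeftHomEquiv U V V' (𝟙_ C)) 0 = 0 := by simp [tensorLeftHomEquiv]
  have h4 : f ≫ (ρ_ _).inv = 0 := h1.symm.trans h3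
  rw [← cancel_mono (ρ_ V).inv, h4, zero_comp]

/-- The left trace of an endomorphism. -/
noncomputable def lTr (V V' : C) [ExactPairing V V'] (f : V ⟶ V) : ℂ :=
  schurScalar (dag (ε_ V V') ≫ V' ◁ f ≫ ε_ V V')

/-- The right trace of an endomorphism. -/
noncomputable def rTr (V V' : C) [ExactPairing V V'] (f : V ⟶ V) : ℂ :=
  schurScalar (η_ V V' ≫ f ▷ V' ≫ dag (η_ V V'))

/-- A pairing is spherical if its left and right traces agree. -/
def IsSpherical (V V' : C) [ExactPairing V V'] : Prop := ∀ f : V ⟶ V, lTr V V' f = rTr V V' f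

theorem lTr_add (V V' : C) [ExactPairing V V'] (f g : V ⟶ V) :
    lTr V V' (f + g) = lTr V V' f + lTr V V' g := by
  simp [lTr, schurScalar_add]

theorem lTr_smul (V V' : C) [ExactPairing V V'] (c : ℂ) (f : V ⟶ V) :
    lTr V V' (c • f) = c * lTr V V' f := by
  simp [lTr, schurScalar_smul]

theorem lTr_sub (V V' : C) [ExactPairing V V'] (f g : V ⟶ V) :
    lTr V V' (f - g) = lTr V V' f - lTr V V' g := by
  have := lTr_add V V' f ((-1 : ℂ) • g)
  rw [lTr_smul] at this
  simpa [sub_eq_add_neg] using this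

theorem lTr_comp_dag {V V' U : C} [ExactPairing V V'] (f : V ⟶ U) :
    lTr V V' (f ≫ dag f) =
      schurScalar ((dag (ε_ V V') ≫ V' ◁ f) ≫ dag (dag (ε_ V V') ≫ V' ◁ f)) := by
  simp [lTr, dag_comp, dag_whiskerL, dag_dag]

theorem lTr_comp_dag_nonneg {V V' U : C} [ExactPairing V V'] (f : V ⟶ U) :
    0 ≤ lTr V V' (f ≫ dag f) := by
  rw [lTr_comp_dag]; exact schurScalar_comp_dag_nonneg _

theorem eq_zero_of_lTr_comp_dag {V V' U : C} [ExactPairing V V'] {f : V ⟶ U}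
    (h : lTr V V' (f ≫ dag f) = 0) : f = 0 := by
  rw [lTr_comp_dag] at h
  have h1 := schurScalar_comp_dag_eq_zero h
  have h2 : V' ◁ dag f ≫ ε_ V V' = 0 := by
    rw [← dag_dag (ε_ V V'), ← dag_whiskerL, ← dag_comp, h1, dag_zero]
  have h3 := eq_zero_of_whiskerLeft_comp_evaluation h2
  rw [← dag_dag f, h3, dag_zero]

/-- The map `g ↦ h` is a modular twist: take the mate of `g`, then its adjoint, the mate of that,
and the adjoint again. The first identity slides `g` around the left cap. The second slides it
around the right cup, and sphericality turns right traces into left ones. -/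
theorem exists_theta {V V' U U' : C} [ExactPairing V V'] [ExactPairing U U']
    (hV : IsSpherical V V') (hU : IsSpherical U U') (g : U ⟶ V) :
    ∃ h : U ⟶ V, (∀ f : V ⟶ U, lTr V V' (f ≫ g) = lTr U U' (h ≫ f)) ∧
      ∀ f : V ⟶ U, lTr U U' (g ≫ f) = lTr V V' (f ≫ h) := by
  obtain ⟨a, ha1, ha2⟩ := exists_rightMate (V := V) (V' := V') (U := U) (U' := U') g
  obtain ⟨k, hk1, hk2⟩ := exists_leftMate (V := U) (V' := U') (U := V) (U' := V') (dag a)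
  have h1 : dag (ε_ V V') ≫ a ▷ V = dag (ε_ U U') ≫ U' ◁ dag k := by
    have := congrArg dag hk1
    simpa [dag_comp, dag_whiskerL, dag_whiskerR, dag_dag] using this
  have h2 : U ◁ a ≫ dag (η_ U U') = dag k ▷ V' ≫ dag (η_ V V') := by
    have := congrArg dag hk2
    simpa [dag_comp, dag_whiskerL, dag_whiskerR, dag_dag] using this
  refine ⟨dag k, fun f => ?_, fun f => ?_⟩
  · unfold lTr
    congr 1
    calc dag (ε_ V V') ≫ V' ◁ (f ≫ g) ≫ ε_ V V'
        = dag (ε_ V V') ≫ V' ◁ f ≫ (V' ◁ g ≫ ε_ V V') := by simp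
      _ = dag (ε_ V V') ≫ (V' ◁ f ≫ a ▷ U) ≫ ε_ U U' := by rw [← ha1]; simp
      _ = (dag (ε_ V V') ≫ a ▷ V) ≫ U' ◁ f ≫ ε_ U U' := by rw [whisker_exchange]; simp
      _ = _ := by rw [h1]; simp
  · rw [hV, hU]
    unfold rTr
    congr 1
    calc η_ U U' ≫ (g ≫ f) ▷ U' ≫ dag (η_ U U')
        = (η_ U U' ≫ g ▷ U') ≫ f ▷ U' ≫ dag (η_ U U') := by simp
      _ = η_ V V' ≫ (V ◁ a ≫ f ▷ U') ≫ dag (η_ U U') := by rw [← ha2]; simp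
      _ = η_ V V' ≫ f ▷ V' ≫ U ◁ a ≫ dag (η_ U U') := by rw [whisker_exchange]; simp
      _ = _ := by rw [h2]; simp

/-- Cyclicity amounts to triviality of the twist of `exists_theta`. The twist is an involution by
faithfulness of the trace, and positivity excludes the eigenvalue `-1`. -/
theorem lTr_comp_comm {V V' U U' : C} [ExactPairing V V'] [ExactPairing U U']
    (hV : IsSpherical V V') (hU : IsSpherical U U') (f : V ⟶ U) (g : U ⟶ V) :
    lTr V V' (f ≫ g) = lTr U U' (g ≫ f) := by
  obtain ⟨h, h1, h2⟩ := exists_theta hV hU g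
  obtain ⟨h', h1', h2'⟩ := exists_theta hV hU h
  -- Twisting twice gives back the same functional on all `f`, so faithfulness yields that the twist
  -- squares to the identity.
  have hinv : h' = g := by
    rw [← sub_eq_zero]
    have : dag (h' - g) = 0 := by
      refine eq_zero_of_lTr_comp_dag (V' := V') ?_
      have e : ∀ f : V ⟶ U, lTr V V' (f ≫ (h' - g)) = 0 := fun f => by
        rw [Preadditive.comp_sub, lTr_sub, h1, ← h2', sub_self]
      rw [dag_dag]; exact e _
    rw [← dag_dag (h' - g), this, dag_zero]
  subst hinv
  -- The difference `h - h'` is negated by the twist. Thus a nonnegative trace on `U` is minus a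
  -- nonnegative trace on `V`, and both vanish.
  have hk : h - h' = 0 := by
    have hpos : 0 ≤ lTr U U' ((h - h') ≫ dag (h - h')) := lTr_comp_dag_nonneg _
    have hneg : lTr U U' ((h - h') ≫ dag (h - h')) =
        -lTr V V' (dag (h - h') ≫ (h - h')) := by
      set k := dag (h - h') with hkk
      rw [Preadditive.sub_comp, lTr_sub, h2, h2', Preadditive.comp_sub, lTr_sub, neg_sub]
    have hpos2 : 0 ≤ lTr V V' (dag (h - h') ≫ (h - h')) := by
      have := lTr_comp_dag_nonneg (V' := V') (dag (h - h'))
      rwa [dag_dag] at this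
    refine dag_injective ?_
    rw [dag_zero]
    refine eq_zero_of_lTr_comp_dag (V' := V') ?_
    rw [dag_dag]
    rw [hneg] at hpos
    exact le_antisymm (neg_nonneg.1 hpos) hpos2
  rw [h1, sub_eq_zero.1 hk]

theorem id_ne_zero_of_simple (V : C) [Simple V] : 𝟙 V ≠ 0 := id_nonzero V

theorem evaluation_ne_zero (V V' : C) [Simple V] [ExactPairing V V'] : ε_ V V' ≠ 0 := by
  intro h
  have h1 := ExactPairing.evaluation_coevaluation V V'
  rw [h, MonoidalPreadditive.whiskerLeft_zero, comp_zero, comp_zero] at h1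
  apply id_ne_zero_of_simple V
  calc 𝟙 V = (λ_ V).inv ≫ ((λ_ V).hom ≫ (ρ_ V).inv) ≫ (ρ_ V).hom := by simp
    _ = 0 := by rw [← h1]; simp

theorem coevaluation_ne_zero (V V' : C) [Simple V] [ExactPairing V V'] : η_ V V' ≠ 0 := by
  intro h
  have h1 := ExactPairing.evaluation_coevaluation V V'
  rw [h, MonoidalPreadditive.zero_whiskerRight, zero_comp] at h1
  apply id_ne_zero_of_simple V
  calc 𝟙 V = (λ_ V).inv ≫ ((λ_ V).hom ≫ (ρ_ V).inv) ≫ (ρ_ V).hom := by simp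
    _ = 0 := by rw [← h1]; simp

/-- Rescaling an exact pairing. -/
@[reducible]
def rescalePairing {V V' : C} (p : ExactPairing V V') (c d : ℂ) (h : c * d = 1) :
    ExactPairing V V' where
  coevaluation' := c • η_ V V'
  evaluation' := d • ε_ V V'
  coevaluation_evaluation' := by
    simp [smul_smul, mul_comm d c, h]
  evaluation_coevaluation' := by
    simp [smul_smul, mul_comm d c, h]

theorem exists_pos_of_ne_zero {S Y : C} [Simple S] {f : S ⟶ Y} (h : f ≠ 0) :
    ∃ r : ℝ, 0 < r ∧ schurScalar (f ≫ dag f) = r := by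
  obtain ⟨c, v, hc, hv, rfl⟩ := exists_isometry_of_ne_zero h
  refine ⟨c * c, by positivity, ?_⟩
  rw [dag_smul, Linear.smul_comp, Linear.comp_smul, hv, schurScalar_smul, schurScalar_smul,
    schurScalar_id]
  simp

/-- As `End V` is one-dimensional, sphericality is a single equation between the squared norms of
the cup and of the cap, which rescaling can solve. -/
theorem exists_spherical_of_simple (V : C) [Simple V] :
    ∃ (V' : C) (_ : ExactPairing V V'), IsSpherical V V' := by
  let V' := Vᘁ
  let _ : ExactPairing V V' := inferInstance
  have he : dag (ε_ V V') ≠ 0 := fun h =>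
    evaluation_ne_zero V V' (by rw [← dag_dag (ε_ V V'), h, dag_zero])
  obtain ⟨r, hr, hr'⟩ := exists_pos_of_ne_zero he
  obtain ⟨s, hs, hs'⟩ := exists_pos_of_ne_zero (coevaluation_ne_zero V V')
  rw [dag_dag] at hr'
  -- Scaling the coevaluation by `c` and the evaluation by `c⁻¹` turns `s` and `r` into `c² s` and
  -- `c⁻² r`; equality requires `c⁴ = r / s`.
  set c : ℝ := Real.sqrt (Real.sqrt (r / s)) with hc
  have hcpos : 0 < c := Real.sqrt_pos.2 (Real.sqrt_pos.2 (div_pos hr hs))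
  have hc4 : c * c * (c * c) * s = r := by
    rw [hc, Real.mul_self_sqrt (Real.sqrt_nonneg _), Real.mul_self_sqrt (div_pos hr hs).le,
      div_mul_cancel₀ _ hs.ne']
  have hcne : (c : ℂ) ≠ 0 := by exact_mod_cast hcpos.ne'
  refine ⟨V', rescalePairing inferInstance c (c : ℂ)⁻¹ (mul_inv_cancel₀ hcne), fun f => ?_⟩
  have h1 : schurScalar (dag ((c : ℂ)⁻¹ • ε_ V V') ≫ V' ◁ f ≫ ((c : ℂ)⁻¹ • ε_ V V')) =
      schurScalar (((c : ℂ) • η_ V V') ≫ f ▷ V' ≫ dag ((c : ℂ) • η_ V V')) := by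
    rw [← schurScalar_smul_id f]
    simp only [dag_smul, MonoidalLinear.whiskerLeft_smul, MonoidalLinear.smul_whiskerRight,
      Linear.smul_comp, Linear.comp_smul, MonoidalCategory.whiskerLeft_id,
      MonoidalCategory.id_whiskerRight, Category.id_comp, schurScalar_smul, hr', hs']
    rw [star_inv₀, Complex.star_def, Complex.conj_ofReal]
    have : (r : ℂ) = c * c * (c * c) * s := by exact_mod_cast hc4.symm
    rw [this]
    field_simp
  exact h1

theorem sum_comp_comp_sum {ι : Type*} [Fintype ι] {W X Y Z : C} (x : ι → (W ⟶ X)) (m : X ⟶ Y)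
    (y : ι → (Y ⟶ Z)) (h : ∀ k l, k ≠ l → x k ≫ m ≫ y l = 0) :
    (∑ k, x k) ≫ m ≫ (∑ l, y l) = ∑ k, x k ≫ m ≫ y k := by
  rw [Preadditive.sum_comp]
  refine Finset.sum_congr rfl fun k _ => ?_
  rw [Preadditive.comp_sum, Preadditive.comp_sum]
  exact Finset.sum_eq_single k (fun l _ hl => h k l hl.symm) (by simp)

/-! ### Direct sums of spherical pairings -/

section DirectSum

variable {n : ℕ} {T T' : C} {S S' : Fin n → C} [∀ k, ExactPairing (S k) (S' k)]
  (v : ∀ k, S k ⟶ T) (v' : ∀ k, S' k ⟶ T')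

/-- Brings the composite `a ≫ b` together inside one term of the zigzag. In the application it is
zero for `k ≠ l` and the identity for `k = l`, so that only diagonal terms survive. -/
theorem zigzag_term (k l : Fin n) {a : S k ⟶ T} {a' : S' k ⟶ T'} {b : T ⟶ S l}
    {b' : T' ⟶ S' l} :
    T' ◁ (η_ (S k) (S' k) ≫ a ▷ S' k ≫ T ◁ a') ≫ (α_ _ _ _).inv ≫
      (b' ▷ T ≫ S' l ◁ b ≫ ε_ (S l) (S' l)) ▷ T' =
    b' ▷ _ ≫ S' l ◁ (η_ (S k) (S' k) ≫ (a ≫ b) ▷ S' k) ≫ (α_ _ _ _).inv ≫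
      (ε_ (S l) (S' l)) ▷ S' k ≫ 𝟙_ C ◁ a' := by
  calc _ = (T' ◁ (η_ (S k) (S' k) ≫ a ▷ S' k ≫ T ◁ a') ≫ b' ▷ (T ⊗ T')) ⊗≫
        (S' l ◁ b ≫ ε_ (S l) (S' l)) ▷ T' := by monoidal
    _ = b' ▷ 𝟙_ C ≫ S' l ◁ (η_ (S k) (S' k) ≫ a ▷ S' k) ⊗≫
        ((S' l ⊗ T) ◁ a' ≫ (S' l ◁ b ≫ ε_ (S l) (S' l)) ▷ T') := by
      rw [whisker_exchange b']; monoidal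
    _ = _ := by rw [whisker_exchange]; monoidal

theorem zigzag_term' (k l : Fin n) {a : S k ⟶ T} {a' : S' k ⟶ T'} {b : T ⟶ S l}
    {b' : T' ⟶ S' l} :
    (η_ (S k) (S' k) ≫ a ▷ S' k ≫ T ◁ a') ▷ T ≫ (α_ _ _ _).hom ≫
      T ◁ (b' ▷ T ≫ S' l ◁ b ≫ ε_ (S l) (S' l)) =
    𝟙_ C ◁ b ≫ (η_ (S k) (S' k) ≫ S k ◁ (a' ≫ b')) ▷ S l ≫ (α_ _ _ _).hom ≫
      S k ◁ (ε_ (S l) (S' l)) ≫ a ▷ 𝟙_ C := by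
  calc _ = η_ (S k) (S' k) ▷ T ⊗≫ (a ▷ (S' k ⊗ T) ≫ T ◁ ((a' ≫ b') ▷ T ≫ S' l ◁ b ≫
        ε_ (S l) (S' l))) := by monoidal
    _ = (η_ (S k) (S' k) ▷ T ≫ (S k ⊗ S' k) ◁ b) ⊗≫ S k ◁ ((a' ≫ b') ▷ S l ≫
        ε_ (S l) (S' l)) ≫ a ▷ 𝟙_ C := by
      rw [← whisker_exchange a, ← whisker_exchange_assoc (a' ≫ b')]; monoidal
    _ = _ := by rw [← whisker_exchange]; monoidal

/-- The direct sum of exact pairings, along orthonormal inclusions. -/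
@[reducible]
noncomputable def directSumPairing
    (hv : ∀ k l, v k ≫ dag (v l) = if h : k = l then eqToHom (by rw [h]) else 0)
    (hs : ∑ k, dag (v k) ≫ v k = 𝟙 T)
    (hv' : ∀ k l, v' k ≫ dag (v' l) = if h : k = l then eqToHom (by rw [h]) else 0)
    (hs' : ∑ k, dag (v' k) ≫ v' k = 𝟙 T') : ExactPairing T T' where
  coevaluation' := ∑ k, η_ (S k) (S' k) ≫ v k ▷ S' k ≫ T ◁ v' k
  evaluation' := ∑ k, dag (v' k) ▷ T ≫ S' k ◁ dag (v k) ≫ ε_ (S k) (S' k)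
  coevaluation_evaluation' := by
    rw [whiskerLeft_sum, sum_whiskerRight, sum_comp_comp_sum]
    · calc _ = ((∑ k, dag (v' k) ≫ v' k) ▷ 𝟙_ C) ≫ (ρ_ T').hom ≫ (λ_ T').inv := by
            rw [sum_whiskerRight, Preadditive.sum_comp]
            refine Finset.sum_congr rfl fun k _ => ?_
            have h1 : v k ≫ dag (v k) = 𝟙 _ := by simpa using hv k k
            rw [zigzag_term, h1]
            simp
        _ = _ := by rw [hs']; simp
    · intro k l hkl
      have h1 : v k ≫ dag (v l) = 0 := by simpa [hkl] using hv k l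
      rw [zigzag_term, h1]
      simp
  evaluation_coevaluation' := by
    rw [whiskerLeft_sum, sum_whiskerRight, sum_comp_comp_sum]
    · calc _ = (𝟙_ C ◁ (∑ k, dag (v k) ≫ v k)) ≫ (λ_ T).hom ≫ (ρ_ T).inv := by
            rw [whiskerLeft_sum, Preadditive.sum_comp]
            refine Finset.sum_congr rfl fun k _ => ?_
            have h1 : v' k ≫ dag (v' k) = 𝟙 _ := by simpa using hv' k k
            rw [zigzag_term', h1]
            simp
        _ = _ := by rw [hs]; simp
    · intro k l hkl
      have h1 : v' k ≫ dag (v' l) = 0 := by simpa [hkl] using hv' k l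
      rw [zigzag_term', h1]
      simp

/-- Orthogonality of the inclusions of the dual summands kills the cross terms. Both traces of `f`
are then sums over `k` of the corresponding traces of the diagonal blocks of `f`, where the summands
are spherical. -/
theorem directSumPairing_isSpherical
    (hv : ∀ k l, v k ≫ dag (v l) = if h : k = l then eqToHom (by rw [h]) else 0)
    (hs : ∑ k, dag (v k) ≫ v k = 𝟙 T)
    (hv' : ∀ k l, v' k ≫ dag (v' l) = if h : k = l then eqToHom (by rw [h]) else 0)
    (hs' : ∑ k, dag (v' k) ≫ v' k = 𝟙 T') (hsph : ∀ k, IsSpherical (S k) (S' k)) :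
    @IsSpherical _ _ _ _ _ _ _ _ _ T T' (directSumPairing v v' hv hs hv' hs') := by
  intro f
  have h1 : schurScalar (dag (∑ k, dag (v' k) ▷ T ≫ S' k ◁ dag (v k) ≫ ε_ (S k) (S' k)) ≫ T' ◁ f ≫
      ∑ k, dag (v' k) ▷ T ≫ S' k ◁ dag (v k) ≫ ε_ (S k) (S' k)) =
      ∑ k, lTr (S k) (S' k) (v k ≫ f ≫ dag (v k)) := by
    have hterm : ∀ k l, dag (dag (v' k) ▷ T ≫ S' k ◁ dag (v k) ≫ ε_ (S k) (S' k)) ≫ T' ◁ f ≫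
        dag (v' l) ▷ T ≫ S' l ◁ dag (v l) ≫ ε_ (S l) (S' l) =
        dag (ε_ (S k) (S' k)) ≫ (v' k ≫ dag (v' l)) ▷ S k ≫
          S' l ◁ (v k ≫ f ≫ dag (v l)) ≫ ε_ (S l) (S' l) := by
      intro k l
      simp only [dag_comp, dag_whiskerL, dag_whiskerR, dag_dag, Category.assoc,
        comp_whiskerRight, MonoidalCategory.whiskerLeft_comp]
      simp only [whisker_exchange_assoc]
    rw [dag_sum, sum_comp_comp_sum, schurScalar_sum]
    · refine Finset.sum_congr rfl fun k _ => ?_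
      have h1 : v' k ≫ dag (v' k) = 𝟙 _ := by simpa using hv' k k
      rw [hterm, h1, id_whiskerRight, Category.id_comp, lTr]
    · intro k l hkl
      have h1 : v' k ≫ dag (v' l) = 0 := by simpa [hkl] using hv' k l
      rw [hterm, h1]
      simp
  have h2 : schurScalar ((∑ k, η_ (S k) (S' k) ≫ v k ▷ S' k ≫ T ◁ v' k) ≫ f ▷ T' ≫
      dag (∑ k, η_ (S k) (S' k) ≫ v k ▷ S' k ≫ T ◁ v' k)) =
      ∑ k, rTr (S k) (S' k) (v k ≫ f ≫ dag (v k)) := by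
    have hterm : ∀ k l, (η_ (S k) (S' k) ≫ v k ▷ S' k ≫ T ◁ v' k) ≫ f ▷ T' ≫
        dag (η_ (S l) (S' l) ≫ v l ▷ S' l ≫ T ◁ v' l) =
        η_ (S k) (S' k) ≫ S k ◁ (v' k ≫ dag (v' l)) ≫
          (v k ≫ f ≫ dag (v l)) ▷ S' l ≫ dag (η_ (S l) (S' l)) := by
      intro k l
      simp only [dag_comp, dag_whiskerL, dag_whiskerR, Category.assoc,
        comp_whiskerRight, MonoidalCategory.whiskerLeft_comp]
      simp only [whisker_exchange_assoc]
    rw [dag_sum, sum_comp_comp_sum, schurScalar_sum]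
    · refine Finset.sum_congr rfl fun k _ => ?_
      have h1 : v' k ≫ dag (v' k) = 𝟙 _ := by simpa using hv' k k
      rw [hterm, h1, MonoidalCategory.whiskerLeft_id, Category.id_comp, rTr]
    · intro k l hkl
      have h1 : v' k ≫ dag (v' l) = 0 := by simpa [hkl] using hv' k l
      rw [hterm, h1]
      simp
  exact h1.trans ((Finset.sum_congr rfl fun k _ => hsph k _).trans h2.symm)

end DirectSum

theorem exists_spherical (T : C) : ∃ (T' : C) (_ : ExactPairing T T'), IsSpherical T T' := by
  let d := simpleDecomp T
  choose S' p hp using fun k => exists_spherical_of_simple (d.obj k)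
  obtain ⟨T', v', hv', hs'⟩ := exists_orthonormal_biproduct S'
  exact ⟨T', directSumPairing d.v v' d.ortho d.sum_eq hv' hs',
    directSumPairing_isSpherical d.v v' d.ortho d.sum_eq hv' hs' hp⟩

/-- A spherical dual. -/
noncomputable def sphDual (T : C) : C := (exists_spherical T).choose

noncomputable instance sphPairing (T : C) : ExactPairing T (sphDual T) :=
  (exists_spherical T).choose_spec.choose

theorem sphPairing_isSpherical (T : C) : IsSpherical T (sphDual T) :=
  (exists_spherical T).choose_spec.choose_spec

/-- The categorical trace. -/
noncomputable def catTr {T : C} (f : T ⟶ T) : ℂ := lTr T (sphDual T) f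

/-- Cyclicity between two pairings of the same object, applied to the identity, shows that the trace
does not depend on the spherical pairing. -/
theorem lTr_eq_catTr {V V' : C} [ExactPairing V V'] (h : IsSpherical V V') (f : V ⟶ V) :
    lTr V V' f = catTr f := by
  have := lTr_comp_comm h (sphPairing_isSpherical V) f (𝟙 V)
  rwa [Category.comp_id, Category.id_comp] at this

theorem rTr_eq_catTr {V V' : C} [ExactPairing V V'] (h : IsSpherical V V') (f : V ⟶ V) :
    rTr V V' f = catTr f := by
  rw [← h, lTr_eq_catTr h]

theorem catTr_comp_comm {V U : C} (f : V ⟶ U) (g : U ⟶ V) : catTr (f ≫ g) = catTr (g ≫ f) :=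
  lTr_comp_comm (sphPairing_isSpherical V) (sphPairing_isSpherical U) f g

theorem catTr_add {V : C} (f g : V ⟶ V) : catTr (f + g) = catTr f + catTr g := lTr_add _ _ f g

theorem catTr_smul {V : C} (c : ℂ) (f : V ⟶ V) : catTr (c • f) = c * catTr f := lTr_smul _ _ c f

/-- The categorical trace as a linear map. -/
noncomputable def catTrLin (V : C) : (V ⟶ V) →ₗ[ℂ] ℂ where
  toFun := catTr
  map_add' := catTr_add
  map_smul' := catTr_smul

theorem catTr_sum {V : C} {ι : Type*} (s : Finset ι) (f : ι → (V ⟶ V)) :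
    catTr (∑ i ∈ s, f i) = ∑ i ∈ s, catTr (f i) :=
  map_sum (catTrLin V) f s

theorem catTr_zero {V : C} : catTr (0 : V ⟶ V) = 0 := map_zero (catTrLin V)

theorem catTr_comp_dag_nonneg {V U : C} (f : V ⟶ U) : 0 ≤ catTr (f ≫ dag f) :=
  lTr_comp_dag_nonneg f

theorem eq_zero_of_catTr_comp_dag {V U : C} {f : V ⟶ U} (h : catTr (f ≫ dag f) = 0) : f = 0 :=
  eq_zero_of_lTr_comp_dag h

theorem catTr_conj {V U : C} (e : V ≅ U) (f : V ⟶ V) : catTr (conjFun e f) = catTr f := by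
  unfold conjFun
  rw [catTr_comp_comm]
  simp

end Spherical


/-! ### Partial traces and dimensions -/

section PartialTrace

variable {C : Type*} [Category C] [Abelian C] [Linear ℂ C] [MonoidalCategory C]
  [MonoidalPreadditive C] [MonoidalLinear ℂ C] [RigidCategory C] [UnitaryFusionCategory C]

/-- `T → (T ⊗ V) ⊗ V'`. -/
def rCup (V V' T : C) [ExactPairing V V'] : T ⟶ (T ⊗ V) ⊗ V' :=
  (ρ_ T).inv ≫ T ◁ η_ V V' ≫ (α_ T V V').inv

/-- `T → V' ⊗ (V ⊗ T)`. -/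
noncomputable def lCup (V V' T : C) [ExactPairing V V'] : T ⟶ V' ⊗ (V ⊗ T) :=
  (λ_ T).inv ≫ dag (ε_ V V') ▷ T ≫ (α_ V' V T).hom

theorem rCup_naturality (V V' : C) [ExactPairing V V'] {T U : C} (f : T ⟶ U) :
    f ≫ rCup V V' U = rCup V V' T ≫ (f ▷ V) ▷ V' := by
  simp only [rCup, Category.assoc, rightUnitor_inv_naturality_assoc]
  rw [← whisker_exchange_assoc, ← associator_inv_naturality_left]

/-- The partial trace over `V` on the right. -/
noncomputable def rPart (V V' : C) [ExactPairing V V'] {T U : C} (f : T ⊗ V ⟶ U ⊗ V) : T ⟶ U :=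
  rCup V V' T ≫ f ▷ V' ≫ dag (rCup V V' U)

/-- The partial trace over `V` on the left. -/
noncomputable def lPart (V V' : C) [ExactPairing V V'] {T U : C} (f : V ⊗ T ⟶ V ⊗ U) : T ⟶ U :=
  lCup V V' T ≫ V' ◁ f ≫ dag (lCup V V' U)

theorem dag_rCup (V V' T : C) [ExactPairing V V'] :
    dag (rCup V V' T) = (α_ T V V').hom ≫ T ◁ dag (η_ V V') ≫ (ρ_ T).hom := by
  simp [rCup, dag_comp, dag_whiskerL, dag_rightUnitor_inv, dag_associator_inv]

theorem dag_lCup (V V' T : C) [ExactPairing V V'] :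
    dag (lCup V V' T) = (α_ V' V T).inv ≫ ε_ V V' ▷ T ≫ (λ_ T).hom := by
  simp [lCup, dag_comp, dag_whiskerR, dag_leftUnitor_inv, dag_associator_hom, dag_dag]

/-- The evaluation of a tensor product is nested, with the cap for `V` inside the cap for `W`.
Closing the inner cap first is the partial trace. -/
theorem lTr_tensor (V V' W W' : C) [ExactPairing V V'] [ExactPairing W W'] (f : V ⊗ W ⟶ V ⊗ W) :
    lTr (V ⊗ W) (W' ⊗ V') f = lTr W W' (lPart V V' f) := by
  unfold lTr
  congr 1
  have h : ε_ (V ⊗ W) (W' ⊗ V') =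
      (α_ W' V' (V ⊗ W)).hom ≫ W' ◁ dag (lCup V V' W) ≫ ε_ W W' := by
    rw [ExactPairing.tensor_evaluation, dag_lCup]
    monoidal
  rw [h]
  simp only [dag_comp, dag_dag, dag_whiskerL, dag_associator_hom, Category.assoc, lPart,
    MonoidalCategory.whiskerLeft_comp]
  simp

theorem rTr_tensor (V V' W W' : C) [ExactPairing V V'] [ExactPairing W W'] (f : V ⊗ W ⟶ V ⊗ W) :
    rTr (V ⊗ W) (W' ⊗ V') f = rTr V V' (rPart W W' f) := by
  unfold rTr
  congr 1
  have h : η_ (V ⊗ W) (W' ⊗ V') =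
      η_ V V' ≫ rCup W W' V ▷ V' ≫ (α_ (V ⊗ W) W' V').hom := by
    rw [ExactPairing.tensor_coevaluation, rCup]
    monoidal
  rw [h]
  simp only [dag_comp, dag_whiskerR, dag_associator_hom, Category.assoc, rPart, comp_whiskerRight]
  simp

/-- The loop closing `V` on the left and the loop closing `W` on the right are disjoint, so they can
be closed in either order. -/
theorem rTr_lPart (V V' W W' : C) [ExactPairing V V'] [ExactPairing W W'] (f : V ⊗ W ⟶ V ⊗ W) :
    rTr W W' (lPart V V' f) = lTr V V' (rPart W W' f) := by
  unfold rTr lTr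
  congr 1
  have h : η_ W W' ≫ lCup V V' W ▷ W' ≫ (α_ V' (V ⊗ W) W').hom =
      dag (ε_ V V') ≫ V' ◁ rCup W W' V := by
    calc _ = 𝟙 _ ⊗≫ (𝟙_ C ◁ η_ W W' ≫ dag (ε_ V V') ▷ (W ⊗ W')) ⊗≫ 𝟙 _ := by
          unfold lCup; monoidal
      _ = _ := by rw [whisker_exchange]; unfold rCup; monoidal
  have h' : (α_ V' (V ⊗ W) W').inv ≫ dag (lCup V V' W) ▷ W' ≫ dag (η_ W W') =
      V' ◁ dag (rCup W W' V) ≫ ε_ V V' := by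
    have := congrArg dag h
    simpa only [dag_comp, dag_whiskerR, dag_whiskerL, dag_associator_hom, dag_dag,
      Category.assoc] using this
  calc η_ W W' ≫ (lPart V V' f) ▷ W' ≫ dag (η_ W W')
      = (η_ W W' ≫ lCup V V' W ▷ W' ≫ (α_ V' (V ⊗ W) W').hom) ≫ V' ◁ (f ▷ W') ≫
        ((α_ V' (V ⊗ W) W').inv ≫ dag (lCup V V' W) ▷ W' ≫ dag (η_ W W')) := by
        simp [lPart]
    _ = _ := by rw [h, h']; simp [rPart]

/-- Move one loop at a time from the left to the right: first that of `W`, then, after exchanging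
the two partial traces, that of `V`. -/
theorem isSpherical_tensor {V V' W W' : C} [ExactPairing V V'] [ExactPairing W W']
    (hV : IsSpherical V V') (hW : IsSpherical W W') : IsSpherical (V ⊗ W) (W' ⊗ V') := by
  intro f
  rw [lTr_tensor, hW, rTr_lPart, hV, rTr_tensor]

theorem catTr_rPart {T V V' : C} [ExactPairing V V'] (hV : IsSpherical V V')
    (f : T ⊗ V ⟶ T ⊗ V) : catTr (rPart V V' f) = catTr f := by
  have h := isSpherical_tensor (sphPairing_isSpherical T) hV
  rw [← rTr_eq_catTr h, rTr_tensor, rTr_eq_catTr (sphPairing_isSpherical T)]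

theorem catTr_lPart {T V V' : C} [ExactPairing V V'] (hV : IsSpherical V V')
    (f : V ⊗ T ⟶ V ⊗ T) : catTr (lPart V V' f) = catTr f := by
  have h := isSpherical_tensor hV (sphPairing_isSpherical T)
  rw [← lTr_eq_catTr h, lTr_tensor, lTr_eq_catTr (sphPairing_isSpherical T)]

/-- The unit object is its own spherical dual, with unitors as cup and cap. -/
theorem catTr_unit (f : 𝟙_ C ⟶ 𝟙_ C) : catTr f = schurScalar f := by
  have h1 : ∀ g : 𝟙_ C ⟶ 𝟙_ C, lTr (𝟙_ C) (𝟙_ C) g = schurScalar g := fun g => by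
    unfold lTr
    have : ε_ (𝟙_ C) (𝟙_ C) = (ρ_ (𝟙_ C)).hom := rfl
    rw [this, dag_rightUnitor_hom]
    congr 1
    rw [← unitors_equal, leftUnitor_naturality, ← Category.assoc, unitors_equal]
    simp
  have h2 : ∀ g : 𝟙_ C ⟶ 𝟙_ C, rTr (𝟙_ C) (𝟙_ C) g = schurScalar g := fun g => by
    unfold rTr
    have : η_ (𝟙_ C) (𝟙_ C) = (ρ_ (𝟙_ C)).inv := rfl
    rw [this, dag_rightUnitor_inv]
    simp
  rw [← h1, lTr_eq_catTr]
  exact fun g => (h1 g).trans (h2 g).symm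

/-- The categorical dimension. -/
noncomputable def catDim (V : C) : ℝ := (catTr (𝟙 V)).re

theorem catTr_id_nonneg (V : C) : 0 ≤ catTr (𝟙 V) := by
  simpa [dag_id] using catTr_comp_dag_nonneg (𝟙 V)

theorem catTr_id (V : C) : catTr (𝟙 V) = catDim V :=
  Complex.eq_re_of_ofReal_le (catTr_id_nonneg V)

theorem catDim_nonneg (V : C) : 0 ≤ catDim V := (Complex.le_def.1 (catTr_id_nonneg V)).1

theorem catDim_pos {V : C} (h : 𝟙 V ≠ 0) : 0 < catDim V := by
  refine lt_of_le_of_ne (catDim_nonneg V) fun h0 => h ?_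
  refine eq_zero_of_catTr_comp_dag ?_
  rw [dag_id, Category.comp_id, catTr_id, ← h0, Complex.ofReal_zero]

theorem catDim_congr {V U : C} (e : V ≅ U) : catDim V = catDim U := by
  unfold catDim
  rw [← catTr_conj e]
  simp [conjFun]

theorem catDim_unit : catDim (𝟙_ C) = 1 := by
  simp [catDim, catTr_unit, schurScalar_id]

theorem η_comp_dag (V : C) : η_ V (sphDual V) ≫ dag (η_ V (sphDual V)) =
    (catDim V : ℂ) • 𝟙 (𝟙_ C) := by
  rw [← catTr_id, ← rTr_eq_catTr (sphPairing_isSpherical V), rTr, schurScalar_smul_id]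
  simp

theorem dag_ε_comp (V : C) : dag (ε_ V (sphDual V)) ≫ ε_ V (sphDual V) =
    (catDim V : ℂ) • 𝟙 (𝟙_ C) := by
  rw [← catTr_id, ← lTr_eq_catTr (sphPairing_isSpherical V), lTr, schurScalar_smul_id]
  simp

theorem rPart_whiskerRight {T U : C} (V : C) (f : T ⟶ U) :
    rPart V (sphDual V) (f ▷ V) = (catDim V : ℂ) • f := by
  unfold rPart
  rw [← reassoc_of% (rCup_naturality V (sphDual V) f)]
  have : rCup V (sphDual V) U ≫ dag (rCup V (sphDual V) U) = (catDim V : ℂ) • 𝟙 U := by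
    rw [dag_rCup, rCup]
    simp only [Category.assoc, Iso.inv_hom_id_assoc]
    rw [← whiskerLeft_comp_assoc, η_comp_dag]
    simp [-Complex.coe_smul]
  rw [this]; simp [-Complex.coe_smul]

theorem catTr_whiskerRight {T : C} (V : C) (f : T ⟶ T) :
    catTr (f ▷ V) = catDim V * catTr f := by
  rw [← catTr_rPart (sphPairing_isSpherical V), rPart_whiskerRight, catTr_smul]

theorem lPart_whiskerLeft {T : C} (V : C) (f : T ⟶ T) :
    lPart V (sphDual V) (V ◁ f) = (catDim V : ℂ) • f := by
  unfold lPart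
  have hn : f ≫ lCup V (sphDual V) T = lCup V (sphDual V) T ≫ sphDual V ◁ V ◁ f := by
    simp only [lCup, Category.assoc, leftUnitor_inv_naturality_assoc]
    rw [whisker_exchange_assoc, associator_naturality_right]
  rw [← Category.assoc, ← hn]
  have : lCup V (sphDual V) T ≫ dag (lCup V (sphDual V) T) = (catDim V : ℂ) • 𝟙 T := by
    rw [dag_lCup, lCup]
    simp only [Category.assoc, Iso.hom_inv_id_assoc]
    rw [← comp_whiskerRight_assoc, dag_ε_comp]
    simp [-Complex.coe_smul]
  rw [Category.assoc, this]; simp [-Complex.coe_smul]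

theorem catTr_whiskerLeft {T : C} (V : C) (f : T ⟶ T) :
    catTr (V ◁ f) = catDim V * catTr f := by
  rw [← catTr_lPart (sphPairing_isSpherical V), lPart_whiskerLeft, catTr_smul]

theorem catDim_tensor (T V : C) : catDim (T ⊗ V) = catDim T * catDim V := by
  have h := catTr_whiskerRight V (𝟙 T)
  rw [id_whiskerRight, catTr_id, catTr_id] at h
  rw [mul_comm]; exact_mod_cast h

/-- The adjoint of an exact pairing. -/
@[reducible]
noncomputable def dagPairing (V V' : C) [ExactPairing V V'] : ExactPairing V' V where
  coevaluation' := dag (ε_ V V')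
  evaluation' := dag (η_ V V')
  coevaluation_evaluation' := by
    have := congrArg dag (ExactPairing.evaluation_coevaluation V V')
    simpa only [dag_comp, dag_whiskerL, dag_whiskerR, dag_associator_hom, dag_leftUnitor_hom,
      dag_rightUnitor_inv, Category.assoc] using this
  evaluation_coevaluation' := by
    have := congrArg dag (ExactPairing.coevaluation_evaluation V V')
    simpa only [dag_comp, dag_whiskerL, dag_whiskerR, dag_associator_inv, dag_rightUnitor_hom,
      dag_leftUnitor_inv, Category.assoc] using this

/-- Sphericality seen from the dual object: the mate of `f` is an endomorphism of `V`, to which the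
assumed sphericality applies. -/
theorem evaluation_whiskerRight_eq {V V' : C} [ExactPairing V V'] (hV : IsSpherical V V')
    (f : V' ⟶ V') : schurScalar (dag (ε_ V V') ≫ f ▷ V ≫ ε_ V V') =
      schurScalar (η_ V V' ≫ V ◁ f ≫ dag (η_ V V')) := by
  obtain ⟨g, h1, h2⟩ := exists_leftMate (V := V) (U := V) f
  rw [h1, reassoc_of% h2]
  exact hV g

theorem dagPairing_isSpherical {V V' : C} [ExactPairing V V'] (hV : IsSpherical V V') :
    @IsSpherical _ _ _ _ _ _ _ _ _ V' V (dagPairing V V') := by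
  intro f
  have h : schurScalar (dag (dag (η_ V V')) ≫ V ◁ f ≫ dag (η_ V V')) =
      schurScalar (dag (ε_ V V') ≫ f ▷ V ≫ dag (dag (ε_ V V'))) := by
    rw [dag_dag, dag_dag, evaluation_whiskerRight_eq hV]
  exact h

theorem catDim_sphDual (V : C) : catDim (sphDual V) = catDim V := by
  have h := @lTr_eq_catTr _ _ _ _ _ _ _ _ _ (sphDual V) V (dagPairing V (sphDual V))
    (dagPairing_isSpherical (sphPairing_isSpherical V)) (𝟙 _)
  have h2 : schurScalar (dag (dag (η_ V (sphDual V))) ≫ V ◁ 𝟙 _ ≫ dag (η_ V (sphDual V))) =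
      catTr (𝟙 (sphDual V)) := h
  rw [dag_dag, MonoidalCategory.whiskerLeft_id, Category.id_comp, η_comp_dag, schurScalar_smul,
    schurScalar_id, mul_one, catTr_id] at h2
  exact_mod_cast h2.symm

theorem catDim_eq_sum {T : C} (d : SimpleDecomp T) : catDim T = ∑ k, catDim (d.obj k) := by
  have h : catTr (𝟙 T) = ∑ k, catTr (𝟙 (d.obj k)) := by
    rw [← d.sum_eq, catTr_sum]
    exact Finset.sum_congr rfl fun k _ => by rw [catTr_comp_comm, d.isometry]
  simp only [catTr_id] at h
  exact_mod_cast h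

/-- The complementary projection `𝟙 T - dag v ≫ v` has nonnegative trace, and that trace is the
difference of the dimensions. -/
theorem catDim_le_of_isometry {S T : C} (v : S ⟶ T) (hv : v ≫ dag v = 𝟙 S) :
    catDim S ≤ catDim T := by
  have hp : (𝟙 T - dag v ≫ v) ≫ dag (𝟙 T - dag v ≫ v) = 𝟙 T - dag v ≫ v := by
    simp only [dag_sub, dag_id, dag_comp, dag_dag, Preadditive.sub_comp, Preadditive.comp_sub,
      Category.assoc, Category.comp_id, Category.id_comp, reassoc_of% hv]
    simp
  have h1 := catTr_comp_dag_nonneg (𝟙 T - dag v ≫ v)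
  rw [hp] at h1
  have h2 : catTr (𝟙 T - dag v ≫ v) = catDim T - catDim S := by
    rw [← catTr_id, ← catTr_id, ← hv, catTr_comp_comm v]
    exact map_sub (catTrLin T) _ _
  rw [h2] at h1
  have : (0 : ℝ) ≤ catDim T - catDim S := by exact_mod_cast h1
  linarith

/-- Cauchy–Schwarz on `Hom(𝟙, Q)`. -/
theorem schurScalar_cauchy_schwarz {S Q : C} [Simple S] (x y : S ⟶ Q) :
    ‖schurScalar (x ≫ dag y)‖ ^ 2 ≤
      (schurScalar (x ≫ dag x)).re * (schurScalar (y ≫ dag y)).re := by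
  set c := schurScalar (x ≫ dag y) with hc
  have ha := schurScalar_comp_dag_nonneg x
  have hb := schurScalar_comp_dag_nonneg y
  obtain ⟨a, ha'⟩ : ∃ a : ℝ, schurScalar (x ≫ dag x) = a := ⟨_, Complex.eq_re_of_ofReal_le ha⟩
  obtain ⟨b, hb'⟩ : ∃ b : ℝ, schurScalar (y ≫ dag y) = b := ⟨_, Complex.eq_re_of_ofReal_le hb⟩
  have hc' : schurScalar (y ≫ dag x) = star c := by
    rw [hc, ← schurScalar_dag, dag_comp, dag_dag]
  rw [hb'] at hb
  have hb0 : 0 ≤ b := by exact_mod_cast hb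
  rw [ha', hb', Complex.ofReal_re, Complex.ofReal_re]
  rcases hb0.eq_or_lt with h0 | h0
  · have : y = 0 := schurScalar_comp_dag_eq_zero (by rw [hb', ← h0, Complex.ofReal_zero])
    rw [hc, this, dag_zero, comp_zero, ← zero_smul ℂ (𝟙 S), schurScalar_smul]
    simp [← h0]
  · have hz := schurScalar_comp_dag_nonneg ((b : ℂ) • x - c • y)
    have he : schurScalar (((b : ℂ) • x - c • y) ≫ dag ((b : ℂ) • x - c • y)) =
        ((b * (a * b - ‖c‖ ^ 2) : ℝ) : ℂ) := by
      simp only [dag_sub, dag_smul, Preadditive.sub_comp, Preadditive.comp_sub, Linear.smul_comp,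
        Linear.comp_smul]
      have hs : ∀ f g : S ⟶ S, schurScalar (f - g) = schurScalar f - schurScalar g :=
        fun f g => map_sub (schurLin S) f g
      simp only [hs, schurScalar_smul, ha', hb', hc', ← hc]
      have hn : c * star c = ((‖c‖ ^ 2 : ℝ) : ℂ) := by
        rw [Complex.star_def, Complex.mul_conj, Complex.normSq_eq_norm_sq]
      push_cast at hn ⊢
      rw [Complex.star_def, Complex.conj_ofReal] at *
      linear_combination (-(b : ℂ)) * hn
    rw [he] at hz
    have hz' : 0 ≤ b * (a * b - ‖c‖ ^ 2) := by exact_mod_cast hz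
    have := nonneg_of_mul_nonneg_right hz' h0
    linarith

/-- Let `S` be the comparison map from the spherical dual to `Y'`. Apply Cauchy–Schwarz to the
adjoint of the given evaluation and to the adjoint of the spherical one followed by `S ▷ Y`. Their
inner product is `catDim Y`, the first has squared norm `r`, and sphericality identifies the squared
norm of the second with `r'`. -/
theorem catDim_sq_le {Y Y' : C} (p : ExactPairing Y Y') {r r' : ℝ}
    (hr : dag (ε_ Y Y') ≫ ε_ Y Y' = (r : ℂ) • 𝟙 (𝟙_ C))
    (hr' : η_ Y Y' ≫ dag (η_ Y Y') = (r' : ℂ) • 𝟙 (𝟙_ C)) : catDim Y ^ 2 ≤ r * r' := by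
  obtain ⟨S, h1, h2⟩ := exists_rightMate (V := Y) (V' := sphDual Y) (U := Y) (U' := Y') (𝟙 Y)
  rw [MonoidalCategory.whiskerLeft_id, Category.id_comp] at h1
  rw [id_whiskerRight, Category.comp_id] at h2
  have h1' : dag (ε_ Y Y') ≫ dag S ▷ Y = dag (ε_ Y (sphDual Y)) := by
    rw [← h1, dag_comp, dag_whiskerR]
  have h2' : Y ◁ dag S ≫ dag (η_ Y (sphDual Y)) = dag (η_ Y Y') := by
    rw [← h2, dag_comp, dag_whiskerL]
  have hcs := schurScalar_cauchy_schwarz (dag (ε_ Y Y')) (dag (ε_ Y (sphDual Y)) ≫ S ▷ Y)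
  have e1 : dag (ε_ Y Y') ≫ dag (dag (ε_ Y (sphDual Y)) ≫ S ▷ Y) =
      (catDim Y : ℂ) • 𝟙 (𝟙_ C) := by
    rw [dag_comp, dag_dag, dag_whiskerR, reassoc_of% h1', dag_ε_comp]
  have e2 : schurScalar ((dag (ε_ Y (sphDual Y)) ≫ S ▷ Y) ≫
      dag (dag (ε_ Y (sphDual Y)) ≫ S ▷ Y)) = r' := by
    have := evaluation_whiskerRight_eq (sphPairing_isSpherical Y) (S ≫ dag S)
    rw [MonoidalCategory.whiskerLeft_comp, Category.assoc, h2', reassoc_of% h2, hr',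
      schurScalar_smul, schurScalar_id, mul_one] at this
    rw [← this]
    simp [dag_comp, dag_whiskerR, dag_dag]
  rw [e1, e2, dag_dag, hr, schurScalar_smul, schurScalar_smul, schurScalar_id] at hcs
  simpa using hcs

/-- The spherical pairing attains the minimum, its cup and cap both having squared norm `catDim Y`;
no other pairing can do better by `catDim_sq_le`. -/
theorem quantumDim_eq_catDim (Y : C) : quantumDim Y = catDim Y := by
  apply le_antisymm
  · refine csInf_le ⟨0, ?_⟩ ⟨sphDual Y, inferInstance, catDim Y, catDim Y, dag_ε_comp Y,
      η_comp_dag Y, (Real.mul_self_sqrt (catDim_nonneg Y)).symm⟩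
    rintro _ ⟨_, _, _, _, _, _, rfl⟩
    positivity
  · refine le_csInf ⟨_, sphDual Y, inferInstance, catDim Y, catDim Y, dag_ε_comp Y,
      η_comp_dag Y, rfl⟩ ?_
    rintro _ ⟨Y', p, r, r', hr, hr', rfl⟩
    have h0 : 0 ≤ r := by
      have := schurScalar_comp_dag_nonneg (dag (ε_ Y Y'))
      rw [dag_dag, hr, schurScalar_smul, schurScalar_id, mul_one] at this
      exact_mod_cast this
    rw [← Real.sqrt_mul h0]
    exact Real.le_sqrt_of_sq_le (catDim_sq_le p hr hr')

end PartialTrace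


/-! ### Pimsner–Popa bases for partial traces -/

section PimsnerPopa

variable {C : Type*} [Category C] [Abelian C] [Linear ℂ C] [MonoidalCategory C]
  [MonoidalPreadditive C] [MonoidalLinear ℂ C] [RigidCategory C] [UnitaryFusionCategory C]

/-- `T → (T ⊗ V') ⊗ V`, from the adjoint of the evaluation. -/
noncomputable def dCup (V V' T : C) [ExactPairing V V'] : T ⟶ (T ⊗ V') ⊗ V :=
  (ρ_ T).inv ≫ T ◁ dag (ε_ V V') ≫ (α_ T V' V).inv

theorem dCup_naturality (V V' : C) [ExactPairing V V'] {T U : C} (f : T ⟶ U) :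
    f ≫ dCup V V' U = dCup V V' T ≫ (f ▷ V') ▷ V := by
  simp only [dCup, Category.assoc, rightUnitor_inv_naturality_assoc]
  rw [← whisker_exchange_assoc, ← associator_inv_naturality_left]

theorem dag_rCup_naturality (V V' : C) [ExactPairing V V'] {T U : C} (f : T ⟶ U) :
    (f ▷ V) ▷ V' ≫ dag (rCup V V' U) = dag (rCup V V' T) ≫ f := by
  have := congrArg dag (rCup_naturality V V' (dag f))
  simpa only [dag_comp, dag_whiskerR, dag_dag] using this.symm

theorem dCup_comp_dag_rCup (V V' T : C) [ExactPairing V V'] :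
    dCup V V' T ▷ V' ≫ dag (rCup V V' (T ⊗ V')) = 𝟙 _ := by
  have h : dag (ε_ V V') ▷ V' ⊗≫ V' ◁ dag (η_ V V') = ⊗𝟙.hom :=
    @ExactPairing.evaluation_coevaluation'' _ _ _ V' V (dagPairing V V')
  rw [dag_rCup, dCup]
  calc _ = 𝟙 _ ⊗≫ T ◁ (dag (ε_ V V') ▷ V' ⊗≫ V' ◁ dag (η_ V V')) ⊗≫ 𝟙 _ := by monoidal
    _ = _ := by rw [h]; monoidal

theorem dCup_comp_dag_rCup_whiskerRight (V V' T : C) [ExactPairing V V'] :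
    dCup V V' (T ⊗ V) ≫ dag (rCup V V' T) ▷ V = 𝟙 _ := by
  have h : V ◁ dag (ε_ V V') ⊗≫ dag (η_ V V') ▷ V = ⊗𝟙.hom :=
    @ExactPairing.coevaluation_evaluation'' _ _ _ V' V (dagPairing V V')
  rw [dag_rCup, dCup]
  calc _ = 𝟙 _ ⊗≫ T ◁ (V ◁ dag (ε_ V V') ⊗≫ dag (η_ V V') ▷ V) ⊗≫ 𝟙 _ := by monoidal
    _ = _ := by rw [h]; monoidal

/-- Bending the leg `V` of a morphism loses nothing: the zigzag identity bends it back. -/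
theorem eq_of_comp_dag_rCup_eq {V V' A T : C} [ExactPairing V V'] {x y : A ⟶ T ⊗ V}
    (h : x ▷ V' ≫ dag (rCup V V' T) = y ▷ V' ≫ dag (rCup V V' T)) : x = y := by
  have key : ∀ z : A ⟶ T ⊗ V, z = dCup V V' A ≫ (z ▷ V' ≫ dag (rCup V V' T)) ▷ V := fun z => by
    rw [comp_whiskerRight, ← reassoc_of% (dCup_naturality V V' z),
      dCup_comp_dag_rCup_whiskerRight, Category.comp_id]
  rw [key x, h, ← key y]

/-- A family of operators on `W ⊗ V` that gives a Pimsner–Popa basis for the partial trace over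
`V`, also after tensoring with identities on the left. -/
def IsCatBasis (W V : C) {r : ℕ} (m : Fin r → (W ⊗ V ⟶ W ⊗ V)) : Prop :=
  ∑ j, (m j ▷ sphDual V ≫ dag (rCup V (sphDual V) W)) ≫
    dag (m j ▷ sphDual V ≫ dag (rCup V (sphDual V) W)) = (catDim V : ℂ) • 𝟙 _

/-- After bending the last leg, both sides become the defining identity of the basis composed with
`x`; the partial trace arises by sliding a morphism through the cup. -/
theorem IsCatBasis.reconstruct {W V : C} {r : ℕ} {m : Fin r → (W ⊗ V ⟶ W ⊗ V)}
    (hm : IsCatBasis W V m) (x : W ⊗ V ⟶ W ⊗ V) :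
    ∑ j, m j ≫ rPart V (sphDual V) (dag (m j) ≫ x) ▷ V = (catDim V : ℂ) • x := by
  refine eq_of_comp_dag_rCup_eq (V := V) (V' := sphDual V) ?_
  have h := congrArg (fun f => f ≫ x ▷ sphDual V ≫ dag (rCup V (sphDual V) W)) hm
  simp only [Preadditive.sum_comp, Linear.smul_comp, Category.id_comp] at h
  rw [sum_whiskerRight, Preadditive.sum_comp, MonoidalLinear.smul_whiskerRight, Linear.smul_comp,
    ← h]
  refine Finset.sum_congr rfl fun j _ => ?_
  rw [comp_whiskerRight, Category.assoc, dag_rCup_naturality, rPart]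
  simp only [dag_comp, dag_dag, dag_whiskerR, comp_whiskerRight, Category.assoc]

theorem dCup_comp_dag_self (V T : C) :
    dCup V (sphDual V) T ≫ dag (dCup V (sphDual V) T) = (catDim V : ℂ) • 𝟙 T := by
  simp only [dCup, dag_comp, dag_whiskerL, dag_dag, dag_rightUnitor_inv, dag_associator_inv,
    Category.assoc, Iso.inv_hom_id_assoc]
  rw [← whiskerLeft_comp_assoc, dag_ε_comp]
  simp [-Complex.coe_smul]

/-- Closing the dual leg of the defining identity produces a loop. One factor `catDim V` comes from
the identity and the other from the loop. -/
theorem IsCatBasis.sum_comp_dag {W V : C} {r : ℕ} {m : Fin r → (W ⊗ V ⟶ W ⊗ V)}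
    (hm : IsCatBasis W V m) :
    ∑ j, m j ≫ dag (m j) = ((catDim V ^ 2 : ℝ) : ℂ) • 𝟙 _ := by
  have h := congrArg (fun f => dCup V (sphDual V) (W ⊗ V) ≫ f ▷ V ≫
    dag (dCup V (sphDual V) (W ⊗ V))) hm
  simp only [sum_whiskerRight, Preadditive.sum_comp, Preadditive.comp_sum,
    MonoidalLinear.smul_whiskerRight, Linear.smul_comp, Linear.comp_smul, id_whiskerRight,
    Category.id_comp, dCup_comp_dag_self, smul_smul] at h
  have e : ((catDim V ^ 2 : ℝ) : ℂ) = catDim V * catDim V := by push_cast; ring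
  rw [e, ← h]
  refine Finset.sum_congr rfl fun j _ => ?_
  have h1 : dCup V (sphDual V) (W ⊗ V) ≫
      (m j ▷ sphDual V ≫ dag (rCup V (sphDual V) W)) ▷ V = m j := by
    rw [comp_whiskerRight, ← reassoc_of% (dCup_naturality V (sphDual V) (m j)),
      dCup_comp_dag_rCup_whiskerRight, Category.comp_id]
  have h2 := congrArg dag h1
  rw [dag_comp, dag_whiskerR] at h2
  rw [comp_whiskerRight, Category.assoc, h2, ← Category.assoc, h1]

theorem rCup_tensor (V V' U W : C) [ExactPairing V V'] :
    rCup V V' (U ⊗ W) = U ◁ rCup V V' W ≫ (α_ U (W ⊗ V) V').inv ≫ (α_ U W V).inv ▷ V' := by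
  unfold rCup
  monoidal

/-- The cup over `V` does not involve the factor `U`. Hence a basis found at one length serves for
all greater lengths. -/
theorem IsCatBasis.whiskerLeft {W V : C} {r : ℕ} {m : Fin r → (W ⊗ V ⟶ W ⊗ V)}
    (hm : IsCatBasis W V m) (U : C) :
    IsCatBasis (U ⊗ W) V fun j => conjFun (α_ U W V).symm (U ◁ m j) := by
  unfold IsCatBasis at *
  have h : ∀ j, conjFun (α_ U W V).symm (U ◁ m j) ▷ sphDual V ≫
      dag (rCup V (sphDual V) (U ⊗ W)) = ((α_ U W V).hom ▷ sphDual V ≫ (α_ _ _ _).hom) ≫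
      U ◁ (m j ▷ sphDual V ≫ dag (rCup V (sphDual V) W)) := by
    intro j
    rw [rCup_tensor]
    simp [conjFun, dag_comp, dag_whiskerR, dag_whiskerL, dag_associator_inv,
      ← comp_whiskerRight_assoc]
  have h2 := congrArg (fun f => ((α_ U W V).hom ▷ sphDual V ≫ (α_ _ _ _).hom) ≫ U ◁ f ≫
    ((α_ _ _ _).inv ≫ (α_ U W V).inv ▷ sphDual V)) hm
  simp only [whiskerLeft_sum, Preadditive.sum_comp, Preadditive.comp_sum,
    MonoidalLinear.whiskerLeft_smul, Linear.smul_comp, Linear.comp_smul,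
    MonoidalCategory.whiskerLeft_id, Category.id_comp] at h2
  refine Eq.trans (Finset.sum_congr rfl fun j _ => ?_) (h2.trans ?_)
  · rw [h, dag_comp (_ ≫ _) (U ◁ _), dag_whiskerL, dag_comp _ (α_ _ _ _).hom, dag_whiskerR,
      dag_associator_hom, dag_associator_hom]
    simp only [MonoidalCategory.whiskerLeft_comp, Category.assoc]
  · congr 1
    simp [← comp_whiskerRight]

theorem IsCatBasis.congr {W W₂ V : C} {r : ℕ} {m : Fin r → (W ⊗ V ⟶ W ⊗ V)}
    (hm : IsCatBasis W V m) (e : W ≅ W₂) (he : IsUnitaryIso e) :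
    IsCatBasis W₂ V fun j => conjFun (whiskerRightIso e V) (m j) := by
  unfold IsCatBasis at *
  have he' : dag e.inv = e.hom := by
    have : dag e.hom = e.inv := he
    rw [← this, dag_dag]
  have h : ∀ j, conjFun (whiskerRightIso e V) (m j) ▷ sphDual V ≫
      dag (rCup V (sphDual V) W₂) = (e.inv ▷ V) ▷ sphDual V ≫
      (m j ▷ sphDual V ≫ dag (rCup V (sphDual V) W)) ≫ e.hom := by
    intro j
    have := dag_rCup_naturality V (sphDual V) e.hom
    simp [conjFun, this]
  have h2 := congrArg (fun f => (e.inv ▷ V) ▷ sphDual V ≫ f ≫ (e.hom ▷ V) ▷ sphDual V) hm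
  simp only [Preadditive.sum_comp, Preadditive.comp_sum,
    Linear.smul_comp, Linear.comp_smul, Category.id_comp] at h2
  refine Eq.trans (Finset.sum_congr rfl fun j _ => ?_) (h2.trans ?_)
  · have e1 : dag e.hom = e.inv := he
    rw [h, dag_comp _ (_ ≫ e.hom), dag_comp _ e.hom, dag_whiskerR, dag_whiskerR, he', e1]
    simp only [Category.assoc, Iso.hom_inv_id_assoc]
  · congr 1
    simp [← comp_whiskerRight]

/-- Decompose `(W ⊗ V) ⊗ sphDual V` by isometries `v k` and choose isometries `y k` of the same
simple objects into `W`. The basis elements are the morphisms `dag (v k) ≫ y k` with one leg bent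
back; their defining sum collapses to `∑ dag (v k) ≫ v k`. -/
theorem exists_isCatBasis {W V : C} (h : ∀ S : C, Simple S →
    (∃ f : S ⟶ (W ⊗ V) ⊗ sphDual V, f ≠ 0) → ∃ g : S ⟶ W, g ≠ 0) :
    ∃ (r : ℕ) (m : Fin r → (W ⊗ V ⟶ W ⊗ V)), IsCatBasis W V m := by
  let d := simpleDecomp ((W ⊗ V) ⊗ sphDual V)
  have hy : ∀ k, ∃ y : d.obj k ⟶ W, y ≫ dag y = 𝟙 _ := fun k => by
    obtain ⟨g, hg⟩ := h (d.obj k) (d.simple k) ⟨d.v k, fun h0 => by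
      have := d.isometry k
      rw [h0, zero_comp] at this
      exact id_nonzero _ this.symm⟩
    obtain ⟨_, v, _, hv, _⟩ := exists_isometry_of_ne_zero hg
    exact ⟨v, hv⟩
  choose y hy using hy
  -- The normalization `s * star s = catDim V` supplies the scalar in the definition of a basis.
  set s : ℂ := ((Real.sqrt (catDim V) : ℝ) : ℂ) with hs
  have hss : s * star s = catDim V := by
    rw [hs, Complex.star_def, Complex.conj_ofReal, ← Complex.ofReal_mul,
      Real.mul_self_sqrt (catDim_nonneg V)]
  refine ⟨d.n, fun k => dCup V (sphDual V) (W ⊗ V) ≫ (s • (dag (d.v k) ≫ y k)) ▷ V, ?_⟩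
  unfold IsCatBasis
  have h1 : ∀ k, (dCup V (sphDual V) (W ⊗ V) ≫ (s • (dag (d.v k) ≫ y k)) ▷ V) ▷ sphDual V ≫
      dag (rCup V (sphDual V) W) = s • (dag (d.v k) ≫ y k) := fun k => by
    rw [comp_whiskerRight, Category.assoc, dag_rCup_naturality,
      reassoc_of% (dCup_comp_dag_rCup V (sphDual V) (W ⊗ V))]
  simp only [h1]
  rw [← d.sum_eq, Finset.smul_sum]
  refine Finset.sum_congr rfl fun k _ => ?_
  rw [dag_smul, Linear.smul_comp, Linear.comp_smul, smul_smul, hss, dag_comp, dag_dag,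
    Category.assoc, reassoc_of% (hy k)]

end PimsnerPopa


/-! ### Uniqueness of the trace -/

section TraceFamily

variable {C : Type*} [Category C] [Abelian C] [Linear ℂ C] [MonoidalCategory C]
  [MonoidalPreadditive C] [MonoidalLinear ℂ C] [RigidCategory C] [UnitaryFusionCategory C]

theorem isUnitaryIso_inv {A B : C} {e : A ≅ B} (he : IsUnitaryIso e) : dag e.inv = e.hom := by
  have : dag e.hom = e.inv := he
  rw [← this, dag_dag]

/-- `A ≅ A ⊗ X ^ ⊗ 0`. -/
def powZeroRight (X A : C) : A ≅ A ⊗ tensorPow X 0 := (ρ_ A).symm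

theorem conjFun_powZeroRight (X : C) {A : C} (f : A ⟶ A) :
    conjFun (powZeroRight X A) f = f ▷ tensorPow X 0 := by
  change (ρ_ A).hom ≫ f ≫ (ρ_ A).inv = f ▷ 𝟙_ C
  simp

theorem isUnitaryIso_powZeroRight (X A : C) : IsUnitaryIso (powZeroRight X A) :=
  isUnitaryIso_symm (UnitaryFusionCategory.unitary_rightUnitor _)

/-- `X ^ ⊗ p ⊗ X ^ ⊗ n ≅ X ^ ⊗ N` for `N = p + n`. -/
def padLIso (X : C) (p n N : ℕ) (h : p + n + 0 = N) :
    tensorPow X p ⊗ tensorPow X n ≅ tensorPow X N :=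
  powZeroRight X _ ≪≫ padIso X p n 0 N h

theorem isUnitaryIso_padLIso (X : C) (p n N : ℕ) (h : p + n + 0 = N) :
    IsUnitaryIso (padLIso X p n N h) :=
  isUnitaryIso_trans (isUnitaryIso_powZeroRight X _) (isUnitaryIso_padIso X p n 0 N h)

theorem padFun_left (X : C) (p n N : ℕ) (h : p + n + 0 = N) (w : tensorPow X n ⟶ tensorPow X n) :
    padFun X p 0 h w = conjFun (padLIso X p n N h) (tensorPow X p ◁ w) := by
  rw [padLIso, conjFun_trans, conjFun_powZeroRight]
  rfl

theorem catTr_pad (X : C) {n N : ℕ} (p q : ℕ) (h : p + n + q = N)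
    (w : tensorPow X n ⟶ tensorPow X n) :
    catTr (padFun X p q h w) =
      catDim (tensorPow X p) * catDim (tensorPow X q) * catTr w := by
  have : padFun X p q h w = conjFun (padIso X p n q N h) ((tensorPow X p ◁ w) ▷ tensorPow X q) :=
    rfl
  rw [this, catTr_conj, catTr_whiskerRight, catTr_whiskerLeft]
  ring

theorem catDim_tensorPow (X : C) (n : ℕ) : catDim (tensorPow X n) = catDim X ^ n := by
  induction n with
  | zero => exact catDim_unit
  | succ n ih => rw [pow_succ, ← ih]; exact catDim_tensor _ _

/-- A family of positive traces on the endomorphism algebras of the tensor powers that is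
compatible with tensoring with identities on the left. -/
structure IsTraceFamily (X : C)
    (t : ∀ n, (tensorPow X n ⟶ tensorPow X n) →ₗ[ℂ] ℂ) : Prop where
  comm : ∀ n f g, t n (f ≫ g) = t n (g ≫ f)
  nonneg : ∀ n (f : tensorPow X n ⟶ tensorPow X n), 0 ≤ t n (f ≫ dag f)
  pad : ∀ p n N (h : p + n + 0 = N) w, t N (padFun X p 0 h w) = t n w

/-- The normalized categorical traces. -/
noncomputable def normTr (X : C) (n : ℕ) : (tensorPow X n ⟶ tensorPow X n) →ₗ[ℂ] ℂ :=
  ((catDim X : ℂ) ^ n)⁻¹ • catTrLin (tensorPow X n)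

theorem normTr_apply (X : C) (n : ℕ) (f : tensorPow X n ⟶ tensorPow X n) :
    normTr X n f = ((catDim X : ℂ) ^ n)⁻¹ * catTr f := rfl

theorem normTr_pad {X : C} (hX : 𝟙 X ≠ 0) {n N : ℕ} (p q : ℕ) (h : p + n + q = N)
    (w : tensorPow X n ⟶ tensorPow X n) : normTr X N (padFun X p q h w) = normTr X n w := by
  have h0 : (catDim X : ℂ) ≠ 0 := by exact_mod_cast (catDim_pos hX).ne'
  subst h
  rw [normTr_apply, normTr_apply, catTr_pad, catDim_tensorPow, catDim_tensorPow]
  push_cast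
  rw [pow_add, pow_add]
  field_simp

theorem normTr_id {X : C} (hX : 𝟙 X ≠ 0) (n : ℕ) : normTr X n (𝟙 _) = 1 := by
  have h0 : (catDim X : ℂ) ≠ 0 := by exact_mod_cast (catDim_pos hX).ne'
  rw [normTr_apply, catTr_id, catDim_tensorPow]
  push_cast
  exact inv_mul_cancel₀ (pow_ne_zero _ h0)

theorem normTr_comm (X : C) (n : ℕ) (f g : tensorPow X n ⟶ tensorPow X n) :
    normTr X n (f ≫ g) = normTr X n (g ≫ f) := by
  rw [normTr_apply, normTr_apply, catTr_comp_comm]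

theorem normTr_nonneg (X : C) (n : ℕ) (f : tensorPow X n ⟶ tensorPow X n) :
    0 ≤ normTr X n (f ≫ dag f) := by
  rw [normTr_apply]
  refine mul_nonneg ?_ (catTr_comp_dag_nonneg f)
  have : (0 : ℝ) ≤ (catDim X ^ n)⁻¹ := inv_nonneg.2 (pow_nonneg (catDim_nonneg X) n)
  exact_mod_cast this

/-- The unit embeds isometrically into `S ⊗ sphDual S`, whose dimension is the square of that of
`S`. -/
theorem one_le_catDim_of_simple (S : C) [Simple S] : 1 ≤ catDim S := by
  obtain ⟨_, v, _, hv, _⟩ := exists_isometry_of_ne_zero (coevaluation_ne_zero S (sphDual S))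
  have h := catDim_le_of_isometry v hv
  rw [catDim_unit, catDim_tensor, catDim_sphDual] at h
  nlinarith [catDim_nonneg S]

theorem ne_zero_bend {A B V V' : C} [ExactPairing V V'] {f : A ⊗ V' ⟶ B} (hf : f ≠ 0) :
    dCup V V' A ≫ f ▷ V ≠ 0 := by
  intro h
  apply hf
  have h2 := congrArg (fun g => g ▷ V' ≫ dag (rCup V V' B)) h
  simp only [comp_whiskerRight, Category.assoc, dag_rCup_naturality] at h2
  rw [reassoc_of% (dCup_comp_dag_rCup V V' A)] at h2
  simpa using h2

theorem ne_zero_unbend {A B V V' : C} [ExactPairing V V'] {f : A ⟶ B ⊗ V} (hf : f ≠ 0) :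
    f ▷ V' ≫ dag (rCup V V' B) ≠ 0 := by
  intro h
  apply hf
  refine eq_of_comp_dag_rCup_eq (V' := V') ?_
  rw [h]; simp

/-- Every simple object embeds into all large tensor powers. -/
structure GeneratesFrom (X : C) (k : ℕ) : Prop where
  ne_zero : 𝟙 X ≠ 0
  exists_hom : ∀ n, k ≤ n → ∀ S : C, Simple S → ∃ f : S ⟶ tensorPow X n, f ≠ 0

theorem exists_simple_isometry {T : C} (hT : 𝟙 T ≠ 0) :
    ∃ (U : C) (_ : Simple U) (u : U ⟶ T), u ≫ dag u = 𝟙 U := by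
  let d := simpleDecomp T
  obtain ⟨k, _⟩ := exists_ne_zero_comp_of_ne_zero d hT
  exact ⟨d.obj k, d.simple k, d.v k, d.isometry k⟩

theorem id_ne_zero_iff_catDim {T : C} : 𝟙 T ≠ 0 ↔ 0 < catDim T := by
  refine ⟨catDim_pos, fun h h0 => ?_⟩
  rw [catDim, h0, catTr_zero] at h
  exact lt_irrefl _ h

/-- Pick a simple summand `U` of `S ⊗ sphDual V`, map it into `Q`, and bend `sphDual V` to the other
side. -/
theorem exists_hom_tensor {S Q V : C} [Simple S] (hV : 𝟙 V ≠ 0)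
    (hQ : ∀ U : C, Simple U → ∃ f : U ⟶ Q, f ≠ 0) : ∃ f : S ⟶ Q ⊗ V, f ≠ 0 := by
  have h0 : 𝟙 (S ⊗ sphDual V) ≠ 0 := by
    rw [id_ne_zero_iff_catDim, catDim_tensor, catDim_sphDual]
    exact mul_pos (catDim_pos (id_nonzero S)) (catDim_pos hV)
  obtain ⟨U, hU, u, hu⟩ := exists_simple_isometry h0
  obtain ⟨f, hf⟩ := hQ U hU
  refine ⟨_, ne_zero_bend (V := V) (f := dag u ≫ f) fun h => hf ?_⟩
  have := congrArg (fun g => u ≫ g) h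
  simpa [reassoc_of% hu] using this

/-- One power containing all simple objects forces all later powers to contain them. The positive
exponent in the hypothesis excludes `X = 0`, since a zero `X` would make the power zero as well. -/
theorem StronglyTensorGenerating.generatesFrom {X : C} (h : StronglyTensorGenerating X) :
    ∃ k, GeneratesFrom X k := by
  obtain ⟨k, hk, hS⟩ := h
  have hX : 𝟙 X ≠ 0 := by
    intro h0
    obtain ⟨r⟩ := hS (𝟙_ C) inferInstance
    obtain ⟨j, rfl⟩ := Nat.exists_eq_add_of_lt hk
    have h1 : 𝟙 (tensorPow X (0 + j + 1)) = 0 := by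
      change 𝟙 (tensorPow X (0 + j) ⊗ X) = 0
      rw [← MonoidalCategory.whiskerLeft_id, h0, MonoidalPreadditive.whiskerLeft_zero]
    apply id_nonzero (𝟙_ C)
    rw [← r.retract, ← Category.id_comp r.r, h1, zero_comp, comp_zero]
  refine ⟨k, hX, fun n hn => ?_⟩
  induction n, hn using Nat.le_induction with
  | base =>
    intro S hS'
    obtain ⟨r⟩ := hS S hS'
    refine ⟨r.i, fun h0 => id_nonzero S ?_⟩
    rw [← r.retract, h0, zero_comp]
  | succ n _ ih =>
    intro S hS'
    exact exists_hom_tensor hX ih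

variable {X : C} {k : ℕ}

theorem GeneratesFrom.catDim_simple_le (h : GeneratesFrom X k) (S : C) [Simple S] :
    catDim S ≤ catDim X ^ k := by
  obtain ⟨f, hf⟩ := h.exists_hom k le_rfl S inferInstance
  obtain ⟨_, v, _, hv, _⟩ := exists_isometry_of_ne_zero hf
  rw [← catDim_tensorPow]
  exact catDim_le_of_isometry v hv

namespace IsTraceFamily

variable {t : ∀ n, (tensorPow X n ⟶ tensorPow X n) →ₗ[ℂ] ℂ}

theorem map_id (ht : IsTraceFamily X t) (n : ℕ) : t n (𝟙 _) = t 0 (𝟙 _) := by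
  rw [← ht.pad n 0 n (by omega) (𝟙 _)]
  congr 1
  simp [padFun]

theorem nonneg' (ht : IsTraceFamily X t) {n : ℕ} {S : C} (f : tensorPow X n ⟶ S) :
    0 ≤ t n (f ≫ dag f) := by
  obtain ⟨g, hg⟩ := exists_comp_dag_eq f
  rw [hg]; exact ht.nonneg n g

/-- The two range projections are equivalent through the partial isometry `dag u ≫ v`, so a trace
takes the same value on both. -/
theorem dag_comp_congr (ht : IsTraceFamily X t) {n : ℕ} {S : C} {u v : S ⟶ tensorPow X n}
    (hu : u ≫ dag u = 𝟙 S) (hv : v ≫ dag v = 𝟙 S) : t n (dag u ≫ u) = t n (dag v ≫ v) := by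
  have h := ht.comm n (dag u ≫ v) (dag v ≫ u)
  simpa only [Category.assoc, reassoc_of% hv, reassoc_of% hu] using h

theorem dag_comp_le (ht : IsTraceFamily X t) {n : ℕ} {S U : C} {u : S ⟶ U}
    {v : U ⟶ tensorPow X n} (hu : u ≫ dag u = 𝟙 S) :
    t n (dag (u ≫ v) ≫ u ≫ v) ≤ t n (dag v ≫ v) := by
  have h1 := ht.nonneg' (dag v ≫ (𝟙 U - dag u ≫ u))
  have h2 : (dag v ≫ (𝟙 U - dag u ≫ u)) ≫ dag (dag v ≫ (𝟙 U - dag u ≫ u)) =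
      dag v ≫ v - dag (u ≫ v) ≫ u ≫ v := by
    simp only [dag_sub, dag_id, dag_comp, dag_dag, Preadditive.sub_comp, Preadditive.comp_sub,
      Category.assoc, Category.comp_id, Category.id_comp, reassoc_of% hu]
    simp
  rw [h2, map_sub] at h1
  exact sub_nonneg.1 h1

/-- The uniform lower bound behind uniqueness. Since `X ^ ⊗ k` contains all simple objects, so does
`X ^ ⊗ k ⊗ S`; every simple summand of `X ^ ⊗ (k + n)` thus sits below a projection of trace `t n
(dag v ≫ v)`. Summing over these summands bounds the total mass. -/
theorem map_id_le (ht : IsTraceFamily X t) (hk : GeneratesFrom X k) {n : ℕ} {S : C} [Simple S]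
    {v : S ⟶ tensorPow X n} (hv : v ≫ dag v = 𝟙 S) :
    t 0 (𝟙 _) ≤ ((catDim X ^ (k + n) : ℝ) : ℂ) * t n (dag v ≫ v) := by
  obtain ⟨N, hN⟩ : ∃ N, k + n + 0 = N := ⟨_, rfl⟩
  let e := padLIso X k n N hN
  have he : IsUnitaryIso e := isUnitaryIso_padLIso X k n N hN
  have he1 : dag e.hom = e.inv := he
  let V : tensorPow X k ⊗ S ⟶ tensorPow X N := tensorPow X k ◁ v ≫ e.hom
  have hV : dag V ≫ V = padFun X k 0 hN (dag v ≫ v) := by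
    rw [padFun_left]
    simp [V, dag_comp, dag_whiskerL, he1, conjFun, e]
  let d := simpleDecomp (tensorPow X N)
  -- The summand is compared with a copy of itself inside `X ^ ⊗ k ⊗ S`; left padding does not
  -- change the trace of the projection onto `S`.
  have hle : ∀ j, t N (dag (d.v j) ≫ d.v j) ≤ t n (dag v ≫ v) := fun j => by
    obtain ⟨f, hf⟩ := exists_hom_tensor (S := d.obj j) (Q := tensorPow X k) (id_nonzero S)
      (hk.exists_hom k le_rfl)
    obtain ⟨_, y, _, hy, _⟩ := exists_isometry_of_ne_zero hf
    have hVV : V ≫ dag V = 𝟙 _ := by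
      simp [V, dag_comp, dag_whiskerL, he1, ← MonoidalCategory.whiskerLeft_comp, hv]
    have hyV : (y ≫ V) ≫ dag (y ≫ V) = 𝟙 _ := by
      rw [dag_comp, Category.assoc, reassoc_of% hVV, hy]
    rw [ht.dag_comp_congr (d.isometry j) hyV, ← ht.pad k n N hN, ← hV]
    exact ht.dag_comp_le hy
  -- Each summand has dimension at least one, so their number is at most the dimension of the whole.
  have hn : (d.n : ℝ) ≤ catDim X ^ (k + n) := by
    rw [show k + n = N from hN, ← catDim_tensorPow, catDim_eq_sum d]
    calc (d.n : ℝ) = ∑ _j : Fin d.n, (1 : ℝ) := by simp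
      _ ≤ _ := Finset.sum_le_sum fun j _ => one_le_catDim_of_simple (d.obj j)
  have h0 : 0 ≤ t n (dag v ≫ v) := by simpa [dag_dag] using ht.nonneg' (dag v)
  calc t 0 (𝟙 _) = t N (𝟙 _) := (ht.map_id N).symm
    _ = ∑ j, t N (dag (d.v j) ≫ d.v j) := by rw [← d.sum_eq, map_sum]
    _ ≤ ∑ _j : Fin d.n, t n (dag v ≫ v) := Finset.sum_le_sum fun j _ => hle j
    _ = (d.n : ℂ) * t n (dag v ≫ v) := by simp
    _ ≤ _ := by
      refine mul_le_mul_of_nonneg_right ?_ h0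
      exact_mod_cast hn

/-- Positivity of a trace need only be tested on projections onto simple summands: cutting `f` by an
orthonormal decomposition writes the trace of `f ≫ dag f` as a sum of nonnegative multiples of such
values. -/
theorem exists_dag_comp (t : ∀ n, (tensorPow X n ⟶ tensorPow X n) →ₗ[ℂ] ℂ)
    {n : ℕ} (hcomm : ∀ f g, t n (f ≫ g) = t n (g ≫ f))
    (h : ∀ (S : C) (_ : Simple S) (v : S ⟶ tensorPow X n), v ≫ dag v = 𝟙 S →
      0 ≤ t n (dag v ≫ v)) (f : tensorPow X n ⟶ tensorPow X n) : 0 ≤ t n (f ≫ dag f) := by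
  let d := simpleDecomp (tensorPow X n)
  have e : t n (f ≫ dag f) = ∑ j, t n (dag (d.v j ≫ f) ≫ (d.v j ≫ f)) := by
    rw [hcomm, ← map_sum]
    congr 1
    simp only [dag_comp, Category.assoc]
    rw [← Preadditive.comp_sum]
    have : ∀ j, dag (d.v j) ≫ d.v j ≫ f = (dag (d.v j) ≫ d.v j) ≫ f := fun j => by simp
    simp only [this]
    rw [← Preadditive.sum_comp, d.sum_eq, Category.id_comp]
  rw [e]
  refine Finset.sum_nonneg fun j _ => ?_
  by_cases h0 : d.v j ≫ f = 0
  · rw [h0]; simp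
  · obtain ⟨c, v, hc, hv, hcv⟩ := exists_isometry_of_ne_zero h0
    rw [hcv, dag_smul, Linear.smul_comp, Linear.comp_smul, map_smul, map_smul, smul_eq_mul,
      smul_eq_mul, ← mul_assoc, mul_comm (star _)]
    exact mul_nonneg (mul_star_self_nonneg _) (h _ (d.simple j) v hv)

/-- The lower bound for positive traces in terms of the normalized trace. -/
noncomputable def lowerConst (X : C) (k : ℕ) : ℝ := (catDim X ^ (k + k))⁻¹

/-- On a projection onto a simple summand, `map_id_le` bounds `t` from below, while the normalized
trace is bounded above because simple objects have dimension at most `catDim X ^ k`. The quotient of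
the bounds is the constant `lowerConst X k` times the mass. -/
theorem sub_smul_normTr (ht : IsTraceFamily X t) (hk : GeneratesFrom X k) :
    IsTraceFamily X fun n => t n - ((lowerConst X k : ℂ) * t 0 (𝟙 _)) • normTr X n where
  comm n f g := by
    simp only [LinearMap.sub_apply, LinearMap.smul_apply]
    rw [ht.comm, normTr_comm]
  pad p n N h w := by
    simp only [LinearMap.sub_apply, LinearMap.smul_apply]
    rw [ht.pad, normTr_pad hk.ne_zero]
  nonneg n f := by
    refine exists_dag_comp (fun n => t n - ((lowerConst X k : ℂ) * t 0 (𝟙 _)) • normTr X n)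
      (fun f g => ?_) (fun S _ v hv => ?_) f
    · simp only [LinearMap.sub_apply, LinearMap.smul_apply]
      rw [ht.comm, normTr_comm]
    · have hd := catDim_pos hk.ne_zero
      simp only [LinearMap.sub_apply, LinearMap.smul_apply, smul_eq_mul]
      have h1 := ht.map_id_le hk hv
      have h0 : 0 ≤ t n (dag v ≫ v) := by simpa [dag_dag] using ht.nonneg' (dag v)
      have h00 : 0 ≤ t 0 (𝟙 _) := by simpa [dag_id] using ht.nonneg 0 (𝟙 _)
      obtain ⟨a, ha⟩ : ∃ a : ℝ, t n (dag v ≫ v) = a := ⟨_, Complex.eq_re_of_ofReal_le h0⟩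
      obtain ⟨b, hb⟩ : ∃ b : ℝ, t 0 (𝟙 _) = b := ⟨_, Complex.eq_re_of_ofReal_le h00⟩
      rw [normTr_apply, catTr_comp_comm, hv, catTr_id, ha, hb]
      rw [ha, hb] at h1
      rw [hb] at h00
      have h1' : b ≤ catDim X ^ (k + n) * a := by exact_mod_cast h1
      have h00' : 0 ≤ b := by exact_mod_cast h00
      have h2 := hk.catDim_simple_le S
      -- The two factors `catDim X ^ k` in `lowerConst` absorb the bound on `catDim S` and the power
      -- `k` in `map_id_le`; the powers `n` cancel.
      have h3 : lowerConst X k * b * ((catDim X ^ n)⁻¹ * catDim S) ≤ a := by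
        calc lowerConst X k * b * ((catDim X ^ n)⁻¹ * catDim S)
            ≤ lowerConst X k * b * ((catDim X ^ n)⁻¹ * catDim X ^ k) := by
              unfold lowerConst; gcongr
          _ ≤ lowerConst X k * (catDim X ^ (k + n) * a) * ((catDim X ^ n)⁻¹ * catDim X ^ k) := by
              unfold lowerConst; gcongr
          _ = a := by
              unfold lowerConst
              rw [pow_add, pow_add]; field_simp
      rw [sub_nonneg]
      exact_mod_cast h3

/-- Each subtraction removes the fraction `lowerConst X k` of the remaining mass, so that after `j`
rounds the mass is `(1 - lowerConst X k) ^ j` times the original one. -/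
theorem sub_smul_iterate (ht : IsTraceFamily X t) (hk : GeneratesFrom X k) (j : ℕ) :
    IsTraceFamily X fun n =>
      t n - ((1 - (1 - (lowerConst X k : ℂ)) ^ j) * t 0 (𝟙 _)) • normTr X n := by
  induction j with
  | zero => simpa using ht
  | succ j ih =>
    have := ih.sub_smul_normTr hk
    convert this using 2 with n
    simp only [LinearMap.sub_apply, LinearMap.smul_apply, normTr_id hk.ne_zero, smul_eq_mul]
    rw [sub_sub, ← add_smul]
    congr 2
    ring

/-- In the limit of the subtractions a positive family of mass zero remains. It is nonpositive on
projections too, so it vanishes on all positive elements and then everywhere by polarization. -/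
theorem eq_smul_normTr (ht : IsTraceFamily X t) (hk : GeneratesFrom X k) (n : ℕ) :
    t n = t 0 (𝟙 _) • normTr X n := by
  have hone : 1 ≤ catDim X := by
    obtain ⟨U, _, u, hu⟩ := exists_simple_isometry hk.ne_zero
    exact (one_le_catDim_of_simple U).trans (catDim_le_of_isometry u hu)
  have hlow : 0 < lowerConst X k := by
    unfold lowerConst
    have := catDim_pos hk.ne_zero
    positivity
  have hlow1 : lowerConst X k ≤ 1 := inv_le_one_of_one_le₀ (one_le_pow₀ hone)
  have hs : IsTraceFamily X fun n => t n - t 0 (𝟙 _) • normTr X n := by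
    refine ⟨fun n f g => ?_, fun n f => ?_, fun p n N h w => ?_⟩
    · simp only [LinearMap.sub_apply, LinearMap.smul_apply]
      rw [ht.comm, normTr_comm]
    · have hlim : Tendsto (fun j : ℕ => (t n - ((1 - (1 - (lowerConst X k : ℂ)) ^ j) *
          t 0 (𝟙 _)) • normTr X n) (f ≫ dag f)) atTop
          (𝓝 ((t n - t 0 (𝟙 _) • normTr X n) (f ≫ dag f))) := by
        simp only [LinearMap.sub_apply, LinearMap.smul_apply, smul_eq_mul]
        refine tendsto_const_nhds.sub (Tendsto.mul_const _ ?_)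
        have : Tendsto (fun j : ℕ => (1 - (1 - (lowerConst X k : ℂ)) ^ j) * t 0 (𝟙 _)) atTop
            (𝓝 ((1 - 0) * t 0 (𝟙 _))) := by
          refine (tendsto_const_nhds.sub ?_).mul_const _
          refine tendsto_pow_atTop_nhds_zero_of_norm_lt_one ?_
          rw [← Complex.ofReal_one, ← Complex.ofReal_sub, Complex.norm_real, Real.norm_eq_abs,
            abs_lt]
          constructor <;> linarith
        simpa using this
      exact ge_of_tendsto' hlim fun j => (ht.sub_smul_iterate hk j).nonneg n f
    · simp only [LinearMap.sub_apply, LinearMap.smul_apply]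
      rw [ht.pad, normTr_pad hk.ne_zero]
  set s : ∀ n, (tensorPow X n ⟶ tensorPow X n) →ₗ[ℂ] ℂ := fun n => t n - t 0 (𝟙 _) • normTr X n
    with hsdef
  have hs1 : s n (𝟙 _) = 0 := by
    simp [hsdef, normTr_id hk.ne_zero, ht.map_id]
  -- A projection lies below the identity, whose value is zero; hence `-s` is also nonnegative on
  -- projections.
  have hproj : ∀ (S : C) (_ : Simple S) (v : S ⟶ tensorPow X n), v ≫ dag v = 𝟙 S →
      0 ≤ (fun n => -s n) n (dag v ≫ v) := fun S _ v hv => by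
    have h1 := hs.dag_comp_le (n := n) (u := v) (v := 𝟙 _) hv
    rw [Category.comp_id, dag_id, Category.comp_id, hs1] at h1
    simpa using h1
  have hzero : ∀ f, s n (f ≫ dag f) = 0 := fun f => by
    refine le_antisymm ?_ (hs.nonneg n f)
    have := exists_dag_comp (fun n => -s n) (n := n)
      (fun f g => by simp only [LinearMap.neg_apply]; rw [hs.comm]) hproj f
    simpa using this
  -- Polarization: expanding `s` at `𝟙 + f` and at `𝟙 + i f` gives `s f = -s (dag f)` and `s f = s
  -- (dag f)`.
  have hsz : s n = 0 := by
    ext f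
    have h1 := hzero (𝟙 _ + f)
    have h2 := hzero (𝟙 _ + Complex.I • f)
    have h3 := hzero f
    simp only [dag_add, dag_id, dag_smul, Preadditive.add_comp, Preadditive.comp_add,
      Category.id_comp, Category.comp_id, Linear.smul_comp, Linear.comp_smul, map_add, map_smul,
      hs1, h3, smul_eq_mul, Complex.star_def, Complex.conj_I] at h1 h2
    have h4 : s n f = -s n (dag f) := by linear_combination h1
    have h5 : Complex.I * s n f = Complex.I * s n (dag f) := by linear_combination h2
    have h6 := mul_left_cancel₀ Complex.I_ne_zero h5
    change s n f = 0
    rw [← h6] at h4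
    linear_combination h4 / 2
  exact sub_eq_zero.1 hsz

end IsTraceFamily

end TraceFamily


/-! ### The GNS representation of a state -/

section GNS

open scoped InnerProductSpace

variable {A : Type*} [CStarAlgebra A] [PartialOrder A] [StarOrderedRing A] (τ : A →ₚ[ℂ] ℂ)

/-- The class of `a` in the GNS space. -/
noncomputable def gnsClass : A →ₗ[ℂ] τ.GNS where
  toFun a := ((τ.toPreGNS a : τ.PreGNS) : UniformSpace.Completion τ.PreGNS)
  map_add' a b := by rw [map_add, UniformSpace.Completion.coe_add]
  map_smul' c a := by rw [map_smul, UniformSpace.Completion.coe_smul]; rfl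

theorem gnsClass_one : gnsClass τ 1 = gnsVector τ := rfl

theorem gnsStarAlgHom_gnsClass (a b : A) : τ.gnsStarAlgHom a (gnsClass τ b) = gnsClass τ (a * b) :=
  τ.gnsNonUnitalStarAlgHom_apply_coe

theorem gnsStarAlgHom_gnsVector (a : A) : τ.gnsStarAlgHom a (gnsVector τ) = gnsClass τ a := by
  rw [← gnsClass_one, gnsStarAlgHom_gnsClass, mul_one]

theorem inner_gnsClass (a b : A) : ⟪gnsClass τ a, gnsClass τ b⟫_ℂ = τ (star a * b) :=
  UniformSpace.Completion.inner_coe _ _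

theorem denseRange_gnsClass : DenseRange (gnsClass τ) :=
  UniformSpace.Completion.denseRange_coe.comp τ.toPreGNS.surjective.denseRange
    (UniformSpace.Completion.continuous_coe _)

theorem norm_gnsVector (h : τ 1 = 1) : ‖gnsVector τ‖ = 1 := by
  have h1 : ⟪gnsVector τ, gnsVector τ⟫_ℂ = 1 := by
    rw [← gnsClass_one, inner_gnsClass, star_one, one_mul, h]
  have h2 : ‖gnsVector τ‖ ^ 2 = 1 := by
    rw [← inner_self_eq_norm_sq (𝕜 := ℂ), h1]; simp
  nlinarith [norm_nonneg (gnsVector τ)]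

theorem norm_state_le (h : τ 1 = 1) (a : A) : ‖τ a‖ ≤ ‖a‖ := by
  have h1 : τ a = ⟪gnsVector τ, τ.gnsStarAlgHom a (gnsVector τ)⟫_ℂ := by
    rw [gnsStarAlgHom_gnsVector, ← gnsClass_one, inner_gnsClass, star_one, one_mul]
  calc ‖τ a‖ ≤ ‖gnsVector τ‖ * (‖τ.gnsStarAlgHom a‖ * ‖gnsVector τ‖) := by
        rw [h1]
        exact (norm_inner_le_norm _ _).trans (by gcongr; exact ContinuousLinearMap.le_opNorm _ _)
    _ ≤ ‖a‖ := by
      rw [norm_gnsVector τ h, one_mul, mul_one]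
      exact NonUnitalStarAlgHom.norm_apply_le τ.gnsStarAlgHom a

theorem continuous_state (h : τ 1 = 1) : Continuous τ :=
  AddMonoidHomClass.continuous_of_bound τ 1 fun a => by rw [one_mul]; exact norm_state_le τ h a

theorem norm_le_of_positive {A : Type*} [CStarAlgebra A] (f : A →ₗ[ℂ] ℂ) (h1 : f 1 = 1)
    (hpos : ∀ a, 0 ≤ f (star a * a)) (a : A) : ‖f a‖ ≤ ‖a‖ := by
  let _ : PartialOrder A := CStarAlgebra.spectralOrder A
  have _ : StarOrderedRing A := CStarAlgebra.spectralOrderedRing A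
  refine norm_state_le (PositiveLinearMap.mk₀ f fun x hx => ?_) h1 a
  obtain ⟨b, rfl⟩ := CStarAlgebra.nonneg_iff_eq_star_mul_self.1 hx
  exact hpos b

end GNS

/-! ### Maps out of the quasi-local algebra and the trace -/

section QuasiLocalMaps

variable {C : Type*} [Category C] [Abelian C] [Linear ℂ C] [MonoidalCategory C]
  [MonoidalPreadditive C] [MonoidalLinear ℂ C] [RigidCategory C] [UnitaryFusionCategory C]

theorem boxStep_iterate {X : C} {E : Type*} (Φ : ∀ N, End (tensorPow X (2 * N)) → E)
    (h : ∀ N w, Φ (N + 1) (boxStep X N w) = Φ N w) (f : LocalSeq X) :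
    ∃ e : E, ∀ᶠ N in atTop, Φ N (LocalSeq.term N f) = e := by
  obtain ⟨N₀, hN⟩ := eventually_atTop.1 (LocalSeq.eventually_term f)
  refine ⟨Φ N₀ (LocalSeq.term N₀ f), eventually_atTop.2 ⟨N₀, fun N hN' => ?_⟩⟩
  induction N, hN' using Nat.le_induction with
  | base => rfl
  | succ N hN' ih => rw [hN N hN', h, ih]

/-- A local sequence is eventually compatible, so the values on its terms become constant. The bound
on each box passes to the limit seminorm, and the map extends by density. -/
theorem exists_quasiLocal_extension {X : C} {E : Type*} [NormedAddCommGroup E] [NormedSpace ℂ E]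
    [CompleteSpace E] (Φ : ∀ N, End (tensorPow X (2 * N)) →ₗ[ℂ] E)
    (h : ∀ N w, Φ (N + 1) (boxStep X N w) = Φ N w) (hn : ∀ N w, ‖Φ N w‖ ≤ ‖w‖) :
    ∃ Ψ : QuasiLocal X →L[ℂ] E,
      (∀ f, ∀ᶠ N in atTop, Ψ (QuasiLocal.ofLocal f) = Φ N (LocalSeq.term N f)) ∧
      ∀ a, ‖Ψ a‖ ≤ ‖a‖ := by
  choose L hL using boxStep_iterate (fun N w => Φ N w) h
  let L' : LocalSeq X →ₗ[ℂ] E :=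
    { toFun := L
      map_add' := fun f g => by
        obtain ⟨N, h1, h2, h3⟩ := ((hL f).and ((hL g).and (hL (f + g)))).exists
        rw [← h1, ← h2, ← h3, map_add, map_add]
      map_smul' := fun c f => by
        obtain ⟨N, h1, h2⟩ := ((hL f).and (hL (c • f))).exists
        rw [← h1, ← h2, map_smul, map_smul, RingHom.id_apply] }
  have hdense : DenseRange (QuasiLocal.ofLocal.toLinearMap : LocalSeq X →ₗ[ℂ] QuasiLocal X) :=
    QuasiLocal.dense_ofLocal
  have hbound : ∀ f : LocalSeq X, ‖L' f‖ ≤ 1 * ‖QuasiLocal.ofLocal.toLinearMap f‖ := fun f => by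
    rw [one_mul]
    change ‖L f‖ ≤ ‖QuasiLocal.ofLocal f‖
    rw [QuasiLocal.norm_ofLocal]
    refine le_of_tendsto_of_tendsto tendsto_const_nhds (LocalSeq.tendsto_norm f) ?_
    filter_upwards [hL f] with N hN
    rw [← hN]; exact hn N _
  refine ⟨L'.extendOfNorm QuasiLocal.ofLocal.toLinearMap, fun f => ?_, fun a => ?_⟩
  · filter_upwards [hL f] with N hN
    exact (LinearMap.extendOfNorm_eq hdense ⟨1, hbound⟩ f).trans hN.symm
  · have := LinearMap.norm_extendOfNorm_apply_le hdense 1 hbound a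
    rwa [one_mul] at this

theorem exists_siteHom_eq {X : C} (f : LocalSeq X) :
    ∀ᶠ M : ℕ in atTop, QuasiLocal.ofLocal f = siteHom X (-(M : ℤ)) (2 * M) (LocalSeq.term M f) := by
  obtain ⟨N₀, h⟩ := eventually_atTop.1 (LocalSeq.eventually_term f)
  refine eventually_atTop.2 ⟨N₀, fun M hM => ?_⟩
  have key : ∀ k, LocalSeq.term (M + 1 + k) f = pad X (k + 1) (k + 1) (by omega)
      (LocalSeq.term M f) := by
    intro k
    induction k with
    | zero => exact h M (by omega)
    | succ k ih =>
      refine (h (M + 1 + k) (by omega)).trans ?_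
      rw [ih]
      refine (padFun_padFun X _ _ _ _ _ _ _).trans ?_
      exact padFun_congr X _ (by omega) (by omega) _
  refine QuasiLocal.ofLocal_eq_of_eventually ?_
  filter_upwards [eventually_term_siteSeq X (-(M : ℤ)) (2 * M), eventually_ge_atTop (M + 1)]
    with N ⟨h1, h2⟩ hN
  obtain ⟨k, rfl⟩ := Nat.exists_eq_add_of_le hN
  rw [h2, key]
  exact padFun_congr X _ (by omega) (by omega) _

/-- To prove a closed property of elements of the quasi-local algebra, it suffices to consider
local operators on large intervals. -/
theorem quasiLocal_induction {X : C} {p : QuasiLocal X → Prop} (a : QuasiLocal X)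
    (hc : IsClosed {a | p a})
    (h : ∀ (M : ℕ) (w : End (tensorPow X (2 * M))), p (siteHom X (-(M : ℤ)) (2 * M) w)) : p a :=
  QuasiLocal.induction_on a hc fun f => by
    obtain ⟨M, hM⟩ := (exists_siteHom_eq f).exists
    rw [hM]; exact h M _

theorem siteHom_extend {X : C} {a b : ℤ} {n m : ℕ} (h1 : b ≤ a) (h2 : a + n ≤ b + m)
    (w : End (tensorPow X n)) : siteHom X a n w =
      siteHom X b m (pad X (a - b).toNat (b + m - (a + n)).toNat (by omega) w) := by
  rw [siteHom_pad]
  congr 2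
  omega

theorem eq_siteHom_of_extension {X : C} {E : Type*} [NormedAddCommGroup E] [NormedSpace ℂ E]
    (Φ : ∀ N, End (tensorPow X (2 * N)) →ₗ[ℂ] E) (Ψ : QuasiLocal X →L[ℂ] E)
    (hΨ : ∀ f, ∀ᶠ N in atTop, Ψ (QuasiLocal.ofLocal f) = Φ N (LocalSeq.term N f))
    (a : ℤ) (n : ℕ) (w : End (tensorPow X n)) :
    ∀ᶠ N : ℕ in atTop, ∃ h : -(N : ℤ) ≤ a ∧ a + n ≤ N, Ψ (siteHom X a n w) =
      Φ N (pad X (a + N).toNat (N - (a + n)).toNat (by omega) w) := by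
  filter_upwards [hΨ (siteSeq X a n w), eventually_term_siteSeq X a n] with N h1 ⟨h2, h3⟩
  refine ⟨h2, ?_⟩
  rw [← h3]; exact h1

variable {X : C}

/-- The normalized categorical traces agree along the inclusions and are contractive, being positive
and unital; positivity and cyclicity of the extension are checked on local operators and pass to
limits. -/
theorem exists_traceState (hX : 𝟙 X ≠ 0) : ∃ τ : QuasiLocal X →ₚ[ℂ] ℂ, IsTracialState τ ∧
    ∀ a n w, τ (siteHom X a n w) = normTr X n w := by
  let Φ : ∀ N, End (tensorPow X (2 * N)) →ₗ[ℂ] ℂ := fun N => normTr X (2 * N)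
  obtain ⟨Ψ, hΨ, _⟩ := exists_quasiLocal_extension Φ (fun N w => normTr_pad hX 1 1 (by omega) w)
    (fun N w => norm_le_of_positive (A := End (tensorPow X (2 * N))) (normTr X (2 * N))
      (normTr_id hX _) (fun a => normTr_nonneg X _ a) w)
  have hs : ∀ a n w, Ψ (siteHom X a n w) = normTr X n w := fun a n w => by
    obtain ⟨N, _, hN⟩ := (eq_siteHom_of_extension Φ Ψ hΨ a n w).exists
    exact hN.trans (normTr_pad hX _ _ _ w)
  have hpos : ∀ b, 0 ≤ Ψ (star b * b) := fun b => by
    refine quasiLocal_induction (p := fun b => 0 ≤ Ψ (star b * b)) b ?_ fun M w => ?_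
    · exact isClosed_le continuous_const (Ψ.continuous.comp
        (QuasiLocal.continuous_star'.mul continuous_id))
    · rw [← map_star, ← map_mul, hs]
      exact normTr_nonneg X _ w
  have hcomm : ∀ a b, Ψ (a * b) = Ψ (b * a) := fun a b => by
    refine QuasiLocal.induction_on (p := fun a => Ψ (a * b) = Ψ (b * a)) a
      (isClosed_eq (Ψ.continuous.comp (continuous_id.mul continuous_const))
      (Ψ.continuous.comp (continuous_const.mul continuous_id))) fun f => ?_
    refine QuasiLocal.induction_on (p := fun b => Ψ (_ * b) = Ψ (b * _)) b
      (isClosed_eq (Ψ.continuous.comp (continuous_const.mul continuous_id))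
      (Ψ.continuous.comp (continuous_id.mul continuous_const))) fun g => ?_
    obtain ⟨M, h1, h2⟩ := ((exists_siteHom_eq f).and (exists_siteHom_eq g)).exists
    rw [h1, h2]
    generalize LocalSeq.term M f = v
    generalize LocalSeq.term M g = w
    rw [← map_mul, ← map_mul, hs, hs]
    exact normTr_comm X _ _ _
  refine ⟨PositiveLinearMap.mk₀ Ψ.toLinearMap fun x hx => ?_, ⟨?_, hcomm⟩, hs⟩
  · obtain ⟨b, rfl⟩ := CStarAlgebra.nonneg_iff_eq_star_mul_self.1 hx
    exact hpos b
  · have := hs 0 0 1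
    rw [map_one] at this
    exact this.trans (normTr_id hX 0)

/-- The trace family obtained from a positive functional on the operators on sites `< x`. -/
theorem isTraceFamily_of_positive (x : ℤ) (τ : QuasiLocal X →ₗ[ℂ] ℂ)
    (hcomm : ∀ n (v w : End (tensorPow X n)), τ (siteHom X (x - n) n v * siteHom X (x - n) n w) =
      τ (siteHom X (x - n) n w * siteHom X (x - n) n v))
    (hpos : ∀ n (w : End (tensorPow X n)),
      0 ≤ τ (star (siteHom X (x - n) n w) * siteHom X (x - n) n w)) :
    IsTraceFamily X fun n => τ ∘ₗ (siteHom X (x - n) n).toAlgHom.toLinearMap where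
  comm n f g := by
    have := hcomm n g f
    rw [← map_mul, ← map_mul] at this
    exact this
  nonneg n f := by
    have := hpos n f
    rw [← map_star, ← map_mul] at this
    exact this
  pad p n N h w := by
    change τ (siteHom X (x - N) N (pad X p 0 h w)) = τ (siteHom X (x - n) n w)
    rw [siteHom_pad]
    congr 3
    omega

/-- Restricting `τ` to intervals with a fixed right end yields a trace family of mass one, to which
uniqueness applies. -/
theorem tracialState_siteHom {k : ℕ} (hk : GeneratesFrom X k) {τ : QuasiLocal X →ₚ[ℂ] ℂ}
    (hτ : IsTracialState τ) (a : ℤ) (n : ℕ) (w : End (tensorPow X n)) :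
    τ (siteHom X a n w) = normTr X n w := by
  have ht := isTraceFamily_of_positive (a + n) τ.toLinearMap
    (fun n v w => hτ.map_mul_comm _ _) (fun n w => τ.map_nonneg (star_mul_self_nonneg _))
  have h := LinearMap.congr_fun (ht.eq_smul_normTr hk n) w
  have h1 : τ.toLinearMap (siteHom X (a + n - (0 : ℕ)) 0 1) = 1 := by
    rw [map_one]; exact hτ.map_one
  have h2 : τ (siteHom X (a + n - n) n w) = 1 * normTr X n w := by
    rw [← h1]; exact h
  rwa [one_mul, add_sub_cancel_right] at h2

theorem tracialState_unique {k : ℕ} (hk : GeneratesFrom X k) {τ τ' : QuasiLocal X →ₚ[ℂ] ℂ}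
    (hτ : IsTracialState τ) (hτ' : IsTracialState τ') : τ' = τ := by
  ext a
  refine quasiLocal_induction (p := fun a => τ' a = τ a) a
    (isClosed_eq (continuous_state τ' hτ'.map_one) (continuous_state τ hτ.map_one)) fun M w => ?_
  rw [tracialState_siteHom hk hτ, tracialState_siteHom hk hτ']

end QuasiLocalMaps

/-! ### Growth of the endomorphism algebras -/

section Growth

variable {C : Type*} [Category C] [Abelian C] [Linear ℂ C] [MonoidalCategory C]
  [MonoidalPreadditive C] [MonoidalLinear ℂ C] [RigidCategory C] [UnitaryFusionCategory C]

/-- A simple summand already has dimension at least one, so its complement has dimension zero and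
vanishes by faithfulness of the trace. -/
theorem exists_simple_iso_of_catDim_le_one {T : C} (h0 : 𝟙 T ≠ 0) (h1 : catDim T ≤ 1) :
    ∃ S : C, Simple S ∧ Nonempty (S ≅ T) := by
  obtain ⟨U, hU, u, hu⟩ := exists_simple_isometry h0
  refine ⟨U, hU, ⟨u, dag u, hu, ?_⟩⟩
  have hp : (𝟙 T - dag u ≫ u) ≫ dag (𝟙 T - dag u ≫ u) = 𝟙 T - dag u ≫ u := by
    simp only [dag_sub, dag_id, dag_comp, dag_dag, Preadditive.sub_comp, Preadditive.comp_sub,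
      Category.assoc, Category.comp_id, Category.id_comp, reassoc_of% hu]
    simp
  have h2 : catTr (𝟙 T - dag u ≫ u) = catDim T - catDim U := by
    rw [← catTr_id, ← catTr_id, ← hu, catTr_comp_comm u]
    exact map_sub (catTrLin T) _ _
  have h3 : catDim T = catDim U :=
    le_antisymm (h1.trans (one_le_catDim_of_simple U)) (catDim_le_of_isometry u hu)
  have h4 : 𝟙 T - dag u ≫ u = 0 := by
    refine eq_zero_of_catTr_comp_dag ?_
    rw [hp, h2, h3, sub_self]
  exact (sub_eq_zero.1 h4).symm

/-- If the dimension were at most one, `X` and `X ^ ⊗ k` would be simple. As every simple object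
maps nontrivially to `X ^ ⊗ k`, all simple objects would be isomorphic, and `X` would be the unit.
-/
theorem one_lt_catDim {X : C} {k : ℕ} (hk : GeneratesFrom X k) (hX : IsEmpty (X ≅ 𝟙_ C)) :
    1 < catDim X := by
  by_contra! h1
  obtain ⟨U, hU, ⟨e⟩⟩ := exists_simple_iso_of_catDim_le_one hk.ne_zero h1
  obtain ⟨S, hS, ⟨e'⟩⟩ := exists_simple_iso_of_catDim_le_one (T := tensorPow X k)
    (id_ne_zero_iff_catDim.2 (by
      rw [catDim_tensorPow]; exact pow_pos (catDim_pos hk.ne_zero) k))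
    (by rw [catDim_tensorPow]; exact pow_le_one₀ (catDim_nonneg X) h1)
  have key : ∀ (T : C) [Simple T], Nonempty (T ≅ S) := fun T _ => by
    obtain ⟨f, hf⟩ := hk.exists_hom k le_rfl T inferInstance
    have : f ≫ e'.inv ≠ 0 := fun h => hf (by
      rw [← Category.comp_id f, ← e'.inv_hom_id, reassoc_of% h, zero_comp])
    have := isIso_of_hom_simple this
    exact ⟨asIso (f ≫ e'.inv)⟩
  obtain ⟨a⟩ := key U
  obtain ⟨b⟩ := key (𝟙_ C)
  exact hX.elim (e.symm ≪≫ a ≪≫ b.symm)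

theorem SimpleDecomp.n_le_finrank {T : C} (d : SimpleDecomp T) :
    d.n ≤ Module.finrank ℂ (T ⟶ T) := by
  have hli : LinearIndependent ℂ fun j => dag (d.v j) ≫ d.v j := by
    refine Fintype.linearIndependent_iff.2 fun g hg i => ?_
    have h := congrArg (fun f => d.v i ≫ f ≫ dag (d.v i)) hg
    simp only [Preadditive.sum_comp, Preadditive.comp_sum, zero_comp, comp_zero] at h
    rw [Finset.sum_eq_single i] at h
    · simp only [Linear.smul_comp, Linear.comp_smul, Category.assoc, d.isometry,
        Category.comp_id] at h
      rcases smul_eq_zero.1 h with h | h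
      · exact h
      · exact absurd h (id_nonzero _)
    · intro j _ hj
      simp only [Linear.smul_comp, Category.assoc, d.ortho_ne hj, comp_zero,
        smul_zero]
    · simp
  simpa using hli.fintype_card_le_finrank

/-- The dimension of `X ^ ⊗ n` grows exponentially while each simple summand contributes at most
`catDim X ^ k`. Hence the number of summands, and with it the number of independent projections, is
unbounded. -/
theorem exists_le_finrank_end {X : C} {k : ℕ} (hk : GeneratesFrom X k)
    (hX : IsEmpty (X ≅ 𝟙_ C)) (M : ℕ) :
    ∃ n, M ≤ Module.finrank ℂ (tensorPow X n ⟶ tensorPow X n) := by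
  obtain ⟨n, hn⟩ := pow_unbounded_of_one_lt (M * catDim X ^ k) (one_lt_catDim hk hX)
  let d := simpleDecomp (tensorPow X n)
  refine ⟨n, le_trans ?_ d.n_le_finrank⟩
  have h0 : 0 < catDim X ^ k := pow_pos (catDim_pos hk.ne_zero) k
  have h : catDim X ^ n ≤ d.n * catDim X ^ k := by
    rw [← catDim_tensorPow, catDim_eq_sum d]
    calc _ ≤ ∑ _j : Fin d.n, catDim X ^ k :=
          Finset.sum_le_sum fun j _ => hk.catDim_simple_le (d.obj j)
      _ = _ := by simp
  have : (M : ℝ) ≤ d.n := le_of_mul_le_mul_right (hn.le.trans h) h0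
  exact_mod_cast this

end Growth


/-! ### Right multiplications and the algebras generated by local operators -/

section Tracial

open scoped InnerProductSpace

variable {A : Type*} [CStarAlgebra A] [PartialOrder A] [StarOrderedRing A] {τ : A →ₚ[ℂ] ℂ}

theorem norm_sq_gnsClass (a : A) : ‖gnsClass τ a‖ ^ 2 = (τ (star a * a)).re := by
  rw [← inner_gnsClass, ← inner_self_eq_norm_sq (𝕜 := ℂ)]; rfl

theorem gnsClass_induction {p : τ.GNS → Prop} (ξ : τ.GNS) (hc : IsClosed {ξ | p ξ})
    (h : ∀ a, p (gnsClass τ a)) : p ξ :=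
  (denseRange_gnsClass τ).induction_on ξ hc h

namespace IsTracialState

variable (hτ : IsTracialState τ)

include hτ

theorem norm_gnsClass_star (a : A) : ‖gnsClass τ (star a)‖ = ‖gnsClass τ a‖ := by
  refine (sq_eq_sq₀ (norm_nonneg _) (norm_nonneg _)).1 ?_
  rw [norm_sq_gnsClass, norm_sq_gnsClass, star_star, hτ.map_mul_comm]

/-- Traciality makes the adjoint isometric on classes, which turns right multiplication into left
multiplication by the adjoint. -/
theorem norm_gnsClass_mul_le (b a : A) : ‖gnsClass τ (b * a)‖ ≤ ‖a‖ * ‖gnsClass τ b‖ := by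
  rw [← hτ.norm_gnsClass_star, star_mul, ← gnsStarAlgHom_gnsClass, ← hτ.norm_gnsClass_star b,
    ← norm_star a]
  exact (ContinuousLinearMap.le_opNorm _ _).trans
    (by gcongr; exact NonUnitalStarAlgHom.norm_apply_le τ.gnsStarAlgHom _)

omit hτ in
/-- Right multiplication by `a` on the GNS space of a tracial state. -/
noncomputable def rightMul (_hτ : IsTracialState τ) (a : A) : τ.GNS →L[ℂ] τ.GNS :=
  (gnsClass τ ∘ₗ LinearMap.mulRight ℂ a).extendOfNorm (gnsClass τ)

theorem rightMul_gnsClass (a b : A) : hτ.rightMul a (gnsClass τ b) = gnsClass τ (b * a) :=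
  LinearMap.extendOfNorm_eq (denseRange_gnsClass τ) ⟨‖a‖, fun b => hτ.norm_gnsClass_mul_le b a⟩ b

theorem rightMul_gnsVector (a : A) : hτ.rightMul a (gnsVector τ) = gnsClass τ a := by
  rw [← gnsClass_one, rightMul_gnsClass, one_mul]

theorem rightMul_gnsStarAlgHom (a b : A) (ξ : τ.GNS) :
    hτ.rightMul a (τ.gnsStarAlgHom b ξ) = τ.gnsStarAlgHom b (hτ.rightMul a ξ) := by
  refine gnsClass_induction (p := fun ξ => hτ.rightMul a (τ.gnsStarAlgHom b ξ) =
    τ.gnsStarAlgHom b (hτ.rightMul a ξ)) ξ (isClosed_eq (by fun_prop) (by fun_prop)) fun c => ?_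
  simp only [gnsStarAlgHom_gnsClass, rightMul_gnsClass, mul_assoc]

theorem inner_rightMul_left (a : A) (ξ η : τ.GNS) :
    ⟪hτ.rightMul a ξ, η⟫_ℂ = ⟪ξ, hτ.rightMul (star a) η⟫_ℂ := by
  refine gnsClass_induction (p := fun ξ => ⟪hτ.rightMul a ξ, η⟫_ℂ =
    ⟪ξ, hτ.rightMul (star a) η⟫_ℂ) ξ (isClosed_eq (by fun_prop) (by fun_prop)) fun b => ?_
  refine gnsClass_induction (p := fun η => ⟪hτ.rightMul a (gnsClass τ b), η⟫_ℂ =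
    ⟪gnsClass τ b, hτ.rightMul (star a) η⟫_ℂ) η
    (isClosed_eq (by fun_prop) (by fun_prop)) fun c => ?_
  rw [rightMul_gnsClass, rightMul_gnsClass, inner_gnsClass, inner_gnsClass, star_mul, mul_assoc,
    hτ.map_mul_comm, mul_assoc]

end IsTracialState

theorem mem_generatedVN {H : Type*} [NormedAddCommGroup H] [InnerProductSpace ℂ H]
    [CompleteSpace H] {S : Set (H →L[ℂ] H)} {T : H →L[ℂ] H} : T ∈ generatedVN S ↔
      ∀ c : H →L[ℂ] H, (∀ s ∈ S, s * c = c * s ∧ star s * c = c * star s) → c * T = T * c := by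
  change T ∈ StarSubalgebra.centralizer ℂ (StarSubalgebra.centralizer ℂ S : Set (H →L[ℂ] H)) ↔ _
  rw [StarSubalgebra.mem_centralizer_iff]
  constructor
  · intro h c hc
    exact (h c (StarSubalgebra.mem_centralizer_iff ℂ |>.2 hc)).1
  · intro h c hc
    exact ⟨h c ((StarSubalgebra.mem_centralizer_iff ℂ).1 hc),
      h (star c) ((StarSubalgebra.mem_centralizer_iff ℂ).1 (star_mem hc))⟩

theorem subset_generatedVN {H : Type*} [NormedAddCommGroup H] [InnerProductSpace ℂ H]
    [CompleteSpace H] {S : Set (H →L[ℂ] H)} {T : H →L[ℂ] H} (hT : T ∈ S) : T ∈ generatedVN S :=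
  mem_generatedVN.2 fun _ hc => ((hc T hT).1).symm

variable (τ) in
/-- The von Neumann algebra on `L²(A, τ)` generated by a *-subalgebra of `A`. -/
noncomputable def vnClosure (B : StarSubalgebra ℂ A) : VonNeumannAlgebra τ.GNS :=
  generatedVN (τ.gnsStarAlgHom '' (B : Set A))

theorem mem_vnClosure {B : StarSubalgebra ℂ A} {T : τ.GNS →L[ℂ] τ.GNS} : T ∈ vnClosure τ B ↔
    ∀ c : τ.GNS →L[ℂ] τ.GNS, (∀ b ∈ B, τ.gnsStarAlgHom b * c = c * τ.gnsStarAlgHom b) →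
      c * T = T * c := by
  rw [vnClosure, mem_generatedVN]
  refine forall_congr' fun c => ⟨fun h hc => h ?_, fun h hc => h fun b hb => ?_⟩
  · rintro _ ⟨b, hb, rfl⟩
    exact ⟨hc b hb, by rw [← map_star]; exact hc _ (star_mem hb)⟩
  · exact (hc _ ⟨b, hb, rfl⟩).1

theorem gnsStarAlgHom_mem_vnClosure {B : StarSubalgebra ℂ A} {b : A} (hb : b ∈ B) :
    τ.gnsStarAlgHom b ∈ vnClosure τ B := subset_generatedVN ⟨b, hb, rfl⟩

theorem commute_starProjection {H : Type*} [NormedAddCommGroup H] [InnerProductSpace ℂ H]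
    [CompleteSpace H] (K : Submodule ℂ H) [K.HasOrthogonalProjection] (T : H →L[ℂ] H)
    (h1 : ∀ ξ ∈ K, T ξ ∈ K) (h2 : ∀ ξ ∈ K, star T ξ ∈ K) :
    T * K.starProjection = K.starProjection * T := by
  ext ξ
  change T (K.starProjection ξ) = K.starProjection (T ξ)
  symm
  refine Submodule.eq_starProjection_of_mem_of_inner_eq_zero
    (h1 _ (Submodule.starProjection_apply_mem K ξ)) fun w hw => ?_
  rw [← map_sub, ← ContinuousLinearMap.adjoint_inner_right]
  exact Submodule.starProjection_inner_eq_zero ξ _ (h2 w hw)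

theorem gnsStarAlgHom_mem_closure {B : StarSubalgebra ℂ A} {b : A} (hb : b ∈ B) {ξ : τ.GNS}
    (hξ : ξ ∈ closure (gnsClass τ '' (B : Set A))) :
    τ.gnsStarAlgHom b ξ ∈ closure (gnsClass τ '' (B : Set A)) := by
  refine map_mem_closure (τ.gnsStarAlgHom b).continuous hξ ?_
  rintro _ ⟨c, hc, rfl⟩
  exact ⟨b * c, mul_mem hb hc, (gnsStarAlgHom_gnsClass τ b c).symm⟩

/-- The projection onto the closure of `B Ω` commutes with `B`, hence with its bicommutant; applying
the bicommutant to `Ω` therefore gives nothing beyond this closure. No density theorem is needed. -/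
theorem coe_vnL2_vnClosure (B : StarSubalgebra ℂ A) :
    (vnL2 (vnClosure τ B) (gnsVector τ) : Set τ.GNS) = closure (gnsClass τ '' (B : Set A)) := by
  let K : Submodule ℂ τ.GNS :=
    (B.toSubalgebra.toSubmodule.map (gnsClass τ)).topologicalClosure
  have hK : (K : Set τ.GNS) = closure (gnsClass τ '' (B : Set A)) := rfl
  have : CompleteSpace K := (Submodule.isClosed_topologicalClosure _).completeSpace_coe
  rw [← hK]
  have hΩ : gnsVector τ ∈ K := subset_closure ⟨1, one_mem B, rfl⟩
  have hmem : ∀ b ∈ B, ∀ ξ ∈ K, τ.gnsStarAlgHom b ξ ∈ K := fun b hb ξ hξ =>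
    gnsStarAlgHom_mem_closure hb hξ
  refine Set.Subset.antisymm ?_ ?_
  · refine Submodule.topologicalClosure_minimal _ (Submodule.span_le.2 ?_)
      (Submodule.isClosed_topologicalClosure _)
    rintro _ ⟨T, hT, rfl⟩
    have h := mem_vnClosure.1 hT K.starProjection fun b hb => by
      refine commute_starProjection K _ (hmem b hb) fun ξ hξ => ?_
      rw [← map_star]; exact hmem _ (star_mem hb) ξ hξ
    have h1 : K.starProjection (T (gnsVector τ)) = T (K.starProjection (gnsVector τ)) :=
      congrArg (fun S : τ.GNS →L[ℂ] τ.GNS => S (gnsVector τ)) h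
    rw [Submodule.starProjection_eq_self_iff.2 hΩ] at h1
    exact Submodule.starProjection_eq_self_iff.1 h1
  · refine Submodule.topologicalClosure_mono ?_
    rintro _ ⟨b, hb, rfl⟩
    exact Submodule.subset_span ⟨_, gnsStarAlgHom_mem_vnClosure hb, gnsStarAlgHom_gnsVector τ b⟩

theorem gnsClass_mem_vnL2 {B : StarSubalgebra ℂ A} {b : A} (hb : b ∈ B) :
    gnsClass τ b ∈ vnL2 (vnClosure τ B) (gnsVector τ) := by
  rw [← SetLike.mem_coe, coe_vnL2_vnClosure]
  exact subset_closure ⟨b, hb, rfl⟩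

/-- To prove a closed property of the elements of `L²(B)`, it suffices to consider `B`. -/
theorem vnL2_induction {B : StarSubalgebra ℂ A}
    {p : vnL2 (vnClosure τ B) (gnsVector τ) → Prop} (ξ : vnL2 (vnClosure τ B) (gnsVector τ))
    (hc : IsClosed {ξ | p ξ}) (h : ∀ b (hb : b ∈ B), p ⟨gnsClass τ b, gnsClass_mem_vnL2 hb⟩) :
    p ξ := by
  have hd : Dense {ξ : vnL2 (vnClosure τ B) (gnsVector τ) | ∃ b ∈ B, gnsClass τ b = ξ} := by
    refine Subtype.dense_iff.2 fun x hx => ?_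
    rw [coe_vnL2_vnClosure] at hx
    refine closure_mono ?_ hx
    rintro _ ⟨b, hb, rfl⟩
    exact ⟨⟨_, gnsClass_mem_vnL2 hb⟩, ⟨b, hb, rfl⟩, rfl⟩
  have := hd.closure_eq.symm.subset (Set.mem_univ ξ)
  refine closure_minimal ?_ hc this
  rintro ⟨_, h'⟩ ⟨b, hb, rfl⟩
  exact h b hb

theorem apply_mem_vnL2 {H : Type*} [NormedAddCommGroup H] [InnerProductSpace ℂ H]
    [CompleteSpace H] {M : VonNeumannAlgebra H} {Ω : H} {T : H →L[ℂ] H} (hT : T ∈ M) {ξ : H}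
    (hξ : ξ ∈ vnL2 M Ω) : T ξ ∈ vnL2 M Ω := by
  refine map_mem_closure T.continuous hξ fun η hη => ?_
  refine Submodule.span_induction (p := fun η _ => T η ∈ Submodule.span ℂ {v | ∃ T ∈ M, T Ω = v})
    ?_ ?_ ?_ ?_ hη
  · rintro _ ⟨S, hS, rfl⟩
    exact Submodule.subset_span ⟨T * S, mul_mem hT hS, rfl⟩
  · rw [map_zero]; exact zero_mem _
  · intro x y _ _ hx hy
    rw [map_add]; exact add_mem hx hy
  · intro c x _ hx
    rw [map_smul]; exact Submodule.smul_mem _ c hx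

namespace IsTracialState

variable (hτ : IsTracialState τ)

include hτ

theorem rightMul_apply_vn {B : StarSubalgebra ℂ A} {T : τ.GNS →L[ℂ] τ.GNS}
    (hT : T ∈ vnClosure τ B) (a : A) (ξ : τ.GNS) : hτ.rightMul a (T ξ) = T (hτ.rightMul a ξ) :=
  congrArg (fun S : τ.GNS →L[ℂ] τ.GNS => S ξ) <| mem_vnClosure.1 hT (hτ.rightMul a) fun b _ => by
    ext ξ; exact (hτ.rightMul_gnsStarAlgHom a b ξ).symm

/-- The trace vector is separating. -/
theorem vn_eq_of_apply_gnsVector {B : StarSubalgebra ℂ A} {S T : τ.GNS →L[ℂ] τ.GNS}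
    (hS : S ∈ vnClosure τ B) (hT : T ∈ vnClosure τ B)
    (h : S (gnsVector τ) = T (gnsVector τ)) : S = T := by
  ext ξ
  refine gnsClass_induction (p := fun ξ => S ξ = T ξ) ξ
    (isClosed_eq (by fun_prop) (by fun_prop)) fun a => ?_
  rw [← hτ.rightMul_gnsVector, ← hτ.rightMul_apply_vn hS, ← hτ.rightMul_apply_vn hT, h]

/-- Extends the trace property to one factor in the von Neumann algebra: such a factor commutes with
right multiplications, which create `gnsClass τ a` from the trace vector. -/
theorem inner_gnsVector_vn {B : StarSubalgebra ℂ A} {T : τ.GNS →L[ℂ] τ.GNS}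
    (hT : T ∈ vnClosure τ B) (a : A) : ⟪gnsVector τ, T (gnsClass τ a)⟫_ℂ =
      ⟪gnsVector τ, τ.gnsStarAlgHom a (T (gnsVector τ))⟫_ℂ := by
  have h1 := hτ.inner_rightMul_left (star a) (gnsVector τ) (T (gnsVector τ))
  rw [star_star, hτ.rightMul_gnsVector, ← gnsStarAlgHom_gnsVector, map_star,
    ContinuousLinearMap.star_eq_adjoint, ContinuousLinearMap.adjoint_inner_left] at h1
  rw [h1, hτ.rightMul_apply_vn hT, hτ.rightMul_gnsVector]

end IsTracialState

end Tracial


/-! ### Module frames and the dimension of a module over a tracial von Neumann algebra -/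

section Frames

open scoped InnerProductSpace

variable {A : Type*} [CStarAlgebra A] [PartialOrder A] [StarOrderedRing A] {τ : A →ₚ[ℂ] ℂ}

/-- A family of operators commuting with `B` that together form an isometry from `K` to a direct
sum of copies of `L²(B)`. -/
structure IsModuleFrame (B : StarSubalgebra ℂ A) (K : Submodule ℂ τ.GNS) {J : Type*}
    (c : J → τ.GNS →L[ℂ] τ.GNS) : Prop where
  comm : ∀ j, ∀ b ∈ B, τ.gnsStarAlgHom b * c j = c j * τ.gnsStarAlgHom b
  mem : ∀ j ξ, c j ξ ∈ vnL2 (vnClosure τ B) (gnsVector τ)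
  hasSum : ∀ ξ ∈ K, HasSum (fun j => ‖c j ξ‖ ^ 2) (‖ξ‖ ^ 2)
  eq_zero : ∀ j, ∀ ξ ∈ Kᗮ, c j ξ = 0

theorem comm_star {B : StarSubalgebra ℂ A} {c : τ.GNS →L[ℂ] τ.GNS}
    (hc : ∀ b ∈ B, τ.gnsStarAlgHom b * c = c * τ.gnsStarAlgHom b) :
    ∀ b ∈ B, τ.gnsStarAlgHom b * star c = star c * τ.gnsStarAlgHom b := fun b hb => by
  have h := congrArg star (hc _ (star_mem hb))
  rwa [star_mul, star_mul, ← map_star, star_star, eq_comm] at h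

theorem inner_star_apply (c : τ.GNS →L[ℂ] τ.GNS) (ξ η : τ.GNS) : ⟪star c ξ, η⟫_ℂ = ⟪ξ, c η⟫_ℂ := by
  rw [ContinuousLinearMap.star_eq_adjoint, ContinuousLinearMap.adjoint_inner_left]

theorem gnsVector_mem_vnL2 (B : StarSubalgebra ℂ A) :
    gnsVector τ ∈ vnL2 (vnClosure τ B) (gnsVector τ) := gnsClass_mem_vnL2 (one_mem B)

namespace IsTracialState

variable (hτ : IsTracialState τ)

include hτ

/-- Against a vector `b Ω` with `b ∈ B`, moving `w` and then `b` across gives `⟨star w Ω, b Ω⟩ =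
⟨star b Ω, w Ω⟩`, and `star b Ω` has the norm of `b Ω`. By density the resulting bound applies to
`star w Ω` itself. This is traciality of the vector state on operators commuting with `B`. -/
theorem norm_star_apply_le {B : StarSubalgebra ℂ A} {w : τ.GNS →L[ℂ] τ.GNS}
    (hw : ∀ b ∈ B, τ.gnsStarAlgHom b * w = w * τ.gnsStarAlgHom b)
    (hmem : star w (gnsVector τ) ∈ vnL2 (vnClosure τ B) (gnsVector τ)) :
    ‖star w (gnsVector τ)‖ ≤ ‖w (gnsVector τ)‖ := by
  have key := vnL2_induction (p := fun ξ : vnL2 (vnClosure τ B) (gnsVector τ) =>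
    ‖⟪star w (gnsVector τ), (ξ : τ.GNS)⟫_ℂ‖ ≤ ‖w (gnsVector τ)‖ * ‖ξ‖)
    ⟨_, hmem⟩ (isClosed_le (by fun_prop) (by fun_prop)) fun b hb => by
      have h1 : w (τ.gnsStarAlgHom b (gnsVector τ)) = τ.gnsStarAlgHom b (w (gnsVector τ)) :=
        congrArg (fun S : τ.GNS →L[ℂ] τ.GNS => S (gnsVector τ)) (hw b hb).symm
      change ‖⟪_, gnsClass τ b⟫_ℂ‖ ≤ _ * ‖gnsClass τ b‖
      rw [inner_star_apply, ← gnsStarAlgHom_gnsVector, h1, ← inner_star_apply, ← map_star,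
        gnsStarAlgHom_gnsVector, gnsStarAlgHom_gnsVector, ← hτ.norm_gnsClass_star b, mul_comm]
      exact norm_inner_le_norm _ _
  change ‖⟪_, star w (gnsVector τ)⟫_ℂ‖ ≤ _ * ‖star w (gnsVector τ)‖ at key
  rw [inner_self_eq_norm_sq_to_K, norm_pow, RCLike.norm_ofReal, abs_norm, sq] at key
  rcases (norm_nonneg (star w (gnsVector τ))).eq_or_lt with h | h
  · rw [← h]; exact norm_nonneg _
  · exact le_of_mul_le_mul_right key h

theorem norm_star_apply {B : StarSubalgebra ℂ A} {w : τ.GNS →L[ℂ] τ.GNS}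
    (hw : ∀ b ∈ B, τ.gnsStarAlgHom b * w = w * τ.gnsStarAlgHom b)
    (h1 : w (gnsVector τ) ∈ vnL2 (vnClosure τ B) (gnsVector τ))
    (h2 : star w (gnsVector τ) ∈ vnL2 (vnClosure τ B) (gnsVector τ)) :
    ‖star w (gnsVector τ)‖ = ‖w (gnsVector τ)‖ := by
  refine le_antisymm (hτ.norm_star_apply_le hw h2) ?_
  have := hτ.norm_star_apply_le (comm_star hw) (by rwa [star_star])
  rwa [star_star] at this

end IsTracialState

namespace IsModuleFrame

variable {B : StarSubalgebra ℂ A} {K : Submodule ℂ τ.GNS} {J J' : Type}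
  {c : J → τ.GNS →L[ℂ] τ.GNS} {d : J' → τ.GNS →L[ℂ] τ.GNS}

theorem star_apply_mem [K.HasOrthogonalProjection] (hc : IsModuleFrame B K c) (j : J)
    (ξ : τ.GNS) : star (c j) ξ ∈ K := by
  rw [← K.orthogonal_orthogonal]
  refine (Submodule.mem_orthogonal' _ _).2 fun η hη => ?_
  rw [inner_star_apply, hc.eq_zero j η hη, inner_zero_right]

/-- Expand each `star (c j) Ω` in the frame `d`, use traciality to replace the norm of `d i (star (c
j) Ω)` by that of `c j (star (d i) Ω)`, and exchange the two sums. Hence the dimension does not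
depend on the frame. -/
theorem tsum_eq [K.HasOrthogonalProjection] (hτ : IsTracialState τ) (hc : IsModuleFrame B K c)
    (hd : IsModuleFrame B K d) :
    ∑' j, ENNReal.ofReal (‖star (c j) (gnsVector τ)‖ ^ 2) =
      ∑' j, ENNReal.ofReal (‖star (d j) (gnsVector τ)‖ ^ 2) := by
  have h1 : ∀ {J J' : Type} {c : J → τ.GNS →L[ℂ] τ.GNS} {d : J' → τ.GNS →L[ℂ] τ.GNS}
      (_ : IsModuleFrame B K c) (_ : IsModuleFrame B K d) (j : J),
      ENNReal.ofReal (‖star (c j) (gnsVector τ)‖ ^ 2) =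
        ∑' i, ENNReal.ofReal (‖d i (star (c j) (gnsVector τ))‖ ^ 2) := by
    intro J J' c d hc hd j
    have h := hd.hasSum _ (hc.star_apply_mem j (gnsVector τ))
    rw [← h.tsum_eq, ENNReal.ofReal_tsum_of_nonneg (fun _ => by positivity) h.summable]
  have h2 : ∀ i j, ‖d i (star (c j) (gnsVector τ))‖ = ‖c j (star (d i) (gnsVector τ))‖ := by
    intro i j
    have h := hτ.norm_star_apply (B := B) (w := c j * star (d i)) (fun b hb => by
      rw [← mul_assoc, hc.comm j b hb, mul_assoc, comm_star (hd.comm i) b hb, mul_assoc])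
      (hc.mem j _) (by rw [star_mul, star_star]; exact hd.mem i _)
    rw [star_mul, star_star] at h
    exact h
  simp only [h1 hc hd, h1 hd hc, h2]
  exact ENNReal.tsum_comm

/-- Pads a finite frame by zeros to one indexed by `ℕ`, as the ampliation requires. -/
theorem extend (hc : IsModuleFrame B K c) {e : J → J'} (he : Function.Injective e) :
    IsModuleFrame B K (Function.extend e c 0) := by
  have key : ∀ j, (∃ i, j = e i ∧ Function.extend e c 0 j = c i) ∨ Function.extend e c 0 j = 0 := by
    intro j
    by_cases h : ∃ i, e i = j
    · obtain ⟨i, rfl⟩ := h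
      exact Or.inl ⟨i, rfl, he.extend_apply _ _ _⟩
    · exact Or.inr (by rw [Function.extend_apply' _ _ _ h]; rfl)
  refine ⟨fun j b hb => ?_, fun j ξ => ?_, fun ξ hξ => ?_, fun j ξ hξ => ?_⟩
  · rcases key j with ⟨i, _, h⟩ | h <;> rw [h]
    · exact hc.comm i b hb
    · rw [mul_zero, zero_mul]
  · rcases key j with ⟨i, _, h⟩ | h <;> rw [h]
    · exact hc.mem i ξ
    · exact zero_mem _
  · have h := hc.hasSum ξ hξ
    rw [← he.hasSum_iff (f := fun j => ‖Function.extend e c 0 j ξ‖ ^ 2)]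
    · convert h using 2 with j
      simp [he.extend_apply]
    · intro x hx
      rw [Function.extend_apply' _ _ _ hx]
      simp
  · rcases key j with ⟨i, _, h⟩ | h <;> rw [h]
    · exact hc.eq_zero i ξ hξ
    · rfl

theorem apply_vn (hc : IsModuleFrame B K c) (j : J) {T : τ.GNS →L[ℂ] τ.GNS}
    (hT : T ∈ vnClosure τ B) (ξ : τ.GNS) : c j (T ξ) = T (c j ξ) :=
  congrArg (fun S : τ.GNS →L[ℂ] τ.GNS => S ξ) (mem_vnClosure.1 hT (c j) (hc.comm j))

/-- The isometry defined by a frame. -/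
theorem exists_isModuleMap {c : ℕ → τ.GNS →L[ℂ] τ.GNS} (hc : IsModuleFrame B K c) :
    ∃ u : K →ₗᵢ[ℂ] ampliation (vnClosure τ B) (gnsVector τ),
      IsModuleMap (vnClosure τ B) (gnsVector τ) K u ∧
      ∀ ξ i, ((u ξ i : vnL2 (vnClosure τ B) (gnsVector τ)) : τ.GNS) = c i ξ := by
  have hmem : ∀ ξ : K, Memℓp (fun i => (⟨c i ξ, hc.mem i ξ⟩ :
      vnL2 (vnClosure τ B) (gnsVector τ))) 2 := fun ξ => by
    refine memℓp_gen ?_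
    have := (hc.hasSum ξ ξ.2).summable
    simpa using this
  let u : K →ₗ[ℂ] ampliation (vnClosure τ B) (gnsVector τ) :=
    { toFun := fun ξ => ⟨fun i => ⟨c i ξ, hc.mem i ξ⟩, hmem ξ⟩
      map_add' := fun ξ η => Subtype.ext (funext fun i => Subtype.ext
        (map_add (c i) (ξ : τ.GNS) (η : τ.GNS)))
      map_smul' := fun a ξ => Subtype.ext (funext fun i => Subtype.ext
        (map_smul (c i) a (ξ : τ.GNS))) }
  refine ⟨⟨u, fun ξ => ?_⟩, fun T hT ξ η h i => ?_, fun ξ i => rfl⟩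
  · have h1 := lp.norm_rpow_eq_tsum (p := 2) (by norm_num) (u ξ)
    have h2 := (hc.hasSum ξ ξ.2).tsum_eq
    simp only [ENNReal.toReal_ofNat, Real.rpow_ofNat] at h1
    refine (sq_eq_sq₀ (norm_nonneg _) (norm_nonneg _)).1 ?_
    rw [h1]
    exact h2
  · change c i η = T (c i ξ)
    rw [h]
    exact hc.apply_vn i hT ξ

end IsModuleFrame

theorem exists_coord {K L : Type*} [NormedAddCommGroup K] [NormedSpace ℂ K] [NormedAddCommGroup L]
    [NormedSpace ℂ L] (u : K →ₗᵢ[ℂ] lp (fun _ : ℕ => L) 2) :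
    ∃ p : ℕ → K →L[ℂ] L, ∀ i ζ, p i ζ = u ζ i :=
  ⟨fun i => (lp.evalCLM ℂ (fun _ : ℕ => L) 2 i).comp u.toContinuousLinearMap, fun _ _ => rfl⟩

/-- The frame defined by an isometry of modules. -/
theorem isModuleFrame_of_isModuleMap {B : StarSubalgebra ℂ A} {K : Submodule ℂ τ.GNS}
    [K.HasOrthogonalProjection] (hK : ∀ b ∈ B, ∀ ξ ∈ K, τ.gnsStarAlgHom b ξ ∈ K)
    [CompleteSpace K] {u : K →ₗᵢ[ℂ] ampliation (vnClosure τ B) (gnsVector τ)}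
    (hu : IsModuleMap (vnClosure τ B) (gnsVector τ) K u) :
    ∃ c : ℕ → τ.GNS →L[ℂ] τ.GNS, IsModuleFrame B K c ∧
      ∀ i, ‖star (c i) (gnsVector τ)‖ = ‖ContinuousLinearMap.adjoint u.toContinuousLinearMap
        (lp.single 2 i (traceVector (vnClosure τ B) (gnsVector τ)))‖ := by
  obtain ⟨q, hq⟩ := exists_coord u
  obtain ⟨p, hp⟩ : ∃ p : ℕ → K →L[ℂ] τ.GNS,
      ∀ i ζ, p i ζ = ((u ζ i : vnL2 (vnClosure τ B) (gnsVector τ)) : τ.GNS) :=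
    ⟨fun i => (Submodule.subtypeL _).comp (q i), fun i ζ => congrArg Subtype.val (hq i ζ)⟩
  let c : ℕ → τ.GNS →L[ℂ] τ.GNS := fun i => (p i).comp K.orthogonalProjectionOnto
  have hc : ∀ i ξ, c i ξ = p i (K.orthogonalProjectionOnto ξ) := fun i ξ => rfl
  refine ⟨c, ⟨fun i b hb => ?_, fun i ξ => ?_, fun ξ hξ => ?_, fun i ξ hξ => ?_⟩, fun i => ?_⟩
  · ext ξ
    change τ.gnsStarAlgHom b (p i (K.orthogonalProjectionOnto ξ)) =
      p i (K.orthogonalProjectionOnto (τ.gnsStarAlgHom b ξ))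
    have h1 : (K.orthogonalProjectionOnto (τ.gnsStarAlgHom b ξ) : τ.GNS) =
        τ.gnsStarAlgHom b (K.orthogonalProjectionOnto ξ : τ.GNS) :=
      congrArg (fun S : τ.GNS →L[ℂ] τ.GNS => S ξ) (commute_starProjection K _ (hK b hb)
        fun η hη => by rw [← map_star]; exact hK _ (star_mem hb) η hη).symm
    rw [hp, hp]
    exact (hu _ (gnsStarAlgHom_mem_vnClosure hb) _ _ h1 i).symm
  · rw [hc, hp]; exact Subtype.property _
  · have h1 := lp.hasSum_norm (p := 2) (by norm_num) (u ⟨ξ, hξ⟩)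
    simp only [ENNReal.toReal_ofNat, Real.rpow_ofNat, u.norm_map] at h1
    have h2 : (fun i => ‖c i ξ‖ ^ 2) = fun i => ‖u ⟨ξ, hξ⟩ i‖ ^ 2 := funext fun i => by
      rw [hc, Submodule.orthogonalProjectionOnto_mem_subspace_eq_self (⟨ξ, hξ⟩ : K), hp]
      rfl
    rw [h2]; exact h1
  · rw [hc, Submodule.orthogonalProjectionOnto_apply_of_mem_orthogonal hξ, map_zero]
  · have : star (c i) (gnsVector τ) =
      (ContinuousLinearMap.adjoint u.toContinuousLinearMap
        (lp.single 2 i (traceVector (vnClosure τ B) (gnsVector τ))) : τ.GNS) := by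
      refine ext_inner_right ℂ fun ξ => ?_
      rw [inner_star_apply, hc, hp, ← Submodule.inner_orthogonalProjectionOnto_eq_of_mem_left,
        ContinuousLinearMap.adjoint_inner_left]
      exact (lp.inner_single_left (𝕜 := ℂ) i (traceVector (vnClosure τ B) (gnsVector τ))
        (u (K.orthogonalProjectionOnto ξ))).symm
    rw [this]; rfl

/-- The Murray–von Neumann dimension, computed from a finite frame. -/
theorem mvnDim_eq_of_frame (hτ : IsTracialState τ) {B : StarSubalgebra ℂ A}
    {K : Submodule ℂ τ.GNS} [CompleteSpace K]
    (hK : ∀ b ∈ B, ∀ ξ ∈ K, τ.gnsStarAlgHom b ξ ∈ K) {J : Type} [Fintype J]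
    {c : J → τ.GNS →L[ℂ] τ.GNS} (hc : IsModuleFrame B K c) :
    mvnDim (vnClosure τ B) (gnsVector τ) K =
      ENNReal.ofReal (∑ j, ‖star (c j) (gnsVector τ)‖ ^ 2) := by
  have h0 : ENNReal.ofReal (∑ j, ‖star (c j) (gnsVector τ)‖ ^ 2) =
      ∑' j, ENNReal.ofReal (‖star (c j) (gnsVector τ)‖ ^ 2) := by
    rw [tsum_fintype, ENNReal.ofReal_sum_of_nonneg fun _ _ => by positivity]
  -- The infimum runs over module isometries, on all of which the functional takes the same value;
  -- the padded frame shows that there is at least one.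
  have key : ∀ u : K →ₗᵢ[ℂ] ampliation (vnClosure τ B) (gnsVector τ),
      IsModuleMap (vnClosure τ B) (gnsVector τ) K u →
      ∑' i : ℕ, ENNReal.ofReal (‖ContinuousLinearMap.adjoint u.toContinuousLinearMap
        (lp.single 2 i (traceVector (vnClosure τ B) (gnsVector τ)))‖ ^ 2) =
      ENNReal.ofReal (∑ j, ‖star (c j) (gnsVector τ)‖ ^ 2) := fun u hu => by
    obtain ⟨d, hd, h⟩ := isModuleFrame_of_isModuleMap hK hu
    rw [h0, ← hd.tsum_eq hτ hc]
    simp only [h]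
  have he : Function.Injective fun j : J => (Fintype.equivFin J j : ℕ) :=
    Fin.val_injective.comp (Fintype.equivFin J).injective
  obtain ⟨u, hu, _⟩ := (hc.extend he).exists_isModuleMap
  refine le_antisymm ?_ ?_
  · exact (iInf₂_le u hu).trans (key u hu).le
  · exact le_iInf₂ fun u hu => (key u hu).ge

end Frames


/-! ### Finite bases and Jones indices -/

section IndexBasis

open scoped InnerProductSpace

variable {A : Type*} [CStarAlgebra A] [PartialOrder A] [StarOrderedRing A] {τ : A →ₚ[ℂ] ℂ}

variable (τ) in
/-- A finite basis `m` of `M` as a left `B`-module, whose coordinates are given by the dual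
basis `m'` and the conditional expectation for `τ`, and whose index element is the scalar `c`. -/
structure IsIndexBasis (B M : StarSubalgebra ℂ A) {J : Type} [Fintype J] (m m' : J → A)
    (c : ℝ) : Prop where
  le : B ≤ M
  mem : ∀ j, m j ∈ M
  mem' : ∀ j, m' j ∈ M
  expand : ∀ x ∈ M, ∃ b : J → A, (∀ j, b j ∈ B) ∧
    (∀ j, ∀ y ∈ B, τ (y * x * m' j) = τ (y * b j)) ∧ x = ∑ j, b j * m j
  sum_eq : ∑ j, m' j * m j = (c : ℂ) • (1 : A)

variable (τ) in
/-- `M` has a finite basis over `B` with scalar index `c`. -/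
def HasIndexBasis (B M : StarSubalgebra ℂ A) (c : ℝ) : Prop :=
  ∃ (J : Type) (_ : Fintype J) (m m' : J → A), IsIndexBasis τ B M m m' c

variable (τ) in
/-- `M` has a finite basis over `B` with scalar index `c` that is dual to its adjoint. -/
def HasStarBasis (B M : StarSubalgebra ℂ A) (c : ℝ) : Prop :=
  ∃ (J : Type) (_ : Fintype J) (m : J → A), IsIndexBasis τ B M m (fun j => star (m j)) c

theorem HasStarBasis.hasIndexBasis {B M : StarSubalgebra ℂ A} {c : ℝ} (h : HasStarBasis τ B M c) :
    HasIndexBasis τ B M c := by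
  obtain ⟨J, _, m, hm⟩ := h
  exact ⟨J, inferInstance, m, _, hm⟩

theorem HasStarBasis.refl (B : StarSubalgebra ℂ A) : HasStarBasis τ B B 1 :=
  ⟨Unit, inferInstance, fun _ => 1, le_rfl, fun _ => one_mem B, fun _ => star_mem (one_mem B),
    fun x hx => ⟨fun _ => x, fun _ => hx, fun _ y _ => by simp, by simp⟩, by simp⟩

/-- Bases multiply along a tower: expand over the upper basis, then expand each coefficient over the
lower one. As the lower index element is scalar, it can be pulled out of the middle of the composite
one. -/
theorem IsIndexBasis.mul (hτ : IsTracialState τ) {B M N : StarSubalgebra ℂ A} {c d : ℝ}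
    {J J' : Type} [Fintype J] [Fintype J'] {p p' : J → A} {m m' : J' → A}
    (hp : IsIndexBasis τ B M p p' c) (hm : IsIndexBasis τ M N m m' d) :
    IsIndexBasis τ B N (fun i : J' × J => p i.2 * m i.1) (fun i => m' i.1 * p' i.2)
      (c * d) := by
  refine ⟨hp.le.trans hm.le, fun i => mul_mem (hm.le (hp.mem _)) (hm.mem _),
    fun i => mul_mem (hm.mem' _) (hm.le (hp.mem' _)), fun x hx => ?_, ?_⟩
  · obtain ⟨e, he, he', hx'⟩ := hm.expand x hx
    choose b hb hb' hb'' using fun j => hp.expand (e j) (he j)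
    refine ⟨fun i => b i.1 i.2, fun i => hb _ _, fun i y hy => ?_, ?_⟩
    · rw [← hb' i.1 i.2 y hy, ← mul_assoc, hτ.map_mul_comm, mul_assoc (y),
        hτ.map_mul_comm (y * e i.1), ← mul_assoc, ← mul_assoc, ← mul_assoc,
        he' i.1 (p' i.2 * y) (mul_mem (hp.mem' _) (hp.le hy)), mul_assoc]
    · rw [Fintype.sum_prod_type, hx']
      refine Finset.sum_congr rfl fun j _ => ?_
      rw [hb'' j, Finset.sum_mul]
      simp only [mul_assoc]
  · rw [Fintype.sum_prod_type]
    calc _ = ∑ j', m' j' * (∑ j, p' j * p j) * m j' := by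
          simp only [Finset.mul_sum, Finset.sum_mul, mul_assoc]
      _ = _ := by
          rw [hp.sum_eq]
          simp only [mul_smul_comm, mul_one, smul_mul_assoc]
          rw [← Finset.smul_sum, hm.sum_eq, smul_smul, Complex.ofReal_mul]

theorem HasIndexBasis.trans (hτ : IsTracialState τ) {B M N : StarSubalgebra ℂ A} {c d : ℝ}
    (h1 : HasIndexBasis τ B M c) (h2 : HasIndexBasis τ M N d) :
    HasIndexBasis τ B N (c * d) := by
  obtain ⟨J, _, p, p', hp⟩ := h1
  obtain ⟨J', _, m, m', hm⟩ := h2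
  exact ⟨_, _, _, _, hp.mul hτ hm⟩

theorem HasStarBasis.trans (hτ : IsTracialState τ) {B M N : StarSubalgebra ℂ A} {c d : ℝ}
    (h1 : HasStarBasis τ B M c) (h2 : HasStarBasis τ M N d) :
    HasStarBasis τ B N (c * d) := by
  obtain ⟨J, _, p, hp⟩ := h1
  obtain ⟨J', _, m, hm⟩ := h2
  refine ⟨J' × J, inferInstance, fun i => p i.2 * m i.1, ?_⟩
  simp only [star_mul]
  exact hp.mul hτ hm

theorem HasIndexBasis.map {B M : StarSubalgebra ℂ A} {c : ℝ} (h : HasIndexBasis τ B M c)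
    (α : A →⋆ₐ[ℂ] A) (hα : ∀ a, τ (α a) = τ a) : HasIndexBasis τ (B.map α) (M.map α) c := by
  obtain ⟨J, _, m, m', hm⟩ := h
  refine ⟨J, inferInstance, fun j => α (m j), fun j => α (m' j), StarSubalgebra.map_mono hm.le,
    fun j => ⟨_, hm.mem j, rfl⟩, fun j => ⟨_, hm.mem' j, rfl⟩, ?_, ?_⟩
  · rintro _ ⟨x, hx, rfl⟩
    obtain ⟨b, hb, hb', hx'⟩ := hm.expand x hx
    refine ⟨fun j => α (b j), fun j => ⟨_, hb j, rfl⟩, ?_, ?_⟩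
    · rintro j _ ⟨y, hy, rfl⟩
      change τ (α y * α x * α (m' j)) = τ (α y * α (b j))
      rw [← map_mul, ← map_mul, ← map_mul, hα, hα, hb' j y hy]
    · change α x = _
      conv_lhs => rw [hx']
      simp only [map_sum, map_mul]
  · have := congrArg α hm.sum_eq
    rw [map_smul, map_one, map_sum] at this
    simpa only [map_mul] using this

theorem inner_starProjection_self {H : Type*} [NormedAddCommGroup H] [InnerProductSpace ℂ H]
    (K : Submodule ℂ H) [K.HasOrthogonalProjection] (ξ η : H) :
    ⟪K.starProjection ξ, η⟫_ℂ = ⟪ξ, K.starProjection η⟫_ℂ :=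
  K.inner_starProjection_left_eq_right ξ η

/-- The projection onto `L²(B)`. -/
noncomputable def vnProj (τ : A →ₚ[ℂ] ℂ) (B : StarSubalgebra ℂ A) : τ.GNS →L[ℂ] τ.GNS :=
  (vnL2 (vnClosure τ B) (gnsVector τ)).starProjection

theorem vnProj_comm {B : StarSubalgebra ℂ A} {T : τ.GNS →L[ℂ] τ.GNS}
    (hT : T ∈ vnClosure τ B) : T * vnProj τ B = vnProj τ B * T :=
  commute_starProjection _ T (fun _ hξ => apply_mem_vnL2 hT hξ)
    fun _ hξ => apply_mem_vnL2 (star_mem hT) hξ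

theorem star_vnProj (B : StarSubalgebra ℂ A) : star (vnProj τ B) = vnProj τ B := by
  ext ξ
  refine ext_inner_right ℂ fun η => ?_
  rw [inner_star_apply, vnProj, inner_starProjection_self]

theorem vnProj_mul_self (B : StarSubalgebra ℂ A) : vnProj τ B * vnProj τ B = vnProj τ B := by
  ext ξ
  exact Submodule.starProjection_eq_self_iff.2 (Submodule.starProjection_apply_mem _ ξ)

theorem vnProj_eq_self {B : StarSubalgebra ℂ A} {ξ : τ.GNS}
    (hξ : ξ ∈ vnL2 (vnClosure τ B) (gnsVector τ)) : vnProj τ B ξ = ξ :=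
  Submodule.starProjection_eq_self_iff.2 hξ

theorem vnProj_mem (B : StarSubalgebra ℂ A) (ξ : τ.GNS) :
    vnProj τ B ξ ∈ vnL2 (vnClosure τ B) (gnsVector τ) := Submodule.starProjection_apply_mem _ ξ

theorem vnL2_mono {B M : StarSubalgebra ℂ A} (h : B ≤ M) :
    vnL2 (vnClosure τ B) (gnsVector τ) ≤ vnL2 (vnClosure τ M) (gnsVector τ) := by
  intro ξ hξ
  rw [← SetLike.mem_coe, coe_vnL2_vnClosure] at hξ ⊢
  exact closure_mono (Set.image_mono h) hξ

theorem norm_vnProj_mono {B M : StarSubalgebra ℂ A} (h : B ≤ M) (ξ : τ.GNS) :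
    ‖vnProj τ B ξ‖ ≤ ‖vnProj τ M ξ‖ := by
  have h1 : vnProj τ B ξ = vnProj τ B (vnProj τ M ξ) := by
    refine ext_inner_right ℂ fun η => ?_
    rw [← star_vnProj B, inner_star_apply, inner_star_apply, ← star_vnProj M, inner_star_apply,
      vnProj_eq_self (vnL2_mono h (vnProj_mem B η))]
  rw [h1]
  exact Submodule.norm_starProjection_apply_le _ _

theorem star_rightMul (hτ : IsTracialState τ) (a : A) :
    star (hτ.rightMul a) = hτ.rightMul (star a) := by
  ext ξ
  refine ext_inner_right ℂ fun η => ?_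
  rw [inner_star_apply, hτ.inner_rightMul_left, star_star]

/-- The operator `x ↦ E_B(x a)` from `L²(M)` to `L²(B)`. -/
noncomputable def frameOp (hτ : IsTracialState τ) (B M : StarSubalgebra ℂ A) (a : A) :
    τ.GNS →L[ℂ] τ.GNS := vnProj τ B * hτ.rightMul a * vnProj τ M

variable (hτ : IsTracialState τ)

include hτ

theorem star_frameOp (B M : StarSubalgebra ℂ A) (a : A) :
    star (frameOp hτ B M a) = frameOp hτ M B (star a) := by
  simp only [frameOp, star_mul, star_vnProj, star_rightMul, mul_assoc]

theorem frameOp_mul_vnProj (B M : StarSubalgebra ℂ A) (a : A) :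
    frameOp hτ B M a * vnProj τ M = frameOp hτ B M a := by
  rw [frameOp, mul_assoc, vnProj_mul_self]

theorem frameOp_comm {B M N : StarSubalgebra ℂ A} (hB : vnClosure τ B ≤ vnClosure τ N)
    (hM : vnClosure τ B ≤ vnClosure τ M) (a : A) :
    ∀ b ∈ B, τ.gnsStarAlgHom b * frameOp hτ N M a = frameOp hτ N M a * τ.gnsStarAlgHom b :=
  fun b hb => by
  have hb' := gnsStarAlgHom_mem_vnClosure (τ := τ) hb
  have h1 : τ.gnsStarAlgHom b * hτ.rightMul a = hτ.rightMul a * τ.gnsStarAlgHom b := by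
    ext ξ; exact (hτ.rightMul_gnsStarAlgHom _ _ _).symm
  rw [frameOp, ← mul_assoc, ← mul_assoc, vnProj_comm (hB hb'), mul_assoc (vnProj τ N), h1,
    mul_assoc, mul_assoc, vnProj_comm (hM hb')]
  simp only [mul_assoc]

theorem frameOp_gnsVector {M : StarSubalgebra ℂ A} (B : StarSubalgebra ℂ A) {a : A}
    (ha : a ∈ M) : frameOp hτ M B a (gnsVector τ) = gnsClass τ a := by
  change vnProj τ M (hτ.rightMul a (vnProj τ B (gnsVector τ))) = _
  rw [vnProj_eq_self (gnsVector_mem_vnL2 B), hτ.rightMul_gnsVector,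
    vnProj_eq_self (gnsClass_mem_vnL2 ha)]

theorem vnClosure_mono {B M : StarSubalgebra ℂ A} (h : B ≤ M) : vnClosure τ B ≤ vnClosure τ M :=
  fun _ hT => mem_vnClosure.2 fun c hc => mem_vnClosure.1 hT c fun b hb => hc b (h hb)

namespace IsIndexBasis

variable {B M : StarSubalgebra ℂ A} {J : Type} [Fintype J] {m m' : J → A} {c : ℝ}

/-- The trace condition in `expand` says that `x * m' j` and `b j` have the same inner products with
`B`, so `b j` represents the projection of `x * m' j` onto `L²(B)`. -/
theorem frameOp_gnsClass (hm : IsIndexBasis τ B M m m' c) {x : A} (hx : x ∈ M) :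
    ∃ b : J → A, (∀ j, b j ∈ B) ∧ (∀ j, ∀ y ∈ B, τ (y * x * m' j) = τ (y * b j)) ∧
      x = ∑ j, b j * m j ∧ ∀ j, frameOp hτ B M (m' j) (gnsClass τ x) = gnsClass τ (b j) := by
  obtain ⟨b, hb, hb', hx'⟩ := hm.expand x hx
  refine ⟨b, hb, hb', hx', fun j => ?_⟩
  change vnProj τ B (hτ.rightMul (m' j) (vnProj τ M (gnsClass τ x))) = _
  rw [vnProj_eq_self (gnsClass_mem_vnL2 hx), hτ.rightMul_gnsClass]
  refine Submodule.eq_starProjection_of_mem_of_inner_eq_zero (gnsClass_mem_vnL2 (hb j))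
    fun w hw => ?_
  refine vnL2_induction (p := fun w : vnL2 (vnClosure τ B) (gnsVector τ) =>
    ⟪gnsClass τ (x * m' j) - gnsClass τ (b j), (w : τ.GNS)⟫_ℂ = 0) ⟨w, hw⟩
    (isClosed_eq (by fun_prop) (by fun_prop)) fun y hy => ?_
  change ⟪_, gnsClass τ y⟫_ℂ = 0
  rw [← inner_conj_symm, inner_sub_right, inner_gnsClass, inner_gnsClass, ← mul_assoc,
    hb' j _ (star_mem hy), sub_self, map_zero]

/-- The operator form of the expansion `x = ∑ b j * m j`, first on classes of elements of `M` and
then on `L²(M)` by density. -/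
theorem sum_frameOp_mul (hm : IsIndexBasis τ B M m m' c) :
    ∑ j, frameOp hτ M B (m j) * frameOp hτ B M (m' j) = vnProj τ M := by
  ext ξ
  have h1 : ∀ ξ, (∑ j, frameOp hτ M B (m j) * frameOp hτ B M (m' j)) ξ =
      ∑ j, frameOp hτ M B (m j) (frameOp hτ B M (m' j) (vnProj τ M ξ)) := fun ξ => by
    rw [sum_apply]
    refine Finset.sum_congr rfl fun j _ => ?_
    conv_lhs => rw [← frameOp_mul_vnProj hτ B M]
    rfl
  rw [h1]
  refine vnL2_induction (p := fun η : vnL2 (vnClosure τ M) (gnsVector τ) =>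
    ∑ j, frameOp hτ M B (m j) (frameOp hτ B M (m' j) η) = (η : τ.GNS))
    ⟨_, vnProj_mem M ξ⟩ (isClosed_eq (by fun_prop) (by fun_prop)) fun x hx => ?_
  obtain ⟨b, hb, -, hx', h⟩ := hm.frameOp_gnsClass hτ hx
  change ∑ j, frameOp hτ M B (m j) (frameOp hτ B M (m' j) (gnsClass τ x)) = gnsClass τ x
  conv_rhs => rw [hx', map_sum]
  refine Finset.sum_congr rfl fun j _ => ?_
  rw [h]
  change vnProj τ M (hτ.rightMul (m j) (vnProj τ B (gnsClass τ (b j)))) = _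
  rw [vnProj_eq_self (gnsClass_mem_vnL2 (hb j)), hτ.rightMul_gnsClass,
    vnProj_eq_self (gnsClass_mem_vnL2 (mul_mem (hm.le (hb j)) (hm.mem j)))]

/-- Cauchy–Schwarz in the reconstruction formula shows that the coordinates bound the vector from
below. Adding one to the constant ensures `1 ≤ C`, as required for inverting the frame operator on
the whole space. -/
theorem exists_norm_sq_le (hm : IsIndexBasis τ B M m m' c) : ∃ C : ℝ, 1 ≤ C ∧
    ∀ ξ, ‖vnProj τ M ξ‖ ^ 2 ≤ C * ∑ j, ‖frameOp hτ B M (m' j) ξ‖ ^ 2 := by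
  refine ⟨1 + ∑ j, ‖frameOp hτ M B (m j)‖ ^ 2, le_add_of_nonneg_right (by positivity),
    fun ξ => ?_⟩
  have h1 : ‖vnProj τ M ξ‖ ≤ ∑ j, ‖frameOp hτ M B (m j)‖ * ‖frameOp hτ B M (m' j) ξ‖ := by
    rw [← hm.sum_frameOp_mul hτ, sum_apply]
    exact (norm_sum_le _ _).trans (Finset.sum_le_sum fun j _ =>
      ContinuousLinearMap.le_opNorm (frameOp hτ M B (m j)) (frameOp hτ B M (m' j) ξ))
  calc ‖vnProj τ M ξ‖ ^ 2
      ≤ (∑ j, ‖frameOp hτ M B (m j)‖ * ‖frameOp hτ B M (m' j) ξ‖) ^ 2 :=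
        pow_le_pow_left₀ (norm_nonneg _) h1 2
    _ ≤ (∑ j, ‖frameOp hτ M B (m j)‖ ^ 2) * ∑ j, ‖frameOp hτ B M (m' j) ξ‖ ^ 2 :=
        Finset.sum_mul_sq_le_sq_mul_sq _ _ _
    _ ≤ _ := by
        gcongr
        exact le_add_of_nonneg_left zero_le_one

end IsIndexBasis

theorem vnL2_invariant {B M : StarSubalgebra ℂ A} (h : vnClosure τ B ≤ vnClosure τ M) :
    ∀ b ∈ B, ∀ ξ ∈ vnL2 (vnClosure τ M) (gnsVector τ),
      τ.gnsStarAlgHom b ξ ∈ vnL2 (vnClosure τ M) (gnsVector τ) := fun _ hb _ hξ =>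
  apply_mem_vnL2 (h (gnsStarAlgHom_mem_vnClosure hb)) hξ

omit hτ in
-- With `G = 1 - P + ∑ star (U j) * U j`, the operator `R` is the inverse square root of `G`.
-- Multiplying each `U j` by `R` makes the family isometric on the range of `P`, and `R` commutes
-- with all symmetries of the data.
theorem exists_isometric_family {H : Type*} [NormedAddCommGroup H] [InnerProductSpace ℂ H]
    [CompleteSpace H] {P : H →L[ℂ] H} (hP : star P = P) (hPP : P * P = P) {J : Type*} [Fintype J]
    (U : J → H →L[ℂ] H) (hU : ∀ j, U j * P = U j) {C : ℝ} (hC : 1 ≤ C)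
    (hb : ∀ ξ, ‖P ξ‖ ^ 2 ≤ C * ∑ j, ‖U j ξ‖ ^ 2) :
    ∃ R : H →L[ℂ] H, (∀ T, Commute P T → (∀ j, Commute (star (U j) * U j) T) → Commute R T) ∧
      Commute R P ∧ ∑ j, star (U j * R) * (U j * R) = P := by
  -- The additional member `1 - P` makes the frame operator invertible also off the range of `P`;
  -- being a projection, it contributes just itself to the sum of squares.
  let g : Option J → H →L[ℂ] H := fun o => o.elim (1 - P) U
  have hg0 : star (1 - P) * (1 - P) = 1 - P := by
    rw [star_sub, star_one, hP, mul_sub, mul_one, sub_mul, one_mul, hPP, sub_self, sub_zero]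
  obtain ⟨G, hG⟩ : ∃ G, G = ∑ i, star (g i) * g i := ⟨_, rfl⟩
  have hG' : G = 1 - P + ∑ j, star (U j) * U j := by
    rw [hG, Fintype.sum_option]
    exact congrArg₂ _ hg0 rfl
  have hU' : ∀ j, P * star (U j) = star (U j) := fun j => by
    rw [← hP, ← star_mul, hU]
  have hsum : ∀ ξ, RCLike.re ⟪ξ, (∑ j, star (U j) * U j) ξ⟫_ℂ = ∑ j, ‖U j ξ‖ ^ 2 := fun ξ => by
    rw [sum_apply, inner_sum, map_sum]
    refine Finset.sum_congr rfl fun j _ => ?_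
    rw [← inner_self_eq_norm_sq (𝕜 := ℂ)]
    change RCLike.re ⟪ξ, star (U j) (U j ξ)⟫_ℂ = _
    rw [ContinuousLinearMap.star_eq_adjoint, ContinuousLinearMap.adjoint_inner_right]
  have hPn : ∀ ξ, RCLike.re ⟪ξ, P ξ⟫_ℂ = ‖P ξ‖ ^ 2 := fun ξ => by
    have h : P ξ = star P (P ξ) := by
      rw [hP]; exact congrArg (fun S : H →L[ℂ] H => S ξ) hPP.symm
    rw [← inner_self_eq_norm_sq (𝕜 := ℂ)]
    conv_lhs => rw [h, ContinuousLinearMap.star_eq_adjoint, ContinuousLinearMap.adjoint_inner_right]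
  have hPle : ∀ ξ, ‖P ξ‖ ^ 2 ≤ ‖ξ‖ ^ 2 := fun ξ => by
    have h1 := re_inner_le_norm (𝕜 := ℂ) ξ (P ξ)
    rw [hPn] at h1
    nlinarith [norm_nonneg (P ξ), norm_nonneg ξ]
  -- The lower bound is `C⁻¹`: on the range of `P` by the assumed inequality, and on the complement
  -- by `1 - P`, where `1 ≤ C` is used.
  have hunit : IsUnit G := by
    have hC0 : (0 : ℝ) < C⁻¹ := inv_pos.2 (zero_lt_one.trans_le hC)
    refine CStarAlgebra.isUnit_of_le (C⁻¹ • (1 : H →L[ℂ] H)) ?_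
      (by rw [← Algebra.algebraMap_eq_smul_one]; exact isStrictlyPositive_algebraMap hC0)
    rw [ContinuousLinearMap.le_def]
    refine (ContinuousLinearMap.isPositive_def').2 ⟨?_, fun ξ => ?_⟩
    · refine IsSelfAdjoint.sub ?_ (IsSelfAdjoint.smul (IsSelfAdjoint.all _) (IsSelfAdjoint.one _))
      rw [hG]
      exact isSelfAdjoint_sum _ fun i _ => IsSelfAdjoint.star_mul_self _
    · have h3 : RCLike.re ⟪ξ, (C⁻¹ • (1 : H →L[ℂ] H)) ξ⟫_ℂ = C⁻¹ * ‖ξ‖ ^ 2 := by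
        change RCLike.re ⟪ξ, C⁻¹ • ξ⟫_ℂ = _
        rw [inner_smul_right_eq_smul, RCLike.smul_re, inner_self_eq_norm_sq]
      have h4 : RCLike.re ⟪ξ, (1 : H →L[ℂ] H) ξ⟫_ℂ = ‖ξ‖ ^ 2 := inner_self_eq_norm_sq _
      rw [ContinuousLinearMap.reApplyInnerSelf_apply, inner_re_symm, hG', sub_apply, add_apply,
        sub_apply, inner_sub_right, inner_add_right, inner_sub_right, map_sub, map_add, map_sub,
        hsum, hPn, h3, h4]
      have h5 : C⁻¹ * ‖P ξ‖ ^ 2 ≤ ∑ j, ‖U j ξ‖ ^ 2 := by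
        rw [inv_mul_le_iff₀ (zero_lt_one.trans_le hC)]; exact hb ξ
      have h6 : C⁻¹ ≤ 1 := inv_le_one_of_one_le₀ hC
      nlinarith [hPle ξ]
  rw [hG] at hunit
  obtain ⟨R, hR, hRG, hRc⟩ := exists_selfAdjoint_inv_sqrt Finset.univ g hunit
  rw [← hG] at hRG hRc
  have hcomm : ∀ T, Commute P T → (∀ j, Commute (star (U j) * U j) T) → Commute R T := by
    intro T h1 h2
    refine hRc T ?_
    rw [hG']
    exact (((Commute.one_left T).sub_left h1)).add_left (Commute.sum_left _ _ _ fun j _ => h2 j)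
  have hRP : Commute R P := by
    refine hcomm P (Commute.refl P) fun j => ?_
    change star (U j) * U j * P = P * (star (U j) * U j)
    rw [mul_assoc, hU, ← mul_assoc, hU']
  refine ⟨R, hcomm, hRP, ?_⟩
  have h1 : G * P = ∑ j, star (U j) * U j := by
    rw [hG', add_mul, sub_mul, one_mul, hPP, sub_self, zero_add, Finset.sum_mul]
    exact Finset.sum_congr rfl fun j _ => by rw [mul_assoc, hU]
  calc ∑ j, star (U j * R) * (U j * R) = R * (∑ j, star (U j) * U j) * R := by
        simp only [star_mul, hR, Finset.mul_sum, Finset.sum_mul, mul_assoc]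
    _ = R * G * R * P := by rw [← h1, mul_assoc _ R P, hRP.eq, mul_assoc, mul_assoc, mul_assoc]
    _ = P := by rw [hRG, one_mul]

omit hτ in
theorem isModuleFrame_of_sum_eq {B M : StarSubalgebra ℂ A} {J : Type} [Fintype J]
    {v : J → τ.GNS →L[ℂ] τ.GNS}
    (hv : ∀ j, ∀ b ∈ B, τ.gnsStarAlgHom b * v j = v j * τ.gnsStarAlgHom b)
    (hmem : ∀ j ξ, v j ξ ∈ vnL2 (vnClosure τ B) (gnsVector τ))
    (hvM : ∀ j, v j * vnProj τ M = v j) (hsum : ∑ j, star (v j) * v j = vnProj τ M) :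
    IsModuleFrame B (vnL2 (vnClosure τ M) (gnsVector τ)) v where
  comm := hv
  mem := hmem
  hasSum ξ hξ := by
    have h1 : ∑ j, ‖v j ξ‖ ^ 2 = ‖ξ‖ ^ 2 := by
      have h2 : ∀ j, ‖v j ξ‖ ^ 2 = RCLike.re ⟪ξ, (star (v j) * v j) ξ⟫_ℂ := fun j => by
        rw [← inner_self_eq_norm_sq (𝕜 := ℂ)]
        change _ = RCLike.re ⟪ξ, star (v j) (v j ξ)⟫_ℂ
        rw [ContinuousLinearMap.star_eq_adjoint, ContinuousLinearMap.adjoint_inner_right]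
      simp only [h2]
      rw [← map_sum, ← inner_sum, ← sum_apply, hsum, vnProj_eq_self hξ]
      exact inner_self_eq_norm_sq ξ
    rw [← h1]
    exact hasSum_fintype _
  eq_zero j ξ hξ := by
    rw [← hvM]
    change v j ((vnL2 (vnClosure τ M) (gnsVector τ)).starProjection ξ) = 0
    rw [(Submodule.starProjection_apply_eq_zero_iff _).2 hξ, map_zero]

/-- If `M` has a finite basis over `B` and `B ⊆ P ⊆ M''`, then `L²(M)` has a finite frame
over `P`. -/
theorem IsIndexBasis.exists_frame {B P M : StarSubalgebra ℂ A} {J : Type} [Fintype J]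
    {m m' : J → A} {c : ℝ} (hm : IsIndexBasis τ B M m m' c) (hBP : B ≤ P)
    (hPM : vnClosure τ P ≤ vnClosure τ M) :
    ∃ v : J → τ.GNS →L[ℂ] τ.GNS, IsModuleFrame P (vnL2 (vnClosure τ M) (gnsVector τ)) v ∧
      ∑ j, star (v j) * v j = vnProj τ M := by
  obtain ⟨C, hC, hb⟩ := hm.exists_norm_sq_le hτ
  obtain ⟨R, hR, hRP, hsum⟩ := exists_isometric_family (star_vnProj M) (vnProj_mul_self M)
    (fun j => frameOp hτ P M (m' j)) (fun j => frameOp_mul_vnProj hτ P M (m' j)) hC fun ξ => by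
      -- The coordinates over the intermediate algebra dominate those over `B`, since projecting
      -- onto the larger space `L²(P)` leaves a larger norm.
      refine (hb ξ).trans (mul_le_mul_of_nonneg_left ?_ (zero_le_one.trans hC))
      exact Finset.sum_le_sum fun j _ => pow_le_pow_left₀ (norm_nonneg _)
        (norm_vnProj_mono hBP (hτ.rightMul (m' j) (vnProj τ M ξ))) 2
  refine ⟨fun j => frameOp hτ P M (m' j) * R, isModuleFrame_of_sum_eq (fun j b hb => ?_)
    (fun j ξ => vnProj_mem P _) (fun j => ?_) hsum, hsum⟩
  · have hRb : Commute R (τ.gnsStarAlgHom b) := by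
      refine hR _ (vnProj_comm (hPM (gnsStarAlgHom_mem_vnClosure hb))).symm fun j => ?_
      have h1 := frameOp_comm hτ le_rfl hPM (m' j)
      change _ * _ * _ = _ * (_ * _)
      rw [mul_assoc, ← h1 b hb, ← mul_assoc, ← comm_star h1 b hb, mul_assoc]
    rw [← mul_assoc, frameOp_comm hτ le_rfl hPM _ b hb, mul_assoc, ← hRb.eq, mul_assoc]
  · rw [mul_assoc, hRP.eq, ← mul_assoc, frameOp_mul_vnProj]

/-- Polarization of the norm identity `norm_star_apply`: the vector state is a trace on operators
commuting with `B` that, together with their adjoints, map the trace vector into `L²(B)`. -/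
theorem IsTracialState.inner_comm {B : StarSubalgebra ℂ A} {w w' : τ.GNS →L[ℂ] τ.GNS}
    (hw : ∀ b ∈ B, τ.gnsStarAlgHom b * w = w * τ.gnsStarAlgHom b)
    (hw' : ∀ b ∈ B, τ.gnsStarAlgHom b * w' = w' * τ.gnsStarAlgHom b)
    (h1 : w (gnsVector τ) ∈ vnL2 (vnClosure τ B) (gnsVector τ))
    (h2 : star w (gnsVector τ) ∈ vnL2 (vnClosure τ B) (gnsVector τ))
    (h1' : w' (gnsVector τ) ∈ vnL2 (vnClosure τ B) (gnsVector τ))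
    (h2' : star w' (gnsVector τ) ∈ vnL2 (vnClosure τ B) (gnsVector τ)) :
    ⟪gnsVector τ, w (w' (gnsVector τ))⟫_ℂ = ⟪gnsVector τ, w' (w (gnsVector τ))⟫_ℂ := by
  -- The norm identity is applied to `star w + ζ • w'`, and the unimodular factor `ζ` is moved
  -- across the adjoint. The four fourth roots of unity suffice for polarization.
  have key : ∀ ζ : ℂ, ‖ζ‖ = 1 → ‖star w (gnsVector τ) + ζ • w' (gnsVector τ)‖ =
      ‖star w' (gnsVector τ) + ζ • w (gnsVector τ)‖ := fun ζ hζ => by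
    have h3 : star ζ * ζ = 1 := by
      rw [Complex.star_def, Complex.conj_mul', hζ]; simp
    have h := hτ.norm_star_apply (B := B) (w := star w + ζ • w') (fun b hb => by
        rw [mul_add, add_mul, comm_star hw b hb, mul_smul_comm, smul_mul_assoc, hw' b hb])
      (add_mem h2 (Submodule.smul_mem _ _ h1'))
      (by rw [star_add, star_star, star_smul]; exact add_mem h1 (Submodule.smul_mem _ _ h2'))
    rw [star_add, star_star, star_smul] at h
    change ‖w (gnsVector τ) + star ζ • star w' (gnsVector τ)‖ = _ at h
    refine h.symm.trans ?_
    rw [← one_mul ‖star w' (gnsVector τ) + _‖, ← hζ, ← norm_star ζ, ← norm_smul, smul_add,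
      smul_smul, h3, one_smul, add_comm]
  rw [← inner_star_apply w (gnsVector τ), ← inner_star_apply w' (gnsVector τ), inner_eq_sum_norm_sq_div_four,
    inner_eq_sum_norm_sq_div_four]
  have k1 := key 1 (by simp)
  have k2 := key (-1) (by simp)
  have k3 := key Complex.I (by simp)
  have k4 := key (-Complex.I) (by simp)
  simp only [one_smul, neg_smul, ← sub_eq_add_neg] at k1 k2 k3 k4
  have e : (RCLike.I : ℂ) = Complex.I := rfl
  rw [e, k1, k2, k3, k4]

/-- The dimension of `L²(M)` over `B` is the index of any finite basis. -/
theorem HasIndexBasis.jonesIndex_eq {B M : StarSubalgebra ℂ A} {c : ℝ}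
    (h : HasIndexBasis τ B M c) :
    jonesIndex (vnClosure τ B) (vnClosure τ M) (gnsVector τ) = ENNReal.ofReal c := by
  obtain ⟨J, _, m, m', hm⟩ := h
  have hBM := vnClosure_mono hτ hm.le
  obtain ⟨v, hv, hsum⟩ := hm.exists_frame hτ le_rfl hBM
  rw [jonesIndex, mvnDim_eq_of_frame hτ (vnL2_invariant hτ hBM) hv]
  congr 1
  have hV : ∀ i, vnProj τ M * star (v i) = star (v i) := fun i => by
    ext ξ
    exact vnProj_eq_self (hv.star_apply_mem i ξ)
  -- Both factors map `L²(B)` to itself and commute with `B`, so the vector state is tracial on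
  -- them.
  have h1 : ∀ i j, ⟪gnsVector τ, (frameOp hτ B M (m' j) * star (v i))
      ((v i * frameOp hτ M B (m j)) (gnsVector τ))⟫_ℂ = ⟪gnsVector τ,
        (v i * frameOp hτ M B (m j)) ((frameOp hτ B M (m' j) * star (v i)) (gnsVector τ))⟫_ℂ := by
    intro i j
    refine hτ.inner_comm (B := B) (fun b hb => ?_) (fun b hb => ?_) (vnProj_mem B _) ?_
      (hv.mem i _) ?_
    · rw [← mul_assoc, frameOp_comm hτ le_rfl hBM _ b hb, mul_assoc, comm_star (hv.comm i) b hb,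
        mul_assoc]
    · rw [← mul_assoc, hv.comm i b hb, mul_assoc, frameOp_comm hτ hBM le_rfl _ b hb, mul_assoc]
    · rw [star_mul, star_star]
      exact hv.mem i _
    · rw [star_mul, star_frameOp]
      exact vnProj_mem B _
  have h2 : ∀ j, ⟪gnsVector τ, frameOp hτ B M (m' j)
      (frameOp hτ M B (m j) (gnsVector τ))⟫_ℂ = τ (m' j * m j) := fun j => by
    rw [frameOp_gnsVector hτ B (hm.mem j), ← inner_star_apply, star_frameOp,
      frameOp_gnsVector hτ B (star_mem (hm.mem' j)), inner_gnsClass, star_star]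
  have h3 : ∀ i, ⟪gnsVector τ, v i (star (v i) (gnsVector τ))⟫_ℂ =
      ((‖star (v i) (gnsVector τ)‖ ^ 2 : ℝ) : ℂ) := fun i => by
    rw [← inner_star_apply, inner_self_eq_norm_sq_to_K]
    norm_cast
  -- The trace of the index element is the trace of the products of coordinate operators. Insert `∑
  -- star (v i) * v i = vnProj τ M` in the middle, exchange the factors by traciality, and collapse
  -- the sum over `j` by the reconstruction formula. What remains is the dimension computed from the
  -- frame.
  have h4 : (c : ℂ) = ∑ i, ((‖star (v i) (gnsVector τ)‖ ^ 2 : ℝ) : ℂ) :=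
    calc (c : ℂ) = ∑ j, τ (m' j * m j) := by
          rw [← map_sum, hm.sum_eq, map_smul, hτ.map_one, smul_eq_mul, mul_one]
      _ = ∑ j, ∑ i, ⟪gnsVector τ, (frameOp hτ B M (m' j) * star (v i))
            ((v i * frameOp hτ M B (m j)) (gnsVector τ))⟫_ℂ := by
          refine Finset.sum_congr rfl fun j _ => ?_
          rw [← h2, ← inner_sum]
          conv_lhs => rw [← frameOp_mul_vnProj hτ B M, ← hsum, Finset.mul_sum, sum_apply]
          rfl
      _ = ∑ i, ∑ j, ⟪gnsVector τ, (v i * frameOp hτ M B (m j))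
            ((frameOp hτ B M (m' j) * star (v i)) (gnsVector τ))⟫_ℂ := by
          rw [Finset.sum_comm]
          simp only [h1]
      _ = _ := by
          refine Finset.sum_congr rfl fun i _ => ?_
          rw [← h3, ← inner_sum]
          conv_rhs => rw [← hV i, ← hm.sum_frameOp_mul hτ, Finset.sum_mul, sum_apply, map_sum]
          rfl
  exact_mod_cast h4.symm

theorem IsIndexBasis.sum_norm_sq_apply {B M : StarSubalgebra ℂ A} {J : Type} [Fintype J]
    {m : J → A} {c : ℝ} (hm : IsIndexBasis τ B M m (fun j => star (m j)) c) (ξ : τ.GNS) :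
    ∑ j, ‖τ.gnsStarAlgHom (m j) ξ‖ ^ 2 = c * ‖ξ‖ ^ 2 := by
  have h1 : ∀ j, ‖τ.gnsStarAlgHom (m j) ξ‖ ^ 2 =
      (⟪ξ, τ.gnsStarAlgHom (star (m j) * m j) ξ⟫_ℂ).re := fun j => by
    rw [map_mul, map_star, ← inner_self_eq_norm_sq (𝕜 := ℂ)]
    change _ = (⟪ξ, star (τ.gnsStarAlgHom (m j)) (τ.gnsStarAlgHom (m j) ξ)⟫_ℂ).re
    rw [ContinuousLinearMap.star_eq_adjoint, ContinuousLinearMap.adjoint_inner_right]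
    rfl
  simp only [h1]
  rw [← Complex.re_sum, ← inner_sum, ← sum_apply, ← map_sum, hm.sum_eq, map_smul, map_one]
  change (⟪ξ, (c : ℂ) • ξ⟫_ℂ).re = _
  rw [inner_smul_right, Complex.re_ofReal_mul, ← inner_self_eq_norm_sq (𝕜 := ℂ)]
  rfl

/-- A basis that is dual to its adjoint gives an isometric frame. -/
theorem IsIndexBasis.sum_star_frameOp_mul {B M : StarSubalgebra ℂ A} {J : Type} [Fintype J]
    {m : J → A} {c : ℝ} (hm : IsIndexBasis τ B M m (fun j => star (m j)) c) :
    ∑ j, star (frameOp hτ B M (star (m j))) * frameOp hτ B M (star (m j)) = vnProj τ M := by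
  rw [← hm.sum_frameOp_mul hτ]
  simp only [star_frameOp, star_star]

/-- Multiplicativity of the dimension. -/
theorem IsModuleFrame.comp {B P : StarSubalgebra ℂ A} {K : Submodule ℂ τ.GNS} {J J' : Type}
    [Fintype J] [Fintype J'] {p : J → A} {c : ℝ}
    (hp : IsIndexBasis τ B P p (fun j => star (p j)) c)
    {v : J' → τ.GNS →L[ℂ] τ.GNS} (hv : IsModuleFrame P K v) :
    IsModuleFrame B K fun i : J' × J => frameOp hτ B P (star (p i.2)) * v i.1 where
  comm i b hb := by
    rw [← mul_assoc, frameOp_comm hτ le_rfl (vnClosure_mono hτ hp.le) _ b hb, mul_assoc,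
      hv.comm _ b (hp.le hb), mul_assoc]
  mem i ξ := vnProj_mem B _
  hasSum ξ hξ := by
    have h0 := isModuleFrame_of_sum_eq (fun j => frameOp_comm hτ le_rfl (vnClosure_mono hτ hp.le) _)
      (fun j ξ => vnProj_mem B _) (fun j => frameOp_mul_vnProj hτ B P (star (p j)))
      (hp.sum_star_frameOp_mul hτ)
    have h1 := (hv.hasSum ξ hξ).tsum_eq
    rw [tsum_fintype] at h1
    have h2 : ∑ i : J' × J, ‖(frameOp hτ B P (star (p i.2)) * v i.1) ξ‖ ^ 2 = ‖ξ‖ ^ 2 := by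
      rw [Fintype.sum_prod_type, ← h1]
      refine Finset.sum_congr rfl fun j _ => ?_
      have := (h0.hasSum _ (hv.mem j ξ)).tsum_eq
      rw [tsum_fintype] at this
      exact this
    rw [← h2]
    exact hasSum_fintype _
  eq_zero i ξ hξ := by
    change frameOp hτ B P (star (p i.2)) (v i.1 ξ) = 0
    rw [hv.eq_zero _ ξ hξ, map_zero]

/-- The Jones index of an intermediate algebra. -/
theorem jonesIndex_eq_div {B P M : StarSubalgebra ℂ A} {c d : ℝ} (h1 : HasStarBasis τ B P c)
    (hc : 0 < c) (h2 : HasIndexBasis τ B M d) (hd0 : 0 < d)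
    (hPM : vnClosure τ P ≤ vnClosure τ M) :
    jonesIndex (vnClosure τ P) (vnClosure τ M) (gnsVector τ) = ENNReal.ofReal (d / c) := by
  have hd := h2.jonesIndex_eq hτ
  obtain ⟨J, _, p, hp⟩ := h1
  obtain ⟨J', _, m, m', hm⟩ := h2
  obtain ⟨v, hv, -⟩ := hm.exists_frame hτ hp.le hPM
  have hBM := (vnClosure_mono hτ hp.le).trans hPM
  rw [jonesIndex, mvnDim_eq_of_frame hτ (vnL2_invariant hτ hBM) (IsModuleFrame.comp hτ hp hv)]
    at hd
  rw [jonesIndex, mvnDim_eq_of_frame hτ (vnL2_invariant hτ hPM) hv]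
  -- Each `star (v j)` commutes with `P`, so `p k` can be moved to the outside. The sum over `k`
  -- then gives the scalar `c`; here the dual basis must consist of the adjoints.
  have h3 : ∑ i : J' × J, ‖star (frameOp hτ B P (star (p i.2)) * v i.1) (gnsVector τ)‖ ^ 2 =
      c * ∑ j, ‖star (v j) (gnsVector τ)‖ ^ 2 := by
    rw [Fintype.sum_prod_type, Finset.mul_sum]
    refine Finset.sum_congr rfl fun j _ => ?_
    rw [← hp.sum_norm_sq_apply hτ]
    refine Finset.sum_congr rfl fun k _ => ?_
    rw [star_mul, star_frameOp, star_star]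
    change ‖star (v j) (frameOp hτ P B (p k) (gnsVector τ))‖ ^ 2 = _
    rw [frameOp_gnsVector hτ B (hp.mem k), ← gnsStarAlgHom_gnsVector]
    have := congrArg (fun S : τ.GNS →L[ℂ] τ.GNS => S (gnsVector τ))
      (comm_star (hv.comm j) _ (hp.mem k))
    exact congrArg (fun x : τ.GNS => ‖x‖ ^ 2) this.symm
  rw [h3, ENNReal.ofReal_eq_ofReal_iff (by positivity) hd0.le] at hd
  rw [← hd, mul_div_cancel_left₀ _ hc.ne']

end IndexBasis


/-! ### Index bases from partial traces -/

section CatBasis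

variable {D : Type*} [Category D] [Abelian D] [Linear ℂ D] [MonoidalCategory D]
  [MonoidalPreadditive D] [MonoidalLinear ℂ D] [RigidCategory D] [UnitaryFusionCategory D]

/-- `z ↦ 1_U ⊗ z`, for operators on `T ⊗ V`, transported along `U ⊗ T ≅ T'`. -/
def shiftFun {U T T' : D} (V : D) (e : U ⊗ T ≅ T') (z : T ⊗ V ⟶ T ⊗ V) : T' ⊗ V ⟶ T' ⊗ V :=
  conjFun (whiskerRightIso e V) (conjFun (α_ U T V).symm (U ◁ z))

theorem conjFun_comp {A B : D} (e : A ≅ B) (f g : A ⟶ A) :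
    conjFun e (f ≫ g) = conjFun e f ≫ conjFun e g := by simp [conjFun]

theorem conjFun_id {A B : D} (e : A ≅ B) : conjFun e (𝟙 A) = 𝟙 B := by simp [conjFun]

theorem dag_conjFun {A B : D} {e : A ≅ B} (he : IsUnitaryIso e) (f : A ⟶ A) :
    dag (conjFun e f) = conjFun e (dag f) := by
  have h : dag e.hom = e.inv := he
  simp [conjFun, dag_comp, h, isUnitaryIso_inv he]

theorem dag_shiftFun {U T T' : D} (V : D) {e : U ⊗ T ≅ T'} (he : IsUnitaryIso e)
    (z : T ⊗ V ⟶ T ⊗ V) : dag (shiftFun V e z) = shiftFun V e (dag z) := by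
  rw [shiftFun, dag_conjFun (isUnitaryIso_whiskerRightIso he V),
    dag_conjFun (isUnitaryIso_symm (UnitaryFusionCategory.unitary_associator _ _ _)),
    dag_whiskerL, shiftFun]

theorem shiftFun_whiskerRight {U T T' : D} (V : D) (e : U ⊗ T ≅ T') (b : T ⟶ T) :
    shiftFun V e (b ▷ V) = conjFun e (U ◁ b) ▷ V := by
  rw [shiftFun, conjFun_whiskerRight]
  congr 1
  simp [conjFun]

theorem rPart_comp_whiskerRight {T U W : D} (V : D) (f : T ⊗ V ⟶ U ⊗ V) (g : U ⟶ W) :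
    rPart V (sphDual V) (f ≫ g ▷ V) = rPart V (sphDual V) f ≫ g := by
  simp only [rPart, comp_whiskerRight, Category.assoc, dag_rCup_naturality]

theorem rPart_whiskerRight_comp {T U W : D} (V : D) (f : T ⊗ V ⟶ U ⊗ V) (g : W ⟶ T) :
    rPart V (sphDual V) (g ▷ V ≫ f) = g ≫ rPart V (sphDual V) f := by
  simp only [rPart, comp_whiskerRight, Category.assoc]
  rw [← reassoc_of% (rCup_naturality V (sphDual V) g)]

theorem rPart_shiftFun {U T T' : D} (V : D) (e : U ⊗ T ≅ T') (z : T ⊗ V ⟶ T ⊗ V) :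
    rPart V (sphDual V) (shiftFun V e z) = conjFun e (U ◁ rPart V (sphDual V) z) := by
  have h1 : rPart V (sphDual V) (conjFun (α_ U T V).symm (U ◁ z)) =
      U ◁ rPart V (sphDual V) z := by
    have h2 := congrArg dag (rCup_tensor V (sphDual V) U T)
    simp only [dag_comp, dag_whiskerL, dag_whiskerR, dag_associator_inv, Category.assoc] at h2
    rw [rPart, h2, rCup_tensor]
    simp [conjFun, rPart, ← comp_whiskerRight_assoc]
  rw [shiftFun]
  have h3 : ∀ f : (U ⊗ T) ⊗ V ⟶ (U ⊗ T) ⊗ V, conjFun (whiskerRightIso e V) f =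
    e.inv ▷ V ≫ f ≫ e.hom ▷ V := fun f => rfl
  rw [h3, rPart_whiskerRight_comp, rPart_comp_whiskerRight, h1]
  rfl

theorem IsCatBasis.shift {U T T' V : D} {r : ℕ} {m : Fin r → (T ⊗ V ⟶ T ⊗ V)}
    (hm : IsCatBasis T V m) {e : U ⊗ T ≅ T'} (he : IsUnitaryIso e) :
    IsCatBasis T' V fun j => shiftFun V e (m j) :=
  (hm.whiskerLeft U).congr e he

/-- Two increasing unions of algebras of operators, on objects `T k` and `T k ⊗ V`. -/
structure IsCatTower {A : Type*} [CStarAlgebra A] [PartialOrder A] (τ : A →ₚ[ℂ] ℂ)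
    (B M : StarSubalgebra ℂ A) (V : D) (T : ℕ → D)
    (F : ∀ k, (T k ⊗ V ⟶ T k ⊗ V) →ₗ[ℂ] A) : Prop where
  map_comp : ∀ k f g, F k (f ≫ g) = F k g * F k f
  map_id : ∀ k, F k (𝟙 _) = 1
  shift : ∀ k k', k ≤ k' → ∃ (U : D) (e : U ⊗ T k ≅ T k'), IsUnitaryIso e ∧
    ∀ z, F k' (shiftFun V e z) = F k z
  trace : ∀ k, ∃ c : ℂ, ∀ z, τ (F k z) = c * catTr z
  mem : ∀ x, x ∈ M ↔ ∃ k z, x = F k z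
  mem' : ∀ b, b ∈ B ↔ ∃ k z, b = F k (z ▷ V)

/-- Any `x` is moved to a common later stage, where the shifted family is still a basis. Its
coordinates are the partial traces of `dag m ≫ x`, divided by `catDim V`; the index element is
computed at stage `k` already. -/
theorem IsCatTower.isIndexBasis {A : Type*} [CStarAlgebra A] [PartialOrder A]
    {τ : A →ₚ[ℂ] ℂ} {B M : StarSubalgebra ℂ A} {V : D} {T : ℕ → D}
    {F : ∀ k, (T k ⊗ V ⟶ T k ⊗ V) →ₗ[ℂ] A} (h : IsCatTower τ B M V T F) (hV : 𝟙 V ≠ 0) {k : ℕ}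
    {r : ℕ} {m : Fin r → (T k ⊗ V ⟶ T k ⊗ V)} (hm : IsCatBasis (T k) V m) :
    IsIndexBasis τ B M (fun j => F k (m j)) (fun j => F k (dag (m j))) (catDim V ^ 2) := by
  have hd : (catDim V : ℂ) ≠ 0 := by exact_mod_cast (catDim_pos hV).ne'
  refine ⟨fun b hb => ?_, fun j => (h.mem _).2 ⟨k, _, rfl⟩, fun j => (h.mem _).2 ⟨k, _, rfl⟩,
    fun x hx => ?_, ?_⟩
  · obtain ⟨k', z, rfl⟩ := (h.mem' b).1 hb
    exact (h.mem _).2 ⟨k', _, rfl⟩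
  · obtain ⟨k₁, x₁, rfl⟩ := (h.mem x).1 hx
    obtain ⟨U₁, e₁, -, hF₁⟩ := h.shift k₁ (max k k₁) (le_max_right _ _)
    obtain ⟨U₀, e₀, he₀, hF₀⟩ := h.shift k (max k k₁) (le_max_left _ _)
    generalize max k k₁ = k₂ at e₁ e₀ hF₁ hF₀ he₀
    rw [← hF₁]
    generalize shiftFun V e₁ x₁ = x
    have hm₂ := hm.shift he₀
    refine ⟨fun j => F k₂ (((catDim V : ℂ)⁻¹ •
      rPart V (sphDual V) (dag (shiftFun V e₀ (m j)) ≫ x)) ▷ V), fun j => (h.mem' _).2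
        ⟨_, _, rfl⟩, fun j y hy => ?_, ?_⟩ <;> beta_reduce
    -- At a stage containing both operators, `τ` is a multiple of `catTr`. The partial trace over
    -- `V` preserves the trace and is linear over operators of the form `z ▷ V`; the factor `catDim
    -- V` of the loop is cancelled by the normalization.
    · obtain ⟨k', y', rfl⟩ := (h.mem' y).1 hy
      rw [← hF₀ (dag (m j)), ← dag_shiftFun V he₀]
      generalize shiftFun V e₀ (m j) = n
      obtain ⟨U₃, e₃, -, hF₃⟩ := h.shift k₂ (max k₂ k') (le_max_left _ _)
      obtain ⟨U₄, e₄, -, hF₄⟩ := h.shift k' (max k₂ k') (le_max_right _ _)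
      generalize max k₂ k' = k₅ at e₃ e₄ hF₃ hF₄
      rw [mul_assoc, ← h.map_comp, ← hF₄, ← hF₃ (dag n ≫ x), ← hF₃ (_ ▷ V), ← h.map_comp,
        ← h.map_comp]
      obtain ⟨c, hc⟩ := h.trace k₅
      rw [hc, hc, shiftFun_whiskerRight, ← catTr_rPart (sphPairing_isSpherical V),
        rPart_comp_whiskerRight, rPart_shiftFun, MonoidalLinear.smul_whiskerRight,
        show shiftFun V e₃ ((catDim V : ℂ)⁻¹ • rPart V (sphDual V) (dag n ≫ x) ▷ V) =
          (catDim V : ℂ)⁻¹ • shiftFun V e₃ (rPart V (sphDual V) (dag n ≫ x) ▷ V) by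
          simp [shiftFun, conjFun], shiftFun_whiskerRight, Linear.smul_comp, catTr_smul,
        ← comp_whiskerRight, catTr_whiskerRight, inv_mul_cancel_left₀ hd]
    · have h1 := congrArg (F k₂) (hm₂.reconstruct x)
      rw [map_smul, map_sum] at h1
      rw [← inv_smul_smul₀ hd (F k₂ x), ← h1, Finset.smul_sum]
      refine Finset.sum_congr rfl fun j _ => ?_
      rw [h.map_comp, ← hF₀ (m j), MonoidalLinear.smul_whiskerRight, map_smul, smul_mul_assoc]
  · simp only [← h.map_comp]
    rw [← map_sum, hm.sum_comp_dag, map_smul, h.map_id]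

end CatBasis

/-! ### Empty paddings and unitors -/

section PowZero

variable {C : Type*} [Category C] [MonoidalCategory C]

theorem conjFun_rightUnitor {T : C} (w : T ⟶ T) : conjFun (ρ_ T) (w ▷ 𝟙_ C) = w := by
  simp [conjFun]

theorem conjFun_leftUnitor {T : C} (w : T ⟶ T) : conjFun (λ_ T) (𝟙_ C ◁ w) = w := by
  simp [conjFun]

theorem leftUnitor_tensor_of_comp {T T' Z : C} {f : 𝟙_ C ⊗ T ⟶ T'} {g : T' ⟶ T}
    (h : f ≫ g = (λ_ T).hom) :
    ((α_ (𝟙_ C) T Z).inv ≫ f ▷ Z) ≫ g ▷ Z = (λ_ (T ⊗ Z)).hom := by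
  rw [Category.assoc, ← comp_whiskerRight, h]
  simp

theorem conjFun_tensorUnit_left {T Z : C} (w : T ⟶ T) :
    conjFun ((α_ T (𝟙_ C) Z).symm ≪≫ whiskerRightIso (ρ_ T) Z) (w ▷ (𝟙_ C ⊗ Z)) = w ▷ Z := by
  simp [conjFun, ← comp_whiskerRight]

theorem conjFun_leftUnitor_of_comp {T T' : C} {e : 𝟙_ C ⊗ T ≅ T'} {c : T' ≅ T}
    (h : e.hom ≫ c.hom = (λ_ T).hom) (w : T ⟶ T) :
    conjFun e (𝟙_ C ◁ w) = conjFun c.symm w := by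
  have h1 : e = λ_ T ≪≫ c.symm := by
    ext
    simp [← h]
  rw [h1, conjFun_trans, conjFun_leftUnitor]

theorem padR_zero (X : C) {n : ℕ} (w : tensorPow X n ⟶ tensorPow X n) : padR X 0 w = w :=
  conjFun_rightUnitor w

theorem powAdd_zero_left (X : C) (n : ℕ) :
    (powAdd X 0 n).hom ≫ (castPow X (Nat.zero_add n)).hom = (λ_ (tensorPow X n)).hom := by
  induction n with
  | zero =>
    change (ρ_ (𝟙_ C)).hom ≫ 𝟙 _ = (λ_ (𝟙_ C)).hom
    rw [Category.comp_id, unitors_equal]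
  | succ n ih =>
    have h : (castPow X (Nat.zero_add (n + 1))).hom = (castPow X (Nat.zero_add n)).hom ▷ X :=
      (eqToHom_tensorPow_whiskerRight X (Nat.zero_add n)).symm
    rw [h]
    exact leftUnitor_tensor_of_comp ih

theorem padL_zero (X : C) {n : ℕ} (w : tensorPow X n ⟶ tensorPow X n) :
    padL X 0 w = conjFun (castPow X (Nat.zero_add n).symm) w :=
  conjFun_leftUnitor_of_comp (powAdd_zero_left X n) w

theorem conjFun_refl {A : C} (w : A ⟶ A) : conjFun (Iso.refl A) w = w := by simp [conjFun]

theorem castPow_whiskerRight_powAdd (X : C) {a b : ℕ} (h : a = b) (n : ℕ) :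
    (castPow X h).hom ▷ tensorPow X n ≫ (powAdd X b n).hom =
      (powAdd X a n).hom ≫ (castPow X (congrArg (· + n) h)).hom := by
  subst h; simp [castPow]

end PowZero

/-! ### The algebras of operators on half-lines -/

section HalfLine

/-- The *-algebra of the operators localized at sites `≤ x`. -/
def leftAlg {A : Type*} [CStarAlgebra A] [PartialOrder A] [StarOrderedRing A]
    (𝒩 : AbstractSpinChain A) (x : ℤ) : StarSubalgebra ℂ A where
  carrier := leftLocal 𝒩 x
  mul_mem' := by
    rintro a b ⟨I, hI, ha⟩ ⟨J, hJ, hb⟩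
    exact ⟨I ⊔ J, sup_le hI hJ, mul_mem (𝒩.mono le_sup_left ha) (𝒩.mono le_sup_right hb)⟩
  add_mem' := by
    rintro a b ⟨I, hI, ha⟩ ⟨J, hJ, hb⟩
    exact ⟨I ⊔ J, sup_le hI hJ, add_mem (𝒩.mono le_sup_left ha) (𝒩.mono le_sup_right hb)⟩
  algebraMap_mem' c := ⟨⟨(x, x), le_rfl⟩, le_rfl, algebraMap_mem _ c⟩
  star_mem' := by
    rintro a ⟨I, hI, ha⟩
    exact ⟨I, hI, star_mem ha⟩

variable {A : Type*} [CStarAlgebra A] [PartialOrder A] [StarOrderedRing A]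

theorem leftVN_eq (𝒩 : AbstractSpinChain A) (τ : A →ₚ[ℂ] ℂ) (x : ℤ) :
    leftVN 𝒩 τ x = vnClosure τ (leftAlg 𝒩 x) := rfl

theorem leftVNImage_eq (𝒩 : AbstractSpinChain A) (τ : A →ₚ[ℂ] ℂ) (α : A ≃⋆ₐ[ℂ] A) (x : ℤ) :
    leftVNImage 𝒩 τ α x =
      vnClosure τ ((leftAlg 𝒩 x).map (α : A →⋆ₐ[ℂ] A)) := rfl

end HalfLine

/-! ### Half-line algebras of the fusion spin chain -/

section HalfChain

variable {C : Type*} [Category C] [Abelian C] [Linear ℂ C] [MonoidalCategory C]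
  [MonoidalPreadditive C] [MonoidalLinear ℂ C] [RigidCategory C] [UnitaryFusionCategory C]
  {X : C}

theorem siteHom_mem_leftAlg {a x : ℤ} {n : ℕ} (h : a + n ≤ x + 1) (w : End (tensorPow X n)) :
    siteHom X a n w ∈ leftAlg (fusionSpinChain X) x := by
  have h1 := siteHom_extend (X := X) (a := a) (b := min a x) (n := n)
    (m := (x + 1 - min a x).toNat) (min_le_left _ _) (by omega) w
  rw [h1]
  have hlen : intervalLength ⟨(min a x, x), min_le_right _ _⟩ = (x + 1 - min a x).toNat := by
    simp only [intervalLength]; omega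
  refine ⟨⟨(min a x, x), min_le_right _ _⟩, le_rfl, ?_⟩
  change _ ∈ (siteHom X (min a x) (intervalLength ⟨(min a x, x), min_le_right _ _⟩)).range
  rw [hlen]
  exact ⟨_, rfl⟩

theorem mem_leftAlg_iff {x : ℤ} {a : QuasiLocal X} : a ∈ leftAlg (fusionSpinChain X) x ↔
    ∃ (n : ℕ) (w : End (tensorPow X n)), a = siteHom X (x + 1 - n) n w := by
  constructor
  · rintro ⟨I, hI, w, rfl⟩
    have h3 := I.fst_le_snd
    have h4 : (intervalLength I : ℤ) = I.snd - I.fst + 1 := by simp only [intervalLength]; omega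
    exact ⟨(x + 1 - I.fst).toNat, _, siteHom_extend (by omega) (by omega) w⟩
  · rintro ⟨n, w, rfl⟩
    exact siteHom_mem_leftAlg (by omega) w

theorem siteHom_pad_left {x : ℤ} (p n N : ℕ) (h : p + n + 0 = N) (w : End (tensorPow X n)) :
    siteHom X (x - N) N (pad X p 0 h w) = siteHom X (x - n) n w := by
  rw [siteHom_pad]
  congr 2
  omega

theorem padFun_zero_left (X : C) {n q N : ℕ} (h : 0 + n + q = N)
    (w : tensorPow X n ⟶ tensorPow X n) :
    padFun X 0 q h w = conjFun (castPow X (by omega)) (padR X q w) := by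
  rw [padFun_eq, padL_zero, padR_cast, conjFun_castPow_trans]

theorem padFun_zero_right (X : C) {p n N : ℕ} (h : p + n + 0 = N)
    (w : tensorPow X n ⟶ tensorPow X n) :
    padFun X p 0 h w = conjFun (castPow X h) (padL X p w) := by
  rw [padFun_eq, padR_zero]

theorem padR_one (X : C) {n : ℕ} (w : tensorPow X n ⟶ tensorPow X n) : padR X 1 w = w ▷ X :=
  conjFun_tensorUnit_left w

theorem siteHom_whiskerRight (a : ℤ) (n : ℕ) (w : End (tensorPow X n)) :
    siteHom X a n w = siteHom X a (n + 1) (w ▷ X : tensorPow X n ⊗ X ⟶ tensorPow X n ⊗ X) := by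
  have h := siteHom_pad X a 0 1 (by omega : 0 + n + 1 = n + 1) w
  have h1 : pad X 0 1 (by omega : 0 + n + 1 = n + 1) w = padR X 1 w :=
    (padFun_zero_left X _ w).trans (conjFun_refl _)
  rw [h1, padR_one, Nat.cast_zero, add_zero] at h
  exact h.symm

/-- The linear map underlying `siteHom`. -/
noncomputable def siteLin (X : C) (a : ℤ) (n : ℕ) :
    (tensorPow X n ⟶ tensorPow X n) →ₗ[ℂ] QuasiLocal X :=
  (siteHom X a n).toAlgHom.toLinearMap

/-- Passing from `x` to `x + 1` appends one tensor factor `X` on the right. Stage `n` consists of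
the `n + 1` sites ending at `x + 1`, and growth to the left is the shift. -/
theorem isCatTower_chain {k : ℕ} (hk : GeneratesFrom X k) {τ : QuasiLocal X →ₚ[ℂ] ℂ}
    (hτ : IsTracialState τ) (x : ℤ) :
    IsCatTower τ (leftAlg (fusionSpinChain X) x) (leftAlg (fusionSpinChain X) (x + 1)) X
      (tensorPow X) fun n => siteLin X (x + 1 - n) (n + 1) where
  map_comp n f g := 
    map_mul (M := End (tensorPow X (n + 1))) (siteHom X (x + 1 - n) (n + 1)) g f
  map_id n := map_one (siteHom X (x + 1 - n) (n + 1))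
  shift n n' h := by
    obtain ⟨p, rfl⟩ := Nat.exists_eq_add_of_le' h
    refine ⟨tensorPow X p, powAdd X p n, isUnitaryIso_powAdd X p n, fun z => ?_⟩
    have h1 := siteHom_pad_left (X := X) (x := x + 1 + 1) p (n + 1) (p + n + 1) (by omega) z
    have h2 : pad X p 0 (by omega : p + (n + 1) + 0 = p + n + 1) z =
        shiftFun X (powAdd X p n) z :=
      (padFun_zero_right X _ _).trans ((conjFun_refl _).trans (conjFun_trans _ _ _))
    rw [h2] at h1
    have e1 : x + 1 + 1 - ((p + n + 1 : ℕ) : ℤ) = x + 1 - ((p + n : ℕ) : ℤ) := by push_cast; ring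
    have e2 : x + 1 + 1 - ((n + 1 : ℕ) : ℤ) = x + 1 - (n : ℤ) := by push_cast; ring
    rw [e1, e2] at h1
    exact h1
  trace n := by
    refine ⟨((catDim X : ℂ) ^ (n + 1))⁻¹, fun z => ?_⟩
    exact tracialState_siteHom hk hτ _ (n + 1) z
  mem a := by
    rw [mem_leftAlg_iff]
    constructor
    · rintro ⟨n, w, rfl⟩
      refine ⟨n, (pad X 1 0 (by omega : 1 + n + 0 = n + 1) w : End (tensorPow X (n + 1))), ?_⟩
      have h := siteHom_pad X (x + 1 - n) 1 0 (by omega : 1 + n + 0 = n + 1) w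
      rw [show x + 1 - (n : ℤ) + (1 : ℕ) = x + 1 + 1 - n by push_cast; ring] at h
      exact h.symm
    · rintro ⟨n, w, rfl⟩
      refine ⟨n + 1, w, ?_⟩
      rw [show x + 1 + 1 - ((n + 1 : ℕ) : ℤ) = x + 1 - n by push_cast; ring]
      rfl
  mem' a := by
    rw [mem_leftAlg_iff]
    constructor
    · rintro ⟨n, w, rfl⟩
      exact ⟨n, w, siteHom_whiskerRight _ n w⟩
    · rintro ⟨n, w, rfl⟩
      exact ⟨n, w, (siteHom_whiskerRight _ n w).symm⟩

/-- Each added site contributes index `catDim X ^ 2`. A basis exists because `X ^ ⊗ k` already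
contains every simple object. The basis is dual to its adjoint, since `siteHom` respects adjoints.
-/
theorem hasStarBasis_chain {k : ℕ} (hk : GeneratesFrom X k) {τ : QuasiLocal X →ₚ[ℂ] ℂ}
    (hτ : IsTracialState τ) (x : ℤ) (d : ℕ) :
    HasStarBasis τ (leftAlg (fusionSpinChain X) x) (leftAlg (fusionSpinChain X) (x + d))
      (catDim X ^ (2 * d)) := by
  induction d with
  | zero => simpa using HasStarBasis.refl _
  | succ d ih =>
    obtain ⟨r, m, hm⟩ := exists_isCatBasis (W := tensorPow X k) (V := X) fun S hS _ =>
      hk.exists_hom k le_rfl S hS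
    have h := (isCatTower_chain hk hτ (x + d)).isIndexBasis hk.ne_zero hm
    have h' : HasStarBasis τ (leftAlg (fusionSpinChain X) (x + d))
        (leftAlg (fusionSpinChain X) (x + d + 1)) (catDim X ^ 2) := by
      refine ⟨Fin r, inferInstance, fun j => siteHom X (x + d + 1 - k) (k + 1) (m j), ?_⟩
      have h1 : ∀ j, star (siteHom X (x + d + 1 - k) (k + 1) (m j)) =
        siteLin X (x + d + 1 - k) (k + 1) (dag (m j)) := fun j => (map_star _ _).symm
      simp only [h1]
      exact h
    have := ih.trans hτ h'
    rw [← pow_add] at this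
    rw [show x + ((d + 1 : ℕ) : ℤ) = x + d + 1 by push_cast; ring, mul_add_one]
    exact this

end HalfChain


/-! ### The finite index property -/

section FiniteIndex

local notation "⟪" x ", " y "⟫_ℂ" => inner ℂ x y

variable {C : Type*} [Category C] [Abelian C] [Linear ℂ C] [MonoidalCategory C]
  [MonoidalPreadditive C] [MonoidalLinear ℂ C] [RigidCategory C] [UnitaryFusionCategory C]
  {X : C} {k : ℕ} {τ : QuasiLocal X →ₚ[ℂ] ℂ}

theorem eq_zero_of_tracialState_siteHom (hk : GeneratesFrom X k) (hτ : IsTracialState τ) {a : ℤ}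
    {n : ℕ} {w : End (tensorPow X n)}
    (h : τ (star (siteHom X a n w) * siteHom X a n w) = 0) : w = 0 := by
  rw [← map_star, ← map_mul, tracialState_siteHom hk hτ, normTr_apply] at h
  have h0 : ((catDim X : ℂ) ^ n)⁻¹ ≠ 0 :=
    inv_ne_zero (pow_ne_zero _ (by exact_mod_cast (catDim_pos hk.ne_zero).ne'))
  exact eq_zero_of_catTr_comp_dag ((mul_eq_zero.1 h).resolve_left h0)

theorem eq_zero_of_gnsStarAlgHom_siteHom (hk : GeneratesFrom X k) (hτ : IsTracialState τ) {a : ℤ}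
    {n : ℕ} {w : End (tensorPow X n)} (h : τ.gnsStarAlgHom (siteHom X a n w) = 0) : w = 0 := by
  refine eq_zero_of_tracialState_siteHom hk hτ (a := a) ?_
  have h1 : gnsClass τ (siteHom X a n w) = 0 := by
    rw [← gnsStarAlgHom_gnsVector, h, zero_apply]
  have h2 := inner_gnsClass τ (siteHom X a n w) (siteHom X a n w)
  rw [h1, inner_zero_left] at h2
  exact h2.symm

theorem finrank_le_of_injective_vn {H : Type*} [NormedAddCommGroup H] [InnerProductSpace ℂ H]
    [CompleteSpace H] (M : VonNeumannAlgebra H) [FiniteDimensional ℂ M.toStarSubalgebra]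
    {V : Type*} [AddCommGroup V] [Module ℂ V] (f : V →ₗ[ℂ] H →L[ℂ] H)
    (hf : Function.Injective f) (hM : ∀ v, f v ∈ M) :
    Module.finrank ℂ V ≤ Module.finrank ℂ M.toStarSubalgebra := by
  have : FiniteDimensional ℂ (Subalgebra.toSubmodule M.toStarSubalgebra.toSubalgebra) :=
    ‹FiniteDimensional ℂ M.toStarSubalgebra›
  exact LinearMap.finrank_le_finrank_of_injective
    (f := f.codRestrict (Subalgebra.toSubmodule M.toStarSubalgebra.toSubalgebra) hM)
    ((LinearMap.injective_codRestrict_iff _).2 hf)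

theorem not_finiteDimensional_leftVN (hk : GeneratesFrom X k) (hX : IsEmpty (X ≅ 𝟙_ C))
    (hτ : IsTracialState τ) (x : ℤ) :
    ¬ FiniteDimensional ℂ (leftVN (fusionSpinChain X) τ x).toStarSubalgebra := by
  rw [leftVN_eq]
  intro hfin
  obtain ⟨n, hn⟩ := exists_le_finrank_end hk hX
    (Module.finrank ℂ (vnClosure τ (leftAlg (fusionSpinChain X) x)).toStarSubalgebra + 1)
  have h := finrank_le_of_injective_vn (vnClosure τ (leftAlg (fusionSpinChain X) x))
    ((τ.gnsStarAlgHom : QuasiLocal X →⋆ₐ[ℂ] τ.GNS →L[ℂ] τ.GNS).toAlgHom.toLinearMap ∘ₗ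
      siteLin X (x + 1 - n) n)
    ((injective_iff_map_eq_zero _).2 fun w hw => eq_zero_of_gnsStarAlgHom_siteHom hk hτ hw)
    fun w => gnsStarAlgHom_mem_vnClosure (siteHom_mem_leftAlg (by omega) w)
  omega

theorem inner_add_norm_nonneg {H : Type*} [NormedAddCommGroup H] [InnerProductSpace ℂ H]
    [CompleteSpace H] {h : H →L[ℂ] H} (hsa : IsSelfAdjoint h) (ξ : H) :
    0 ≤ ⟪ξ, (h + (‖h‖ : ℂ) • (1 : H →L[ℂ] H)) ξ⟫_ℂ := by
  have h1 := hsa.neg_algebraMap_norm_le_self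
  rw [ContinuousLinearMap.le_def, sub_neg_eq_add] at h1
  have h2 := h1.inner_nonneg_right ξ
  rw [Algebra.algebraMap_eq_smul_one] at h2
  rwa [Complex.coe_smul]

/-- The functional `a ↦ ⟨Ω, a T Ω⟩` is a positive trace on the half-line algebra. By uniqueness of
trace families it is a multiple of `τ`, so `T Ω` is a multiple of `Ω`, and the trace vector is
separating. -/
theorem eq_smul_one_of_central_of_nonneg (hk : GeneratesFrom X k) (hτ : IsTracialState τ) {x : ℤ}
    {T : τ.GNS →L[ℂ] τ.GNS} (hT : T ∈ vnClosure τ (leftAlg (fusionSpinChain X) x))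
    (hc : ∀ b ∈ leftAlg (fusionSpinChain X) x, τ.gnsStarAlgHom b * T = T * τ.gnsStarAlgHom b)
    (hpos : ∀ ξ, 0 ≤ ⟪ξ, T ξ⟫_ℂ) : ∃ c : ℂ, T = c • (1 : τ.GNS →L[ℂ] τ.GNS) := by
  let f : QuasiLocal X →ₗ[ℂ] ℂ :=
    { toFun := fun a => ⟪gnsVector τ, τ.gnsStarAlgHom a (T (gnsVector τ))⟫_ℂ
      map_add' := fun a b => by rw [map_add, add_apply, inner_add_right]
      map_smul' := fun c a => by rw [map_smul, smul_apply, inner_smul_right]; rfl }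
  have hf : ∀ a, f a = ⟪gnsVector τ, τ.gnsStarAlgHom a (T (gnsVector τ))⟫_ℂ := fun a => rfl
  have hmem : ∀ n (w : End (tensorPow X n)), siteHom X (x + 1 - n) n w ∈
    leftAlg (fusionSpinChain X) x := fun n w => siteHom_mem_leftAlg (by omega) w
  have hTb : ∀ b ∈ leftAlg (fusionSpinChain X) x, ∀ ξ,
      T (τ.gnsStarAlgHom b ξ) = τ.gnsStarAlgHom b (T ξ) := fun b hb ξ =>
    (congrArg (fun S : τ.GNS →L[ℂ] τ.GNS => S ξ) (hc b hb)).symm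
  -- Cyclicity combines the trace property for `a T` and `b` with the fact that `T` commutes with
  -- `b`.
  have hmul : ∀ a ∈ leftAlg (fusionSpinChain X) x, ∀ b ∈ leftAlg (fusionSpinChain X) x,
      f (a * b) = f (b * a) := fun a ha b hb => by
    have h1 := hτ.inner_gnsVector_vn (mul_mem (gnsStarAlgHom_mem_vnClosure ha) hT) b
    rw [hf, hf, map_mul, map_mul]
    refine Eq.trans ?_ h1
    change _ = ⟪gnsVector τ, τ.gnsStarAlgHom a (T (gnsClass τ b))⟫_ℂ
    rw [← gnsStarAlgHom_gnsVector, hTb b hb]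
    rfl
  have hinner : ∀ a ξ η, ⟪τ.gnsStarAlgHom (star a) ξ, η⟫_ℂ = ⟪ξ, τ.gnsStarAlgHom a η⟫_ℂ :=
    fun a ξ η => by rw [map_star, inner_star_apply]
  have ht := isTraceFamily_of_positive (X := X) (x + 1) f
    (fun n v w => hmul _ (hmem n v) _ (hmem n w)) fun n w => by
      rw [hf, map_mul]
      change 0 ≤ ⟪gnsVector τ, τ.gnsStarAlgHom (star _) (τ.gnsStarAlgHom _ (T _))⟫_ℂ
      rw [← hinner, star_star, ← hTb _ (hmem n w)]
      exact hpos _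
  have hval : ∀ b ∈ leftAlg (fusionSpinChain X) x, f b = f 1 * τ b := fun b hb => by
    obtain ⟨n, w, rfl⟩ := mem_leftAlg_iff.1 hb
    have h1 := congrArg (fun g => g w) (ht.eq_smul_normTr hk n)
    have h2 : f (siteHom X (x + 1 - n) n w) =
        f (siteHom X (x + 1 - (0 : ℕ)) 0 (1 : End (tensorPow X 0))) * normTr X n w := h1
    rw [h2, map_one, tracialState_siteHom hk hτ]
  refine ⟨f 1, hτ.vn_eq_of_apply_gnsVector hT ((vnClosure τ _).toStarSubalgebra.smul_mem
    (one_mem (vnClosure τ (leftAlg (fusionSpinChain X) x))) _) ?_⟩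
  change T (gnsVector τ) = f 1 • gnsVector τ
  rw [← sub_eq_zero]
  have hmem' : T (gnsVector τ) - f 1 • gnsVector τ ∈
      vnL2 (vnClosure τ (leftAlg (fusionSpinChain X) x)) (gnsVector τ) :=
    sub_mem (apply_mem_vnL2 hT (gnsVector_mem_vnL2 _)) (Submodule.smul_mem _ _
      (gnsVector_mem_vnL2 _))
  generalize hζ : T (gnsVector τ) - f 1 • gnsVector τ = ζ at hmem'
  -- The difference `T Ω - f(1) Ω` lies in `L²` of the half-line algebra and is orthogonal to a
  -- dense subset of it.
  have key : ∀ b ∈ leftAlg (fusionSpinChain X) x, ⟪gnsClass τ b, ζ⟫_ℂ = 0 := fun b hb => by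
    rw [← hζ, inner_sub_right, inner_smul_right, sub_eq_zero, ← gnsStarAlgHom_gnsVector,
      ← star_star b, hinner, hinner, ← hf, hval _ (star_mem hb), gnsStarAlgHom_gnsVector,
      ← gnsClass_one, inner_gnsClass, star_one, one_mul]
  refine inner_self_eq_zero (𝕜 := ℂ).1 ?_
  exact vnL2_induction (p := fun ξ => ⟪(ξ : τ.GNS), ζ⟫_ℂ = 0) ⟨ζ, hmem'⟩
    (isClosed_eq (by fun_prop) (by fun_prop)) key

theorem isFactor_leftVN (hk : GeneratesFrom X k) (hτ : IsTracialState τ) (x : ℤ) :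
    IsFactor (leftVN (fusionSpinChain X) τ x) := by
  rw [leftVN_eq]
  intro z hz' hcomm
  -- A self-adjoint central element becomes positive after adding its norm. The general case follows
  -- from the self-adjoint elements `z + star z` and `i (z - star z)`.
  have hself : ∀ h ∈ vnClosure τ (leftAlg (fusionSpinChain X) x), IsSelfAdjoint h →
      (∀ b ∈ leftAlg (fusionSpinChain X) x, τ.gnsStarAlgHom b * h = h * τ.gnsStarAlgHom b) →
      ∃ c : ℂ, h = c • (1 : τ.GNS →L[ℂ] τ.GNS) := fun h hh hsa hc => by
    have hone := (vnClosure τ (leftAlg (fusionSpinChain X) x)).toStarSubalgebra.smul_mem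
      (one_mem (vnClosure τ (leftAlg (fusionSpinChain X) x))) (‖h‖ : ℂ)
    obtain ⟨c, hc'⟩ := eq_smul_one_of_central_of_nonneg hk hτ (T := h + (‖h‖ : ℂ) • 1)
      (add_mem hh hone) (fun b hb => by
        rw [mul_add, add_mul, hc b hb, mul_smul_comm, smul_mul_assoc, mul_one, one_mul])
      (inner_add_norm_nonneg hsa)
    exact ⟨c - ‖h‖, by rw [sub_smul, ← hc', add_sub_cancel_right]⟩
  have hc1 : ∀ b ∈ leftAlg (fusionSpinChain X) x,
      τ.gnsStarAlgHom b * z = z * τ.gnsStarAlgHom b := fun b hb =>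
    (hcomm _ (gnsStarAlgHom_mem_vnClosure hb)).symm
  have hc2 := comm_star hc1
  have hsm : ∀ (c : ℂ), ∀ T ∈ vnClosure τ (leftAlg (fusionSpinChain X) x),
      c • T ∈ vnClosure τ (leftAlg (fusionSpinChain X) x) := fun c T hT =>
    (vnClosure τ (leftAlg (fusionSpinChain X) x)).toStarSubalgebra.smul_mem hT c
  obtain ⟨c, hc⟩ := hself (z + star z) (add_mem hz' (star_mem hz'))
    (IsSelfAdjoint.add_star_self z) fun b hb => by rw [mul_add, add_mul, hc1 b hb, hc2 b hb]
  obtain ⟨d, hd⟩ := hself (Complex.I • (z - star z)) (hsm _ _ (sub_mem hz' (star_mem hz')))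
    (by
      rw [isSelfAdjoint_iff, star_smul, star_sub, star_star, Complex.star_def, Complex.conj_I,
        neg_smul, ← smul_neg, neg_sub])
    fun b hb => by
      rw [mul_smul_comm, smul_mul_assoc, mul_sub, sub_mul, hc1 b hb, hc2 b hb]
  refine ⟨2⁻¹ * (c - Complex.I * d), ?_⟩
  rw [mul_smul, sub_smul, mul_smul, ← hc, ← hd, smul_smul, Complex.I_mul_I, neg_smul, one_smul,
    sub_neg_eq_add, add_add_sub_cancel, ← two_smul ℂ z, smul_smul]
  norm_num

theorem finiteIndexProperty (hk : GeneratesFrom X k) (hX : IsEmpty (X ≅ 𝟙_ C))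
    (hτ : IsTracialState τ) : FiniteIndexProperty (fusionSpinChain X) τ := fun x =>
  ⟨isFactor_leftVN hk hτ x, not_finiteDimensional_leftVN hk hX hτ x, fun z hz => by
    obtain ⟨d, rfl⟩ := Int.le.dest hz.le
    rw [leftVN_eq, leftVN_eq,
      (hasStarBasis_chain hk hτ x d).hasIndexBasis.jonesIndex_eq hτ]
    exact ENNReal.ofReal_ne_top⟩

end FiniteIndex


/-! ### Operators on blocks -/

section Blocks

variable {D : Type*} [Category D] [MonoidalCategory D]

theorem conjFun_symm {A B : D} (e : A ≅ B) (w : A ⟶ A) : conjFun e.symm (conjFun e w) = w := by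
  simp [conjFun]

theorem conjFun_symm' {A B : D} (e : A ≅ B) (w : B ⟶ B) : conjFun e (conjFun e.symm w) = w := by
  simp [conjFun]

theorem conjFun_tensorIso_whiskerLeft {A B T T' : D} (e : A ≅ B) (f : T ≅ T') (w : T ⟶ T) :
    conjFun (e ⊗ᵢ f) (A ◁ w) = B ◁ conjFun f w := by
  have h : e ⊗ᵢ f = whiskerLeftIso A f ≪≫ whiskerRightIso e T' := by
    ext; exact MonoidalCategory.tensorHom_def' _ _
  rw [h, conjFun_trans, ← conjFun_whiskerLeft, conjFun_whiskerRightIso_whiskerLeft]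

theorem conjFun_tensorIso_whiskerRight {A B T T' : D} (e : A ≅ B) (f : T ≅ T') (w : A ⟶ A) :
    conjFun (e ⊗ᵢ f) (w ▷ T) = conjFun e w ▷ T' := by
  have h : e ⊗ᵢ f = whiskerLeftIso A f ≪≫ whiskerRightIso e T' := by
    ext; exact MonoidalCategory.tensorHom_def' _ _
  rw [h, conjFun_trans, conjFun_whiskerLeftIso_whiskerRight, ← conjFun_whiskerRight]

theorem conjFun_associator_symm_left {A B T : D} (w : T ⟶ T) :
    conjFun (α_ A B T).symm (A ◁ B ◁ w) = (A ⊗ B) ◁ w := by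
  simp [conjFun]

/-- The reassociation in the definition of `regroupIso`. -/
def regroupCoh (Y Z T : D) : Y ⊗ ((T ⊗ (Z ⊗ Y)) ⊗ Z) ≅ (Y ⊗ (T ⊗ Z)) ⊗ (Y ⊗ Z) :=
  monoidalIso _ _

/-- A reassociation. -/
def frontCoh (Y Z T : D) : Y ⊗ (((Z ⊗ Y) ⊗ T) ⊗ Z) ≅ (Y ⊗ Z) ⊗ (Y ⊗ (T ⊗ Z)) :=
  monoidalIso _ _

/-- A reassociation. -/
def halfCoh (Y Z S : D) : (S ⊗ Y) ⊗ (Z ⊗ Y) ≅ (S ⊗ (Y ⊗ Z)) ⊗ Y :=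
  monoidalIso _ _

/-- The operator `1_{Y ⊗ Z} ⊗ 1_Y ⊗ [σ^{⊗ m} ∘ v ∘ (σ⁻¹)^{⊗ m}] ⊗ 1_Z`. -/
def translateFun {Y Z : D} (σ : Y ⊗ Z ≅ Z ⊗ Y) (m : ℕ)
    (v : tensorPow (Y ⊗ Z) m ⟶ tensorPow (Y ⊗ Z) m) :
    tensorPow (Y ⊗ Z) (m + 2) ⟶ tensorPow (Y ⊗ Z) (m + 2) :=
  conjFun (whiskerLeftIso (Y ⊗ Z) (regroupIso Y Z m) ≪≫ frontIso (Y ⊗ Z) (m + 1))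
    ((Y ⊗ Z) ◁ (Y ◁ (conjFun (powIso σ m) v ▷ Z)))

/-- The inductive step with arbitrary objects in place of the tensor powers, so that the coherence
computation involves only generic factors. -/
theorem conjFun_regroup_succ_aux {Y Z T T' R R' : D} (reg : Y ⊗ (T' ⊗ Z) ≅ R)
    (fr : (Y ⊗ Z) ⊗ R ≅ R') (p : T ≅ T') (σ : Y ⊗ Z ≅ Z ⊗ Y) (v : T ⟶ T) :
    conjFun (whiskerLeftIso (Y ⊗ Z) (regroupCoh Y Z T' ≪≫ whiskerRightIso reg (Y ⊗ Z)) ≪≫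
        ((α_ (Y ⊗ Z) R (Y ⊗ Z)).symm ≪≫ whiskerRightIso fr (Y ⊗ Z)))
      ((Y ⊗ Z) ◁ (Y ◁ (conjFun (p ⊗ᵢ σ) (v ▷ (Y ⊗ Z)) ▷ Z))) =
    conjFun (whiskerLeftIso (Y ⊗ Z) reg ≪≫ fr) ((Y ⊗ Z) ◁ (Y ◁ (conjFun p v ▷ Z))) ▷ (Y ⊗ Z) := by
  have h1 : conjFun (regroupCoh Y Z T') (Y ◁ (conjFun p v ▷ (Z ⊗ Y) ▷ Z)) =
      (Y ◁ (conjFun p v ▷ Z)) ▷ (Y ⊗ Z) := by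
    rw [conjFun, Iso.inv_comp_eq]
    simp only [regroupCoh]
    monoidal
  have h2 : ∀ u : R ⟶ R, conjFun (α_ (Y ⊗ Z) R (Y ⊗ Z)).symm ((Y ⊗ Z) ◁ (u ▷ (Y ⊗ Z))) =
    ((Y ⊗ Z) ◁ u) ▷ (Y ⊗ Z) := fun u => by simp [conjFun]
  rw [conjFun_tensorIso_whiskerRight, conjFun_trans, ← conjFun_whiskerLeft,
    conjFun_trans (regroupCoh Y Z T'), h1, conjFun_trans, ← conjFun_whiskerRight, h2, ← conjFun_whiskerRight, conjFun_trans,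
    ← conjFun_whiskerLeft]

/-- Translation is compatible with enlarging the support by a block on the right. With
`translateFun_front`, its counterpart on the left, this makes the translate of a local operator
independent of the chosen support. -/
theorem translateFun_whiskerRight {Y Z : D} (σ : Y ⊗ Z ≅ Z ⊗ Y) (m : ℕ)
    (v : tensorPow (Y ⊗ Z) m ⟶ tensorPow (Y ⊗ Z) m) :
    translateFun σ (m + 1) (v ▷ (Y ⊗ Z)) = translateFun σ m v ▷ (Y ⊗ Z) :=
  conjFun_regroup_succ_aux _ _ _ _ _

theorem frontIso_naturality {V W : D} (σ : V ≅ W) (m : ℕ) :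
    (frontIso V m).hom ≫ (powIso σ (m + 1)).hom =
      (σ.hom ⊗ₘ (powIso σ m).hom) ≫ (frontIso W m).hom := by
  induction m with
  | zero =>
    change ((ρ_ V).hom ≫ (λ_ V).inv) ≫ (𝟙 (𝟙_ D) ⊗ₘ σ.hom) =
      (σ.hom ⊗ₘ 𝟙 (𝟙_ D)) ≫ (ρ_ W).hom ≫ (λ_ W).inv
    simp
  | succ m ih =>
    have aux : ∀ {T T' R R' : D} (p : T ⟶ T') (f : V ⊗ T ⟶ R) (f' : W ⊗ T' ⟶ R') (q : R ⟶ R')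
        (h : f ≫ q = (σ.hom ⊗ₘ p) ≫ f'), ((α_ V T V).inv ≫ f ▷ V) ≫ (q ⊗ₘ σ.hom) =
          (σ.hom ⊗ₘ (p ⊗ₘ σ.hom)) ≫ (α_ W T' W).inv ≫ f' ▷ W := by
      intro T T' R R' p f f' q h
      rw [MonoidalCategory.tensorHom_def q, Category.assoc, ← comp_whiskerRight_assoc, h]
      rw [comp_whiskerRight, Category.assoc, ← whisker_exchange, associator_inv_naturality_assoc,
        MonoidalCategory.tensorHom_def (σ.hom ⊗ₘ p), Category.assoc]
    exact aux _ _ _ _ ih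

/-- The regrouping is defined by recursion on the right; this is the corresponding recursion on the
left, where a front factor `Z ⊗ Y` becomes a front block `Y ⊗ Z`. -/
theorem frontIso_regroupIso (Y Z : D) (m : ℕ) :
    Y ◁ ((frontIso (Z ⊗ Y) m).hom ▷ Z) ≫ (regroupIso Y Z (m + 1)).hom =
      (frontCoh Y Z (tensorPow (Z ⊗ Y) m)).hom ≫
      (Y ⊗ Z) ◁ (regroupIso Y Z m).hom ≫ (frontIso (Y ⊗ Z) (m + 1)).hom := by
  induction m with
  | zero =>
    change Y ◁ (((ρ_ (Z ⊗ Y)).hom ≫ (λ_ (Z ⊗ Y)).inv) ▷ Z) ≫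
      (regroupCoh Y Z (𝟙_ D)).hom ≫
        (Y ◁ (λ_ Z).hom ≫ (λ_ (Y ⊗ Z)).inv) ▷ (Y ⊗ Z) =
      (frontCoh Y Z (𝟙_ D)).hom ≫
        (Y ⊗ Z) ◁ (Y ◁ (λ_ Z).hom ≫ (λ_ (Y ⊗ Z)).inv) ≫
        (α_ (Y ⊗ Z) (𝟙_ D) (Y ⊗ Z)).inv ≫ ((ρ_ (Y ⊗ Z)).hom ≫ (λ_ (Y ⊗ Z)).inv) ▷ (Y ⊗ Z)
    simp only [regroupCoh, frontCoh]
    monoidal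
  | succ m ih =>
    have aux : ∀ {T T₁ R R' : D} (fW : (Z ⊗ Y) ⊗ T ⟶ T₁) (reg : Y ⊗ (T ⊗ Z) ⟶ R)
        (reg' : Y ⊗ (T₁ ⊗ Z) ⟶ R') (fr : (Y ⊗ Z) ⊗ R ⟶ R')
        (h : Y ◁ (fW ▷ Z) ≫ reg' = (frontCoh Y Z T).hom ≫ (Y ⊗ Z) ◁ reg ≫ fr),
        Y ◁ (((α_ (Z ⊗ Y) T (Z ⊗ Y)).inv ≫ fW ▷ (Z ⊗ Y)) ▷ Z) ≫
          (regroupCoh Y Z T₁).hom ≫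
            reg' ▷ (Y ⊗ Z) =
        (frontCoh Y Z (T ⊗ (Z ⊗ Y))).hom ≫
          (Y ⊗ Z) ◁ ((regroupCoh Y Z T).hom ≫
            reg ▷ (Y ⊗ Z)) ≫ (α_ (Y ⊗ Z) R (Y ⊗ Z)).inv ≫ fr ▷ (Y ⊗ Z) := by
      intro T T₁ R R' fW reg reg' fr h
      calc _ = (monoidalIso (Y ⊗ (((Z ⊗ Y) ⊗ (T ⊗ (Z ⊗ Y))) ⊗ Z))
            ((Y ⊗ (((Z ⊗ Y) ⊗ T) ⊗ Z)) ⊗ (Y ⊗ Z))).hom ≫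
              (Y ◁ (fW ▷ Z) ≫ reg') ▷ (Y ⊗ Z) := by
              simp only [regroupCoh]; monoidal
        _ = _ := by rw [h]; simp only [frontCoh, regroupCoh]; monoidal
    exact aux _ _ _ _ ih

theorem conjFun_front_regroup_aux {Y Z T T₁ R R' : D} (fW : (Z ⊗ Y) ⊗ T ≅ T₁)
    (reg : Y ⊗ (T ⊗ Z) ≅ R) (reg' : Y ⊗ (T₁ ⊗ Z) ≅ R') (fr : (Y ⊗ Z) ⊗ R ≅ R')
    (h : Y ◁ (fW.hom ▷ Z) ≫ reg'.hom = (frontCoh Y Z T).hom ≫ (Y ⊗ Z) ◁ reg.hom ≫ fr.hom) (v : T ⟶ T) :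
    conjFun reg' (Y ◁ (conjFun fW ((Z ⊗ Y) ◁ v) ▷ Z)) =
      conjFun (whiskerLeftIso (Y ⊗ Z) reg ≪≫ fr) ((Y ⊗ Z) ◁ (Y ◁ (v ▷ Z))) := by
  have h1 : whiskerLeftIso Y (whiskerRightIso fW Z) ≪≫ reg' = frontCoh Y Z T ≪≫
        whiskerLeftIso (Y ⊗ Z) reg ≪≫ fr := Iso.ext h
  rw [conjFun_whiskerRight, conjFun_whiskerLeft, ← conjFun_trans, h1, conjFun_trans]
  congr 1
  rw [conjFun, Iso.inv_comp_eq]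
  simp only [frontCoh]
  monoidal

theorem translateFun_front {Y Z : D} (σ : Y ⊗ Z ≅ Z ⊗ Y) (m : ℕ)
    (v : tensorPow (Y ⊗ Z) m ⟶ tensorPow (Y ⊗ Z) m) :
    translateFun σ (m + 1) (conjFun (frontIso (Y ⊗ Z) m) ((Y ⊗ Z) ◁ v)) =
      conjFun (frontIso (Y ⊗ Z) (m + 2)) ((Y ⊗ Z) ◁ translateFun σ m v) := by
  have h1 : frontIso (Y ⊗ Z) m ≪≫ powIso σ (m + 1) = (σ ⊗ᵢ powIso σ m) ≪≫ frontIso (Z ⊗ Y) m :=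
    Iso.ext (frontIso_naturality σ m)
  rw [translateFun, ← conjFun_trans, h1, conjFun_trans (σ ⊗ᵢ _), conjFun_tensorIso_whiskerLeft,
    conjFun_trans, ← conjFun_whiskerLeft,
    conjFun_front_regroup_aux _ _ _ _ (frontIso_regroupIso Y Z m), translateFun]

/-- The canonical isomorphism `Y ⊗ (Z ⊗ Y) ^ ⊗ m ≅ (Y ⊗ Z) ^ ⊗ m ⊗ Y`. -/
def halfIso (Y Z : D) : ∀ m : ℕ, Y ⊗ tensorPow (Z ⊗ Y) m ≅ tensorPow (Y ⊗ Z) m ⊗ Y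
  | 0 => ρ_ Y ≪≫ (λ_ Y).symm
  | m + 1 => (α_ Y (tensorPow (Z ⊗ Y) m) (Z ⊗ Y)).symm ≪≫ whiskerRightIso (halfIso Y Z m) (Z ⊗ Y) ≪≫
      halfCoh Y Z (tensorPow (Y ⊗ Z) m)

/-- The regrouping never touches the final `Z`: it is `halfIso` tensored with `Z`. Hence a
translated operator acts trivially on that factor. -/
theorem regroupIso_hom (Y Z : D) (m : ℕ) : (regroupIso Y Z m).hom =
    (α_ Y (tensorPow (Z ⊗ Y) m) Z).inv ≫ (halfIso Y Z m).hom ▷ Z ≫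
      (α_ (tensorPow (Y ⊗ Z) m) Y Z).hom := by
  induction m with
  | zero =>
    change Y ◁ (λ_ Z).hom ≫ (λ_ (Y ⊗ Z)).inv =
      (α_ Y (𝟙_ D) Z).inv ≫ ((ρ_ Y).hom ≫ (λ_ Y).inv) ▷ Z ≫ (α_ (𝟙_ D) Y Z).hom
    monoidal
  | succ m ih =>
    have aux : ∀ {T S : D} (reg : Y ⊗ (T ⊗ Z) ⟶ S ⊗ (Y ⊗ Z)) (hf : Y ⊗ T ⟶ S ⊗ Y)
        (h : reg = (α_ Y T Z).inv ≫ hf ▷ Z ≫ (α_ S Y Z).hom),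
        (regroupCoh Y Z T).hom ≫
          reg ▷ (Y ⊗ Z) = (α_ Y (T ⊗ (Z ⊗ Y)) Z).inv ≫ ((α_ Y T (Z ⊗ Y)).inv ≫
            hf ▷ (Z ⊗ Y) ≫ (halfCoh Y Z S).hom) ▷ Z ≫
              (α_ (S ⊗ (Y ⊗ Z)) Y Z).hom := by
      rintro T S _ hf rfl
      simp only [regroupCoh, halfCoh]
      monoidal
    exact aux _ _ ih

/-- Regrouping once with the roles of `Y` and `Z` exchanged and once in the original order amounts
to inserting a whole block in front. This makes every operator on `(Y ⊗ Z) ^ ⊗ m ⊗ Y` reachable by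
translation. -/
theorem regroupIso_halfIso (Y Z : D) (m : ℕ) :
    Y ◁ (regroupIso Z Y m).hom ≫ (halfIso Y Z (m + 1)).hom =
      (α_ Y Z (tensorPow (Y ⊗ Z) m ⊗ Y)).inv ≫ (α_ (Y ⊗ Z) (tensorPow (Y ⊗ Z) m) Y).inv ≫
        (frontIso (Y ⊗ Z) m).hom ▷ Y := by
  induction m with
  | zero =>
    change Y ◁ (Z ◁ (λ_ Y).hom ≫ (λ_ (Z ⊗ Y)).inv) ≫ (α_ Y (𝟙_ D) (Z ⊗ Y)).inv ≫
      ((ρ_ Y).hom ≫ (λ_ Y).inv) ▷ (Z ⊗ Y) ≫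
        (halfCoh Y Z (𝟙_ D)).hom =
      (α_ Y Z (𝟙_ D ⊗ Y)).inv ≫ (α_ (Y ⊗ Z) (𝟙_ D) Y).inv ≫
        ((ρ_ (Y ⊗ Z)).hom ≫ (λ_ (Y ⊗ Z)).inv) ▷ Y
    simp only [halfCoh]
    monoidal
  | succ m ih =>
    have aux : ∀ {S T R : D} (reg : Z ⊗ (S ⊗ Y) ⟶ T) (hf : Y ⊗ T ⟶ R ⊗ Y)
        (fr : (Y ⊗ Z) ⊗ S ⟶ R) (h : Y ◁ reg ≫ hf = (α_ Y Z (S ⊗ Y)).inv ≫ (α_ (Y ⊗ Z) S Y).inv ≫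
          fr ▷ Y),
        Y ◁ ((regroupCoh Z Y S).hom ≫
            reg ▷ (Z ⊗ Y)) ≫ (α_ Y T (Z ⊗ Y)).inv ≫ hf ▷ (Z ⊗ Y) ≫
            (halfCoh Y Z R).hom =
          (α_ Y Z ((S ⊗ (Y ⊗ Z)) ⊗ Y)).inv ≫ (α_ (Y ⊗ Z) (S ⊗ (Y ⊗ Z)) Y).inv ≫
            ((α_ (Y ⊗ Z) S (Y ⊗ Z)).inv ≫ fr ▷ (Y ⊗ Z)) ▷ Y := by
      intro S T R reg hf fr h
      calc _ = (monoidalIso (Y ⊗ (Z ⊗ ((S ⊗ (Y ⊗ Z)) ⊗ Y))) ((Y ⊗ (Z ⊗ (S ⊗ Y))) ⊗ (Z ⊗ Y))).hom ≫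
            (Y ◁ reg ≫ hf) ▷ (Z ⊗ Y) ≫
              (halfCoh Y Z R).hom := by
              simp only [halfCoh, regroupCoh]; monoidal
        _ = _ := by rw [h]; simp only [halfCoh]; monoidal
    exact aux _ _ _ ih

/-- `translateFun` acts only on the left factors. -/
theorem translateFun_eq {Y Z : D} (σ : Y ⊗ Z ≅ Z ⊗ Y) (m : ℕ)
    (v : tensorPow (Y ⊗ Z) m ⟶ tensorPow (Y ⊗ Z) m) :
    translateFun σ m v = conjFun (α_ (tensorPow (Y ⊗ Z) (m + 1)) Y Z)
      (conjFun (whiskerRightIso (frontIso (Y ⊗ Z) m) Y) (conjFun (α_ (Y ⊗ Z) _ Y).symm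
        ((Y ⊗ Z) ◁ conjFun (halfIso Y Z m) (Y ◁ conjFun (powIso σ m) v))) ▷ Z) := by
  have h1 : regroupIso Y Z m = (α_ Y (tensorPow (Z ⊗ Y) m) Z).symm ≪≫
      whiskerRightIso (halfIso Y Z m) Z ≪≫ α_ (tensorPow (Y ⊗ Z) m) Y Z :=
    Iso.ext (regroupIso_hom Y Z m)
  have aux : ∀ {T S S' : D} (hf : Y ⊗ T ≅ S ⊗ Y) (fr : (Y ⊗ Z) ⊗ S ≅ S') (u : T ⟶ T),
      conjFun (whiskerLeftIso (Y ⊗ Z) ((α_ Y T Z).symm ≪≫ whiskerRightIso hf Z ≪≫ α_ S Y Z) ≪≫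
        ((α_ (Y ⊗ Z) S (Y ⊗ Z)).symm ≪≫ whiskerRightIso fr (Y ⊗ Z)))
        ((Y ⊗ Z) ◁ (Y ◁ (u ▷ Z))) = conjFun (α_ S' Y Z) (conjFun (whiskerRightIso fr Y)
          (conjFun (α_ (Y ⊗ Z) S Y).symm ((Y ⊗ Z) ◁ conjFun hf (Y ◁ u))) ▷ Z) := by
    intro T S S' hf fr u
    simp only [conjFun, Iso.trans_hom, Iso.trans_inv, Iso.symm_hom, Iso.symm_inv,
      whiskerLeftIso_hom, whiskerLeftIso_inv, whiskerRightIso_hom, whiskerRightIso_inv]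
    monoidal
  rw [translateFun, h1]
  exact aux _ _ _

theorem conjFun_halfIso_regroupIso (Y Z : D) (m : ℕ)
    (z : tensorPow (Y ⊗ Z) m ⊗ Y ⟶ tensorPow (Y ⊗ Z) m ⊗ Y) :
    conjFun (halfIso Y Z (m + 1)) (Y ◁ conjFun (regroupIso Z Y m) (Z ◁ z)) =
      conjFun (whiskerRightIso (frontIso (Y ⊗ Z) m) Y) (conjFun (α_ (Y ⊗ Z) _ Y).symm
        ((Y ⊗ Z) ◁ z)) := by
  have h1 : whiskerLeftIso Y (regroupIso Z Y m) ≪≫ halfIso Y Z (m + 1) =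
      (α_ Y Z (tensorPow (Y ⊗ Z) m ⊗ Y)).symm ≪≫ (α_ (Y ⊗ Z) (tensorPow (Y ⊗ Z) m) Y).symm ≪≫
        whiskerRightIso (frontIso (Y ⊗ Z) m) Y := Iso.ext (regroupIso_halfIso Y Z m)
  rw [conjFun_whiskerLeft, ← conjFun_trans, h1, conjFun_trans, conjFun_associator_symm_left,
    conjFun_trans]

/-! ### Blocks and functors -/

variable {C : Type*} [Category C] [MonoidalCategory C] (ι : C ⥤ D) [ι.Monoidal]

theorem map_conjFun {A B : C} (e : A ≅ B) (w : A ⟶ A) :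
    ι.map (conjFun e w) = conjFun (ι.mapIso e) (ι.map w) := by
  simp [conjFun]

theorem conjFun_μIso_whiskerLeft {A P : C} (w : P ⟶ P) :
    conjFun (Functor.Monoidal.μIso ι A P).symm (ι.map (A ◁ w)) = ι.obj A ◁ ι.map w := by
  change Functor.LaxMonoidal.μ ι A P ≫ ι.map (A ◁ w) ≫ Functor.OplaxMonoidal.δ ι A P = _
  rw [Functor.Monoidal.map_whiskerLeft]
  simp only [Category.assoc, Functor.Monoidal.μ_δ_assoc, Functor.Monoidal.μ_δ, Category.comp_id]

theorem conjFun_μIso_whiskerRight {A P : C} (w : P ⟶ P) :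
    conjFun (Functor.Monoidal.μIso ι P A).symm (ι.map (w ▷ A)) = ι.map w ▷ ι.obj A := by
  change Functor.LaxMonoidal.μ ι P A ≫ ι.map (w ▷ A) ≫ Functor.OplaxMonoidal.δ ι P A = _
  rw [Functor.Monoidal.map_whiskerRight]
  simp only [Category.assoc, Functor.Monoidal.μ_δ_assoc, Functor.Monoidal.μ_δ, Category.comp_id]

/-- An operator on `m` blocks of `n` sites, as an operator on `(Y ⊗ Z) ^ ⊗ m`. -/
def blockEnd (X : C) (n : ℕ) {Y Z : D} (φ : ι.obj (tensorPow X n) ≅ Y ⊗ Z) (m : ℕ)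
    (w : tensorPow X (n * m) ⟶ tensorPow X (n * m)) :
    tensorPow (Y ⊗ Z) m ⟶ tensorPow (Y ⊗ Z) m :=
  conjFun (blockIso ι X n φ m) (ι.map w)

variable (X : C) (n : ℕ) {Y Z : D} (φ : ι.obj (tensorPow X n) ≅ Y ⊗ Z)

theorem conjFun_block_right_aux {A P PA : C} {T V : D} (p : P ⊗ A ≅ PA) (b : ι.obj P ≅ T)
    (φ : ι.obj A ≅ V) (w : P ⟶ P) :
    conjFun (ι.mapIso p.symm ≪≫ (Functor.Monoidal.μIso ι P A).symm ≪≫ (b ⊗ᵢ φ))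
      (ι.map (conjFun p (w ▷ A))) = conjFun b (ι.map w) ▷ V := by
  rw [conjFun_trans, conjFun_trans, ← map_conjFun, conjFun_symm, conjFun_μIso_whiskerRight,
    conjFun_tensorIso_whiskerRight]

theorem blockEnd_padR (m : ℕ) (w : tensorPow X (n * m) ⟶ tensorPow X (n * m)) :
    blockEnd ι X n φ (m + 1) (padR X n w) = blockEnd ι X n φ m w ▷ (Y ⊗ Z) :=
  conjFun_block_right_aux ι _ _ _ _

theorem block_front_aux {A P PA AP R : C} {T T' V : D} (p : P ⊗ A ≅ PA) (q : A ⊗ P ≅ AP)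
    (r : A ⊗ PA ≅ R) (s : AP ⊗ A ≅ R) (b : ι.obj P ≅ T) (b' : ι.obj AP ≅ T')
    (φ : ι.obj A ≅ V) (f : V ⊗ T ≅ T') (h : ι.map q.hom ≫ b'.hom =
      Functor.OplaxMonoidal.δ ι A P ≫ (φ.hom ⊗ₘ b.hom) ≫ f.hom)
    (hs : q.hom ▷ A ≫ s.hom = (α_ A P A).hom ≫ A ◁ p.hom ≫ r.hom) :
    ι.map r.hom ≫ ι.map s.inv ≫ Functor.OplaxMonoidal.δ ι AP A ≫ (b'.hom ⊗ₘ φ.hom) =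
      Functor.OplaxMonoidal.δ ι A PA ≫ (φ.hom ⊗ₘ (ι.map p.inv ≫
        Functor.OplaxMonoidal.δ ι P A ≫ (b.hom ⊗ₘ φ.hom))) ≫ (α_ V T V).inv ≫ f.hom ▷ V := by
  have h1 : r.hom ≫ s.inv = A ◁ p.inv ≫ (α_ A P A).inv ≫ q.hom ▷ A := by
    rw [Iso.comp_inv_eq, Category.assoc, Category.assoc, hs]
    simp
  rw [← ι.map_comp_assoc, h1]
  have h2 : ι.map q.hom ▷ ι.obj A ≫ (b'.hom ⊗ₘ φ.hom) =
      Functor.OplaxMonoidal.δ ι A P ▷ ι.obj A ≫ ((φ.hom ⊗ₘ b.hom) ⊗ₘ φ.hom) ≫ f.hom ▷ V := by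
    rw [MonoidalCategory.tensorHom_def, ← comp_whiskerRight_assoc, h,
      MonoidalCategory.tensorHom_def (φ.hom ⊗ₘ b.hom)]
    simp only [comp_whiskerRight, Category.assoc]
    rw [whisker_exchange]
  have h3 : (φ.hom ⊗ₘ (ι.map p.inv ≫ Functor.OplaxMonoidal.δ ι P A ≫ (b.hom ⊗ₘ φ.hom))) =
      ι.obj A ◁ ι.map p.inv ≫ ι.obj A ◁ Functor.OplaxMonoidal.δ ι P A ≫
        (φ.hom ⊗ₘ (b.hom ⊗ₘ φ.hom)) := by
    rw [MonoidalCategory.tensorHom_def', MonoidalCategory.tensorHom_def' φ.hom]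
    simp
  rw [h3, ι.map_comp, ι.map_comp, Functor.Monoidal.map_associator_inv]
  simp only [Category.assoc]
  rw [← Functor.OplaxMonoidal.δ_natural_left_assoc, h2, Functor.Monoidal.μ_δ_assoc,
    ← comp_whiskerRight_assoc, Functor.Monoidal.μ_δ, id_whiskerRight, Category.id_comp,
    ← Functor.OplaxMonoidal.δ_natural_right_assoc, associator_inv_naturality_assoc]

/-- The block identification is built by appending blocks on the right; here it is shown to respect
a block added on the left, by induction from associativity of `powAdd` and the monoidal structure of
`ι`. -/
theorem map_powAdd_blockIso (m : ℕ) (h : n + n * m = n * (m + 1)) :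
    ι.map ((powAdd X n (n * m)).hom ≫ (castPow X h).hom) ≫ (blockIso ι X n φ (m + 1)).hom =
      Functor.OplaxMonoidal.δ ι (tensorPow X n) (tensorPow X (n * m)) ≫
        (φ.hom ⊗ₘ (blockIso ι X n φ m).hom) ≫ (frontIso (Y ⊗ Z) m).hom := by
  induction m with
  | zero =>
    have aux : ∀ {A A' : C} {V : D} (φ : ι.obj A ≅ V) (e : 𝟙_ C ⊗ A ≅ A') (c : A ≅ A')
        (_ : e.hom ≫ c.inv = (λ_ A).hom),
        ι.map ((ρ_ A).hom ≫ c.hom) ≫ ι.map e.inv ≫ Functor.OplaxMonoidal.δ ι (𝟙_ C) A ≫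
          ((Functor.Monoidal.εIso ι).inv ⊗ₘ φ.hom) =
        Functor.OplaxMonoidal.δ ι A (𝟙_ C) ≫ (φ.hom ⊗ₘ (Functor.Monoidal.εIso ι).inv) ≫
          (ρ_ V).hom ≫ (λ_ V).inv := by
      intro A A' V φ e c hc
      have h1 : c.hom ≫ e.inv = (λ_ A).inv := by
        rw [← cancel_mono (λ_ A).hom, Iso.inv_hom_id, Category.assoc, ← hc]
        simp
      rw [ι.map_comp, Category.assoc, ← ι.map_comp_assoc c.hom, h1,
        Functor.Monoidal.map_leftUnitor_inv, Functor.Monoidal.map_rightUnitor]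
      simp only [Category.assoc, Functor.Monoidal.εIso_inv, Functor.Monoidal.μ_δ_assoc]
      rw [MonoidalCategory.tensorHom_def (Functor.OplaxMonoidal.η ι), ← comp_whiskerRight_assoc,
        Functor.Monoidal.ε_η, MonoidalCategory.tensorHom_def' φ.hom]
      simp
    exact aux φ (powAdd X 0 n) (castPow X h) (powAdd_zero_left X n)
  | succ m ih =>
    have h' : n + n * m = n * (m + 1) := by ring
    exact block_front_aux ι (powAdd X (n * m) n) (powAdd X n (n * m) ≪≫ castPow X h')
      (powAdd X n (n * (m + 1)) ≪≫ castPow X h) (powAdd X (n * (m + 1)) n)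
      (blockIso ι X n φ m) (blockIso ι X n φ (m + 1)) φ (frontIso (Y ⊗ Z) m) (ih h') (by
        have h1 := congrArg (fun f => f ≫ (castPow X h).hom) (powAdd_assoc X n (n * m) n)
        simp only [Iso.trans_hom, comp_whiskerRight, Category.assoc]
        rw [castPow_whiskerRight_powAdd]
        simp only [Category.assoc, castPow, eqToIso.hom, eqToHom_trans] at h1 ⊢
        exact h1)

theorem blockEnd_padL (m : ℕ) (h : n + n * m = n * (m + 1))
    (w : tensorPow X (n * m) ⟶ tensorPow X (n * m)) :
    blockEnd ι X n φ (m + 1) (conjFun (castPow X h) (padL X n w)) =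
      conjFun (frontIso (Y ⊗ Z) m) ((Y ⊗ Z) ◁ blockEnd ι X n φ m w) := by
  have h1 : ι.mapIso (powAdd X n (n * m) ≪≫ castPow X h) ≪≫ blockIso ι X n φ (m + 1) =
      (Functor.Monoidal.μIso ι (tensorPow X n) (tensorPow X (n * m))).symm ≪≫
        (φ ⊗ᵢ blockIso ι X n φ m) ≪≫ frontIso (Y ⊗ Z) m :=
    Iso.ext (map_powAdd_blockIso ι X n φ m h)
  rw [blockEnd, padL, ← conjFun_trans, map_conjFun, ← conjFun_trans, h1, conjFun_trans,
    conjFun_μIso_whiskerLeft, conjFun_trans, conjFun_tensorIso_whiskerLeft, blockEnd]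


end Blocks


/-! ### Operators on blocks in the quasi-local algebra -/

section BlockOperators

variable {C : Type*} [Category C] [Abelian C] [Linear ℂ C] [MonoidalCategory C]
  [MonoidalPreadditive C] [MonoidalLinear ℂ C] [RigidCategory C] [UnitaryFusionCategory C]
  {D : Type*} [Category D] [Abelian D] [Linear ℂ D] [MonoidalCategory D]
  [MonoidalPreadditive D] [MonoidalLinear ℂ D] [RigidCategory D] [UnitaryFusionCategory D]

theorem conjFun_add {A B : D} (e : A ≅ B) (f g : A ⟶ A) :
    conjFun e (f + g) = conjFun e f + conjFun e g := by simp [conjFun]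

theorem conjFun_smul {A B : D} (e : A ≅ B) (c : ℂ) (f : A ⟶ A) :
    conjFun e (c • f) = c • conjFun e f := by simp [conjFun]

theorem isUnitaryIso_refl (A : D) : IsUnitaryIso (Iso.refl A) := dag_id A

theorem isUnitaryIso_whiskerLeftIso {A B : D} {e : A ≅ B} (he : IsUnitaryIso e) (Z : D) :
    IsUnitaryIso (whiskerLeftIso Z e) := by
  have h : dag e.hom = e.inv := he
  change dag (Z ◁ e.hom) = Z ◁ e.inv
  rw [dag_whiskerL, h]

theorem isUnitaryIso_tensorIso {A B A' B' : D} {e : A ≅ B} {f : A' ≅ B'} (he : IsUnitaryIso e)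
    (hf : IsUnitaryIso f) : IsUnitaryIso (e ⊗ᵢ f) := by
  have h : e ⊗ᵢ f = whiskerLeftIso A f ≪≫ whiskerRightIso e B' := by
    ext; exact MonoidalCategory.tensorHom_def' _ _
  rw [h]
  exact isUnitaryIso_trans (isUnitaryIso_whiskerLeftIso hf _) (isUnitaryIso_whiskerRightIso he _)

theorem isUnitaryIso_powIso {V W : D} {σ : V ≅ W} (hσ : IsUnitaryIso σ) (m : ℕ) :
    IsUnitaryIso (powIso σ m) := by
  induction m with
  | zero => exact isUnitaryIso_refl _
  | succ m ih => exact isUnitaryIso_tensorIso ih hσ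

theorem isUnitaryIso_frontIso (V : D) (m : ℕ) : IsUnitaryIso (frontIso V m) := by
  induction m with
  | zero =>
    exact isUnitaryIso_trans (UnitaryFusionCategory.unitary_rightUnitor V)
      (isUnitaryIso_symm (UnitaryFusionCategory.unitary_leftUnitor V))
  | succ m ih =>
    exact isUnitaryIso_trans
      (isUnitaryIso_symm (UnitaryFusionCategory.unitary_associator _ _ _))
      (isUnitaryIso_whiskerRightIso ih _)

theorem isUnitaryIso_regroupCoh (Y Z T : D) : IsUnitaryIso (regroupCoh Y Z T) := by
  have h : regroupCoh Y Z T = whiskerLeftIso Y (α_ T (Z ⊗ Y) Z) ≪≫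
      whiskerLeftIso Y (whiskerLeftIso T (α_ Z Y Z)) ≪≫
      whiskerLeftIso Y (α_ T Z (Y ⊗ Z)).symm ≪≫ (α_ Y (T ⊗ Z) (Y ⊗ Z)).symm := by
    ext
    simp only [regroupCoh, Iso.trans_hom, whiskerLeftIso_hom, Iso.symm_hom]
    monoidal
  have ha := fun A B E : D => UnitaryFusionCategory.unitary_associator A B E
  rw [h]
  exact isUnitaryIso_trans (isUnitaryIso_whiskerLeftIso (ha _ _ _) _) <| isUnitaryIso_trans
    (isUnitaryIso_whiskerLeftIso (isUnitaryIso_whiskerLeftIso (ha _ _ _) _) _) <|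
    isUnitaryIso_trans (isUnitaryIso_whiskerLeftIso (isUnitaryIso_symm (ha _ _ _)) _)
      (isUnitaryIso_symm (ha _ _ _))

theorem isUnitaryIso_regroupIso (Y Z : D) (m : ℕ) : IsUnitaryIso (regroupIso Y Z m) := by
  induction m with
  | zero =>
    exact isUnitaryIso_trans
      (isUnitaryIso_whiskerLeftIso (UnitaryFusionCategory.unitary_leftUnitor _) _)
      (isUnitaryIso_symm (UnitaryFusionCategory.unitary_leftUnitor _))
  | succ m ih =>
    exact isUnitaryIso_trans (isUnitaryIso_regroupCoh Y Z _)
      (isUnitaryIso_whiskerRightIso ih _)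

/-! ### Algebraic properties and range of the block translation -/

section TranslateFun

variable {Y Z : D} (σ : Y ⊗ Z ≅ Z ⊗ Y) (m : ℕ)

theorem translateFun_comp (v w : tensorPow (Y ⊗ Z) m ⟶ tensorPow (Y ⊗ Z) m) :
    translateFun σ m (v ≫ w) = translateFun σ m v ≫ translateFun σ m w := by
  simp only [translateFun, conjFun_comp, comp_whiskerRight, MonoidalCategory.whiskerLeft_comp]

theorem translateFun_id : translateFun σ m (𝟙 _) = 𝟙 _ := by
  simp only [translateFun, conjFun_id, id_whiskerRight, MonoidalCategory.whiskerLeft_id]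

theorem translateFun_add (v w : tensorPow (Y ⊗ Z) m ⟶ tensorPow (Y ⊗ Z) m) :
    translateFun σ m (v + w) = translateFun σ m v + translateFun σ m w := by
  simp only [translateFun, conjFun_add, MonoidalPreadditive.add_whiskerRight,
    MonoidalPreadditive.whiskerLeft_add]

theorem translateFun_smul (c : ℂ) (v : tensorPow (Y ⊗ Z) m ⟶ tensorPow (Y ⊗ Z) m) :
    translateFun σ m (c • v) = c • translateFun σ m v := by
  simp only [translateFun, conjFun_smul, MonoidalLinear.smul_whiskerRight,
    MonoidalLinear.whiskerLeft_smul]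

theorem dag_translateFun {σ : Y ⊗ Z ≅ Z ⊗ Y} (hσ : IsUnitaryIso σ)
    (v : tensorPow (Y ⊗ Z) m ⟶ tensorPow (Y ⊗ Z) m) :
    dag (translateFun σ m v) = translateFun σ m (dag v) := by
  rw [translateFun, dag_conjFun (isUnitaryIso_trans (isUnitaryIso_whiskerLeftIso
    (isUnitaryIso_regroupIso Y Z m) _) (isUnitaryIso_frontIso _ _)), dag_whiskerL, dag_whiskerL,
    dag_whiskerR, dag_conjFun (isUnitaryIso_powIso hσ m), translateFun]

/-- Every operator on `(Y ⊗ Z) ^ ⊗ m ⊗ Y` is, up to tensoring with identities, in the range of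
`translateFun`. -/
theorem translateFun_regroup (z : tensorPow (Y ⊗ Z) m ⊗ Y ⟶ tensorPow (Y ⊗ Z) m ⊗ Y) :
    translateFun σ (m + 1) (conjFun (powIso σ (m + 1)).symm
      (conjFun (regroupIso Z Y m) (Z ◁ z))) =
    conjFun (α_ (tensorPow (Y ⊗ Z) (m + 2)) Y Z) (shiftFun Y (frontIso (Y ⊗ Z) (m + 1))
      (shiftFun Y (frontIso (Y ⊗ Z) m) z) ▷ Z) := by
  rw [translateFun_eq, conjFun_symm', conjFun_halfIso_regroupIso]
  rfl

theorem conjFun_shiftFun_whiskerRight {U T T' : D} (e : U ⊗ T ≅ T') (z : T ⊗ Y ⟶ T ⊗ Y) :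
    conjFun (α_ T' Y Z) (shiftFun Y e z ▷ Z) =
      conjFun ((α_ U T (Y ⊗ Z)).symm ≪≫ whiskerRightIso e (Y ⊗ Z))
        (U ◁ conjFun (α_ T Y Z) (z ▷ Z)) := by
  simp only [shiftFun, conjFun, Iso.trans_hom, Iso.trans_inv, Iso.symm_hom, Iso.symm_inv,
    whiskerRightIso_hom, whiskerRightIso_inv]
  monoidal

theorem conjFun_associator_whiskerRight {T : D} (u : T ⟶ T) :
    conjFun (α_ T Y Z) ((u ▷ Y) ▷ Z) = u ▷ (Y ⊗ Z) := by
  simp [conjFun]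

end TranslateFun

variable {ι : C ⥤ D} [ι.Monoidal] [ι.Full] (hι : IsFullInclusion ι)

include hι

theorem isUnitaryIso_mapIso {A B : C} {e : A ≅ B} (he : IsUnitaryIso e) :
    IsUnitaryIso (ι.mapIso e) := by
  have h : dag e.hom = e.inv := he
  change dag (ι.map e.hom) = ι.map e.inv
  rw [← hι.map_dag, h]

theorem isUnitaryIso_blockIso (X : C) (n : ℕ) {Y Z : D} {φ : ι.obj (tensorPow X n) ≅ Y ⊗ Z}
    (hφ : IsUnitaryIso φ) (m : ℕ) : IsUnitaryIso (blockIso ι X n φ m) := by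
  induction m with
  | zero => exact isUnitaryIso_symm hι.unitary_ε
  | succ m ih =>
    exact isUnitaryIso_trans
      (isUnitaryIso_mapIso hι (isUnitaryIso_symm (isUnitaryIso_powAdd X _ _))) <|
        isUnitaryIso_trans (isUnitaryIso_symm (hι.unitary_μ _ _)) (isUnitaryIso_tensorIso ih hφ)

variable {X : C} {n : ℕ} {Y Z : D} (φ : ι.obj (tensorPow X n) ≅ Y ⊗ Z)

theorem blockEnd_injective (m : ℕ) : Function.Injective (blockEnd ι X n φ m) := fun v w h => by
  have := hι.faithful
  refine ι.map_injective ?_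
  have h1 := congrArg (conjFun (blockIso ι X n φ m).symm) h
  rwa [blockEnd, blockEnd, conjFun_symm, conjFun_symm] at h1

omit hι in
theorem exists_blockEnd_eq (m : ℕ) (u : tensorPow (Y ⊗ Z) m ⟶ tensorPow (Y ⊗ Z) m) :
    ∃ w, blockEnd ι X n φ m w = u :=
  ⟨ι.preimage (conjFun (blockIso ι X n φ m).symm u), by
    rw [blockEnd, ι.map_preimage, conjFun_symm']⟩

/-- `blockEnd`, as a linear equivalence. -/
noncomputable def blockEquiv (m : ℕ) : (tensorPow X (n * m) ⟶ tensorPow X (n * m)) ≃ₗ[ℂ]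
    (tensorPow (Y ⊗ Z) m ⟶ tensorPow (Y ⊗ Z) m) :=
  LinearEquiv.ofBijective
    { toFun := blockEnd ι X n φ m
      map_add' := fun v w => by simp only [blockEnd, hι.map_add, conjFun_add]
      map_smul' := fun c w => by simp only [blockEnd, hι.map_smul, conjFun_smul, RingHom.id_apply] }
    ⟨blockEnd_injective hι φ m, exists_blockEnd_eq φ m⟩

/-- An operator on `(Y ⊗ Z) ^ ⊗ m`, as an operator localized in the blocks `k, …, k + m - 1`. -/
noncomputable def blockOp (s k : ℤ) (m : ℕ) :
    (tensorPow (Y ⊗ Z) m ⟶ tensorPow (Y ⊗ Z) m) →ₗ[ℂ] QuasiLocal X :=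
  siteLin X (s + n * k) (n * m) ∘ₗ (blockEquiv hι φ m).symm.toLinearMap

theorem blockOp_blockEnd (s k : ℤ) (m : ℕ) (w : End (tensorPow X (n * m))) :
    blockOp hι φ s k m (blockEnd ι X n φ m w) = siteHom X (s + n * k) (n * m) w := by
  change siteHom X (s + n * k) (n * m) ((blockEquiv hι φ m).symm (blockEquiv hι φ m w)) = _
  rw [LinearEquiv.symm_apply_apply]

theorem blockOp_comp (s k : ℤ) (m : ℕ) (u v : tensorPow (Y ⊗ Z) m ⟶ tensorPow (Y ⊗ Z) m) :
    blockOp hι φ s k m (u ≫ v) = blockOp hι φ s k m v * blockOp hι φ s k m u := by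
  obtain ⟨u, rfl⟩ := exists_blockEnd_eq φ m u
  obtain ⟨v, rfl⟩ := exists_blockEnd_eq φ m v
  have h : blockEnd ι X n φ m u ≫ blockEnd ι X n φ m v = blockEnd ι X n φ m (u ≫ v) := by
    rw [blockEnd, blockEnd, ← conjFun_comp, ← ι.map_comp, blockEnd]
  rw [h, blockOp_blockEnd, blockOp_blockEnd, blockOp_blockEnd, ← map_mul]
  rfl

theorem blockOp_id (s k : ℤ) (m : ℕ) : blockOp hι φ s k m (𝟙 _) = 1 := by
  have h : 𝟙 _ = blockEnd ι X n φ m (𝟙 _) := by rw [blockEnd, ι.map_id, conjFun_id]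
  rw [h, blockOp_blockEnd]
  exact map_one _

theorem blockOp_dag {φ : ι.obj (tensorPow X n) ≅ Y ⊗ Z} (hφ : IsUnitaryIso φ) (s k : ℤ) (m : ℕ)
    (u : tensorPow (Y ⊗ Z) m ⟶ tensorPow (Y ⊗ Z) m) :
    blockOp hι φ s k m (dag u) = star (blockOp hι φ s k m u) := by
  obtain ⟨u, rfl⟩ := exists_blockEnd_eq φ m u
  have h : dag (blockEnd ι X n φ m u) = blockEnd ι X n φ m (dag u) := by
    rw [blockEnd, dag_conjFun (isUnitaryIso_blockIso hι X n hφ m), ← hι.map_dag, blockEnd]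
  rw [h, blockOp_blockEnd, blockOp_blockEnd, ← map_star]
  rfl

theorem blockOp_whiskerRight (s k : ℤ) (m : ℕ) (u : tensorPow (Y ⊗ Z) m ⟶ tensorPow (Y ⊗ Z) m) :
    blockOp hι φ s k (m + 1) (u ▷ (Y ⊗ Z)) = blockOp hι φ s k m u := by
  obtain ⟨u, rfl⟩ := exists_blockEnd_eq φ m u
  rw [← blockEnd_padR]
  refine (blockOp_blockEnd hι φ s k (m + 1) (padR X n u)).trans ?_
  rw [blockOp_blockEnd]
  have h := siteHom_pad X (s + n * k) 0 n (by ring : 0 + n * m + n = n * (m + 1)) u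
  have h1 : pad X 0 n (by ring : 0 + n * m + n = n * (m + 1)) u = padR X n u :=
    (padFun_zero_left X _ u).trans (conjFun_refl _)
  rw [h1, Nat.cast_zero, add_zero] at h
  exact h

theorem blockOp_front (s k : ℤ) (m : ℕ) (u : tensorPow (Y ⊗ Z) m ⟶ tensorPow (Y ⊗ Z) m) :
    blockOp hι φ s (k - 1) (m + 1) (conjFun (frontIso (Y ⊗ Z) m) ((Y ⊗ Z) ◁ u)) =
      blockOp hι φ s k m u := by
  obtain ⟨u, rfl⟩ := exists_blockEnd_eq φ m u
  have h0 : n + n * m = n * (m + 1) := by ring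
  rw [← blockEnd_padL ι X n φ m h0]
  refine (blockOp_blockEnd hι φ s (k - 1) (m + 1) (conjFun (castPow X h0) (padL X n u))).trans ?_
  rw [blockOp_blockEnd]
  have h := siteHom_pad X (s + n * (k - 1)) n 0 (by ring : n + n * m + 0 = n * (m + 1)) u
  have h1 : pad X n 0 (by ring : n + n * m + 0 = n * (m + 1)) u =
    conjFun (castPow X h0) (padL X n u) := padFun_zero_right X _ u
  rw [h1, show s + n * (k - 1) + n = s + n * k by ring] at h
  exact h

theorem isGeneralizedTranslation_iff (σ : Y ⊗ Z ≅ Z ⊗ Y) (s : ℤ)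
    (α : QuasiLocal X ≃⋆ₐ[ℂ] QuasiLocal X) : IsGeneralizedTranslation ι X n φ σ s α ↔
      ∀ (k : ℤ) (m : ℕ), 0 < m → ∀ u : tensorPow (Y ⊗ Z) m ⟶ tensorPow (Y ⊗ Z) m,
        α (blockOp hι φ s k m u) = blockOp hι φ s (k - 1) (m + 2) (translateFun σ m u) := by
  have key : ∀ (k : ℤ) (m : ℕ) (w : End (tensorPow X (n * m))),
      siteHom X (s + n * (k - 1)) (n * (m + 2)) (translateBlock ι X n φ σ m w) =
        blockOp hι φ s (k - 1) (m + 2) (translateFun σ m (blockEnd ι X n φ m w)) := by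
    intro k m w
    have h : blockEnd ι X n φ (m + 2) (translateBlock ι X n φ σ m w) =
        translateFun σ m (blockEnd ι X n φ m w) := by
      rw [blockEnd, translateBlock, ι.map_preimage, conjFun_symm']
      rfl
    rw [← blockOp_blockEnd hι φ, h]
  refine forall₂_congr fun k m => forall_congr' fun _ => ⟨fun h u => ?_, fun h w => ?_⟩
  · obtain ⟨u, rfl⟩ := exists_blockEnd_eq φ m u
    rw [blockOp_blockEnd, h, key]
  · rw [key, ← h, blockOp_blockEnd]

omit hι in
-- Round both ends of the interval outward to block boundaries. The right end is always moved to the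
-- next boundary, which keeps the number of blocks positive even for an empty interval.
theorem exists_blocks (hn : 0 < n) (s a : ℤ) (l : ℕ) : ∃ (k : ℤ) (m : ℕ), 0 < m ∧
    a - n < s + n * k ∧ s + n * k ≤ a ∧ a + l ≤ s + n * k + (n * m : ℕ) ∧
      s + n * k + (n * m : ℕ) ≤ a + l + n := by
  have hn' : (0 : ℤ) < n := by exact_mod_cast hn
  obtain ⟨k, hk⟩ : ∃ k, k = (a - s) / n := ⟨_, rfl⟩
  obtain ⟨k', hk'⟩ : ∃ k', k' = (a + l - s) / n + 1 := ⟨_, rfl⟩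
  have h1 := Int.emod_add_mul_ediv (a - s) n
  have h2 := Int.emod_add_mul_ediv (a + l - s) n
  have h3 := Int.emod_nonneg (a - s) hn'.ne'
  have h4 := Int.emod_nonneg (a + l - s) hn'.ne'
  have h5 := Int.emod_lt_of_pos (a - s) hn'
  have h6 := Int.emod_lt_of_pos (a + l - s) hn'
  have h7 : (a - s) / n ≤ (a + l - s) / n := Int.ediv_le_ediv hn' (by omega)
  obtain ⟨m, hm⟩ : ∃ m : ℕ, (m : ℤ) = k' - k := ⟨(k' - k).toNat, by omega⟩
  have h8 : (n : ℤ) * k + (n * m : ℕ) = n * ((a + l - s) / n) + n := by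
    push_cast
    rw [hm, hk']; ring
  have h9 : (n : ℤ) * k = n * ((a - s) / n) := by rw [hk]
  exact ⟨k, m, by omega, by omega, by omega, by omega, by omega⟩

theorem siteHom_eq_blockOp {s k a : ℤ} {m l : ℕ} (h1 : s + n * k ≤ a)
    (h2 : a + l ≤ s + n * k + (n * m : ℕ)) (w : End (tensorPow X l)) :
    siteHom X a l w = blockOp hι φ s k m (blockEnd ι X n φ m (pad X (a - (s + n * k)).toNat
      (s + n * k + (n * m : ℕ) - (a + l)).toNat (by omega) w)) := by
  rw [blockOp_blockEnd]
  exact siteHom_extend h1 h2 w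

/-- Enlarging the support of an operator and enlarging that of its translate can be done by the same
representative, one block at a time on the right and then on the left. -/
theorem exists_blockOp_extend (s k k' : ℤ) (m m' : ℕ) (hk : k' ≤ k) (hm : k + m ≤ k' + m')
    (σ : Y ⊗ Z ≅ Z ⊗ Y) (u : tensorPow (Y ⊗ Z) m ⟶ tensorPow (Y ⊗ Z) m) :
    ∃ u' : tensorPow (Y ⊗ Z) m' ⟶ tensorPow (Y ⊗ Z) m',
      blockOp hι φ s k' m' u' = blockOp hι φ s k m u ∧
      blockOp hι φ s (k' - 1) (m' + 2) (translateFun σ m' u') =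
        blockOp hι φ s (k - 1) (m + 2) (translateFun σ m u) := by
  have hR : ∀ (j : ℕ) (k : ℤ) (m : ℕ) (u : tensorPow (Y ⊗ Z) m ⟶ tensorPow (Y ⊗ Z) m),
      ∃ u' : tensorPow (Y ⊗ Z) (m + j) ⟶ tensorPow (Y ⊗ Z) (m + j),
        blockOp hι φ s k (m + j) u' = blockOp hι φ s k m u ∧
        blockOp hι φ s (k - 1) (m + j + 2) (translateFun σ (m + j) u') =
          blockOp hι φ s (k - 1) (m + 2) (translateFun σ m u) := by
    intro j k m u
    induction j with
    | zero => exact ⟨u, rfl, rfl⟩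
    | succ j ih =>
      obtain ⟨u', h1, h2⟩ := ih
      refine ⟨u' ▷ (Y ⊗ Z), ?_, ?_⟩
      · rw [← h1]
        exact blockOp_whiskerRight hι φ s k (m + j) u'
      · rw [← h2]
        refine (congrArg _ (translateFun_whiskerRight σ (m + j) u')).trans ?_
        exact blockOp_whiskerRight hι φ s (k - 1) (m + j + 2) _
  have hL : ∀ (j : ℕ) (k : ℤ) (m : ℕ) (u : tensorPow (Y ⊗ Z) m ⟶ tensorPow (Y ⊗ Z) m),
      ∃ u' : tensorPow (Y ⊗ Z) (m + j) ⟶ tensorPow (Y ⊗ Z) (m + j),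
        blockOp hι φ s (k - j) (m + j) u' = blockOp hι φ s k m u ∧
        blockOp hι φ s (k - j - 1) (m + j + 2) (translateFun σ (m + j) u') =
          blockOp hι φ s (k - 1) (m + 2) (translateFun σ m u) := by
    intro j k m u
    induction j with
    | zero => exact ⟨u, by simp, by simp⟩
    | succ j ih =>
      obtain ⟨u', h1, h2⟩ := ih
      have e : k - ((j + 1 : ℕ) : ℤ) = k - j - 1 := by push_cast; ring
      refine ⟨conjFun (frontIso (Y ⊗ Z) (m + j)) ((Y ⊗ Z) ◁ u'), ?_, ?_⟩
      · rw [← h1, e]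
        exact blockOp_front hι φ s (k - j) (m + j) u'
      · rw [← h2, e]
        refine (congrArg _ (translateFun_front σ (m + j) u')).trans ?_
        exact blockOp_front hι φ s (k - j - 1) (m + j + 2) _
  obtain ⟨j, rfl⟩ : ∃ j : ℕ, k' = k - j := ⟨(k - k').toNat, by omega⟩
  obtain ⟨i, rfl⟩ : ∃ i : ℕ, m' = m + i + j := ⟨m' - m - j, by omega⟩
  obtain ⟨u₁, h1, h2⟩ := hR i k m u
  obtain ⟨u₂, h3, h4⟩ := hL j k (m + i) u₁
  exact ⟨u₂, h3.trans h1, h4.trans h2⟩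

/-- Operators on blocks are translates. -/
theorem exists_translate_eq (σ : Y ⊗ Z ≅ Z ⊗ Y) (s k : ℤ) (m : ℕ)
    (u : tensorPow (Y ⊗ Z) m ⟶ tensorPow (Y ⊗ Z) m) :
    ∃ v : tensorPow (Y ⊗ Z) (m + 1) ⟶ tensorPow (Y ⊗ Z) (m + 1),
      blockOp hι φ s (k - 1 - 1) (m + 1 + 2) (translateFun σ (m + 1) v) =
        blockOp hι φ s k m u := by
  -- Taking `u ▷ Y` for the operator on `(Y ⊗ Z) ^ ⊗ m ⊗ Y` leaves identities on the last block and
  -- on the first two, which can be stripped off.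
  refine ⟨_, (congrArg _ (translateFun_regroup σ m (u ▷ Y))).trans ?_⟩
  rw [shiftFun_whiskerRight, shiftFun_whiskerRight, conjFun_associator_whiskerRight]
  refine (blockOp_whiskerRight hι φ s (k - 1 - 1) (m + 2) _).trans ?_
  refine (blockOp_front hι φ s (k - 1) (m + 1) _).trans ?_
  exact blockOp_front hι φ s k m u

end BlockOperators


/-! ### Existence and uniqueness of generalized translations -/

section Translations

variable {C : Type*} [Category C] [Abelian C] [Linear ℂ C] [MonoidalCategory C]
  [MonoidalPreadditive C] [MonoidalLinear ℂ C] [RigidCategory C] [UnitaryFusionCategory C]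
  {X : C} {l : ℕ} {τ : QuasiLocal X →ₚ[ℂ] ℂ}

theorem siteHom_injective (hl : GeneratesFrom X l) (a : ℤ) (n : ℕ) :
    Function.Injective (siteHom X a n) := by
  obtain ⟨τ, hτ, -⟩ := exists_traceState hl.ne_zero
  refine (injective_iff_map_eq_zero _).2 fun w hw => ?_
  exact eq_zero_of_tracialState_siteHom hl hτ (a := a) (by rw [hw, mul_zero, map_zero])

/-- The composite of `τ` with a unital *-endomorphism is again a tracial state, so uniqueness
applies. -/
theorem tracialState_map (hl : GeneratesFrom X l) (hτ : IsTracialState τ)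
    (f : QuasiLocal X →⋆ₐ[ℂ] QuasiLocal X) (a : QuasiLocal X) : τ (f a) = τ a := by
  let τ' : QuasiLocal X →ₚ[ℂ] ℂ := PositiveLinearMap.mk₀
    (τ.toLinearMap ∘ₗ f.toAlgHom.toLinearMap) fun x hx => by
      obtain ⟨b, rfl⟩ := CStarAlgebra.nonneg_iff_eq_star_mul_self.1 hx
      change 0 ≤ τ (f (star b * b))
      rw [map_mul, map_star]
      exact map_nonneg τ (star_mul_self_nonneg _)
  have hτ' : IsTracialState τ' := by
    refine ⟨?_, fun a b => ?_⟩
    · change τ (f 1) = 1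
      rw [map_one, hτ.map_one]
    · change τ (f (a * b)) = τ (f (b * a))
      rw [map_mul f a b, map_mul f b a, hτ.map_mul_comm]
  exact congrArg (fun σ : QuasiLocal X →ₚ[ℂ] ℂ => σ a) (tracialState_unique hl hτ hτ')

theorem siteHom_mem_alg {I : NonemptyInterval ℤ} {a : ℤ} {n : ℕ} (h1 : I.fst ≤ a)
    (h2 : a + n ≤ I.snd + 1) (w : End (tensorPow X n)) :
    siteHom X a n w ∈ (fusionSpinChain X).alg I := by
  have hI := I.fst_le_snd
  have hlen : (intervalLength I : ℤ) = I.snd + 1 - I.fst := by simp only [intervalLength]; omega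
  rw [siteHom_extend (b := I.fst) (m := intervalLength I) h1 (by omega) w]
  exact ⟨_, rfl⟩

variable {D : Type*} [Category D] [Abelian D] [Linear ℂ D] [MonoidalCategory D]
  [MonoidalPreadditive D] [MonoidalLinear ℂ D] [RigidCategory D] [UnitaryFusionCategory D]
  {ι : C ⥤ D} [ι.Monoidal] [ι.Full] (hι : IsFullInclusion ι)
  {n : ℕ} {Y Z : D} {φ : ι.obj (tensorPow X n) ≅ Y ⊗ Z} {σ : Y ⊗ Z ≅ Z ⊗ Y} {s : ℤ}

include hι

theorem blockOp_mem_alg {I : NonemptyInterval ℤ} {k : ℤ} {m : ℕ} (h1 : I.fst ≤ s + n * k)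
    (h2 : s + n * k + (n * m : ℕ) ≤ I.snd + 1) (u : tensorPow (Y ⊗ Z) m ⟶ tensorPow (Y ⊗ Z) m) :
    blockOp hι φ s k m u ∈ (fusionSpinChain X).alg I := by
  obtain ⟨w, rfl⟩ := exists_blockEnd_eq φ m u
  rw [blockOp_blockEnd]
  exact siteHom_mem_alg h1 h2 w

theorem isQCA_of_isGeneralizedTranslation (hn : 0 < n) {α : QuasiLocal X ≃⋆ₐ[ℂ] QuasiLocal X}
    (hα : IsGeneralizedTranslation ι X n φ σ s α) : IsQCA (fusionSpinChain X) α := by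
  rw [isGeneralizedTranslation_iff hι] at hα
  -- Rounding to blocks costs at most `n` sites at each end, and the translation or its inverse at
  -- most one further block.
  refine ⟨2 * n, fun I => ?_⟩
  have hI := I.fst_le_snd
  have hlen : (intervalLength I : ℤ) = I.snd + 1 - I.fst := by simp only [intervalLength]; omega
  have ht1 : (thicken I (2 * n)).fst = I.fst - 2 * n := by simp [thicken]
  have ht2 : (thicken I (2 * n)).snd = I.snd + 2 * n := by simp [thicken]
  obtain ⟨k, m, hm, h1, h2, h3, h4⟩ := exists_blocks hn s I.fst (intervalLength I)
  constructor
  · rintro _ ⟨w, rfl⟩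
    change α (siteHom X I.fst (intervalLength I) w) ∈ _
    rw [siteHom_eq_blockOp hι φ h2 h3, hα k m hm]
    have e1 : (n : ℤ) * (k - 1) = n * k - n := by ring
    have e2 : ((n * (m + 2) : ℕ) : ℤ) = (n * m : ℕ) + 2 * n := by push_cast; ring
    exact blockOp_mem_alg hι (by omega) (by omega) _
  · rintro _ ⟨w, rfl⟩
    change α.symm (siteHom X I.fst (intervalLength I) w) ∈ _
    rw [siteHom_eq_blockOp hι φ h2 h3]
    obtain ⟨v, hv⟩ := exists_translate_eq hι φ σ s k m (blockEnd ι X n φ m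
      (pad X (I.fst - (s + n * k)).toNat
        (s + n * k + (n * m : ℕ) - (I.fst + intervalLength I)).toNat (by omega) w))
    rw [← hv, ← hα (k - 1) (m + 1) (by omega), StarAlgEquiv.symm_apply_apply]
    have e1 : (n : ℤ) * (k - 1) = n * k - n := by ring
    have e2 : ((n * (m + 1) : ℕ) : ℤ) = (n * m : ℕ) + n := by push_cast; ring
    exact blockOp_mem_alg hι (by omega) (by omega) _

theorem isGeneralizedTranslation_unique (hn : 0 < n) {α β : QuasiLocal X ≃⋆ₐ[ℂ] QuasiLocal X}
    (hα : IsGeneralizedTranslation ι X n φ σ s α) (hβ : IsGeneralizedTranslation ι X n φ σ s β) :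
    α = β := by
  rw [isGeneralizedTranslation_iff hι] at hα hβ
  ext a
  have hcα : Continuous α := (NonUnitalStarAlgHom.isometry (α : QuasiLocal X →⋆ₐ[ℂ] QuasiLocal X)
    α.injective).continuous
  have hcβ : Continuous β := (NonUnitalStarAlgHom.isometry (β : QuasiLocal X →⋆ₐ[ℂ] QuasiLocal X)
    β.injective).continuous
  refine quasiLocal_induction (p := fun a => α a = β a) a (isClosed_eq hcα hcβ) fun M w => ?_
  obtain ⟨k, m, hm, h1, h2, h3, h4⟩ := exists_blocks hn s (-(M : ℤ)) (2 * M)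
  rw [siteHom_eq_blockOp hι φ h2 h3, hα k m hm, hβ k m hm]

theorem blockOp_injective (hl : GeneratesFrom X l) (k : ℤ) (m : ℕ) :
    Function.Injective (blockOp hι φ s k m) := fun u v h => by
  obtain ⟨u, rfl⟩ := exists_blockEnd_eq φ m u
  obtain ⟨v, rfl⟩ := exists_blockEnd_eq φ m v
  rw [blockOp_blockEnd, blockOp_blockEnd] at h
  rw [siteHom_injective hl _ _ h]

/-- Well-definedness of the translate: extend both representatives to a common range of blocks,
where they coincide by injectivity. -/
theorem blockOp_translateFun_congr (hl : GeneratesFrom X l) (σ : Y ⊗ Z ≅ Z ⊗ Y) {k k' : ℤ}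
    {m m' : ℕ} {u : tensorPow (Y ⊗ Z) m ⟶ tensorPow (Y ⊗ Z) m}
    {u' : tensorPow (Y ⊗ Z) m' ⟶ tensorPow (Y ⊗ Z) m'}
    (h : blockOp hι φ s k m u = blockOp hι φ s k' m' u') :
    blockOp hι φ s (k - 1) (m + 2) (translateFun σ m u) =
      blockOp hι φ s (k' - 1) (m' + 2) (translateFun σ m' u') := by
  obtain ⟨v, h1, h2⟩ := exists_blockOp_extend hι φ s k (min k k') m
    (max (k + m) (k' + m') - min k k').toNat (min_le_left _ _) (by omega) σ u
  obtain ⟨v', h3, h4⟩ := exists_blockOp_extend hι φ s k' (min k k') m'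
    (max (k + m) (k' + m') - min k k').toNat (min_le_right _ _) (by omega) σ u'
  rw [← h2, ← h4]
  rw [← h1, ← h3] at h
  rw [blockOp_injective hι hl _ _ h]

omit hι in
theorem blockEnd_id (m : ℕ) : blockEnd ι X n φ m (𝟙 _) = 𝟙 _ := by
  rw [blockEnd, ι.map_id, conjFun_id]

theorem dag_blockEnd (hφ : IsUnitaryIso φ) (m : ℕ)
    (f : tensorPow X (n * m) ⟶ tensorPow X (n * m)) :
    blockEnd ι X n φ m (dag f) = dag (blockEnd ι X n φ m f) := by
  rw [blockEnd, blockEnd, dag_conjFun (isUnitaryIso_blockIso hι X n hφ m), ← hι.map_dag]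

variable (φ) in
/-- The translate of an operator on `m` blocks. -/
noncomputable def translateOp (σ : Y ⊗ Z ≅ Z ⊗ Y) (s k : ℤ) (m : ℕ)
    (w : End (tensorPow X (n * m))) : QuasiLocal X :=
  blockOp hι φ s (k - 1) (m + 2) (translateFun σ m (blockEnd ι X n φ m w))

theorem translateOp_id (k : ℤ) (m : ℕ) : translateOp hι φ σ s k m (𝟙 _) = 1 := by
  rw [translateOp, blockEnd_id, translateFun_id, blockOp_id]

theorem translateOp_comp (k : ℤ) (m : ℕ) (f g : tensorPow X (n * m) ⟶ tensorPow X (n * m)) :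
    translateOp hι φ σ s k m (f ≫ g) = translateOp hι φ σ s k m g * translateOp hι φ σ s k m f := by
  have h : blockEnd ι X n φ m (f ≫ g) = blockEnd ι X n φ m f ≫ blockEnd ι X n φ m g := by
    rw [blockEnd, ι.map_comp, conjFun_comp]
    rfl
  rw [translateOp, h, translateFun_comp, blockOp_comp]
  rfl

theorem translateOp_add (k : ℤ) (m : ℕ) (f g : End (tensorPow X (n * m))) :
    translateOp hι φ σ s k m (f + g) = translateOp hι φ σ s k m f + translateOp hι φ σ s k m g := by
  have h : blockEnd ι X n φ m (f + g) = blockEnd ι X n φ m f + blockEnd ι X n φ m g :=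
    map_add (blockEquiv hι φ m) f g
  rw [translateOp, h, translateFun_add, map_add]
  rfl

theorem translateOp_smul (k : ℤ) (m : ℕ) (c : ℂ) (f : tensorPow X (n * m) ⟶ tensorPow X (n * m)) :
    translateOp hι φ σ s k m (c • f) = c • translateOp hι φ σ s k m f := by
  have h : blockEnd ι X n φ m (c • f) = c • blockEnd ι X n φ m f :=
    map_smul (blockEquiv hι φ m) c f
  rw [translateOp, h, translateFun_smul, map_smul]
  rfl

theorem translateOp_dag (hφ : IsUnitaryIso φ) (hσ : IsUnitaryIso σ) (k : ℤ) (m : ℕ)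
    (f : tensorPow X (n * m) ⟶ tensorPow X (n * m)) :
    translateOp hι φ σ s k m (dag f) = star (translateOp hι φ σ s k m f) := by
  rw [translateOp, dag_blockEnd hι hφ, ← dag_translateFun m hσ, blockOp_dag hι hφ]
  rfl

/-- The translation of the operators on `m` blocks, as a *-homomorphism. -/
noncomputable def translateHom (hφ : IsUnitaryIso φ) (hσ : IsUnitaryIso σ) (s k : ℤ) (m : ℕ) :
    End (tensorPow X (n * m)) →⋆ₐ[ℂ] QuasiLocal X where
  toFun := translateOp hι φ σ s k m
  map_one' := translateOp_id hι k m
  map_mul' f g := translateOp_comp hι k m g f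
  map_zero' := by
    have h := translateOp_smul (σ := σ) (s := s) hι (φ := φ) k m 0 (𝟙 _)
    rw [zero_smul, zero_smul] at h
    exact h
  map_add' := translateOp_add hι k m
  commutes' c := by
    refine (translateOp_smul hι k m c (𝟙 _)).trans ?_
    rw [translateOp_id, Algebra.algebraMap_eq_smul_one]
  map_star' f := translateOp_dag hι hφ hσ k m f

/-- The local formula defines compatible *-homomorphisms on the boxes and extends by continuity.
Unitarity of `φ` and `σ` enters through compatibility with adjoints. Trace preservation gives
isometry, and surjectivity follows because every block operator is a translate. -/
theorem exists_translation (hl : GeneratesFrom X l) (hn : 0 < n) (hφ : IsUnitaryIso φ)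
    (hσ : IsUnitaryIso σ) (s : ℤ) :
    ∃ α : QuasiLocal X ≃⋆ₐ[ℂ] QuasiLocal X, IsGeneralizedTranslation ι X n φ σ s α := by
  choose k m hm h1 h2 h3 h4 using fun N : ℕ => exists_blocks hn s (-(N : ℤ)) (2 * N)
  let Φ : ∀ N, End (tensorPow X (2 * N)) →⋆ₐ[ℂ] QuasiLocal X := fun N =>
    (translateHom hι hφ hσ s (k N) (m N)).comp (pad X (-(N : ℤ) - (s + n * k N)).toNat
      (s + n * k N + (n * m N : ℕ) - (-(N : ℤ) + (2 * N : ℕ))).toNat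
      (by have := h2 N; have := h3 N; omega))
  have hΦ' : ∀ (N : ℕ) (w : End (tensorPow X (2 * N))), Φ N w = blockOp hι φ s (k N - 1) (m N + 2)
      (translateFun σ (m N) (blockEnd ι X n φ (m N) (pad X (-(N : ℤ) - (s + n * k N)).toNat
      (s + n * k N + (n * m N : ℕ) - (-(N : ℤ) + (2 * N : ℕ))).toNat
      (by have := h2 N; have := h3 N; omega) w))) := fun N w => rfl
  -- The value does not depend on the chosen cover of the box by blocks, so any other representation
  -- may be used below.
  have hΦ : ∀ (N : ℕ) (w : End (tensorPow X (2 * N))) (k' : ℤ) (m' : ℕ) (u : tensorPow (Y ⊗ Z) m' ⟶ tensorPow (Y ⊗ Z) m'),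
      siteHom X (-(N : ℤ)) (2 * N) w = blockOp hι φ s k' m' u →
      Φ N w = blockOp hι φ s (k' - 1) (m' + 2) (translateFun σ m' u) := fun N w k' m' u h => by
    rw [siteHom_eq_blockOp hι φ (h2 N) (h3 N)] at h
    rw [hΦ']
    exact blockOp_translateFun_congr hι hl σ h
  have hexp : ∀ (N : ℕ) (w : End (tensorPow X (2 * N))), ∃ (k' : ℤ) (m' : ℕ) (u : tensorPow (Y ⊗ Z) m' ⟶ tensorPow (Y ⊗ Z) m'),
      0 < m' ∧ siteHom X (-(N : ℤ)) (2 * N) w = blockOp hι φ s k' m' u := fun N w =>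
    ⟨_, _, _, hm N, siteHom_eq_blockOp hι φ (h2 N) (h3 N) w⟩
  obtain ⟨Ψ, hΨ, -⟩ := exists_quasiLocal_extension (fun N => (Φ N).toAlgHom.toLinearMap)
    (fun N w => by
      obtain ⟨k', m', u, -, hu⟩ := hexp N w
      refine (hΦ (N + 1) (boxStep X N w) k' m' u ?_).trans (hΦ N w k' m' u hu).symm
      rw [← hu]
      refine (siteHom_pad X (-((N + 1 : ℕ) : ℤ)) 1 1 (by omega) w).trans ?_
      congr 2
      push_cast; ring)
    fun N w => NonUnitalStarAlgHom.norm_apply_le (Φ N) w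
  have key : ∀ (k' : ℤ) (m' : ℕ) (u : tensorPow (Y ⊗ Z) m' ⟶ tensorPow (Y ⊗ Z) m'),
      Ψ (blockOp hι φ s k' m' u) = blockOp hι φ s (k' - 1) (m' + 2) (translateFun σ m' u) := by
    intro k' m' u
    obtain ⟨w, hw⟩ := exists_blockEnd_eq φ m' u
    have hu : blockOp hι φ s k' m' u = siteHom X (s + n * k') (n * m') w := by
      rw [← hw, blockOp_blockEnd]
    obtain ⟨N, hN, hN'⟩ := (eq_siteHom_of_extension _ Ψ hΨ (s + n * k') (n * m') w).exists
    rw [hu, hN']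
    refine hΦ N _ k' m' u ?_
    rw [hu, siteHom_extend (b := -(N : ℤ)) (m := 2 * N) hN.1 (by push_cast at hN ⊢; omega) w]
    refine congrArg _ ?_
    exact padFun_congr X _ (by omega) (by push_cast; omega) _
  have hpair : ∀ (M : ℕ) (w : End (tensorPow X (2 * M))) (M' : ℕ)
      (w' : End (tensorPow X (2 * M'))), ∃ (k' : ℤ) (m' : ℕ)
      (u u' : tensorPow (Y ⊗ Z) m' ⟶ tensorPow (Y ⊗ Z) m'),
      siteHom X (-(M : ℤ)) (2 * M) w = blockOp hι φ s k' m' u ∧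
      siteHom X (-(M' : ℤ)) (2 * M') w' = blockOp hι φ s k' m' u' := by
    intro M w M' w'
    obtain ⟨k, m, u, -, hu⟩ := hexp M w
    obtain ⟨k', m', u', -, hu'⟩ := hexp M' w'
    obtain ⟨v, h1, -⟩ := exists_blockOp_extend hι φ s k (min k k') m
      (max (k + m) (k' + m') - min k k').toNat (min_le_left _ _) (by omega) σ u
    obtain ⟨v', h3, -⟩ := exists_blockOp_extend hι φ s k' (min k k') m'
      (max (k + m) (k' + m') - min k k').toNat (min_le_right _ _) (by omega) σ u'
    exact ⟨_, _, v, v', hu.trans h1.symm, hu'.trans h3.symm⟩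
  have hmul : ∀ a b, Ψ (a * b) = Ψ a * Ψ b := fun a b => by
    refine quasiLocal_induction (p := fun a => Ψ (a * b) = Ψ a * Ψ b) a
      (isClosed_eq (by fun_prop) (by fun_prop)) fun M w => ?_
    refine quasiLocal_induction (p := fun b => Ψ (siteHom X (-(M : ℤ)) (2 * M) w * b) =
      Ψ (siteHom X (-(M : ℤ)) (2 * M) w) * Ψ b) b
      (isClosed_eq (by fun_prop) (by fun_prop)) fun M' w' => ?_
    obtain ⟨k', m', u, u', hu, hu'⟩ := hpair M w M' w'
    rw [hu, hu', ← blockOp_comp, key, key, key, translateFun_comp, blockOp_comp]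
  have hstar : ∀ a, Ψ (star a) = star (Ψ a) := fun a => by
    refine quasiLocal_induction (p := fun a => Ψ (star a) = star (Ψ a)) a
      (isClosed_eq (by fun_prop) (by fun_prop)) fun M w => ?_
    obtain ⟨k', m', u, -, hu⟩ := hexp M w
    rw [hu, ← blockOp_dag hι hφ, key, key, ← blockOp_dag hι hφ, dag_translateFun _ hσ]
  have hone : Ψ 1 = 1 := by
    rw [← blockOp_id hι φ s 0 0, key, translateFun_id, blockOp_id, blockOp_id]
  let f : QuasiLocal X →⋆ₐ[ℂ] QuasiLocal X :=
    { toFun := Ψ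
      map_one' := hone
      map_mul' := hmul
      map_zero' := map_zero Ψ
      map_add' := map_add Ψ
      commutes' := fun c => by
        rw [Algebra.algebraMap_eq_smul_one, map_smul, hone]
      map_star' := hstar }
  have hf : ∀ a, f a = Ψ a := fun a => rfl
  -- Since `f` preserves the faithful trace it is injective on every box algebra, and injective
  -- *-homomorphisms of C*-algebras are isometric.
  have hiso : ∀ a, ‖f a‖ = ‖a‖ := fun a => by
    refine quasiLocal_induction (p := fun a => ‖f a‖ = ‖a‖) a
      (isClosed_eq (by simp only [hf]; fun_prop) (by fun_prop)) fun M w => ?_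
    obtain ⟨τ, hτ, -⟩ := exists_traceState hl.ne_zero
    have hinj : Function.Injective (f.comp (siteHom X (-(M : ℤ)) (2 * M))) := by
      refine (injective_iff_map_eq_zero _).2 fun w hw => ?_
      refine eq_zero_of_tracialState_siteHom hl hτ (a := -(M : ℤ)) ?_
      rw [← tracialState_map hl hτ f, map_mul]
      have hw' : f (siteHom X (-(M : ℤ)) (2 * M) w) = 0 := hw
      rw [hw', mul_zero, map_zero]
    have h5 := NonUnitalStarAlgHom.norm_map _ hinj w
    have h6 := NonUnitalStarAlgHom.norm_map _ (siteHom_injective hl (-(M : ℤ)) (2 * M)) w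
    rw [h6]
    exact h5
  have hisom : Isometry f := AddMonoidHomClass.isometry_of_norm f hiso
  -- The range of an isometry on a complete space is closed, so it suffices to reach the local
  -- operators.
  have hsurj : Function.Surjective f := fun a => by
    refine quasiLocal_induction (p := fun a => a ∈ Set.range f) a
      hisom.isClosedEmbedding.isClosed_range fun M w => ?_
    obtain ⟨k', m', u, -, hu⟩ := hexp M w
    obtain ⟨v, hv⟩ := exists_translate_eq hι φ σ s k' m' u
    exact ⟨blockOp hι φ s (k' - 1) (m' + 1) v, by rw [hu, ← hv, hf, key]⟩
  refine ⟨StarAlgEquiv.ofBijective f ⟨hisom.injective, hsurj⟩, ?_⟩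
  rw [isGeneralizedTranslation_iff hι]
  intro k' m' _ u
  exact key k' m' u

end Translations


/-! ### The index of a generalized translation -/

section TranslationIndex

variable {C : Type*} [Category C] [Abelian C] [Linear ℂ C] [MonoidalCategory C]
  [MonoidalPreadditive C] [MonoidalLinear ℂ C] [RigidCategory C] [UnitaryFusionCategory C]
  {D : Type*} [Category D] [Abelian D] [Linear ℂ D] [MonoidalCategory D]
  [MonoidalPreadditive D] [MonoidalLinear ℂ D] [RigidCategory D] [UnitaryFusionCategory D]

theorem shiftFun_leftUnitor {V T : D} (z : T ⊗ V ⟶ T ⊗ V) : shiftFun V (λ_ T) z = z := by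
  simp only [shiftFun, conjFun, Iso.symm_hom, Iso.symm_inv, whiskerRightIso_hom,
    whiskerRightIso_inv]
  monoidal

theorem shiftFun_shiftFun {V U T T' U' T'' : D} (e : U ⊗ T ≅ T') (f : U' ⊗ T' ≅ T'')
    (z : T ⊗ V ⟶ T ⊗ V) : shiftFun V f (shiftFun V e z) =
      shiftFun V (α_ U' U T ≪≫ whiskerLeftIso U' e ≪≫ f) z := by
  simp only [shiftFun, conjFun, Iso.trans_hom, Iso.trans_inv, Iso.symm_hom, Iso.symm_inv,
    whiskerRightIso_hom, whiskerRightIso_inv, whiskerLeftIso_hom, whiskerLeftIso_inv]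
  monoidal

/-- `z ↦ z ⊗ 1_Z`, for operators on `T ⊗ Y`. -/
def extendRight (T Y Z : D) : (T ⊗ Y ⟶ T ⊗ Y) →ₗ[ℂ] (T ⊗ (Y ⊗ Z) ⟶ T ⊗ (Y ⊗ Z)) where
  toFun z := conjFun (α_ T Y Z) (z ▷ Z)
  map_add' z z' := by rw [MonoidalPreadditive.add_whiskerRight, conjFun_add]
  map_smul' c z := by rw [MonoidalLinear.smul_whiskerRight, conjFun_smul, RingHom.id_apply]

theorem extendRight_comp (T Y Z : D) (f g : T ⊗ Y ⟶ T ⊗ Y) :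
    extendRight T Y Z (f ≫ g) = extendRight T Y Z f ≫ extendRight T Y Z g := by
  change conjFun _ _ = conjFun _ _ ≫ conjFun _ _
  rw [comp_whiskerRight, conjFun_comp]

theorem extendRight_id (T Y Z : D) : extendRight T Y Z (𝟙 _) = 𝟙 _ := by
  change conjFun _ _ = _
  rw [id_whiskerRight, conjFun_id]

theorem catTr_extendRight (T Y Z : D) (z : T ⊗ Y ⟶ T ⊗ Y) :
    catTr (extendRight T Y Z z) = catDim Z * catTr z :=
  (catTr_conj _ _).trans (catTr_whiskerRight Z z)

theorem exists_translateFun_eq {Y Z : D} (σ : Y ⊗ Z ≅ Z ⊗ Y) (m : ℕ)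
    (v : tensorPow (Y ⊗ Z) m ⟶ tensorPow (Y ⊗ Z) m) :
    ∃ z, translateFun σ m v = extendRight (tensorPow (Y ⊗ Z) (m + 1)) Y Z z :=
  ⟨_, translateFun_eq σ m v⟩

theorem whiskerRight_ne_zero {A B V : D} (hV : 𝟙 V ≠ 0) {f : A ⟶ B} (hf : f ≠ 0) :
    f ▷ V ≠ 0 := by
  intro h
  have h1 := catTr_whiskerRight V (f ≫ dag f)
  rw [comp_whiskerRight, h, zero_comp, catTr_zero] at h1
  have h2 : (catDim V : ℂ) ≠ 0 := by exact_mod_cast (catDim_pos hV).ne'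
  exact hf (eq_zero_of_catTr_comp_dag ((mul_eq_zero.1 h1.symm).resolve_left h2))

/-- The image of a dual pair under a monoidal functor. -/
@[reducible]
def mapPairing (ι : C ⥤ D) [ι.Monoidal] (A A' : C) [ExactPairing A A'] :
    ExactPairing (ι.obj A) (ι.obj A') where
  coevaluation' := Functor.LaxMonoidal.ε ι ≫ ι.map (η_ A A') ≫ Functor.OplaxMonoidal.δ ι A A'
  evaluation' := Functor.LaxMonoidal.μ ι A' A ≫ ι.map (ε_ A A') ≫ Functor.OplaxMonoidal.η ι
  coevaluation_evaluation' := by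
    have h := congrArg (fun f => Functor.LaxMonoidal.μ ι A' (𝟙_ C) ≫ ι.map f ≫
      Functor.OplaxMonoidal.δ ι (𝟙_ C) A') (ExactPairing.coevaluation_evaluation A A')
    simp only [ι.map_comp, Functor.Monoidal.map_whiskerLeft, Functor.Monoidal.map_whiskerRight,
      Functor.Monoidal.map_associator_inv, Category.assoc, Functor.Monoidal.μ_δ_assoc,
      Functor.Monoidal.μ_δ, Functor.Monoidal.map_rightUnitor, Category.comp_id,
      Functor.Monoidal.map_leftUnitor_inv] at h
    simp only [MonoidalCategory.whiskerLeft_comp, comp_whiskerRight, Category.assoc]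
    rw [reassoc_of% h, ← MonoidalCategory.whiskerLeft_comp_assoc, Functor.Monoidal.ε_η,
      ← comp_whiskerRight, Functor.Monoidal.ε_η]
    simp
  evaluation_coevaluation' := by
    have h := congrArg (fun f => Functor.LaxMonoidal.μ ι (𝟙_ C) A ≫ ι.map f ≫
      Functor.OplaxMonoidal.δ ι A (𝟙_ C)) (ExactPairing.evaluation_coevaluation A A')
    simp only [ι.map_comp, Functor.Monoidal.map_whiskerLeft, Functor.Monoidal.map_whiskerRight,
      Functor.Monoidal.map_associator, Category.assoc, Functor.Monoidal.μ_δ_assoc,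
      Functor.Monoidal.μ_δ, Functor.Monoidal.map_leftUnitor, Category.comp_id,
      Functor.Monoidal.map_rightUnitor_inv] at h
    simp only [MonoidalCategory.whiskerLeft_comp, comp_whiskerRight, Category.assoc]
    rw [reassoc_of% h, ← comp_whiskerRight_assoc, Functor.Monoidal.ε_η,
      ← MonoidalCategory.whiskerLeft_comp, Functor.Monoidal.ε_η]
    simp

/-! ### The trace of the chain evaluated in the larger category -/

section Trace

variable {ι : C ⥤ D} [ι.Monoidal] [ι.Full] (hι : IsFullInclusion ι)

include hι

theorem obj_ne_zero {A : C} (hA : 𝟙 A ≠ 0) : 𝟙 (ι.obj A) ≠ 0 := by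
  have := hι.faithful
  intro h
  refine hA (ι.map_injective ?_)
  have h0 := hι.map_smul 0 (𝟙 A)
  rw [zero_smul, zero_smul] at h0
  rw [ι.map_id, h, h0]

omit hι [ι.Full] in
theorem catDim_obj_tensorPow (X : C) (p : ℕ) :
    catDim (ι.obj (tensorPow X p)) = catDim (ι.obj X) ^ p := by
  induction p with
  | zero => exact (catDim_congr (Functor.Monoidal.εIso ι).symm).trans catDim_unit
  | succ p ih =>
    rw [pow_succ, ← ih, ← catDim_tensor]
    exact catDim_congr (Functor.Monoidal.μIso ι _ _).symm

omit hι [ι.Full] in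
theorem catTr_map_whiskerLeft {A P : C} (w : P ⟶ P) :
    catTr (ι.map (A ◁ w)) = catDim (ι.obj A) * catTr (ι.map w) := by
  rw [← catTr_whiskerLeft, ← conjFun_μIso_whiskerLeft, catTr_conj]

theorem isTraceFamily_map {X : C} (hX : 𝟙 X ≠ 0) : IsTraceFamily X fun n =>
    ((catDim (ι.obj X) : ℂ) ^ n)⁻¹ • (catTrLin (ι.obj (tensorPow X n)) ∘ₗ
      ({ toFun := fun w => ι.map w
         map_add' := hι.map_add
         map_smul' := hι.map_smul } :
        (tensorPow X n ⟶ tensorPow X n) →ₗ[ℂ] (ι.obj (tensorPow X n) ⟶ ι.obj (tensorPow X n)))) where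
  comm n f g := by
    change _ * catTr (ι.map (f ≫ g)) = _ * catTr (ι.map (g ≫ f))
    rw [ι.map_comp, ι.map_comp, catTr_comp_comm]
  nonneg n f := by
    change 0 ≤ ((catDim (ι.obj X) : ℂ) ^ n)⁻¹ * catTr (ι.map (f ≫ dag f))
    rw [ι.map_comp, hι.map_dag]
    have h0 : (0 : ℝ) ≤ (catDim (ι.obj X) ^ n)⁻¹ := by have := catDim_nonneg (ι.obj X); positivity
    have h1 : (0 : ℂ) ≤ ((catDim (ι.obj X) : ℂ) ^ n)⁻¹ := by exact_mod_cast h0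
    exact mul_nonneg h1 (catTr_comp_dag_nonneg _)
  pad p n N h w := by
    have h0 : (catDim (ι.obj X) : ℂ) ≠ 0 := by
      exact_mod_cast (catDim_pos (obj_ne_zero hι hX)).ne'
    change ((catDim (ι.obj X) : ℂ) ^ N)⁻¹ * catTr (ι.map (padFun X p 0 h w)) =
      ((catDim (ι.obj X) : ℂ) ^ n)⁻¹ * catTr (ι.map w)
    rw [padFun_zero_right, padL, map_conjFun, map_conjFun, catTr_conj, catTr_conj,
      catTr_map_whiskerLeft, catDim_obj_tensorPow, ← h, add_zero, pow_add]
    push_cast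
    field_simp

/-- The trace of `D` pulled back along `ι` is a trace family of mass one, hence the normalized
trace. Thus spherical duals chosen in `C` and in `D` never have to be compared. -/
theorem catTr_map_eq {X : C} {l : ℕ} (hl : GeneratesFrom X l) (n : ℕ)
    (w : tensorPow X n ⟶ tensorPow X n) :
    normTr X n w = ((catDim (ι.obj X) : ℂ) ^ n)⁻¹ * catTr (ι.map w) := by
  have h := LinearMap.congr_fun ((isTraceFamily_map hι hl.ne_zero).eq_smul_normTr hl n) w
  have h1 : ((catDim (ι.obj X) : ℂ) ^ 0)⁻¹ * catTr (ι.map (𝟙 (tensorPow X 0))) = 1 := by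
    rw [ι.map_id, catTr_id, catDim_obj_tensorPow]
    simp
  have h2 : ((catDim (ι.obj X) : ℂ) ^ n)⁻¹ * catTr (ι.map w) =
    ((catDim (ι.obj X) : ℂ) ^ 0)⁻¹ * catTr (ι.map (𝟙 (tensorPow X 0))) * normTr X n w := h
  rw [h2, h1, one_mul]

end Trace

variable {ι : C ⥤ D} [ι.Monoidal] [ι.Full] (hι : IsFullInclusion ι)
  {X : C} {l n : ℕ} {Y Z : D} {φ : ι.obj (tensorPow X n) ≅ Y ⊗ Z} {σ : Y ⊗ Z ≅ Z ⊗ Y} {s : ℤ}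
  {τ : QuasiLocal X →ₚ[ℂ] ℂ}

include hι

theorem tracialState_blockOp (hl : GeneratesFrom X l) (hτ : IsTracialState τ) (k : ℤ) (m : ℕ)
    (u : tensorPow (Y ⊗ Z) m ⟶ tensorPow (Y ⊗ Z) m) : τ (blockOp hι φ s k m u) =
      ((catDim (ι.obj X) : ℂ) ^ (n * m))⁻¹ * catTr u := by
  obtain ⟨u, rfl⟩ := exists_blockEnd_eq φ m u
  rw [blockOp_blockEnd, tracialState_siteHom hl hτ]
  refine (catTr_map_eq hι hl _ _).trans ?_
  rw [blockEnd, catTr_conj]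

variable (φ) in
/-- An operator on `(Y ⊗ Z) ^ ⊗ m ⊗ Y`, as an operator localized in the blocks
`k - m, …, k`. -/
noncomputable def halfBlockOp (s k : ℤ) (m : ℕ) :
    (tensorPow (Y ⊗ Z) m ⊗ Y ⟶ tensorPow (Y ⊗ Z) m ⊗ Y) →ₗ[ℂ] QuasiLocal X :=
  blockOp hι φ s (k - m) (m + 1) ∘ₗ extendRight (tensorPow (Y ⊗ Z) m) Y Z

theorem halfBlockOp_apply (s k : ℤ) (m : ℕ)
    (z : tensorPow (Y ⊗ Z) m ⊗ Y ⟶ tensorPow (Y ⊗ Z) m ⊗ Y) :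
    halfBlockOp hι φ s k m z = blockOp hι φ s (k - m) (m + 1)
      (extendRight (tensorPow (Y ⊗ Z) m) Y Z z) := rfl

theorem halfBlockOp_shift (k : ℤ) (m : ℕ)
    (z : tensorPow (Y ⊗ Z) m ⊗ Y ⟶ tensorPow (Y ⊗ Z) m ⊗ Y) :
    halfBlockOp hι φ s k (m + 1) (shiftFun Y (frontIso (Y ⊗ Z) m) z) =
      halfBlockOp hι φ s k m z := by
  have e : k - ((m + 1 : ℕ) : ℤ) = k - m - 1 := by push_cast; ring
  rw [halfBlockOp_apply, halfBlockOp_apply, e]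
  refine (congrArg _ (conjFun_shiftFun_whiskerRight (frontIso (Y ⊗ Z) m) z)).trans ?_
  exact blockOp_front hι φ s (k - m) (m + 1) _

theorem mem_leftAlg_iff_blockOp (hn : 0 < n) {k : ℤ} {b : QuasiLocal X} :
    b ∈ leftAlg (fusionSpinChain X) (s + n * k - 1) ↔ ∃ (m : ℕ)
      (u : tensorPow (Y ⊗ Z) m ⟶ tensorPow (Y ⊗ Z) m), b = blockOp hι φ s (k - m) m u := by
  constructor
  · intro hb
    obtain ⟨j, w, rfl⟩ := mem_leftAlg_iff.1 hb
    have hj : (j : ℤ) ≤ n * j := by exact_mod_cast Nat.le_mul_of_pos_left j hn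
    have e1 : (n : ℤ) * (k - j) = n * k - n * j := by ring
    have e2 : ((n * j : ℕ) : ℤ) = n * j := by push_cast; ring
    exact ⟨j, _, siteHom_eq_blockOp hι φ (k := k - j) (m := j) (by omega) (by omega) w⟩
  · rintro ⟨m, u, rfl⟩
    obtain ⟨w, rfl⟩ := exists_blockEnd_eq φ m u
    rw [blockOp_blockEnd]
    refine siteHom_mem_leftAlg ?_ w
    push_cast
    linarith [mul_sub (n : ℤ) k m]

/-- At a block boundary, translates act trivially on the last `Z`, and every operator on `(Y ⊗ Z) ^
⊗ m ⊗ Y` is such a translate. The image algebra is therefore the original one with a single factor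
`Y` appended on the right. No adjoints are involved, so `φ` and `σ` may be arbitrary. -/
theorem isCatTower_translation (hl : GeneratesFrom X l) (hτ : IsTracialState τ) (hn : 0 < n)
    {α : QuasiLocal X ≃⋆ₐ[ℂ] QuasiLocal X} (hα : IsGeneralizedTranslation ι X n φ σ s α) (k : ℤ) :
    IsCatTower τ (leftAlg (fusionSpinChain X) (s + n * k - 1))
      ((leftAlg (fusionSpinChain X) (s + n * k - 1)).map
        (α : QuasiLocal X →⋆ₐ[ℂ] QuasiLocal X)) Y (tensorPow (Y ⊗ Z)) (halfBlockOp hι φ s k) where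
  map_comp m f g := by
    rw [halfBlockOp_apply, extendRight_comp]
    exact blockOp_comp hι φ s _ (m + 1) _ _
  map_id m := by
    rw [halfBlockOp_apply, extendRight_id]
    exact blockOp_id hι φ s _ (m + 1)
  shift m m' h := by
    induction m', h using Nat.le_induction with
    | base =>
      exact ⟨𝟙_ D, λ_ _, UnitaryFusionCategory.unitary_leftUnitor _, fun z => by
        rw [shiftFun_leftUnitor]⟩
    | succ m' h ih =>
      obtain ⟨U, e, he, hF⟩ := ih
      refine ⟨(Y ⊗ Z) ⊗ U, α_ (Y ⊗ Z) U _ ≪≫ whiskerLeftIso (Y ⊗ Z) e ≪≫ frontIso (Y ⊗ Z) m',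
        isUnitaryIso_trans (UnitaryFusionCategory.unitary_associator _ _ _)
          (isUnitaryIso_trans (isUnitaryIso_whiskerLeftIso he _) (isUnitaryIso_frontIso _ _)),
        fun z => ?_⟩
      rw [← shiftFun_shiftFun, halfBlockOp_shift, hF]
  trace m := by
    refine ⟨((catDim (ι.obj X) : ℂ) ^ (n * (m + 1)))⁻¹ * catDim Z, fun z => ?_⟩
    rw [halfBlockOp_apply]
    refine (tracialState_blockOp hι hl hτ _ (m + 1) _).trans ?_
    rw [mul_assoc]
    exact congrArg _ (catTr_extendRight _ Y Z z)
  mem x := by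
    rw [isGeneralizedTranslation_iff hι] at hα
    constructor
    · rintro ⟨b, hb, rfl⟩
      obtain ⟨m, u, rfl⟩ := (mem_leftAlg_iff_blockOp hι hn (φ := φ)).1 hb
      -- One block is added because the translation formula is assumed only for a positive number of
      -- blocks.
      obtain ⟨u', h1, -⟩ := exists_blockOp_extend hι φ s (k - m) (k - (m + 1 : ℕ)) m (m + 1)
        (by push_cast; omega) (by push_cast; omega) σ u
      rw [← h1]
      obtain ⟨z, hz⟩ := exists_translateFun_eq σ (m + 1) u'
      refine ⟨m + 1 + 1, z, (hα _ _ (Nat.succ_pos m) u').trans ?_⟩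
      refine (congrArg _ hz).trans ?_
      rw [halfBlockOp_apply]
      have e : k - ((m + 1 : ℕ) : ℤ) - 1 = k - ((m + 1 + 1 : ℕ) : ℤ) := by push_cast; ring
      rw [e]
    · rintro ⟨m, z, rfl⟩
      -- The preimage is the one supplied by `translateFun_regroup`; its image is `z` with two
      -- identity blocks in front, which is why `z` is shifted twice.
      refine ⟨blockOp hι φ s (k - (m + 1 : ℕ)) (m + 1) _,
        (mem_leftAlg_iff_blockOp hι hn).2 ⟨m + 1, _, rfl⟩,
        (hα _ _ (Nat.succ_pos m) _).trans ((congrArg _ (translateFun_regroup σ m z)).trans ?_)⟩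
      rw [← halfBlockOp_shift hι k m z, ← halfBlockOp_shift hι k (m + 1), halfBlockOp_apply]
      have e : k - ((m + 1 : ℕ) : ℤ) - 1 = k - ((m + 1 + 1 : ℕ) : ℤ) := by push_cast; ring
      rw [e]
      rfl
  mem' b := by
    rw [mem_leftAlg_iff_blockOp hι hn (φ := φ)]
    refine exists₂_congr fun m u => ?_
    have h : halfBlockOp hι φ s k m (u ▷ Y) = blockOp hι φ s (k - m) m u :=
      (congrArg _ (conjFun_associator_whiskerRight u)).trans
        (blockOp_whiskerRight hι φ s (k - m) m u)
    rw [h]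

/-- Some simple summand of `P` in `C` receives a nonzero map from `S`, and that summand embeds
isometrically in every large power of `X`. -/
theorem exists_hom_of_hom_obj (hl : GeneratesFrom X l) {S : D} {P : C} {f : S ⟶ ι.obj P}
    (hf : f ≠ 0) {N : ℕ} (hN : l ≤ N) : ∃ g : S ⟶ ι.obj (tensorPow X N), g ≠ 0 := by
  let d := simpleDecomp P
  have hk : ∃ k, f ≫ ι.map (dag (d.v k)) ≠ 0 := by
    by_contra! hc
    have : ι.Additive := ⟨hι.map_add _ _⟩
    refine hf ?_
    rw [← Category.comp_id f, ← ι.map_id, ← d.sum_eq, Functor.map_sum, Preadditive.comp_sum]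
    exact Finset.sum_eq_zero fun k _ => by
      rw [ι.map_comp, ← Category.assoc, hc, zero_comp]
  obtain ⟨k, hk⟩ := hk
  obtain ⟨g, hg⟩ := hl.exists_hom N hN (d.obj k) (d.simple k)
  obtain ⟨_, v, -, hv, -⟩ := exists_isometry_of_ne_zero hg
  refine ⟨(f ≫ ι.map (dag (d.v k))) ≫ ι.map v, fun h => hk ?_⟩
  have h1 := congrArg (· ≫ ι.map (dag v)) h
  beta_reduce at h1
  rwa [Category.assoc, ← ι.map_comp, hv, ι.map_id, Category.comp_id, zero_comp] at h1

omit [ι.Full] hι in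
-- Unbend `f` to a nonzero map `S ⊗ Y ⟶ W ⊗ Y` and tensor with `Z`. Now `Y ⊗ Z` is the image of `X ^
-- ⊗ n`, whose dual also comes from `C`; bending it back shows that `S` maps nontrivially to an
-- object from `C`.
theorem exists_hom_obj (φ : ι.obj (tensorPow X n) ≅ Y ⊗ Z) (hZ : 𝟙 Z ≠ 0) {S W : D} {Q : C}
    (e : ι.obj Q ≅ W) {f : S ⟶ (W ⊗ Y) ⊗ sphDual Y} (hf : f ≠ 0) :
    ∃ (P : C) (g : S ⟶ ι.obj P), g ≠ 0 := by
  have h1 := whiskerRight_ne_zero hZ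
    (@ne_zero_unbend _ _ _ _ _ _ _ _ _ _ _ _ _ (dagPairing Y (sphDual Y)) f hf)
  generalize f ▷ Y ≫ _ = f₁ at h1
  have h2 : S ◁ φ.hom ≫ (α_ S Y Z).inv ≫ f₁ ▷ Z ≫ (α_ W Y Z).hom ≫ W ◁ φ.inv ≫
      e.inv ▷ ι.obj (tensorPow X n) ≫ Functor.LaxMonoidal.μ ι _ _ ≠ 0 := by
    intro h
    refine h1 ?_
    have h3 := congrArg (fun g => (α_ S Y Z).hom ≫ S ◁ φ.inv ≫ g ≫ Functor.OplaxMonoidal.δ ι _ _ ≫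
      e.hom ▷ ι.obj (tensorPow X n) ≫ W ◁ φ.hom ≫ (α_ W Y Z).inv) h
    simpa [← MonoidalCategory.whiskerLeft_comp_assoc, ← comp_whiskerRight_assoc,
      ← MonoidalCategory.whiskerLeft_comp] using h3
  generalize S ◁ φ.hom ≫ _ = f₂ at h2
  have := dagPairing (tensorPow X n) (sphDual (tensorPow X n))
  have := mapPairing ι (sphDual (tensorPow X n)) (tensorPow X n)
  have h3 := ne_zero_bend (V := ι.obj (sphDual (tensorPow X n))) h2
  obtain ⟨f₃, h3⟩ : ∃ f₃ : S ⟶ ι.obj (Q ⊗ tensorPow X n) ⊗ ι.obj (sphDual (tensorPow X n)),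
    f₃ ≠ 0 := ⟨_, h3⟩
  refine ⟨_, f₃ ≫ Functor.LaxMonoidal.μ ι _ _, fun h => h3 ?_⟩
  have h5 := congrArg (· ≫ Functor.OplaxMonoidal.δ ι _ _) h
  simpa using h5

/-- Supplies the hypothesis of `exists_isCatBasis`. The category `D` may have simple objects that
occur in no power of `X`, but those occurring here map nontrivially to objects from `C`. -/
theorem exists_hom_tensorPow (hl : GeneratesFrom X l) (hn : 0 < n)
    (φ : ι.obj (tensorPow X n) ≅ Y ⊗ Z) (hZ : 𝟙 Z ≠ 0) {S : D}
    (h : ∃ f : S ⟶ (tensorPow (Y ⊗ Z) l ⊗ Y) ⊗ sphDual Y, f ≠ 0) :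
    ∃ g : S ⟶ tensorPow (Y ⊗ Z) l, g ≠ 0 := by
  obtain ⟨f, hf⟩ := h
  obtain ⟨P, g, hg⟩ := exists_hom_obj φ hZ (blockIso ι X n φ l) hf
  obtain ⟨g, hg⟩ := exists_hom_of_hom_obj hι hl hg (Nat.le_mul_of_pos_left l hn)
  refine ⟨g ≫ (blockIso ι X n φ l).hom, fun h => hg ?_⟩
  have h5 := congrArg (· ≫ (blockIso ι X n φ l).inv) h
  simpa using h5

omit hι [ι.Monoidal] [ι.Full] in
theorem hasIndex_of_jonesIndex {A : Type*} [CStarAlgebra A] [PartialOrder A] [StarOrderedRing A]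
    {𝒩 : AbstractSpinChain A} {τ : A →ₚ[ℂ] ℂ} {α : A ≃⋆ₐ[ℂ] A} {d : ℝ} (hd : 0 < d) {z : ℤ}
    (h0 : vnClosure τ (leftAlg 𝒩 z) ≤ vnClosure τ ((leftAlg 𝒩 z).map (α : A →⋆ₐ[ℂ] A)))
    (h : ∀ x y : ℤ, y ≤ x →
      vnClosure τ (leftAlg 𝒩 y) ≤ vnClosure τ ((leftAlg 𝒩 x).map (α : A →⋆ₐ[ℂ] A)) →
      ∃ c : ℝ, 0 < c ∧ jonesIndex (vnClosure τ (leftAlg 𝒩 y))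
        (vnClosure τ ((leftAlg 𝒩 x).map (α : A →⋆ₐ[ℂ] A))) (gnsVector τ) =
          ENNReal.ofReal (c * d ^ 2) ∧
        jonesIndex (vnClosure τ (leftAlg 𝒩 y)) (vnClosure τ (leftAlg 𝒩 x)) (gnsVector τ) =
          ENNReal.ofReal c) : HasIndex 𝒩 τ α d := by
  refine ⟨⟨z, z, le_rfl, ?_⟩, fun x y hyx hle => ?_⟩
  · rw [leftVN_eq, leftVNImage_eq]
    exact h0
  · rw [leftVN_eq, leftVNImage_eq] at *
    obtain ⟨c, hc, h1, h2⟩ := h x y hyx hle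
    rw [leftVN_eq, h1, h2, ENNReal.toReal_ofReal (by positivity), ENNReal.toReal_ofReal hc.le,
      mul_div_cancel_left₀ _ hc.ne', Real.sqrt_sq hd.le]
    exact ⟨ENNReal.ofReal_ne_top, ENNReal.ofReal_ne_top, rfl⟩

/-- At block boundaries the index of the inclusion into the image is `catDim Y ^ 2`. For other `x`
and `y` indices multiply along a tower starting far to the left, and the part belonging to `𝒜_y` is
divided out; the powers of `catDim X` then cancel in the ratio. -/
theorem hasIndex_translation (hl : GeneratesFrom X l) (hτ : IsTracialState τ) (hn : 0 < n)
    {α : QuasiLocal X ≃⋆ₐ[ℂ] QuasiLocal X} (hα : IsGeneralizedTranslation ι X n φ σ s α) :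
    HasIndex (fusionSpinChain X) τ α (catDim Y) := by
  have hV : catDim Y * catDim Z ≠ 0 := by
    rw [← catDim_tensor, ← catDim_congr φ, catDim_obj_tensorPow]
    exact pow_ne_zero _ (catDim_pos (obj_ne_zero hι hl.ne_zero)).ne'
  have hY : 𝟙 Y ≠ 0 := fun h => left_ne_zero_of_mul hV (by
    rw [catDim, h, catTr_zero, Complex.zero_re])
  have hZ : 𝟙 Z ≠ 0 := fun h => right_ne_zero_of_mul hV (by
    rw [catDim, h, catTr_zero, Complex.zero_re])
  have hY0 : 0 < catDim Y := catDim_pos hY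
  have hX0 : 0 < catDim X := catDim_pos hl.ne_zero
  obtain ⟨r, m, hm⟩ := exists_isCatBasis (W := tensorPow (Y ⊗ Z) l) (V := Y) fun S _ hS =>
    exists_hom_tensorPow hι hl hn φ hZ hS
  have hbasis : ∀ k : ℤ, HasIndexBasis τ (leftAlg (fusionSpinChain X) (s + n * k - 1))
      ((leftAlg (fusionSpinChain X) (s + n * k - 1)).map (α : QuasiLocal X →⋆ₐ[ℂ] QuasiLocal X))
      (catDim Y ^ 2) := fun k =>
    ⟨_, _, _, _, (isCatTower_translation hι hl hτ hn hα k).isIndexBasis hY hm⟩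
  have hchain : ∀ x z : ℤ, x ≤ z → HasStarBasis τ (leftAlg (fusionSpinChain X) x)
      (leftAlg (fusionSpinChain X) z) (catDim X ^ (2 * (z - x).toNat)) := fun x z hxz => by
    have h := hasStarBasis_chain hl hτ x (z - x).toNat
    rwa [Int.toNat_of_nonneg (by omega), add_sub_cancel] at h
  have hle : ∀ k : ℤ, leftAlg (fusionSpinChain X) (s + n * k - 1) ≤
      (leftAlg (fusionSpinChain X) (s + n * k - 1)).map (α : QuasiLocal X →⋆ₐ[ℂ] QuasiLocal X) :=
    fun k => by
      obtain ⟨J, _, m, m', h⟩ := hbasis k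
      exact h.le
  refine hasIndex_of_jonesIndex hY0 (vnClosure_mono hτ (hle 0)) fun x y hyx hyM => ?_
  have hn' : (0 : ℤ) < n := by exact_mod_cast hn
  -- The last site before some block boundary, not beyond `x`; the image algebra is known there.
  obtain ⟨k, hkx⟩ : ∃ k : ℤ, s + n * k - 1 ≤ x := by
    have := Int.mul_ediv_self_le (x := x + 1 - s) (k := n) hn'.ne'
    exact ⟨(x + 1 - s) / n, by omega⟩
  have hb := hbasis k
  generalize s + n * k - 1 = x₁ at hkx hb
  refine ⟨catDim X ^ (2 * (x - y).toNat), by positivity, ?_, (hchain y x hyx).hasIndexBasis.jonesIndex_eq hτ⟩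
  -- The tower runs from the half-line at `min y x₁` to that at `x₁`, then to its image, then to the
  -- image of the half-line at `x`. The last basis is transported by `α`, which preserves the trace.
  have h1 := (((hchain (min y x₁) x₁ (min_le_right _ _)).hasIndexBasis.trans hτ hb).trans hτ
    ((hchain x₁ x hkx).hasIndexBasis.map (α : QuasiLocal X →⋆ₐ[ℂ] QuasiLocal X)
      (tracialState_map hl hτ _)))
  rw [jonesIndex_eq_div hτ (hchain (min y x₁) y (min_le_left _ _)) (by positivity) h1
    (by positivity) hyM]
  congr 1
  have e : (x₁ - min y x₁).toNat + (x - x₁).toNat = (x - y).toNat + (y - min y x₁).toNat := by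
    omega
  have e2 : catDim X ^ (2 * (x₁ - min y x₁).toNat) * catDim X ^ (2 * (x - x₁).toNat) =
      catDim X ^ (2 * (x - y).toNat) * catDim X ^ (2 * (y - min y x₁).toNat) := by
    rw [← pow_add, ← pow_add, ← mul_add, ← mul_add, e]
  rw [div_eq_iff (by positivity)]
  linear_combination (catDim Y ^ 2) * e2

end TranslationIndex


/-! ### Tambara–Yamagami categories and the main theorem -/

section TambaraYamagami

variable {C : Type*} [Category C] [Abelian C] [Linear ℂ C] [MonoidalCategory C]
  [MonoidalPreadditive C] [MonoidalLinear ℂ C] [RigidCategory C] [UnitaryFusionCategory C]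
  {D : Type*} [Category D] [Abelian D] [Linear ℂ D] [MonoidalCategory D]
  [MonoidalPreadditive D] [MonoidalLinear ℂ D] [RigidCategory D] [UnitaryFusionCategory D]

theorem catDim_biproduct {B : Type*} [Finite B] (f : B → D) [Fintype B] :
    catDim (⨁ f) = ∑ b, catDim (f b) := by
  have h : catTr (𝟙 (⨁ f)) = ∑ b, catTr (𝟙 (f b)) := by
    have h0 : ∑ b, biproduct.π f b ≫ biproduct.ι f b = 𝟙 (⨁ f) := by
      classical
      refine biproduct.hom_ext _ _ fun j => ?_
      rw [Preadditive.sum_comp, Category.id_comp, Finset.sum_eq_single j]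
      · simp
      · intro b _ hb
        rw [Category.assoc, biproduct.ι_π_ne f hb, comp_zero]
      · simp
    rw [← h0, catTr_sum]
    exact Finset.sum_congr rfl fun b _ => by rw [catTr_comp_comm, biproduct.ι_π_self]
  simp only [catTr_id] at h
  exact_mod_cast h

variable {B : Type*} [CommGroup B] [Finite B] (T : TambaraYamagami B D)

theorem catDim_ρ_pos : 0 < catDim T.ρ :=
  have := T.simple_ρ
  catDim_pos (id_nonzero _)

/-- Multiplicativity applied to `b ⊗ ρ ≅ ρ`; the dimension of `ρ` is positive and cancels. -/
theorem catDim_obj (b : B) : catDim (T.obj b) = 1 := by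
  obtain ⟨e⟩ := T.fusion_obj_ρ b
  have h := catDim_congr e
  rw [catDim_tensor] at h
  exact mul_right_cancel₀ (catDim_ρ_pos T).ne' (h.trans (one_mul _).symm)

theorem catDim_ρ : catDim T.ρ = Real.sqrt (Nat.card B) := by
  have := Fintype.ofFinite B
  obtain ⟨e⟩ := T.fusion_ρ_ρ
  have h := catDim_congr e
  rw [catDim_tensor, catDim_biproduct] at h
  simp only [catDim_obj, Finset.sum_const, Finset.card_univ, nsmul_eq_mul, mul_one] at h
  rw [Nat.card_eq_fintype_card, ← h, Real.sqrt_mul_self (catDim_nonneg _)]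

/-- Under such an isomorphism every summand would map nontrivially to the simple unit and so be
isomorphic to it, contradicting the existence of two distinct group elements. -/
theorem isEmpty_biproduct_iso_unit [Nontrivial B] : IsEmpty ((⨁ T.obj) ≅ 𝟙_ D) := by
  refine ⟨fun e => ?_⟩
  have h : ∀ b, Nonempty (T.obj b ≅ 𝟙_ D) := fun b => by
    have := T.simple_obj b
    have hne : biproduct.ι T.obj b ≫ e.hom ≠ 0 := by
      intro h0
      refine id_nonzero (T.obj b) ?_
      have h1 := congrArg (· ≫ e.inv ≫ biproduct.π T.obj b) h0
      simpa using h1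
    have := isIso_of_hom_simple hne
    exact ⟨asIso (biproduct.ι T.obj b ≫ e.hom)⟩
  obtain ⟨a, b, hab⟩ := exists_pair_ne B
  exact hab (T.obj_injective a b ⟨(h a).some ≪≫ (h b).some.symm⟩)

variable {T} {ι : C ⥤ D} [ι.Monoidal] [ι.Full]

theorem isEmpty_iso_unit [Nontrivial B] {X : C} (hX : Nonempty (ι.obj X ≅ ⨁ T.obj)) :
    IsEmpty (X ≅ 𝟙_ C) :=
  ⟨fun e => (isEmpty_biproduct_iso_unit T).elim
    (hX.some.symm ≪≫ ι.mapIso e ≪≫ (Functor.Monoidal.εIso ι).symm)⟩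

theorem stronglyTensorGenerating_of_iso_biproduct (hι : IsFullInclusion ι)
    (hC : ∀ S : C, Simple S → ∃ b, Nonempty (ι.obj S ≅ T.obj b)) {X : C}
    (hX : Nonempty (ι.obj X ≅ ⨁ T.obj)) : StronglyTensorGenerating X := by
  have := hι.faithful
  obtain ⟨e⟩ := hX
  -- The first power suffices, since `X` itself contains every simple object of `C`; full
  -- faithfulness lifts the retraction from `D`.
  refine ⟨1, one_pos, fun S hS => ?_⟩
  obtain ⟨b, ⟨f⟩⟩ := hC S hS
  have r : Retract S X := ⟨ι.preimage (f.hom ≫ biproduct.ι T.obj b ≫ e.inv),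
    ι.preimage (e.hom ≫ biproduct.π T.obj b ≫ f.inv), ι.map_injective (by simp)⟩
  exact ⟨r.trans (Retract.ofIso (λ_ X).symm)⟩

theorem exists_unitaryIso_ρ {X : C} (hX : Nonempty (ι.obj X ≅ ⨁ T.obj)) :
    ∃ φ : ι.obj (tensorPow X 1) ≅ T.ρ ⊗ T.ρ, IsUnitaryIso φ :=
  exists_unitaryIso (ι.mapIso (λ_ X : tensorPow X 1 ≅ X) ≪≫ hX.some ≪≫ T.fusion_ρ_ρ.some.symm)

end TambaraYamagami

/-! ### Assembly of both parts of the proposition -/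

section Package

variable {C : Type*} [Category C] [Abelian C] [Linear ℂ C] [MonoidalCategory C]
  [MonoidalPreadditive C] [MonoidalLinear ℂ C] [RigidCategory C] [UnitaryFusionCategory C]
  {D : Type*} [Category D] [Abelian D] [Linear ℂ D] [MonoidalCategory D]
  [MonoidalPreadditive D] [MonoidalLinear ℂ D] [RigidCategory D] [UnitaryFusionCategory D]
  {ι : C ⥤ D} [ι.Monoidal] [ι.Full]

theorem existsUnique_translation (hι : IsFullInclusion ι) {X : C} {l n : ℕ}
    (hl : GeneratesFrom X l) (hn : 0 < n) {Y Z : D} {φ : ι.obj (tensorPow X n) ≅ Y ⊗ Z}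
    {σ : Y ⊗ Z ≅ Z ⊗ Y} (hφ : IsUnitaryIso φ) (hσ : IsUnitaryIso σ) (s : ℤ) :
    ∃! α : QuasiLocal X ≃⋆ₐ[ℂ] QuasiLocal X,
      IsQCA (fusionSpinChain X) α ∧ IsGeneralizedTranslation ι X n φ σ s α := by
  obtain ⟨α, hα⟩ := exists_translation hι hl hn hφ hσ s
  exact ⟨α, ⟨isQCA_of_isGeneralizedTranslation hι hn hα, hα⟩, fun β hβ =>
    isGeneralizedTranslation_unique hι hn hβ.2 hα⟩

theorem index_of_generalizedTranslations (hι : IsFullInclusion ι) {X : C}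
    (hX : StronglyTensorGenerating X) (hX' : IsEmpty (X ≅ 𝟙_ C)) :
    ∃ τ : QuasiLocal X →ₚ[ℂ] ℂ, IsTracialState τ ∧ (∀ τ', IsTracialState τ' → τ' = τ) ∧
      FiniteIndexProperty (fusionSpinChain X) τ ∧
      ∀ (n : ℕ), 0 < n → ∀ (s : ℤ) (Y Z : D) (φ : ι.obj (tensorPow X n) ≅ Y ⊗ Z)
        (σ : Y ⊗ Z ≅ Z ⊗ Y),
        (IsUnitaryIso φ → IsUnitaryIso σ →
          ∃! α : QuasiLocal X ≃⋆ₐ[ℂ] QuasiLocal X,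
            IsQCA (fusionSpinChain X) α ∧ IsGeneralizedTranslation ι X n φ σ s α) ∧
        ∀ α : QuasiLocal X ≃⋆ₐ[ℂ] QuasiLocal X, IsQCA (fusionSpinChain X) α →
          IsGeneralizedTranslation ι X n φ σ s α →
          HasIndex (fusionSpinChain X) τ α (quantumDim Y) := by
  obtain ⟨l, hl⟩ := hX.generatesFrom
  obtain ⟨τ, hτ, -⟩ := exists_traceState hl.ne_zero
  refine ⟨τ, hτ, fun τ' hτ' => tracialState_unique hl hτ hτ', finiteIndexProperty hl hX' hτ,
    fun n hn s Y Z φ σ => ⟨fun hφ hσ => existsUnique_translation hι hl hn hφ hσ s,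
      fun α _ hα => ?_⟩⟩
  rw [quantumDim_eq_catDim]
  exact hasIndex_translation hι hl hτ hn hα

end Package

theorem mainTheorem4
    {C : Type*} [Category C] [Abelian C] [Linear ℂ C] [MonoidalCategory C]
    [MonoidalPreadditive C] [MonoidalLinear ℂ C] [RigidCategory C] [UnitaryFusionCategory C]
    {D : Type*} [Category D] [Abelian D] [Linear ℂ D] [MonoidalCategory D]
    [MonoidalPreadditive D] [MonoidalLinear ℂ D] [RigidCategory D] [UnitaryFusionCategory D]
    (ι : C ⥤ D) [ι.Monoidal] [ι.Full] (hι : IsFullInclusion ι) :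
    (∀ X : C, StronglyTensorGenerating X → IsEmpty (X ≅ 𝟙_ C) →
      ∃ τ : QuasiLocal X →ₚ[ℂ] ℂ, IsTracialState τ ∧ (∀ τ', IsTracialState τ' → τ' = τ) ∧
        FiniteIndexProperty (fusionSpinChain X) τ ∧
        ∀ (n : ℕ), 0 < n → ∀ (s : ℤ) (Y Z : D) (φ : ι.obj (tensorPow X n) ≅ Y ⊗ Z)
          (σ : Y ⊗ Z ≅ Z ⊗ Y),
          (IsUnitaryIso φ → IsUnitaryIso σ →
            ∃! α : QuasiLocal X ≃⋆ₐ[ℂ] QuasiLocal X,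
              IsQCA (fusionSpinChain X) α ∧ IsGeneralizedTranslation ι X n φ σ s α) ∧
          ∀ α : QuasiLocal X ≃⋆ₐ[ℂ] QuasiLocal X, IsQCA (fusionSpinChain X) α →
            IsGeneralizedTranslation ι X n φ σ s α →
            HasIndex (fusionSpinChain X) τ α (quantumDim Y)) ∧
    (∀ (B : Type*) [CommGroup B] [Finite B] [Nontrivial B] (T : TambaraYamagami B D),
      (∀ S : C, Simple S → ∃ b, Nonempty (ι.obj S ≅ T.obj b)) →
      (∀ b, ∃ S : C, Nonempty (ι.obj S ≅ T.obj b)) →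
      ∀ X : C, Nonempty (ι.obj X ≅ ⨁ T.obj) →
        StronglyTensorGenerating X ∧ IsEmpty (X ≅ 𝟙_ C) ∧
        ∃ τ : QuasiLocal X →ₚ[ℂ] ℂ, IsTracialState τ ∧ (∀ τ', IsTracialState τ' → τ' = τ) ∧
          FiniteIndexProperty (fusionSpinChain X) τ ∧
          (∃ φ : ι.obj (tensorPow X 1) ≅ T.ρ ⊗ T.ρ, IsUnitaryIso φ) ∧
          ∀ φ : ι.obj (tensorPow X 1) ≅ T.ρ ⊗ T.ρ,
            (IsUnitaryIso φ → ∃! α : QuasiLocal X ≃⋆ₐ[ℂ] QuasiLocal X,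
              IsQCA (fusionSpinChain X) α ∧
                IsGeneralizedTranslation ι X 1 φ (Iso.refl (T.ρ ⊗ T.ρ)) 0 α) ∧
            ∀ α : QuasiLocal X ≃⋆ₐ[ℂ] QuasiLocal X, IsQCA (fusionSpinChain X) α →
              IsGeneralizedTranslation ι X 1 φ (Iso.refl (T.ρ ⊗ T.ρ)) 0 α →
              HasIndex (fusionSpinChain X) τ α (Real.sqrt (Nat.card B))) := by
  refine ⟨fun X hX hX' => index_of_generalizedTranslations hι hX hX',
    fun B _ _ _ T hC _ X hX => ?_⟩
  have hgen := stronglyTensorGenerating_of_iso_biproduct hι hC hX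
  have hne := isEmpty_iso_unit hX
  obtain ⟨τ, hτ, huniq, hfin, h⟩ := index_of_generalizedTranslations hι hgen hne
  refine ⟨hgen, hne, τ, hτ, huniq, hfin, exists_unitaryIso_ρ hX, fun φ => ?_⟩
  obtain ⟨h1, h2⟩ := h 1 one_pos 0 T.ρ T.ρ φ (Iso.refl _)
  refine ⟨fun hφ => h1 hφ (isUnitaryIso_refl _), fun α hα hα' => ?_⟩
  rw [← catDim_ρ T, ← quantumDim_eq_catDim]
  exact h2 α hα hα'
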